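/- Let $R>0$ and $\kappa\in\mathbb R$ with $R^2|\kappa|<1$, and let $M=\mathbb D_R=\{z\in\mathbb C:\ |z|\le R\}$ with the metric $g_\kappa=(1+\kappa|z|^2)^{-2}|dz|^2$ of constant curvature $4\kappa$ and area measure $d\mathrm{Vol}$. Parameterize the inward unit vectors at the boundary, $\partial_+SM$, by $(\beta,\alpha)\in\mathbb S^1\times(-\frac\pi2,\frac\pi2)$, where $(\beta,\alpha)$ stands for the vector $(1+\kappa R^2)e^{i(\beta+\pi+\alpha)}$ at the point $Re^{i\beta}$, and put $\mu=\cos\alpha$, $d\Sigma^2=\frac{R}{1+\kappa R^2}\,d\beta\,d\alpha$. Let $I_0f(\beta,\alpha)=\int_0^\tau f(\gamma_{\beta,\alpha}(t))\,dt$ be the geodesic X-ray transform, where $\gamma_{\beta,\alpha}$ is the unit-speed $g_\kappa$-geodesic issued from $(\beta,\alpha)$ and $\tau$ is its exit time from $M$, and let $I_0^*$ be the adjoint of $I_0\colon L^2(M,d\mathrm{Vol})\to L^2(\partial_+SM,d\Sigma^2)$, that is, $I_0^*h(z)=\int_{\mathbb S^1}(h/\mu)(\beta_-(z,\theta),\alpha_-(z,\theta))\,d\theta$,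 where $(\beta_-,\alpha_-)(z,\theta)$ is the element of $\partial_+SM$ from which the geodesic through $z$ with direction $e^{i\theta}$ is issued. Then there exist a second-order differential operator $\mathcal L$ on $M$ with real coefficients that are smooth up to the boundary, a first-order differential operator $T$ on $\partial_+SM$ with smooth real coefficients (its principal part vanishes nowhere), and a positive function $w\in C^\infty(M)$ such that the following holds. 1. For every $h\in C^\infty(\partial_+SM)$ the function $I_0^*h$ is smooth in the interior of $M$, and $\mathcal L I_0^*h=I_0^*(-T^2h)$ there. For every $f\in C^\infty(M)$ the function $I_0(wf)$ is smooth on $\partial_+SM$, and $I_0(w\,\mathcal Lf)=-T^2I_0(wf)$. 2. $\mathcal L$ is degenerate elliptic of Kimura type: it is elliptic in the interior of $M$, and near $\partial M$, with $r=R-|z|$ and $\omega$ the polar angle, its second-order part in the coordinates $(r,\omega)$ is $-(A\,r\,\partial_r^2+B\,\partial_\omega^2)$ with smooth functions $A>0$ and $B>0$. 3. On $L^2(M,w\,d\mathrm{Vol})$ with domain $C^\infty(M)$, the operator $\mathcal L$ is formally self-adjoint, $(\mathcal Lu,v)=(u,\mathcal Lv)$, positive, $(\mathcal Lu,u)>0$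 for $u\ne0$, and coercive, $(\mathcal Lu,u)\ge C\|u\|^2$ for some constant $C>0$ and all $u\in C^\infty(M)$. 4. For every $f\in C^\infty(M)$ one has $I_0^*I_0(wf)\in C^\infty(M)$, and $$\mathcal L\,(I_0^*I_0w)^2f=c_{\kappa,R}^2\,f\quad\text{on }M,\qquad c_{\kappa,R}=\frac{4\pi R}{1-\kappa R^2}.$$ -/

import Mathlib

open scoped ContDiff

namespace GeodesicDisk

noncomputable section

/-! ### The surface: the closed disk of radius `R` in `ℂ = ℝ²` with the metric `g_κ` -/

/-- The closed disk `𝔻_R`. -/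
def disk (R : ℝ) : Set ℂ := Metric.closedBall 0 R

/-- The coordinate vectors `∂/∂x`, `∂/∂y` of the plane `ℂ = ℝ²`. -/
def coordVec : Fin 2 → ℂ := ![1, Complex.I]

/-- The coordinates of a vector of the plane `ℂ = ℝ²`. -/
def coord (i : Fin 2) (v : ℂ) : ℝ := ![v.re, v.im] i

/-- The metric tensor `g_κ(z) = (1 + κ|z|²)⁻² |dz|²`, as a matrix in the coordinates `x, y`. -/
def metric (κ : ℝ) (z : ℂ) : Matrix (Fin 2) (Fin 2) ℝ :=
  ((1 + κ * ‖z‖ ^ 2) ^ 2)⁻¹ • (1 : Matrix (Fin 2) (Fin 2) ℝ)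

/-- The partial derivative `∂_l g_{ij}` of the metric. -/
def dMetric (κ : ℝ) (l i j : Fin 2) (z : ℂ) : ℝ :=
  fderiv ℝ (fun y => metric κ y i j) z (coordVec l)

/-- The Christoffel symbol `Γ^k_{ij}` of the Levi-Civita connection of `g_κ`. -/
def christoffel (κ : ℝ) (k i j : Fin 2) (z : ℂ) : ℝ :=
  1 / 2 * ∑ l, (metric κ z)⁻¹ k l *
    (dMetric κ i j l z + dMetric κ j i l z - dMetric κ l i j z)

/-- The acceleration `-Γ(z)(v, v)` of a geodesic with position `z` and velocity `v`. -/
def geodesicAcc (κ : ℝ) (z v : ℂ) : ℂ :=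
  -∑ k, (∑ i, ∑ j, christoffel κ k i j z * coord i v * coord j v) • coordVec k

/-- The Riemannian area measure `dVol = √(det g_κ) dx dy` of the disk. -/
def areaMeasure (κ R : ℝ) : MeasureTheory.Measure ℂ :=
  (MeasureTheory.volume.restrict (disk R)).withDensity
    (fun z => ENNReal.ofReal √(metric κ z).det)

/-- `C^∞(M)`: complex-valued functions that are smooth up to the boundary of the disk. -/
def SmoothOnDisk (R : ℝ) (f : ℂ → ℂ) : Prop := ContDiffOn ℝ ∞ f (disk R)

/-! ### The inward boundary `∂₊SM` in fan-beam coordinates `(β, α) ∈ 𝕊¹ × (-π/2, π/2)` -/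

/-- The range of fan-beam coordinates; functions of `β ∈ 𝕊¹` are `2π`-periodic functions of `β`. -/
def strip : Set (ℝ × ℝ) := Set.univ ×ˢ Set.Ioo (-(Real.pi / 2)) (Real.pi / 2)

/-- The boundary point `x = R e^{iβ}`. -/
def bdryPoint (R : ℝ) (p : ℝ × ℝ) : ℂ := R * Complex.exp (Complex.I * p.1)

/-- The inward unit vector `v = (1 + κR²) e^{i(β + π + α)}` at `x = R e^{iβ}`; its angle with the
inward unit normal `-(1 + κR²) e^{iβ}` is `α`. -/
def bdryVector (κ R : ℝ) (p : ℝ × ℝ) : ℂ :=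
  (1 + κ * R ^ 2 : ℝ) * Complex.exp (Complex.I * (p.1 + Real.pi + p.2 : ℝ))

/-- `μ(x, v) = g_x(v, ν_x) = cos α`. -/
def mu (p : ℝ × ℝ) : ℝ := Real.cos p.2

/-- A function on `𝕊¹ × (-π/2, π/2)`. -/
def IsPeriodic {E : Type*} (h : ℝ × ℝ → E) : Prop :=
  ∀ β α : ℝ, h (β + 2 * Real.pi, α) = h (β, α)

/-- `C^∞(∂₊SM)`. -/
def SmoothOnBdry (h : ℝ × ℝ → ℂ) : Prop := IsPeriodic h ∧ ContDiffOn ℝ ∞ h strip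

/-- The measure `dΣ²` on `∂₊SM`: arclength `R (1 + κR²)⁻¹ dβ` on `∂M` times `dα`. -/
def sigmaMeasure (κ R : ℝ) : MeasureTheory.Measure (ℝ × ℝ) :=
  ENNReal.ofReal (R / (1 + κ * R ^ 2)) • MeasureTheory.volume.restrict
    (Set.Ico 0 (2 * Real.pi) ×ˢ Set.Ioo (-(Real.pi / 2)) (Real.pi / 2))

/-! ### Geodesics and the X-ray transform -/

/-- `γ` is the unit-speed geodesic with initial condition given by `p = (β, α) ∈ ∂₊SM`, `V` is its
velocity and `τ` its exit time: it lies in the interior of the disk at the times `0 < t < τ` and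
reaches the boundary again at the time `τ`. -/
structure IsExitGeodesic (κ R : ℝ) (p : ℝ × ℝ) (τ : ℝ) (γ V : ℝ → ℂ) : Prop where
  pos : 0 < τ
  position : ∀ t ∈ Set.Icc 0 τ, HasDerivWithinAt γ (V t) (Set.Icc 0 τ) t
  velocity : ∀ t ∈ Set.Icc 0 τ,
    HasDerivWithinAt V (geodesicAcc κ (γ t) (V t)) (Set.Icc 0 τ) t
  init_position : γ 0 = bdryPoint R p
  init_velocity : V 0 = bdryVector κ R p
  interior : ∀ t ∈ Set.Ioo 0 τ, ‖γ t‖ < R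
  exit : ‖γ τ‖ = R

/-- There is an exit time with a geodesic and its velocity issued from `p`. -/
def HasExitGeodesic (κ R : ℝ) (p : ℝ × ℝ) : Prop :=
  ∃ q : ℝ × (ℝ → ℂ) × (ℝ → ℂ), IsExitGeodesic κ R p q.1 q.2.1 q.2.2

open Classical in
/-- The geodesic X-ray transform `I₀ f(β, α) = ∫_0^τ f(γ(t)) dt`. -/
def xray (κ R : ℝ) (f : ℂ → ℂ) (p : ℝ × ℝ) : ℂ :=
  if h : HasExitGeodesic κ R p then ∫ t in (0 : ℝ)..h.choose.1, f (h.choose.2.1 t) else 0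

/-- `p = (β_-, α_-)` is the footpoint of the unit vector `(1 + κ|z|²) e^{iθ}` at `z`: the geodesic
issued from `p` passes through `z` with this velocity. -/
def IsFootpoint (κ R : ℝ) (z : ℂ) (θ : ℝ) (p : ℝ × ℝ) : Prop :=
  p ∈ Set.Ico 0 (2 * Real.pi) ×ˢ Set.Ioo (-(Real.pi / 2)) (Real.pi / 2) ∧
  ∃ (τ : ℝ) (γ V : ℝ → ℂ), IsExitGeodesic κ R p τ γ V ∧ ∃ t ∈ Set.Icc 0 τ,
    γ t = z ∧ V t = (1 + κ * ‖z‖ ^ 2 : ℝ) * Complex.exp (Complex.I * θ)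

open Classical in
/-- The footpoint map. It is defined by its property except at the vectors that are tangent to
the boundary, which have no footpoint. -/
def footpoint (κ R : ℝ) (z : ℂ) (θ : ℝ) : ℝ × ℝ :=
  if h : ∃ p, IsFootpoint κ R z θ p then h.choose else 0

/-- `I₀^♯ h(z) = ∫_{𝕊¹} h(β_-(z, θ), α_-(z, θ)) dθ`. -/
def xraySharp (κ R : ℝ) (h : ℝ × ℝ → ℂ) (z : ℂ) : ℂ :=
  ∫ θ in (0 : ℝ)..(2 * Real.pi), h (footpoint κ R z θ)

/-- The adjoint `I₀^* = I₀^♯ μ⁻¹` of `I₀ : L²(M, dVol) → L²(∂₊SM, dΣ²)`. -/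
def xrayStar (κ R : ℝ) (h : ℝ × ℝ → ℂ) : ℂ → ℂ :=
  xraySharp κ R (fun p => h p / mu p)

/-- The operator `I₀ w = I₀(w ·)`. -/
def xrayW (κ R : ℝ) (w : ℂ → ℝ) (f : ℂ → ℂ) : ℝ × ℝ → ℂ :=
  xray κ R (fun z => w z * f z)

/-- The operator `I₀^* I₀ w`. -/
def normalW (κ R : ℝ) (w : ℂ → ℝ) (f : ℂ → ℂ) : ℂ → ℂ :=
  xrayStar κ R (xrayW κ R w f)

/-! ### Differential operators -/

/-- The derivative in the direction `v` on the closed disk (one-sided at the boundary). -/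
def diskDeriv (R : ℝ) (v : ℂ) (f : ℂ → ℂ) (z : ℂ) : ℂ := fderivWithin ℝ f (disk R) z v

/-- The coefficients of a second-order differential operator
`-(a₁₁ ∂_x² + 2 a₁₂ ∂_x ∂_y + a₂₂ ∂_y²) + b₁ ∂_x + b₂ ∂_y + c`. -/
structure SecondOrderOp where
  a₁₁ : ℂ → ℝ
  a₁₂ : ℂ → ℝ
  a₂₂ : ℂ → ℝ
  b₁ : ℂ → ℝ
  b₂ : ℂ → ℝ
  c : ℂ → ℝ

/-- The action of the operator on functions on the disk. -/
def SecondOrderOp.apply (L : SecondOrderOp) (R : ℝ) (f : ℂ → ℂ) (z : ℂ) : ℂ :=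
  -(L.a₁₁ z * diskDeriv R 1 (diskDeriv R 1 f) z
      + 2 * L.a₁₂ z * diskDeriv R 1 (diskDeriv R Complex.I f) z
      + L.a₂₂ z * diskDeriv R Complex.I (diskDeriv R Complex.I f) z)
    + L.b₁ z * diskDeriv R 1 f z + L.b₂ z * diskDeriv R Complex.I f z + L.c z * f z

/-- The coefficients are smooth up to the boundary of the disk. -/
def SecondOrderOp.IsSmooth (L : SecondOrderOp) (R : ℝ) : Prop :=
  ContDiffOn ℝ ∞ L.a₁₁ (disk R) ∧ ContDiffOn ℝ ∞ L.a₁₂ (disk R) ∧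
  ContDiffOn ℝ ∞ L.a₂₂ (disk R) ∧ ContDiffOn ℝ ∞ L.b₁ (disk R) ∧
  ContDiffOn ℝ ∞ L.b₂ (disk R) ∧ ContDiffOn ℝ ∞ L.c (disk R)

/-- The principal symbol at `z`, a symmetric bilinear form on covectors; a covector is written as
the complex number with the same coordinates. -/
def SecondOrderOp.symbol (L : SecondOrderOp) (z ξ η : ℂ) : ℝ :=
  L.a₁₁ z * (ξ.re * η.re) + L.a₁₂ z * (ξ.re * η.im + ξ.im * η.re) + L.a₂₂ z * (ξ.im * η.im)

/-- The differential `dρ` of the polar coordinate `ρ = |z|`. -/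
def dRho (z : ℂ) : ℂ := z / ‖z‖

/-- The differential `dω` of the polar angle `ω`. -/
def dOmega (z : ℂ) : ℂ := Complex.I * z / ‖z‖ ^ 2

/-- Kimura type: the operator is elliptic in the interior and, near the boundary, its principal
part in the coordinates `(r, ω)`, where `r = R - |z|` is the distance function of the plane to the
boundary, is `-(A r ∂_r² + B ∂_ω²)` with smooth positive functions `A` and `B`. The coefficients of
`∂_r²`, `∂_r ∂_ω`, `∂_ω²` are the values of the symbol on the differentials of the coordinates. -/
def SecondOrderOp.IsKimuraType (L : SecondOrderOp) (R : ℝ) : Prop :=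
  (∀ z : ℂ, ‖z‖ < R → ∀ ξ : ℂ, ξ ≠ 0 → 0 < L.symbol z ξ ξ) ∧
  ∃ δ : ℝ, 0 < δ ∧ δ < R ∧ ∃ A B : ℂ → ℝ,
    ContDiffOn ℝ ∞ A {z | R - δ ≤ ‖z‖ ∧ ‖z‖ ≤ R} ∧
    ContDiffOn ℝ ∞ B {z | R - δ ≤ ‖z‖ ∧ ‖z‖ ≤ R} ∧
    ∀ z : ℂ, R - δ ≤ ‖z‖ → ‖z‖ ≤ R →
      0 < A z ∧ 0 < B z ∧
      L.symbol z (-dRho z) (-dRho z) = A z * (R - ‖z‖) ∧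
      L.symbol z (-dRho z) (dOmega z) = 0 ∧
      L.symbol z (dOmega z) (dOmega z) = B z

/-- The coefficients of a first-order differential operator `a ∂_β + b ∂_α + c` on `∂₊SM`. -/
structure FirstOrderOp where
  a : ℝ × ℝ → ℝ
  b : ℝ × ℝ → ℝ
  c : ℝ × ℝ → ℝ

/-- The action of the operator on functions on `∂₊SM`. -/
def FirstOrderOp.apply (T : FirstOrderOp) (h : ℝ × ℝ → ℂ) (p : ℝ × ℝ) : ℂ :=
  T.a p * fderiv ℝ h p (1, 0) + T.b p * fderiv ℝ h p (0, 1) + T.c p * h p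

/-- The operator `-T²`. -/
def FirstOrderOp.negSq (T : FirstOrderOp) (h : ℝ × ℝ → ℂ) (p : ℝ × ℝ) : ℂ :=
  -T.apply (T.apply h) p

/-- The coefficients are smooth functions on `∂₊SM` and the operator has order one everywhere. -/
def FirstOrderOp.IsSmooth (T : FirstOrderOp) : Prop :=
  IsPeriodic T.a ∧ IsPeriodic T.b ∧ IsPeriodic T.c ∧
  ContDiffOn ℝ ∞ T.a strip ∧ ContDiffOn ℝ ∞ T.b strip ∧ ContDiffOn ℝ ∞ T.c strip ∧
  ∀ p ∈ strip, T.a p ≠ 0 ∨ T.b p ≠ 0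

/-- The inner product `(u, v)` of `L²(M, w dVol)`. -/
def innerW (κ R : ℝ) (w : ℂ → ℝ) (u v : ℂ → ℂ) : ℂ :=
  ∫ z, u z * (starRingEnd ℂ) (v z) * w z ∂(areaMeasure κ R)

end

end GeodesicDisk

open GeodesicDisk

/-! The map Ψ(z) = c z/(1 - κ|z|²), c = (1 - κR²)/R, carries M onto the closed unit disk and the
geodesics of g_κ onto straight chords: it passes from the conformal to the projective model of
constant curvature. The problem is thus transported to the flat disk, and the weight w = (1 +
κ|z|²)/(1 - κ|z|²) makes the transport exact. Put a = (1 - κR²)/(1 + κR²), D = cos²α + a² sin²α, and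
describe a chord by its offset q from the origin and its direction θ. If f = w·(g∘Ψ), then I₀(wf) =
cos α/(cD) times the integral of g over the chord, parametrized by s ∈ [-1, 1] (`xrayW_eq`), and
I₀^*h = w·(backprojection of D h/cos α)∘Ψ (`xrayStar_eq`). Hence I₀^*I₀w is conjugate to N/c, where
N is chord mean followed by backprojection, the normal operator of the flat unit disk.

On the unit disk let Z = -(Δ - (x·∇)² - 2x·∇) + 1 be the Zernike operator; 𝓛 is Z in the coordinate
Ψ, conjugated by w (`kimuraOp_applyOn`). Chord means and backprojection both intertwine Z with P =
-(1 - q²)∂_q² + 3q∂_q + 1 (`exists_deriv_chordMean`, `OffsetDomain.zernike_backproj`). In fan-beam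
coordinates, T corresponds to -√(1 - q²)∂_q acting on √D h, and D h/cos α is √D h divided by √(1 -
q²). So -T² corresponds to P acting on D h/cos α (`starKernel_negSq`), which gives both intertwining
relations.

The inversion formula is spectral. The ridge functions U_n(x·ν), with U_n the Chebyshev polynomials
of the second kind and ν a unit vector, are eigenfunctions of Z with eigenvalue (n + 1)² by the
Chebyshev equation, and of N with eigenvalue 4π/(n + 1) by Marr's formula and a reproducing kernel
on trigonometric polynomials. They are total, because orthogonality to all of them annihilates the
Fourier transform. Since Z and N are symmetric, Z N² = (4π)² follows by testing against ridge
functions (`zernike_normal_normal`), and c_{κ,R} = 4π/c.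

The quadratic form of Z is ∫ (1 - |x|²)|∇u|² + |∂_ω u|² + |u|², so Z is symmetric and bounded below
by 1. The Jacobian of Ψ turns w dVol on functions w·(g∘Ψ) into c⁻² dx (`innerW_eq`), so 𝓛 inherits
both properties.

Smoothness up to the boundary is delicate because a chord has half-length √(1 - q²). Differentiating
a chord mean in q produces a factor 1/√(1 - q²), which an integration by parts in s cancels at the
cost of one more factor 1 - s² in the weight. Thus derivatives of chord means are combinations of
chord means again, and induction applies (`contDiffOn_chordMean_nat`). -/

namespace GeodesicDisk

open Set Filter Topology MeasureTheory

/-! ### Integrals depending on a parameter, up to the boundary of a convex set -/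

section Parametric

variable {E F G X : Type*} [NormedAddCommGroup E] [NormedSpace ℝ E]
  [NormedAddCommGroup F] [NormedSpace ℝ F] [NormedAddCommGroup G] [NormedSpace ℝ G]

theorem continuousOn_intervalIntegral [TopologicalSpace X] [FirstCountableTopology X]
    {S : Set X} {a b : ℝ} (hab : a ≤ b)
    {f : X → ℝ → G} (hf : ContinuousOn (Function.uncurry f) (S ×ˢ Icc a b)) :
    ContinuousOn (fun x => ∫ s in a..b, f x s) S := by
  rw [continuousOn_iff_continuous_domRestrict]
  -- Clamping s to [a, b] extends the integrand continuously to all real s without changing the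
  -- integral.
  have h1 : Continuous (Function.uncurry
      fun (x : S) (s : ℝ) => f x (projIcc a b hab s : ℝ)) := by
    refine hf.comp_continuous (f := fun q : S × ℝ => ((q.1 : X), (projIcc a b hab q.2 : ℝ)))
      ?_ ?_
    · exact (continuous_subtype_val.comp continuous_fst).prodMk
        (continuous_subtype_val.comp (continuous_projIcc.comp continuous_snd))
    · intro q
      exact ⟨q.1.2, (projIcc a b hab q.2).2⟩
  have h2 := intervalIntegral.continuous_parametric_intervalIntegral_of_continuous'
    (μ := volume) h1 a b
  convert h2 using 2 with x
  refine intervalIntegral.integral_congr fun s hs => ?_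
  rw [uIcc_of_le hab] at hs
  simp [projIcc_of_mem hab hs]

/-- A compact ball around the point supplies the dominating constant. Differentiability is asked
only for s in the open interval because the endpoints of a chord lie on the unit circle, where the
integrand is merely one-sidedly differentiable. -/
theorem hasFDerivAt_intervalIntegral [ProperSpace E] {U : Set E} (hU : IsOpen U)
    {a b : ℝ} (hab : a ≤ b) {f : E → ℝ → G} {f' : E → ℝ → E →L[ℝ] G}
    (hf : ContinuousOn (Function.uncurry f) (U ×ˢ Icc a b))
    (hf' : ContinuousOn (Function.uncurry f') (U ×ˢ Icc a b))
    (hd : ∀ x ∈ U, ∀ s ∈ Ioo a b, HasFDerivAt (fun x => f x s) (f' x s) x)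
    {x : E} (hx : x ∈ U) :
    HasFDerivAt (fun x => ∫ s in a..b, f x s) (∫ s in a..b, f' x s) x := by
  obtain ⟨ε, hε, hball⟩ := Metric.nhds_basis_closedBall.mem_iff.1 (hU.mem_nhds hx)
  have hc : IsCompact (Metric.closedBall x ε ×ˢ Icc a b) :=
    (isCompact_closedBall x ε).prod isCompact_Icc
  obtain ⟨C, hC⟩ := hc.exists_bound_of_continuousOn
    (hf'.mono (prod_mono hball subset_rfl))
  have hsec : ∀ y ∈ U, ContinuousOn (f y) (Icc a b) := fun y hy =>
    hf.comp (f := fun s => (y, s)) (by fun_prop) fun s hs => ⟨hy, hs⟩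
  have hsec' : ContinuousOn (f' x) (Icc a b) :=
    hf'.comp (f := fun s => (x, s)) (by fun_prop) fun s hs => ⟨hx, hs⟩
  -- Interval integrals are taken over the half-open interval, which contains the endpoint b not
  -- covered by `hd`.
  have hne : ∀ᵐ t : ℝ, t ≠ b := by
    simp [ae_iff, measure_singleton]
  refine intervalIntegral.hasFDerivAt_integral_of_dominated_of_fderiv_le
    (bound := fun _ => C) (Metric.closedBall_mem_nhds x hε) ?_ ?_ ?_ ?_ ?_ ?_
  · filter_upwards [hU.mem_nhds hx] with y hy
    rw [uIoc_of_le hab]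
    exact ((hsec y hy).mono Ioc_subset_Icc_self).aestronglyMeasurable measurableSet_Ioc
  · exact (hsec x hx).intervalIntegrable_of_Icc hab
  · rw [uIoc_of_le hab]
    exact (hsec'.mono Ioc_subset_Icc_self).aestronglyMeasurable measurableSet_Ioc
  · refine Eventually.of_forall fun t ht y hy => ?_
    rw [uIoc_of_le hab] at ht
    exact hC (y, t) ⟨hy, Ioc_subset_Icc_self ht⟩
  · exact intervalIntegrable_const
  · filter_upwards [hne] with t htb ht y hy
    rw [uIoc_of_le hab] at ht
    exact hd y (hball hy) t ⟨ht.1, lt_of_le_of_ne ht.2 htb⟩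

/-- If the derivative in the interior extends continuously to the boundary, the extension is the
one-sided derivative: the mean value inequality on the convex set of interior points near x passes
to the closure. -/
theorem hasFDerivWithinAt_of_interior {S : Set E} (hS : Convex ℝ S) (hne : (interior S).Nonempty)
    {f : E → F} {f' : E → E →L[ℝ] F} (hf : ContinuousOn f S) (hf' : ContinuousOn f' S)
    (hd : ∀ x ∈ interior S, HasFDerivAt f (f' x) x) {x : E} (hx : x ∈ S) :
    HasFDerivWithinAt f (f' x) S x := by
  have hcl : S ⊆ closure (interior S) := by
    rw [hS.closure_interior_eq_closure_of_nonempty_interior hne]; exact subset_closure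
  have key : ∀ ε > 0, ∃ δ > 0, ∀ y ∈ Metric.ball x δ ∩ S, ‖f' y - f' x‖ ≤ ε := by
    intro ε hε
    obtain ⟨δ, hδ, h⟩ := Metric.continuousWithinAt_iff.1 (hf' x hx) ε hε
    exact ⟨δ, hδ, fun y hy => by
      have := h hy.2 hy.1
      rw [dist_eq_norm] at this
      exact this.le⟩
  rw [hasFDerivWithinAt_iff_isLittleO, Asymptotics.isLittleO_iff]
  intro ε hε
  obtain ⟨δ, hδ, h⟩ := key ε hε
  filter_upwards [inter_mem_nhdsWithin S (Metric.ball_mem_nhds x hδ)] with y hy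
  -- the interior of the convex set `S ∩ ball x δ`
  set B := interior S ∩ Metric.ball x δ with hB
  have hBc : Convex ℝ B := hS.interior.inter (convex_ball x δ)
  have hBo : IsOpen B := isOpen_interior.inter Metric.isOpen_ball
  -- Mean value inequality with the derivative frozen at the possibly boundary point x; only
  -- continuity is then needed to let the second point tend to x.
  have main : ∀ z ∈ B ×ˢ B, ‖f z.1 - f z.2 - f' x (z.1 - z.2)‖ ≤ ε * ‖z.1 - z.2‖ := by
    rintro ⟨u, v⟩ ⟨hu, hv⟩
    exact hBc.norm_image_sub_le_of_norm_hasFDerivWithin_le' (f' := f')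
      (fun z hz => (hd z hz.1).hasFDerivWithinAt)
      (fun z hz => h z ⟨hz.2, interior_subset hz.1⟩) hv hu
  have hmem : ∀ z ∈ S ∩ Metric.ball x δ, z ∈ closure B := fun z hz => by
    rw [hB, inter_comm]
    exact Metric.isOpen_ball.inter_closure ⟨hz.2, hcl hz.1⟩
  have hyx : (y, x) ∈ closure (B ×ˢ B) := by
    rw [closure_prod_eq]
    exact ⟨hmem y hy, hmem x ⟨hx, Metric.mem_ball_self hδ⟩⟩
  have hBS : B ⊆ S := inter_subset_left.trans interior_subset
  refine ContinuousWithinAt.closure_le (f := fun z : E × E => ‖f z.1 - f z.2 - f' x (z.1 - z.2)‖)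
    (g := fun z : E × E => ε * ‖z.1 - z.2‖) hyx ?_ ?_ main
  · have h1 : ContinuousWithinAt (fun z : E × E => f z.1) (B ×ˢ B) (y, x) :=
      ((hf y hy.1).mono hBS).comp continuousWithinAt_fst fun z hz => hz.1
    have h2 : ContinuousWithinAt (fun z : E × E => f z.2) (B ×ˢ B) (y, x) :=
      ((hf x hx).mono hBS).comp continuousWithinAt_snd fun z hz => hz.2
    exact ((h1.sub h2).sub (by fun_prop)).norm
  · fun_prop

/-- The induction step for regularity up to the boundary, used both for chord means and for
backprojections: derivatives are computed in the interior only. -/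
theorem contDiffOn_succ_of_interior {S : Set E} (hS : Convex ℝ S)
    (hne : (interior S).Nonempty) {n : ℕ}
    {f : E → F} {f' : E → E →L[ℝ] F} (hf : ContinuousOn f S) (hf' : ContDiffOn ℝ n f' S)
    (hd : ∀ x ∈ interior S, HasFDerivAt f (f' x) x) :
    ContDiffOn ℝ (n + 1) f S := by
  rw [contDiffOn_succ_iff_hasFDerivWithinAt_of_uniqueDiffOn (uniqueDiffOn_convex hS hne)]
  exact ⟨fun h => absurd h (by simp), f', hf',
    fun x hx => hasFDerivWithinAt_of_interior hS hne hf hf'.continuousOn hd hx⟩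

end Parametric

/-! ### Directional derivatives on subsets of the plane -/

noncomputable section

/-- The derivative in the direction `v` within `S`. -/
def dirDeriv (S : Set ℂ) (v : ℂ) (f : ℂ → ℂ) (z : ℂ) : ℂ := fderivWithin ℝ f S z v

theorem diskDeriv_eq_dirDeriv (R : ℝ) (v : ℂ) (f : ℂ → ℂ) :
    diskDeriv R v f = dirDeriv (disk R) v f := rfl

section

variable {S : Set ℂ} {f g : ℂ → ℂ} {z : ℂ}

theorem contDiffOn_fderivWithin_apply (hS : UniqueDiffOn ℝ S) (hf : ContDiffOn ℝ ∞ f S)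
    {a : ℂ → ℂ} (ha : ContDiffOn ℝ ∞ a S) :
    ContDiffOn ℝ ∞ (fun z => fderivWithin ℝ f S z (a z)) S :=
  (hf.fderivWithin hS (m := ∞) (by simp)).clm_apply ha

theorem contDiffOn_dirDeriv (hS : UniqueDiffOn ℝ S) (hf : ContDiffOn ℝ ∞ f S) (v : ℂ) :
    ContDiffOn ℝ ∞ (dirDeriv S v f) S :=
  contDiffOn_fderivWithin_apply hS hf contDiffOn_const

theorem fderivWithin_apply_eq (S : Set ℂ) (f : ℂ → ℂ) (z v : ℂ) :
    fderivWithin ℝ f S z v = v.re * dirDeriv S 1 f z + v.im * dirDeriv S Complex.I f z := by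
  have h : v = v.re • (1 : ℂ) + v.im • Complex.I := by
    simp [Complex.re_add_im]
  conv_lhs => rw [h, map_add, map_smul, map_smul]
  simp [dirDeriv]

theorem dirDeriv_eq (S : Set ℂ) (f : ℂ → ℂ) (v z : ℂ) :
    dirDeriv S v f z = v.re * dirDeriv S 1 f z + v.im * dirDeriv S Complex.I f z :=
  fderivWithin_apply_eq S f z v

theorem dirDeriv_congr (h : EqOn f g S) (v : ℂ) (hz : z ∈ S) :
    dirDeriv S v f z = dirDeriv S v g z := by
  rw [dirDeriv, dirDeriv, fderivWithin_congr h (h hz)]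

theorem dirDeriv_add (hS : UniqueDiffOn ℝ S) (hf : DifferentiableOn ℝ f S)
    (hg : DifferentiableOn ℝ g S) (v : ℂ) (hz : z ∈ S) :
    dirDeriv S v (fun z => f z + g z) z = dirDeriv S v f z + dirDeriv S v g z := by
  rw [dirDeriv, fderivWithin_fun_add (hS z hz) (hf z hz) (hg z hz)]
  rfl

theorem dirDeriv_mul (hS : UniqueDiffOn ℝ S) (hf : DifferentiableOn ℝ f S)
    (hg : DifferentiableOn ℝ g S) (v : ℂ) (hz : z ∈ S) :
    dirDeriv S v (fun z => f z * g z) z = f z * dirDeriv S v g z + dirDeriv S v f z * g z := by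
  rw [dirDeriv, fderivWithin_fun_mul (hS z hz) (hf z hz) (hg z hz)]
  simp [dirDeriv, mul_comm]

theorem dirDeriv_const_mul (hS : UniqueDiffOn ℝ S) (hg : DifferentiableOn ℝ g S) (c v : ℂ)
    (hz : z ∈ S) : dirDeriv S v (fun z => c * g z) z = c * dirDeriv S v g z := by
  rw [dirDeriv, fderivWithin_const_mul (hS z hz) (hg z hz)]
  simp [dirDeriv]

/-- Mixed second derivatives commute. -/
theorem dirDeriv_comm (hS : Convex ℝ S) (hne : (interior S).Nonempty)
    (hf : ContDiffOn ℝ ∞ f S) (u v : ℂ) (hz : z ∈ S) :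
    dirDeriv S u (dirDeriv S v f) z = dirDeriv S v (dirDeriv S u f) z := by
  have hU := uniqueDiffOn_convex hS hne
  have hcl : z ∈ closure (interior S) := by
    rw [hS.closure_interior_eq_closure_of_nonempty_interior hne]; exact subset_closure hz
  have hsymm : IsSymmSndFDerivWithinAt ℝ f S z :=
    (hf z hz).isSymmSndFDerivWithinAt (n := ∞)
      (by simpa using WithTop.coe_le_coe.2 (le_top : (2 : ℕ∞) ≤ ⊤)) hU hcl hz
  have hd : DifferentiableWithinAt ℝ (fderivWithin ℝ f S) S z :=
    ((hf.fderivWithin hU (m := ∞) (by simp)).differentiableOn (by simp)) z hz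
  have key : ∀ a b : ℂ, dirDeriv S a (dirDeriv S b f) z =
      fderivWithin ℝ (fderivWithin ℝ f S) S z a b := by
    intro a b
    have := (hd.hasFDerivWithinAt.clm_apply
      (hasFDerivWithinAt_const b z S)).fderivWithin (hU z hz)
    change fderivWithin ℝ (fun y => fderivWithin ℝ f S y b) S z a = _
    rw [this]
    simp
  rw [key, key]
  exact hsymm.eq u v

theorem dirDeriv_dirDeriv_eq (hS : Convex ℝ S) (hne : (interior S).Nonempty)
    (hf : ContDiffOn ℝ ∞ f S) (u v : ℂ) (hz : z ∈ S) :
    dirDeriv S u (dirDeriv S v f) z =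
      u.re * v.re * dirDeriv S 1 (dirDeriv S 1 f) z +
      (u.re * v.im + u.im * v.re) * dirDeriv S 1 (dirDeriv S Complex.I f) z +
      u.im * v.im * dirDeriv S Complex.I (dirDeriv S Complex.I f) z := by
  have hU := uniqueDiffOn_convex hS hne
  have h1 := contDiffOn_dirDeriv hU hf 1
  have h2 := contDiffOn_dirDeriv hU hf Complex.I
  have hv : dirDeriv S v f = fun z => (v.re : ℂ) * dirDeriv S 1 f z +
      v.im * dirDeriv S Complex.I f z := by
    funext y; exact dirDeriv_eq S f v y
  have d1 := h1.differentiableOn (n := ∞) (by simp)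
  have d2 := h2.differentiableOn (n := ∞) (by simp)
  have key : ∀ w, dirDeriv S w (dirDeriv S v f) z = v.re * dirDeriv S w (dirDeriv S 1 f) z +
      v.im * dirDeriv S w (dirDeriv S Complex.I f) z := by
    intro w
    rw [hv, dirDeriv_add hU (d1.const_mul _) (d2.const_mul _) w hz,
      dirDeriv_const_mul hU d1 _ _ hz, dirDeriv_const_mul hU d2 _ _ hz]
  rw [dirDeriv_eq, key, key, dirDeriv_comm hS hne hf Complex.I 1 hz]
  ring

end

theorem convex_disk (R : ℝ) : Convex ℝ (disk R) := convex_closedBall 0 R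

theorem interior_disk {R : ℝ} (hR : R ≠ 0) : interior (disk R) = Metric.ball 0 R :=
  interior_closedBall 0 hR

theorem interior_disk_nonempty {R : ℝ} (hR : 0 < R) : (interior (disk R)).Nonempty := by
  rw [interior_disk hR.ne']
  exact ⟨0, Metric.mem_ball_self hR⟩

theorem uniqueDiffOn_disk {R : ℝ} (hR : 0 < R) : UniqueDiffOn ℝ (disk R) :=
  uniqueDiffOn_convex (convex_disk R) (interior_disk_nonempty hR)

theorem mem_disk {R : ℝ} {z : ℂ} : z ∈ disk R ↔ ‖z‖ ≤ R := by simp [disk]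

theorem disk_mem_nhds {R : ℝ} {z : ℂ} (hz : ‖z‖ < R) : disk R ∈ 𝓝 z :=
  mem_of_superset (Metric.isOpen_ball.mem_nhds (by simpa using hz)) Metric.ball_subset_closedBall

theorem SmoothOnDisk.diskDeriv {R : ℝ} (hR : 0 < R) {f : ℂ → ℂ} (hf : SmoothOnDisk R f) (v : ℂ) :
    SmoothOnDisk R (diskDeriv R v f) :=
  contDiffOn_dirDeriv (uniqueDiffOn_disk hR) hf v

theorem SmoothOnDisk.hasFDerivAt {R : ℝ} {f : ℂ → ℂ} (hf : SmoothOnDisk R f)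
    {z : ℂ} (hz : ‖z‖ < R) : HasFDerivAt f (fderivWithin ℝ f (disk R) z) z :=
  (((ContDiffOn.differentiableOn hf (by simp)) z (mem_disk.2 hz.le)).hasFDerivWithinAt).hasFDerivAt
    (disk_mem_nhds hz)

/-! ### Mean values along the chords of the unit disk -/

/-- The point with parameter `s ∈ [-1, 1]` on the chord with signed distance `p.1` from the origin
and direction `e^{i p.2}`. -/
def chordPoint (p : ℝ × ℝ) (s : ℝ) : ℂ :=
  Complex.exp (Complex.I * p.2) * ((√(1 - p.1 ^ 2) * s : ℝ) + Complex.I * p.1)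

/-- The weighted mean `∫ (1 - s²)^m g ds` along a chord. -/
def chordMean (m : ℕ) (g : ℂ → ℂ) (p : ℝ × ℝ) : ℂ :=
  ∫ s in (-1 : ℝ)..1, ((1 - s ^ 2) ^ m : ℝ) * g (chordPoint p s)

/-- The unoriented chords of the closed disk, with their tangent lines. -/
def chordSpace : Set (ℝ × ℝ) := Icc (-1) 1 ×ˢ univ

theorem norm_chordPoint_sq {p : ℝ × ℝ} (hp : p.1 ∈ Icc (-1 : ℝ) 1) (s : ℝ) :
    ‖chordPoint p s‖ ^ 2 = (1 - p.1 ^ 2) * s ^ 2 + p.1 ^ 2 := by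
  have h1 : 0 ≤ 1 - p.1 ^ 2 := by nlinarith [hp.1, hp.2]
  have h2 : ‖Complex.exp (Complex.I * p.2)‖ = 1 := by
    rw [mul_comm]; exact Complex.norm_exp_ofReal_mul_I _
  rw [chordPoint, norm_mul, h2, one_mul, ← Complex.normSq_eq_norm_sq, Complex.normSq_apply]
  simp
  nlinarith [Real.sq_sqrt h1]

theorem chordPoint_mem {p : ℝ × ℝ} (hp : p ∈ chordSpace) {s : ℝ} (hs : s ∈ Icc (-1 : ℝ) 1) :
    chordPoint p s ∈ disk 1 := by
  have h := norm_chordPoint_sq hp.1 s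
  have h1 : 0 ≤ 1 - p.1 ^ 2 := by nlinarith [hp.1.1, hp.1.2]
  have h2 : 0 ≤ 1 - s ^ 2 := by nlinarith [hs.1, hs.2]
  rw [mem_disk]
  nlinarith [norm_nonneg (chordPoint p s), mul_nonneg h1 h2]

theorem norm_chordPoint_lt {p : ℝ × ℝ} (hp : p.1 ∈ Ioo (-1 : ℝ) 1) {s : ℝ}
    (hs : s ∈ Ioo (-1 : ℝ) 1) : ‖chordPoint p s‖ < 1 := by
  have h := norm_chordPoint_sq (Ioo_subset_Icc_self hp) s
  have h1 : 0 < 1 - p.1 ^ 2 := by nlinarith [hp.1, hp.2]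
  have h2 : 0 < 1 - s ^ 2 := by nlinarith [hs.1, hs.2]
  nlinarith [norm_nonneg (chordPoint p s), mul_pos h1 h2]

theorem continuous_chordPoint : Continuous (Function.uncurry chordPoint) := by
  unfold chordPoint Function.uncurry
  fun_prop

theorem continuousOn_chordMean_integrand {g : ℂ → ℂ} (hg : ContinuousOn g (disk 1)) (m : ℕ) :
    ContinuousOn (Function.uncurry fun (p : ℝ × ℝ) (s : ℝ) =>
      (((1 - s ^ 2) ^ m : ℝ) : ℂ) * g (chordPoint p s)) (chordSpace ×ˢ Icc (-1) 1) := by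
  refine ContinuousOn.mul (by fun_prop) ?_
  exact hg.comp continuous_chordPoint.continuousOn fun x hx => chordPoint_mem hx.1 hx.2

theorem continuousOn_chordMean {g : ℂ → ℂ} (hg : ContinuousOn g (disk 1)) (m : ℕ) :
    ContinuousOn (chordMean m g) chordSpace :=
  continuousOn_intervalIntegral (by norm_num) (continuousOn_chordMean_integrand hg m)

theorem chordMean_congr {g₁ g₂ : ℂ → ℂ} (h : EqOn g₁ g₂ (disk 1)) (m : ℕ) {p : ℝ × ℝ}
    (hp : p ∈ chordSpace) : chordMean m g₁ p = chordMean m g₂ p := by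
  refine intervalIntegral.integral_congr fun s hs => ?_
  rw [uIcc_of_le (by norm_num)] at hs
  simp only [h (chordPoint_mem hp hs)]

theorem intervalIntegrable_chord {g : ℂ → ℂ} (hg : ContinuousOn g (disk 1)) {p : ℝ × ℝ}
    (hp : p ∈ chordSpace) {c : ℝ → ℂ} (hc : Continuous c) :
    IntervalIntegrable (fun s => c s * g (chordPoint p s)) volume (-1) 1 := by
  refine ContinuousOn.intervalIntegrable_of_Icc (by norm_num) ?_
  refine hc.continuousOn.mul (hg.comp ?_ fun s hs => chordPoint_mem hp hs)
  exact (continuous_chordPoint.comp (Continuous.prodMk_right p)).continuousOn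

theorem chordMean_add {g₁ g₂ : ℂ → ℂ} (h₁ : ContinuousOn g₁ (disk 1))
    (h₂ : ContinuousOn g₂ (disk 1)) (m : ℕ) {p : ℝ × ℝ} (hp : p ∈ chordSpace) :
    chordMean m (fun z => g₁ z + g₂ z) p = chordMean m g₁ p + chordMean m g₂ p := by
  unfold chordMean
  rw [← intervalIntegral.integral_add (intervalIntegrable_chord h₁ hp (by fun_prop))
    (intervalIntegrable_chord h₂ hp (by fun_prop))]
  simp only [mul_add]

theorem chordMean_const_mul (g : ℂ → ℂ) (m : ℕ) (c : ℂ) (p : ℝ × ℝ) :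
    chordMean m (fun z => c * g z) p = c * chordMean m g p := by
  unfold chordMean
  rw [← intervalIntegral.integral_const_mul]
  congr 1; funext s; ring

theorem hasDerivAt_chordPoint_param (p : ℝ × ℝ) (s : ℝ) :
    HasDerivAt (chordPoint p) (√(1 - p.1 ^ 2) * Complex.exp (Complex.I * p.2)) s := by
  unfold chordPoint
  have h : HasDerivAt (fun s : ℝ => ((√(1 - p.1 ^ 2) * s : ℝ) : ℂ)) (√(1 - p.1 ^ 2) : ℝ) s := by
    have := ((hasDerivAt_id s).const_mul (√(1 - p.1 ^ 2))).ofReal_comp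
    simpa using this
  exact ((h.add_const (Complex.I * p.1)).const_mul (Complex.exp (Complex.I * p.2))).congr_deriv
    (mul_comm _ _)

/-- Integration by parts along a chord. -/
theorem integral_mul_chord_eq {u : ℂ → ℂ} (hu : SmoothOnDisk 1 u) {p : ℝ × ℝ}
    (hp : p.1 ∈ Ioo (-1 : ℝ) 1) {a a' : ℝ → ℝ} (ha : ∀ s, HasDerivAt a (a' s) s)
    (hca' : Continuous a') (ha1 : a 1 = 0) (ha2 : a (-1) = 0) :
    ∫ s in (-1 : ℝ)..1, (a' s : ℂ) * u (chordPoint p s) =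
      -√(1 - p.1 ^ 2) * ∫ s in (-1 : ℝ)..1, (a s : ℂ) *
        diskDeriv 1 (Complex.exp (Complex.I * p.2)) u (chordPoint p s) := by
  set v := Complex.exp (Complex.I * p.2)
  have hp' : p ∈ chordSpace := ⟨Ioo_subset_Icc_self hp, mem_univ _⟩
  have hca : Continuous a := continuous_iff_continuousAt.2 fun s => (ha s).continuousAt
  have hdu := (hu.diskDeriv one_pos v).continuousOn
  have key : ∫ s in (-1 : ℝ)..1, ((a' s : ℂ) * u (chordPoint p s) +
      √(1 - p.1 ^ 2) * ((a s : ℂ) * diskDeriv 1 v u (chordPoint p s))) =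
      (a 1 : ℂ) * u (chordPoint p 1) - (a (-1) : ℂ) * u (chordPoint p (-1)) := by
    refine intervalIntegral.integral_eq_sub_of_hasDerivAt_of_le (by norm_num)
      (f := fun s => (a s : ℂ) * u (chordPoint p s)) ?_ ?_ ?_
    · refine ContinuousOn.mul (by fun_prop) (hu.continuousOn.comp ?_ fun s hs =>
        chordPoint_mem hp' hs)
      exact (continuous_chordPoint.comp (Continuous.prodMk_right p)).continuousOn
    · intro s hs
      have h1 := (hu.hasFDerivAt (norm_chordPoint_lt hp hs)).comp_hasDerivAt s
        (hasDerivAt_chordPoint_param p s)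
      refine ((ha s).ofReal_comp.mul h1).congr_deriv ?_
      have : (√(1 - p.1 ^ 2) : ℂ) * v = √(1 - p.1 ^ 2) • v := by simp
      rw [this, map_smul]
      simp [diskDeriv]
      ring
    · exact (intervalIntegrable_chord hu.continuousOn hp' (by fun_prop)).add
        ((intervalIntegrable_chord hdu hp' (by fun_prop)).const_mul _)
  rw [intervalIntegral.integral_add (intervalIntegrable_chord hu.continuousOn hp' (by fun_prop))
    ((intervalIntegrable_chord hdu hp' (by fun_prop)).const_mul _), ha1, ha2,
    intervalIntegral.integral_const_mul] at key
  simp only [Complex.ofReal_zero, zero_mul, sub_zero] at key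
  linear_combination key

/-- A weight odd in s gains a factor √(1 - q²) by integration by parts. This is what compensates the
singular factor q/√(1 - q²) in the derivative of a chord point. -/
theorem integral_mul_weight_chord_eq {u : ℂ → ℂ} (hu : SmoothOnDisk 1 u) (m : ℕ) {p : ℝ × ℝ}
    (hp : p.1 ∈ Ioo (-1 : ℝ) 1) :
    ∫ s in (-1 : ℝ)..1, ((s * (1 - s ^ 2) ^ m : ℝ) : ℂ) * u (chordPoint p s) =
      √(1 - p.1 ^ 2) / (2 * (m + 1)) *
        chordMean (m + 1) (diskDeriv 1 (Complex.exp (Complex.I * p.2)) u) p := by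
  have hm : (m + 1 : ℝ) ≠ 0 := by positivity
  have hmc : (m + 1 : ℂ) ≠ 0 := by exact_mod_cast hm
  -- The primitive of s(1 - s²)^m that vanishes at both endpoints, so that there is no boundary
  -- term.
  rw [integral_mul_chord_eq hu hp (a := fun s => -(1 - s ^ 2) ^ (m + 1) / (2 * (m + 1)))
    (a' := fun s => s * (1 - s ^ 2) ^ m) ?_ (by fun_prop) (by simp) (by simp), chordMean,
    ← intervalIntegral.integral_const_mul, ← intervalIntegral.integral_const_mul]
  · congr 1; funext s
    push_cast
    field_simp
  · intro s
    refine (((((hasDerivAt_pow 2 s).const_sub 1).pow (m + 1)).neg).div_const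
      (2 * ((m : ℝ) + 1))).congr_deriv ?_
    simp
    field_simp

/-- The derivative along rotations. -/
def rotDeriv (g : ℂ → ℂ) (z : ℂ) : ℂ := fderivWithin ℝ g (disk 1) z (Complex.I * z)

theorem SmoothOnDisk.rotDeriv {g : ℂ → ℂ} (hg : SmoothOnDisk 1 g) : SmoothOnDisk 1 (rotDeriv g) :=
  contDiffOn_fderivWithin_apply (uniqueDiffOn_disk one_pos) hg (by fun_prop)

/-- The derivative of `chordMean m g`. -/
def chordMeanDeriv (m : ℕ) (g : ℂ → ℂ) (p : ℝ × ℝ) : ℝ × ℝ →L[ℝ] ℂ :=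
  (ContinuousLinearMap.fst ℝ ℝ ℝ).smulRight
    (chordMean m (diskDeriv 1 (Complex.I * Complex.exp (Complex.I * p.2)) g) p -
      p.1 / (2 * (m + 1)) * chordMean (m + 1) (diskDeriv 1 (Complex.exp (Complex.I * p.2))
        (diskDeriv 1 (Complex.exp (Complex.I * p.2)) g)) p) +
  (ContinuousLinearMap.snd ℝ ℝ ℝ).smulRight (chordMean m (rotDeriv g) p)

/-- The derivative of `chordPoint p s` in `p`. -/
def chordPointDeriv (p : ℝ × ℝ) (s : ℝ) : ℝ × ℝ →L[ℝ] ℂ :=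
  (ContinuousLinearMap.fst ℝ ℝ ℝ).smulRight
    (Complex.exp (Complex.I * p.2) * (((-(p.1 / √(1 - p.1 ^ 2)) * s : ℝ) : ℂ) + Complex.I)) +
  (ContinuousLinearMap.snd ℝ ℝ ℝ).smulRight (Complex.I * chordPoint p s)

theorem hasDerivAt_sqrt_one_sub_sq {q : ℝ} (hq : q ∈ Ioo (-1 : ℝ) 1) :
    HasDerivAt (fun q : ℝ => √(1 - q ^ 2)) (-(q / √(1 - q ^ 2))) q := by
  have h : 1 - q ^ 2 ≠ 0 := by nlinarith [hq.1, hq.2]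
  refine (((hasDerivAt_pow 2 q).const_sub 1).sqrt h).congr_deriv ?_
  have : √(1 - q ^ 2) ≠ 0 := by
    rw [Real.sqrt_ne_zero'] ; nlinarith [hq.1, hq.2]
  field_simp
  simp

theorem hasDerivAt_exp_I (θ : ℝ) :
    HasDerivAt (fun θ : ℝ => Complex.exp (Complex.I * θ))
      (Complex.I * Complex.exp (Complex.I * θ)) θ := by
  refine ((((Complex.ofRealCLM.hasDerivAt (x := θ)).const_mul Complex.I)).cexp).congr_deriv ?_
  simp [mul_comm]

theorem hasFDerivAt_chordPoint {p : ℝ × ℝ} (hp : p.1 ∈ Ioo (-1 : ℝ) 1) (s : ℝ) :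
    HasFDerivAt (fun p => chordPoint p s) (chordPointDeriv p s) p := by
  have h1 : HasFDerivAt (fun p : ℝ × ℝ => Complex.exp (Complex.I * p.2)) _ p :=
    (hasDerivAt_exp_I p.2).hasFDerivAt.comp p hasFDerivAt_snd
  have h3 : HasDerivAt (fun q : ℝ => ((√(1 - q ^ 2) * s : ℝ) : ℂ) + Complex.I * q)
      (((-(p.1 / √(1 - p.1 ^ 2)) * s : ℝ) : ℂ) + Complex.I) p.1 := by
    refine ((((hasDerivAt_sqrt_one_sub_sq hp).mul_const s).ofReal_comp).add
      ((Complex.ofRealCLM.hasDerivAt (x := p.1)).const_mul Complex.I)).congr_deriv ?_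
    simp
  have h2 : HasFDerivAt (fun p : ℝ × ℝ => ((√(1 - p.1 ^ 2) * s : ℝ) : ℂ) + Complex.I * p.1) _ p :=
    h3.hasFDerivAt.comp p hasFDerivAt_fst
  refine (h1.mul h2).congr_fderiv ?_
  ext
  · simp [chordPointDeriv]
  · simp [chordPointDeriv, chordPoint]
    ring

theorem isOpen_interior_chordSpace : IsOpen (Ioo (-1 : ℝ) 1 ×ˢ (univ : Set ℝ)) :=
  isOpen_Ioo.prod isOpen_univ

/-- Differentiation under the integral gives the normal derivative of g and, because the chord
shrinks, a term -(q/√(1 - q²)) s ∂_v g. Integrating the latter by parts removes the singular factor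
and raises the exponent of 1 - s² by one. -/
theorem hasFDerivAt_chordMean {g : ℂ → ℂ} (hg : SmoothOnDisk 1 g) (m : ℕ) {p : ℝ × ℝ}
    (hp : p.1 ∈ Ioo (-1 : ℝ) 1) : HasFDerivAt (chordMean m g) (chordMeanDeriv m g p) p := by
  have hp' : p ∈ chordSpace := ⟨Ioo_subset_Icc_self hp, mem_univ _⟩
  set U : Set (ℝ × ℝ) := Ioo (-1 : ℝ) 1 ×ˢ univ with hU
  have hsub : U ⊆ chordSpace := prod_mono Ioo_subset_Icc_self subset_rfl
  have hDg : ContinuousOn (fderivWithin ℝ g (disk 1)) (disk 1) :=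
    ContDiffOn.continuousOn_fderivWithin hg (uniqueDiffOn_disk one_pos) (by simp)
  set f' : ℝ × ℝ → ℝ → ℝ × ℝ →L[ℝ] ℂ := fun p s =>
    ((1 - s ^ 2) ^ m : ℝ) • (fderivWithin ℝ g (disk 1) (chordPoint p s)).comp
      (chordPointDeriv p s) with hf'def
  have hcd : ContinuousOn (Function.uncurry chordPointDeriv) (U ×ˢ Icc (-1) 1) := by
    have h0 : ContinuousOn (fun x : (ℝ × ℝ) × ℝ => x.1.1 / √(1 - x.1.1 ^ 2)) (U ×ˢ Icc (-1) 1) := by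
      refine ContinuousOn.div (by fun_prop) (by fun_prop) fun x hx => ?_
      rw [Real.sqrt_ne_zero']; nlinarith [hx.1.1.1, hx.1.1.2]
    have h1 : ContinuousOn (fun x : (ℝ × ℝ) × ℝ => chordPoint x.1 x.2) (U ×ˢ Icc (-1) 1) :=
      continuous_chordPoint.continuousOn
    unfold chordPointDeriv Function.uncurry
    refine ContinuousOn.add ?_ ?_
    · refine (ContinuousLinearMap.smulRightL ℝ (ℝ × ℝ) ℂ
        (ContinuousLinearMap.fst ℝ ℝ ℝ)).continuous.comp_continuousOn ?_
      refine ContinuousOn.mul (by fun_prop) (ContinuousOn.add ?_ (by fun_prop))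
      exact Complex.continuous_ofReal.comp_continuousOn (h0.neg.mul (by fun_prop))
    · exact (ContinuousLinearMap.smulRightL ℝ (ℝ × ℝ) ℂ
        (ContinuousLinearMap.snd ℝ ℝ ℝ)).continuous.comp_continuousOn (continuousOn_const.mul h1)
  have hcf' : ContinuousOn (Function.uncurry f') (U ×ˢ Icc (-1) 1) := by
    have hw : ContinuousOn (fun x : (ℝ × ℝ) × ℝ => ((1 - x.2 ^ 2) ^ m : ℝ)) (U ×ˢ Icc (-1) 1) := by
      fun_prop
    refine hw.smul (ContinuousOn.clm_comp ?_ hcd)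
    exact hDg.comp continuous_chordPoint.continuousOn fun x hx =>
      chordPoint_mem (hsub hx.1) hx.2
  have key := hasFDerivAt_intervalIntegral (U := U) isOpen_interior_chordSpace
    (a := -1) (b := 1) (by norm_num)
    (f := fun p s => (((1 - s ^ 2) ^ m : ℝ) : ℂ) * g (chordPoint p s)) (f' := f')
    ((continuousOn_chordMean_integrand hg.continuousOn m).mono (prod_mono hsub subset_rfl))
    hcf' (fun x hx s hs => by
      have h1 := ((hg.hasFDerivAt (norm_chordPoint_lt hx.1 hs)).comp x
        (hasFDerivAt_chordPoint hx.1 s)).const_smul ((1 - s ^ 2) ^ m : ℝ)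
      exact h1.congr_of_eventuallyEq (.of_forall fun y => by simp))
    (x := p) ⟨hp, mem_univ _⟩
  refine key.congr_fderiv ?_
  have hint : IntervalIntegrable (f' p) volume (-1) 1 := by
    refine ContinuousOn.intervalIntegrable_of_Icc (by norm_num) ?_
    exact hcf'.comp (f := fun s => (p, s)) (by fun_prop) fun s hs => ⟨⟨hp, mem_univ _⟩, hs⟩
  have hfst : chordMeanDeriv m g p (1, 0) = chordMean m (diskDeriv 1
      (Complex.I * Complex.exp (Complex.I * p.2)) g) p -
      p.1 / (2 * (m + 1)) * chordMean (m + 1) (diskDeriv 1 (Complex.exp (Complex.I * p.2))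
        (diskDeriv 1 (Complex.exp (Complex.I * p.2)) g)) p := by simp [chordMeanDeriv]
  have hsnd : chordMeanDeriv m g p (0, 1) = chordMean m (rotDeriv g) p := by
    simp [chordMeanDeriv]
  set v := Complex.exp (Complex.I * p.2) with hv
  have hsq : (√(1 - p.1 ^ 2) : ℂ) ≠ 0 := by
    rw [Complex.ofReal_ne_zero, Real.sqrt_ne_zero']; nlinarith [hp.1, hp.2]
  apply ContinuousLinearMap.ext
  suffices h : (∫ s in (-1 : ℝ)..1, f' p s) (1, 0) = chordMeanDeriv m g p (1, 0) ∧
      (∫ s in (-1 : ℝ)..1, f' p s) (0, 1) = chordMeanDeriv m g p (0, 1) by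
    rintro ⟨x, y⟩
    have hxy : ((x, y) : ℝ × ℝ) = x • ((1, 0) : ℝ × ℝ) + y • ((0, 1) : ℝ × ℝ) := by simp
    rw [hxy, map_add, map_add, map_smul, map_smul, map_smul, map_smul, h.1, h.2]
  rw [ContinuousLinearMap.intervalIntegral_apply hint,
    ContinuousLinearMap.intervalIntegral_apply hint, hfst, hsnd]
  constructor
  · have hw := integral_mul_weight_chord_eq (hg.diskDeriv one_pos v) m hp
    have h1 : ∀ s, f' p s (1, 0) = (((1 - s ^ 2) ^ m : ℝ) : ℂ) * diskDeriv 1 (Complex.I * v) g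
        (chordPoint p s) - p.1 / √(1 - p.1 ^ 2) *
          (((s * (1 - s ^ 2) ^ m : ℝ) : ℂ) * diskDeriv 1 v g (chordPoint p s)) := by
      intro s
      have h2 : chordPointDeriv p s (1, 0) = Complex.I * v -
          (p.1 / √(1 - p.1 ^ 2) * s) • v := by
        simp [chordPointDeriv, ← hv]
        ring
      simp only [hf'def, smul_apply, ContinuousLinearMap.comp_apply, h2,
        map_sub, map_smul, diskDeriv]
      simp
      ring
    simp only [h1]
    have hd := fun w => (hg.diskDeriv one_pos w).continuousOn
    rw [intervalIntegral.integral_sub (intervalIntegrable_chord (hd _) hp' (by fun_prop))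
      ((intervalIntegrable_chord (hd _) hp' (by fun_prop)).const_mul _),
      intervalIntegral.integral_const_mul, hw]
    rw [← hv, ← chordMean]
    field_simp
  · rw [chordMean]
    congr 1; funext s
    simp [hf'def, chordPointDeriv, rotDeriv]

theorem convex_chordSpace : Convex ℝ chordSpace := (convex_Icc _ _).prod convex_univ

theorem interior_chordSpace : interior chordSpace = Ioo (-1) 1 ×ˢ univ := by
  rw [chordSpace, interior_prod_eq, interior_Icc, interior_univ]

theorem interior_chordSpace_nonempty : (interior chordSpace).Nonempty := by
  rw [interior_chordSpace]; exact ⟨(0, 0), by norm_num, mem_univ _⟩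

theorem _root_.ContinuousOn.const_mul' {g : ℂ → ℂ} {S : Set ℂ} (hg : ContinuousOn g S) (c : ℂ) :
    ContinuousOn (fun z => c * g z) S :=
  continuousOn_const.mul hg

theorem _root_.ContinuousOn.add' {f g : ℂ → ℂ} {S : Set ℂ} (hf : ContinuousOn f S)
    (hg : ContinuousOn g S) : ContinuousOn (fun z => f z + g z) S :=
  hf.add hg

theorem chordMean_dirDeriv_eq {g : ℂ → ℂ} (hg : SmoothOnDisk 1 g) (m : ℕ) (v : ℂ) {p : ℝ × ℝ}
    (hp : p ∈ chordSpace) : chordMean m (diskDeriv 1 v g) p =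
      v.re * chordMean m (diskDeriv 1 1 g) p + v.im * chordMean m (diskDeriv 1 Complex.I g) p := by
  have h1 := (hg.diskDeriv one_pos 1).continuousOn
  have h2 := (hg.diskDeriv one_pos Complex.I).continuousOn
  have : diskDeriv 1 v g = fun z => (v.re : ℂ) * diskDeriv 1 1 g z +
      v.im * diskDeriv 1 Complex.I g z := by
    funext z; exact dirDeriv_eq _ g v z
  rw [this, chordMean_add (h1.const_mul' _) (h2.const_mul' _) m hp,
    chordMean_const_mul, chordMean_const_mul]

theorem chordMean_dirDeriv_dirDeriv_eq {g : ℂ → ℂ} (hg : SmoothOnDisk 1 g) (m : ℕ) (v : ℂ)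
    {p : ℝ × ℝ} (hp : p ∈ chordSpace) : chordMean m (diskDeriv 1 v (diskDeriv 1 v g)) p =
      (v.re ^ 2 : ℝ) * chordMean m (diskDeriv 1 1 (diskDeriv 1 1 g)) p +
      (2 * v.re * v.im : ℝ) * chordMean m (diskDeriv 1 1 (diskDeriv 1 Complex.I g)) p +
      (v.im ^ 2 : ℝ) * chordMean m (diskDeriv 1 Complex.I (diskDeriv 1 Complex.I g)) p := by
  have h1 := hg.diskDeriv one_pos 1
  have h2 := hg.diskDeriv one_pos Complex.I
  have h11 := (h1.diskDeriv one_pos 1).continuousOn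
  have h12 := (h2.diskDeriv one_pos 1).continuousOn
  have h22 := (h2.diskDeriv one_pos Complex.I).continuousOn
  rw [chordMean_congr (g₂ := fun z =>
    ((v.re ^ 2 : ℝ) : ℂ) * diskDeriv 1 1 (diskDeriv 1 1 g) z +
      ((2 * v.re * v.im : ℝ) : ℂ) * diskDeriv 1 1 (diskDeriv 1 Complex.I g) z +
      ((v.im ^ 2 : ℝ) : ℂ) * diskDeriv 1 Complex.I (diskDeriv 1 Complex.I g) z) ?_ m hp,
    chordMean_add ((h11.const_mul' _).add' (h12.const_mul' _)) (h22.const_mul' _) m hp,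
    chordMean_add (h11.const_mul' _) (h12.const_mul' _) m hp,
    chordMean_const_mul, chordMean_const_mul, chordMean_const_mul]
  intro z hz
  have := dirDeriv_dirDeriv_eq (convex_disk 1) (interior_disk_nonempty one_pos) hg v v hz
  simp only [diskDeriv_eq_dirDeriv]
  rw [this]
  push_cast
  ring

/-- The means of a smooth function along chords depend smoothly on the chord, also where the chord
degenerates to a point. -/
theorem contDiffOn_chordMean_nat (n : ℕ) : ∀ (m : ℕ) {g : ℂ → ℂ}, SmoothOnDisk 1 g →
    ContDiffOn ℝ n (chordMean m g) chordSpace := by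
  induction n with
  | zero => exact fun m g hg => contDiffOn_zero.2 (continuousOn_chordMean hg.continuousOn m)
  | succ n ih =>
    intro m g hg
    refine contDiffOn_succ_of_interior convex_chordSpace interior_chordSpace_nonempty
      (continuousOn_chordMean hg.continuousOn m) (f' := chordMeanDeriv m g) ?_ ?_
    -- The directions in the derivative rotate with the chord. Expanded in ∂_x and ∂_y they leave
    -- means of fixed smooth functions, with coefficients smooth in the chord, and the induction
    -- hypothesis applies to the weights m and m + 1.
    · have h1 := hg.diskDeriv one_pos 1
      have h2 := hg.diskDeriv one_pos Complex.I
      have h11 := ih (m + 1) (h1.diskDeriv one_pos 1)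
      have h12 := ih (m + 1) (h2.diskDeriv one_pos 1)
      have h22 := ih (m + 1) (h2.diskDeriv one_pos Complex.I)
      have h1 := ih m h1
      have h2 := ih m h2
      have hr := ih m hg.rotDeriv
      have hcos : ContDiff ℝ n fun p : ℝ × ℝ => ((Complex.exp (Complex.I * p.2)).re : ℂ) := by
        have : (fun p : ℝ × ℝ => ((Complex.exp (Complex.I * p.2)).re : ℂ)) =
            fun p => Complex.ofRealCLM (Complex.reCLM (Complex.exp (Complex.I *
              Complex.ofRealCLM p.2))) := rfl
        rw [this]; fun_prop
      have hsin : ContDiff ℝ n fun p : ℝ × ℝ => ((Complex.exp (Complex.I * p.2)).im : ℂ) := by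
        have : (fun p : ℝ × ℝ => ((Complex.exp (Complex.I * p.2)).im : ℂ)) =
            fun p => Complex.ofRealCLM (Complex.imCLM (Complex.exp (Complex.I *
              Complex.ofRealCLM p.2))) := rfl
        rw [this]; fun_prop
      have hq : ContDiff ℝ n fun p : ℝ × ℝ => (p.1 : ℂ) :=
        Complex.ofRealCLM.contDiff.comp contDiff_fst
      have hcos := hcos.contDiffOn (s := chordSpace)
      have hsin := hsin.contDiffOn (s := chordSpace)
      have hq := hq.contDiffOn (s := chordSpace)
      refine ContDiffOn.add ((ContinuousLinearMap.smulRightL ℝ (ℝ × ℝ) ℂ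
        (ContinuousLinearMap.fst ℝ ℝ ℝ)).contDiff.comp_contDiffOn ?_)
        ((ContinuousLinearMap.smulRightL ℝ (ℝ × ℝ) ℂ
          (ContinuousLinearMap.snd ℝ ℝ ℝ)).contDiff.comp_contDiffOn hr)
      refine ContDiffOn.congr (f := fun p : ℝ × ℝ =>
        (-((Complex.exp (Complex.I * p.2)).im : ℂ) * chordMean m (diskDeriv 1 1 g) p +
          ((Complex.exp (Complex.I * p.2)).re : ℂ) * chordMean m (diskDeriv 1 Complex.I g) p) -
        p.1 * (2 * (m + 1) : ℂ)⁻¹ *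
          (((Complex.exp (Complex.I * p.2)).re : ℂ) * (Complex.exp (Complex.I * p.2)).re *
              chordMean (m + 1) (diskDeriv 1 1 (diskDeriv 1 1 g)) p +
            2 * (Complex.exp (Complex.I * p.2)).re * (Complex.exp (Complex.I * p.2)).im *
              chordMean (m + 1) (diskDeriv 1 1 (diskDeriv 1 Complex.I g)) p +
            ((Complex.exp (Complex.I * p.2)).im : ℂ) * (Complex.exp (Complex.I * p.2)).im *
              chordMean (m + 1) (diskDeriv 1 Complex.I (diskDeriv 1 Complex.I g)) p)) ?_ ?_
      · exact ((hsin.neg.mul h1).add (hcos.mul h2)).sub ((hq.mul contDiffOn_const).mul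
          ((((hcos.mul hcos).mul h11).add (((contDiffOn_const.mul hcos).mul hsin).mul h12)).add
            ((hsin.mul hsin).mul h22)))
      · intro p hp
        rw [chordMean_dirDeriv_eq hg m _ hp, chordMean_dirDeriv_dirDeriv_eq hg (m + 1) _ hp]
        simp only [Complex.mul_re, Complex.mul_im, Complex.I_re, Complex.I_im]
        push_cast
        ring
    · rw [interior_chordSpace]
      exact fun p hp => hasFDerivAt_chordMean hg m hp.1

theorem contDiffOn_chordMean {g : ℂ → ℂ} (hg : SmoothOnDisk 1 g) (m : ℕ) :
    ContDiffOn ℝ ∞ (chordMean m g) chordSpace :=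
  contDiffOn_infty.2 fun n => contDiffOn_chordMean_nat n m hg

/-! ### The Zernike operator and chord means -/

/-- The Zernike operator `-(Δ - (x·∇)² - 2 x·∇) + 1` of the unit disk. -/
def zernike (S : Set ℂ) (g : ℂ → ℂ) (z : ℂ) : ℂ :=
  -((1 - z.re ^ 2) * dirDeriv S 1 (dirDeriv S 1 g) z
      - 2 * z.re * z.im * dirDeriv S 1 (dirDeriv S Complex.I g) z
      + (1 - z.im ^ 2) * dirDeriv S Complex.I (dirDeriv S Complex.I g) z)
    + 3 * (z.re * dirDeriv S 1 g z + z.im * dirDeriv S Complex.I g z) + g z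

theorem zernike_contDiffOn {S : Set ℂ} (hS : UniqueDiffOn ℝ S) {g : ℂ → ℂ}
    (hg : ContDiffOn ℝ ∞ g S) : ContDiffOn ℝ ∞ (zernike S g) S := by
  have h1 := contDiffOn_dirDeriv hS hg 1
  have h2 := contDiffOn_dirDeriv hS hg Complex.I
  have h11 := contDiffOn_dirDeriv hS h1 1
  have h12 := contDiffOn_dirDeriv hS h2 1
  have h22 := contDiffOn_dirDeriv hS h2 Complex.I
  have hre : ContDiffOn ℝ ∞ (fun z : ℂ => (z.re : ℂ)) S :=
    (Complex.ofRealCLM.contDiff.comp Complex.reCLM.contDiff).contDiffOn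
  have him : ContDiffOn ℝ ∞ (fun z : ℂ => (z.im : ℂ)) S :=
    (Complex.ofRealCLM.contDiff.comp Complex.imCLM.contDiff).contDiffOn
  exact ((((contDiffOn_const.sub (hre.pow 2)).mul h11).sub
    (((contDiffOn_const.mul hre).mul him).mul h12)).add
    ((contDiffOn_const.sub (him.pow 2)).mul h22)).neg.add
    (contDiffOn_const.mul ((hre.mul h1).add (him.mul h2))) |>.add hg

/-- The Zernike operator in a rotated orthonormal frame. -/
theorem zernike_eq_of_frame {S : Set ℂ} (hS : Convex ℝ S) (hne : (interior S).Nonempty) {g : ℂ → ℂ}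
    (hg : ContDiffOn ℝ ∞ g S) {v : ℂ} (hv : v.re ^ 2 + v.im ^ 2 = 1) {t q : ℝ} {z : ℂ}
    (hz : z ∈ S) (hzv : z = v * (t + Complex.I * q)) :
    zernike S g z = -((1 - t ^ 2) * dirDeriv S v (dirDeriv S v g) z
      - 2 * t * q * dirDeriv S v (dirDeriv S (Complex.I * v) g) z
      + (1 - q ^ 2) * dirDeriv S (Complex.I * v) (dirDeriv S (Complex.I * v) g) z)
    + 3 * (t * dirDeriv S v g z + q * dirDeriv S (Complex.I * v) g z) + g z := by
  have hre : z.re = v.re * t - v.im * q := by rw [hzv]; simp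
  have him : z.im = v.re * q + v.im * t := by rw [hzv]; simp
  have hv' : (v.re : ℂ) ^ 2 + (v.im : ℂ) ^ 2 = 1 := by exact_mod_cast hv
  rw [dirDeriv_dirDeriv_eq hS hne hg v v hz, dirDeriv_dirDeriv_eq hS hne hg v _ hz,
    dirDeriv_dirDeriv_eq hS hne hg (Complex.I * v) _ hz, dirDeriv_eq S g v,
    dirDeriv_eq S g (Complex.I * v), zernike, hre, him]
  simp only [Complex.mul_re, Complex.mul_im, Complex.I_re, Complex.I_im]
  push_cast
  linear_combination (dirDeriv S 1 (dirDeriv S 1 g) z +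
    dirDeriv S Complex.I (dirDeriv S Complex.I g) z) * hv'

theorem exp_re_sq_add_im_sq (θ : ℝ) :
    (Complex.exp (Complex.I * θ)).re ^ 2 + (Complex.exp (Complex.I * θ)).im ^ 2 = 1 := by
  rw [mul_comm, Complex.exp_ofReal_mul_I_re, Complex.exp_ofReal_mul_I_im, Real.cos_sq_add_sin_sq]

/-- The identity `∫ (3 s² - 1) u ds = (1 - q²) / 4 ∫ (1 - s²)² ∂_v² u ds` along chords. -/
theorem chordMean_zero_sub_one {u : ℂ → ℂ} (hu : SmoothOnDisk 1 u) {p : ℝ × ℝ}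
    (hp : p.1 ∈ Ioo (-1 : ℝ) 1) :
    chordMean 0 u p - 3 / 2 * chordMean 1 u p = (1 - p.1 ^ 2) / 8 *
      chordMean 2 (diskDeriv 1 (Complex.exp (Complex.I * p.2))
        (diskDeriv 1 (Complex.exp (Complex.I * p.2)) u)) p := by
  have hp' : p ∈ chordSpace := ⟨Ioo_subset_Icc_self hp, mem_univ _⟩
  set v := Complex.exp (Complex.I * p.2) with hv
  have hw := integral_mul_weight_chord_eq (hu.diskDeriv one_pos v) 1 hp
  -- The combination 1 - (3/2)(1 - s²) = (3s² - 1)/2 is the derivative of (s³ - s)/2, which vanishes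
  -- at both endpoints and is again an odd weight, so a second integration by parts is possible.
  have h1 := integral_mul_chord_eq hu hp (a := fun s => (s ^ 3 - s) / 2)
    (a' := fun s => (3 * s ^ 2 - 1) / 2)
    (fun s => (((hasDerivAt_pow 3 s).sub (hasDerivAt_id s)).div_const 2).congr_deriv (by simp))
    (by fun_prop) (by norm_num) (by norm_num)
  have hsq : (√(1 - p.1 ^ 2) : ℂ) * √(1 - p.1 ^ 2) = 1 - p.1 ^ 2 := by
    rw [← Complex.ofReal_mul, Real.mul_self_sqrt (by nlinarith [hp.1, hp.2])]
    simp
  have h2 : chordMean 0 u p - 3 / 2 * chordMean 1 u p =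
      ∫ s in (-1 : ℝ)..1, (((3 * s ^ 2 - 1) / 2 : ℝ) : ℂ) * u (chordPoint p s) := by
    unfold chordMean
    rw [← intervalIntegral.integral_const_mul, ← intervalIntegral.integral_sub
      (intervalIntegrable_chord hu.continuousOn hp' (by fun_prop))
      ((intervalIntegrable_chord hu.continuousOn hp' (by fun_prop)).const_mul _)]
    congr 1; funext s; push_cast; ring
  have h3 : ∫ s in (-1 : ℝ)..1, (((s ^ 3 - s) / 2 : ℝ) : ℂ) * diskDeriv 1 v u (chordPoint p s) =
      -(1 / 2) * ∫ s in (-1 : ℝ)..1, ((s * (1 - s ^ 2) ^ 1 : ℝ) : ℂ) *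
        diskDeriv 1 v u (chordPoint p s) := by
    rw [← intervalIntegral.integral_const_mul]
    congr 1; funext s; push_cast; ring
  rw [h2, h1, ← hv, h3, hw, ← hv]
  push_cast
  linear_combination (1 / 8 * chordMean 2 (diskDeriv 1 v (diskDeriv 1 v u)) p) * hsq

theorem hasDerivAt_chordMean_fst {g : ℂ → ℂ} (hg : SmoothOnDisk 1 g) (m : ℕ) {q : ℝ}
    (hq : q ∈ Ioo (-1 : ℝ) 1) (θ : ℝ) :
    HasDerivAt (fun q => chordMean m g (q, θ))
      (chordMean m (diskDeriv 1 (Complex.I * Complex.exp (Complex.I * θ)) g) (q, θ) -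
        q / (2 * (m + 1)) * chordMean (m + 1) (diskDeriv 1 (Complex.exp (Complex.I * θ))
          (diskDeriv 1 (Complex.exp (Complex.I * θ)) g)) (q, θ)) q := by
  have h := (hasFDerivAt_chordMean hg m (p := (q, θ)) hq).comp_hasDerivAt q
    ((hasDerivAt_id q).prodMk (hasDerivAt_const q θ))
  exact h.congr_deriv (by simp [chordMeanDeriv])

/-- The mean of `zernike g` along a chord. -/
theorem chordMean_zernike {g : ℂ → ℂ} (hg : SmoothOnDisk 1 g) {p : ℝ × ℝ}
    (hp : p.1 ∈ Ioo (-1 : ℝ) 1) {v : ℂ} (hv : v = Complex.exp (Complex.I * p.2)) :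
    chordMean 0 (zernike (disk 1) g) p =
      -(p.1 ^ 2 * chordMean 0 (diskDeriv 1 v (diskDeriv 1 v g)) p
        + (1 - p.1 ^ 2) * chordMean 1 (diskDeriv 1 v (diskDeriv 1 v g)) p
        - (1 - p.1 ^ 2) * p.1 *
          chordMean 1 (diskDeriv 1 v (diskDeriv 1 v (diskDeriv 1 (Complex.I * v) g))) p
        + (1 - p.1 ^ 2) * chordMean 0 (diskDeriv 1 (Complex.I * v) (diskDeriv 1 (Complex.I * v) g)) p)
      + 3 / 2 * (1 - p.1 ^ 2) * chordMean 1 (diskDeriv 1 v (diskDeriv 1 v g)) p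
      + 3 * p.1 * chordMean 0 (diskDeriv 1 (Complex.I * v) g) p + chordMean 0 g p := by
  have hp' : p ∈ chordSpace := ⟨Ioo_subset_Icc_self hp, mem_univ _⟩
  set n := Complex.I * v with hn
  set r : ℝ := √(1 - p.1 ^ 2) with hr
  have hsq : (r : ℂ) * r = 1 - p.1 ^ 2 := by
    rw [← Complex.ofReal_mul, Real.mul_self_sqrt (by nlinarith [hp.1, hp.2])]
    simp
  have sv := hg.diskDeriv one_pos v
  have sn := hg.diskDeriv one_pos n
  have svv := sv.diskDeriv one_pos v
  have svn := sn.diskDeriv one_pos v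
  have snn := sn.diskDeriv one_pos n
  -- The terms of `zernike` that are odd in s are integrated by parts; the resulting √(1 - q²) joins
  -- the one already present in the coordinate t = √(1 - q²) s.
  have hw1 := integral_mul_weight_chord_eq sv 0 hp
  have hw2 := integral_mul_weight_chord_eq svn 0 hp
  rw [← hv] at hw1 hw2
  have hint : ∀ {u : ℂ → ℂ} (hu : SmoothOnDisk 1 u) {c : ℝ → ℂ} (hc : Continuous c),
      IntervalIntegrable (fun s => c s * u (chordPoint p s)) volume (-1) 1 :=
    fun hu _ hc => intervalIntegrable_chord hu.continuousOn hp' hc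
  have h0 : ∀ u : ℂ → ℂ, chordMean 0 u p = ∫ s in (-1 : ℝ)..1, (1 : ℂ) * u (chordPoint p s) := by
    intro u; unfold chordMean; simp
  have hw0 : ∀ u : ℂ → ℂ, (∫ s in (-1 : ℝ)..1, ((s * (1 - s ^ 2) ^ 0 : ℝ) : ℂ) *
      u (chordPoint p s)) = ∫ s in (-1 : ℝ)..1, (s : ℂ) * u (chordPoint p s) := by
    intro u; simp
  rw [hw0] at hw1 hw2
  -- In the frame of the chord the point has coordinates (t, q) with t = √(1 - q²) s, and 1 - t² =
  -- q² + (1 - q²)(1 - s²) splits the tangential term into weights 0 and 1.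
  have main : chordMean 0 (zernike (disk 1) g) p = ∫ s in (-1 : ℝ)..1,
      ((-(p.1 : ℂ) ^ 2) * ((1 : ℂ) * diskDeriv 1 v (diskDeriv 1 v g) (chordPoint p s))
      + (-(1 - p.1 ^ 2 : ℂ)) * ((((1 - s ^ 2) ^ 1 : ℝ) : ℂ) *
          diskDeriv 1 v (diskDeriv 1 v g) (chordPoint p s))
      + (2 * r * p.1 : ℂ) * ((s : ℂ) * diskDeriv 1 v (diskDeriv 1 n g) (chordPoint p s))
      + (-(1 - p.1 ^ 2 : ℂ)) * ((1 : ℂ) * diskDeriv 1 n (diskDeriv 1 n g) (chordPoint p s))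
      + (3 * r : ℂ) * ((s : ℂ) * diskDeriv 1 v g (chordPoint p s))
      + (3 * p.1 : ℂ) * ((1 : ℂ) * diskDeriv 1 n g (chordPoint p s))
      + (1 : ℂ) * ((1 : ℂ) * g (chordPoint p s))) := by
    rw [h0]
    refine intervalIntegral.integral_congr fun s hs => ?_
    rw [uIcc_of_le (by norm_num)] at hs
    have hz := chordPoint_mem hp' hs
    rw [zernike_eq_of_frame (convex_disk 1) (interior_disk_nonempty one_pos) hg
      (v := v) (by rw [hv]; exact exp_re_sq_add_im_sq _) (t := r * s) (q := p.1) hz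
      (by rw [chordPoint, hv])]
    simp only [diskDeriv_eq_dirDeriv, ← hn]
    push_cast
    linear_combination (-(s : ℂ) ^ 2 * -dirDeriv (disk 1) v (dirDeriv (disk 1) v g)
      (chordPoint p s)) * hsq
  have i1 := (hint svv (c := fun _ => 1) (by fun_prop)).const_mul (-(p.1 : ℂ) ^ 2)
  have i2 := (hint svv (c := fun s => (((1 - s ^ 2) ^ 1 : ℝ) : ℂ)) (by fun_prop)).const_mul
    (-(1 - p.1 ^ 2 : ℂ))
  have i3 := (hint svn (c := fun s => (s : ℂ)) (by fun_prop)).const_mul (2 * r * p.1 : ℂ)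
  have i4 := (hint snn (c := fun _ => 1) (by fun_prop)).const_mul (-(1 - p.1 ^ 2 : ℂ))
  have i5 := (hint sv (c := fun s => (s : ℂ)) (by fun_prop)).const_mul (3 * r : ℂ)
  have i6 := (hint sn (c := fun _ => 1) (by fun_prop)).const_mul (3 * p.1 : ℂ)
  have i7 := (hint hg (c := fun _ => 1) (by fun_prop)).const_mul (1 : ℂ)
  rw [main,
    intervalIntegral.integral_add (((((i1.add i2).add i3).add i4).add i5).add i6) i7,
    intervalIntegral.integral_add ((((i1.add i2).add i3).add i4).add i5) i6,
    intervalIntegral.integral_add (((i1.add i2).add i3).add i4) i5,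
    intervalIntegral.integral_add ((i1.add i2).add i3) i4,
    intervalIntegral.integral_add (i1.add i2) i3,
    intervalIntegral.integral_add i1 i2]
  have h0' : ∀ u : ℂ → ℂ, ∫ s in (-1 : ℝ)..1, u (chordPoint p s) = chordMean 0 u p := by
    intro u; rw [h0]; simp only [one_mul]
  simp only [intervalIntegral.integral_const_mul, one_mul]
  rw [hw1, hw2, h0', h0', h0', h0', ← chordMean]
  push_cast
  linear_combination (p.1 * chordMean 1 (diskDeriv 1 v (diskDeriv 1 v (diskDeriv 1 n g))) p +
    3 / 2 * chordMean 1 (diskDeriv 1 v (diskDeriv 1 v g)) p) * hsq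

/-- Means along chords intertwine the Zernike operator with
`-(1 - q²) ∂_q² + 3 q ∂_q + 1`. -/
theorem exists_deriv_chordMean {g : ℂ → ℂ} (hg : SmoothOnDisk 1 g) (θ : ℝ) :
    ∃ k₁ k₂ : ℝ → ℂ, ∀ q ∈ Ioo (-1 : ℝ) 1,
      HasDerivAt (fun q => chordMean 0 g (q, θ)) (k₁ q) q ∧ HasDerivAt k₁ (k₂ q) q ∧
      -((1 - q ^ 2) * k₂ q) + 3 * q * k₁ q + chordMean 0 g (q, θ) =
        chordMean 0 (zernike (disk 1) g) (q, θ) := by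
  set v := Complex.exp (Complex.I * θ) with hv
  set n := Complex.I * v with hn
  have sv := hg.diskDeriv one_pos v
  have sn := hg.diskDeriv one_pos n
  have svv := sv.diskDeriv one_pos v
  have H := fun q (hq : q ∈ Ioo (-1 : ℝ) 1) => hasDerivAt_chordMean_fst hg 0 hq θ
  have Hn := fun q (hq : q ∈ Ioo (-1 : ℝ) 1) => hasDerivAt_chordMean_fst sn 0 hq θ
  have Hvv := fun q (hq : q ∈ Ioo (-1 : ℝ) 1) => hasDerivAt_chordMean_fst svv 1 hq θ
  simp only [← hv, ← hn] at H Hn Hvv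
  refine ⟨_, fun q => _, fun q hq => ⟨H q hq, ((Hn q hq).sub
    (((Complex.ofRealCLM.hasDerivAt (x := q)).div_const _).mul (Hvv q hq))), ?_⟩⟩
  have h1 := chordMean_zernike hg (p := (q, θ)) hq (v := v) hv
  -- The second q-derivative contains a fourth tangential derivative with weight (1 - s²)²; this
  -- identity trades it for means of the second tangential derivative.
  have h2 := chordMean_zero_sub_one svv (p := (q, θ)) hq
  have hp' : (q, θ) ∈ chordSpace := ⟨Ioo_subset_Icc_self hq, mem_univ _⟩
  have h3 : chordMean 1 (diskDeriv 1 n (diskDeriv 1 v (diskDeriv 1 v g))) (q, θ) =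
      chordMean 1 (diskDeriv 1 v (diskDeriv 1 v (diskDeriv 1 n g))) (q, θ) := by
    refine chordMean_congr (fun z hz => ?_) 1 hp'
    simp only [diskDeriv_eq_dirDeriv]
    rw [dirDeriv_comm (convex_disk 1) (interior_disk_nonempty one_pos)
      (f := dirDeriv (disk 1) v g) sv n v hz]
    refine dirDeriv_congr (fun y hy => ?_) v hz
    exact dirDeriv_comm (convex_disk 1) (interior_disk_nonempty one_pos) hg n v hy
  simp only [← hv, ← hn] at h1 h2
  simp only [Complex.ofRealCLM_apply, h1, h3]
  norm_num
  linear_combination ((q : ℂ) ^ 2) * h2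

/-! ### Backprojection -/

/-- The signed distance from the origin of the line through `x` with direction `e^{iθ}`. -/
def offset (x : ℂ) (θ : ℝ) : ℝ := (x * Complex.exp (-(Complex.I * θ))).im

/-- The integral of `K` over the lines through `x`. -/
def backproj (K : ℝ × ℝ → ℂ) (x : ℂ) : ℂ := ∫ θ in (0 : ℝ)..(2 * Real.pi), K (offset x θ, θ)

theorem offset_eq (x : ℂ) (θ : ℝ) : offset x θ = x.im * Real.cos θ - x.re * Real.sin θ := by
  have h : Complex.exp (-(Complex.I * θ)) = Complex.exp ((-θ : ℝ) * Complex.I) := by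
    push_cast; ring_nf
  rw [offset, h, Complex.mul_im, Complex.exp_ofReal_mul_I_re, Complex.exp_ofReal_mul_I_im]
  simp
  ring

theorem offset_one (θ : ℝ) : offset 1 θ = -Real.sin θ := by simp [offset_eq]

theorem offset_I (θ : ℝ) : offset Complex.I θ = Real.cos θ := by simp [offset_eq]

theorem offset_eq_re_im (x : ℂ) (θ : ℝ) :
    offset x θ = x.re * offset 1 θ + x.im * offset Complex.I θ := by
  rw [offset_one, offset_I, offset_eq]; ring

theorem abs_offset_le (x : ℂ) (θ : ℝ) : |offset x θ| ≤ ‖x‖ := by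
  refine (Complex.abs_im_le_norm _).trans ?_
  have h : Complex.exp (-(Complex.I * θ)) = Complex.exp ((-θ : ℝ) * Complex.I) := by
    push_cast; ring_nf
  rw [norm_mul, h, Complex.norm_exp_ofReal_mul_I, mul_one]

theorem continuous_offset : Continuous (Function.uncurry offset) := by
  unfold offset Function.uncurry
  fun_prop

/-- The offset as a linear function of the point. -/
def offsetCLM (θ : ℝ) : ℂ →L[ℝ] ℝ :=
  offset 1 θ • Complex.reCLM + offset Complex.I θ • Complex.imCLM

theorem offsetCLM_apply (x : ℂ) (θ : ℝ) : offsetCLM θ x = offset x θ := by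
  rw [offset_eq_re_im]; simp [offsetCLM]; ring

/-- A convex set of points in the plane together with a convex set of offsets of the lines
through these points. -/
structure OffsetDomain (S : Set ℂ) (J : Set ℝ) : Prop where
  convex : Convex ℝ S
  nonempty : (interior S).Nonempty
  convex' : Convex ℝ J
  nonempty' : (interior J).Nonempty
  mem : ∀ x ∈ S, ∀ θ, offset x θ ∈ J
  mem_interior : ∀ x ∈ interior S, ∀ θ, offset x θ ∈ interior J

/-- The pair used for backprojections of kernels that may blow up at q = ±1, such as those of
general functions on ∂₊SM. -/
theorem offsetDomain_ball : OffsetDomain (Metric.ball 0 1) (Ioo (-1) 1) where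
  convex := convex_ball 0 1
  nonempty := by rw [Metric.isOpen_ball.interior_eq]; exact ⟨0, by simp⟩
  convex' := convex_Ioo _ _
  nonempty' := by rw [interior_Ioo]; exact ⟨0, by norm_num⟩
  mem x hx θ := abs_lt.1 ((abs_offset_le x θ).trans_lt (by simpa using hx))
  mem_interior x hx θ := by
    rw [interior_Ioo]
    rw [Metric.isOpen_ball.interior_eq] at hx
    exact abs_lt.1 ((abs_offset_le x θ).trans_lt (by simpa using hx))

/-- The pair used for kernels smooth up to q = ±1, such as chord means; it gives regularity up to
the boundary. -/
theorem offsetDomain_disk : OffsetDomain (disk 1) (Icc (-1) 1) where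
  convex := convex_disk 1
  nonempty := interior_disk_nonempty one_pos
  convex' := convex_Icc _ _
  nonempty' := by rw [interior_Icc]; exact ⟨0, by norm_num⟩
  mem x hx θ := abs_le.1 ((abs_offset_le x θ).trans (mem_disk.1 hx))
  mem_interior x hx θ := by
    rw [interior_Icc]
    rw [interior_disk one_ne_zero] at hx
    exact abs_lt.1 ((abs_offset_le x θ).trans_lt (by simpa using hx))

/-- The partial derivative with respect to the offset. -/
def offsetDeriv (J : Set ℝ) (K : ℝ × ℝ → ℂ) (p : ℝ × ℝ) : ℂ :=
  fderivWithin ℝ K (J ×ˢ univ) p (1, 0)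

section

variable {S : Set ℂ} {J : Set ℝ}

theorem OffsetDomain.uniqueDiffOn (h : OffsetDomain S J) : UniqueDiffOn ℝ S :=
  uniqueDiffOn_convex h.convex h.nonempty

theorem OffsetDomain.uniqueDiffOn' (h : OffsetDomain S J) :
    UniqueDiffOn ℝ (J ×ˢ (univ : Set ℝ)) := by
  refine uniqueDiffOn_convex (h.convex'.prod convex_univ) ?_
  rw [interior_prod_eq, interior_univ]
  exact h.nonempty'.prod univ_nonempty

theorem OffsetDomain.continuousOn_integrand (h : OffsetDomain S J) {K : ℝ × ℝ → ℂ}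
    (hK : ContinuousOn K (J ×ˢ univ)) (T : Set ℝ) :
    ContinuousOn (Function.uncurry fun (x : ℂ) (θ : ℝ) => K (offset x θ, θ)) (S ×ˢ T) := by
  refine hK.comp (f := fun y : ℂ × ℝ => (offset y.1 y.2, y.2)) ?_ fun y hy =>
    ⟨h.mem y.1 hy.1 y.2, mem_univ _⟩
  exact (continuous_offset.prodMk continuous_snd).continuousOn

theorem OffsetDomain.continuousOn_backproj (h : OffsetDomain S J) {K : ℝ × ℝ → ℂ}
    (hK : ContinuousOn K (J ×ˢ univ)) : ContinuousOn (backproj K) S :=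
  continuousOn_intervalIntegral (by positivity) (h.continuousOn_integrand hK _)

theorem OffsetDomain.intervalIntegrable (h : OffsetDomain S J) {K : ℝ × ℝ → ℂ}
    (hK : ContinuousOn K (J ×ˢ univ)) {x : ℂ} (hx : x ∈ S) :
    IntervalIntegrable (fun θ => K (offset x θ, θ)) volume 0 (2 * Real.pi) := by
  refine ContinuousOn.intervalIntegrable ?_
  exact (h.continuousOn_integrand hK univ).comp (f := fun θ => (x, θ)) (by fun_prop)
    fun θ _ => ⟨hx, mem_univ _⟩

theorem OffsetDomain.contDiffOn_offsetDeriv (h : OffsetDomain S J) {K : ℝ × ℝ → ℂ} {n : WithTop ℕ∞}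
    (hK : ContDiffOn ℝ (n + 1) K (J ×ˢ univ)) : ContDiffOn ℝ n (offsetDeriv J K) (J ×ˢ univ) :=
  (hK.fderivWithin h.uniqueDiffOn' le_rfl).clm_apply contDiffOn_const

/-- The derivative of a backprojection. -/
def backprojDeriv (J : Set ℝ) (K : ℝ × ℝ → ℂ) (x : ℂ) : ℂ →L[ℝ] ℂ :=
  Complex.reCLM.smulRight (backproj (fun p => offset 1 p.2 * offsetDeriv J K p) x) +
  Complex.imCLM.smulRight (backproj (fun p => offset Complex.I p.2 * offsetDeriv J K p) x)

theorem contDiff_offset (v : ℂ) (n : WithTop ℕ∞) :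
    ContDiff ℝ n fun p : ℝ × ℝ => (offset v p.2 : ℂ) := by
  have : (fun p : ℝ × ℝ => (offset v p.2 : ℂ)) = fun p : ℝ × ℝ => Complex.ofRealCLM
      (v.im * Real.cos p.2 - v.re * Real.sin p.2) := by
    funext p; rw [offset_eq]; simp
  rw [this]
  fun_prop

theorem OffsetDomain.contDiffOn_mul (h : OffsetDomain S J) {K : ℝ × ℝ → ℂ} {n : WithTop ℕ∞}
    (hK : ContDiffOn ℝ (n + 1) K (J ×ˢ univ)) (v : ℂ) :
    ContDiffOn ℝ n (fun p => offset v p.2 * offsetDeriv J K p) (J ×ˢ univ) :=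
  (contDiff_offset v n).contDiffOn.mul (h.contDiffOn_offsetDeriv hK)

/-- The offset is linear in the point for a fixed direction, so the chain rule under the integral
yields backprojections of ∂_q K with trigonometric factors. -/
theorem OffsetDomain.hasFDerivAt_backproj (h : OffsetDomain S J) {K : ℝ × ℝ → ℂ}
    (hK : ContDiffOn ℝ 1 K (J ×ˢ univ)) {x : ℂ} (hx : x ∈ interior S) :
    HasFDerivAt (backproj K) (backprojDeriv J K x) x := by
  have hK0 := (zero_add (1 : WithTop ℕ∞)).symm ▸ hK
  have hc1 := (h.contDiffOn_mul hK0 1).continuousOn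
  have hcI := (h.contDiffOn_mul hK0 Complex.I).continuousOn
  have hd := (h.contDiffOn_offsetDeriv hK0).continuousOn
  have hsub := interior_subset (s := S)
  have key := hasFDerivAt_intervalIntegral (U := interior S) isOpen_interior
    (a := 0) (b := 2 * Real.pi) (by positivity)
    (f := fun x θ => K (offset x θ, θ))
    (f' := fun x θ => Complex.reCLM.smulRight (offset 1 θ * offsetDeriv J K (offset x θ, θ)) +
      Complex.imCLM.smulRight (offset Complex.I θ * offsetDeriv J K (offset x θ, θ)))
    ((h.continuousOn_integrand hK.continuousOn _).mono (prod_mono hsub subset_rfl)) ?_ ?_ hx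
  · refine key.congr_fderiv ?_
    have hx' := hsub hx
    have i1 := h.intervalIntegrable hc1 hx'
    have i2 := h.intervalIntegrable hcI hx'
    have e : ∀ (L : ℂ →L[ℝ] ℝ) {F : ℝ → ℂ} (hF : IntervalIntegrable F volume 0 (2 * Real.pi)),
        IntervalIntegrable (fun θ => L.smulRight (F θ)) volume 0 (2 * Real.pi) ∧
        ∫ θ in (0 : ℝ)..(2 * Real.pi), L.smulRight (F θ) =
          L.smulRight (∫ θ in (0 : ℝ)..(2 * Real.pi), F θ) := by
      intro L F hF
      have := ContinuousLinearMap.intervalIntegral_comp_comm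
        (ContinuousLinearMap.smulRightL ℝ ℂ ℂ L) hF
      refine ⟨?_, this⟩
      exact ⟨(ContinuousLinearMap.smulRightL ℝ ℂ ℂ L).integrable_comp hF.1,
        (ContinuousLinearMap.smulRightL ℝ ℂ ℂ L).integrable_comp hF.2⟩
    rw [intervalIntegral.integral_add (e _ i1).1 (e _ i2).1, (e _ i1).2, (e _ i2).2]
    rfl
  · refine ContinuousOn.add ?_ ?_
    · exact (ContinuousLinearMap.smulRightL ℝ ℂ ℂ Complex.reCLM).continuous.comp_continuousOn
        ((h.continuousOn_integrand hc1 _).mono (prod_mono hsub subset_rfl))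
    · exact (ContinuousLinearMap.smulRightL ℝ ℂ ℂ Complex.imCLM).continuous.comp_continuousOn
        ((h.continuousOn_integrand hcI _).mono (prod_mono hsub subset_rfl))
  · intro y hy θ _
    have hmem : (offset y θ, θ) ∈ interior (J ×ˢ (univ : Set ℝ)) := by
      rw [interior_prod_eq, interior_univ]
      exact ⟨h.mem_interior y hy θ, mem_univ _⟩
    have hKd : HasFDerivAt K (fderivWithin ℝ K (J ×ˢ univ) (offset y θ, θ)) (offset y θ, θ) :=
      ((hK.differentiableOn (by simp) _ (interior_subset hmem)).hasFDerivWithinAt).hasFDerivAt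
        (mem_interior_iff_mem_nhds.1 hmem)
    have hoff : HasFDerivAt (fun x => offset x θ) (offsetCLM θ) y := by
      have := (offsetCLM θ).hasFDerivAt (x := y)
      exact this.congr_of_eventuallyEq (.of_forall fun x => (offsetCLM_apply x θ).symm)
    refine (hKd.comp y (hoff.prodMk (hasFDerivAt_const θ y))).congr_fderiv ?_
    have hlin : ∀ r : ℝ, ((r, 0) : ℝ × ℝ) = r • ((1, 0) : ℝ × ℝ) := by intro r; simp
    apply ContinuousLinearMap.ext
    intro w
    simp only [ContinuousLinearMap.comp_apply, ContinuousLinearMap.prod_apply,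
      zero_apply, offsetCLM_apply]
    rw [hlin, map_smul, offset_eq_re_im]
    simp [offsetDeriv]
    ring

theorem OffsetDomain.continuousOn_backprojDeriv (h : OffsetDomain S J) {K : ℝ × ℝ → ℂ} {n : ℕ}
    (ih : ∀ K : ℝ × ℝ → ℂ, ContDiffOn ℝ n K (J ×ˢ univ) → ContDiffOn ℝ n (backproj K) S)
    (hK : ContDiffOn ℝ (n + 1) K (J ×ˢ univ)) : ContDiffOn ℝ n (backprojDeriv J K) S :=
  ((ContinuousLinearMap.smulRightL ℝ ℂ ℂ Complex.reCLM).contDiff.comp_contDiffOn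
    (ih _ (h.contDiffOn_mul hK 1))).add
  ((ContinuousLinearMap.smulRightL ℝ ℂ ℂ Complex.imCLM).contDiff.comp_contDiffOn
    (ih _ (h.contDiffOn_mul hK Complex.I)))

theorem OffsetDomain.contDiffOn_backproj_nat (h : OffsetDomain S J) (n : ℕ) :
    ∀ K : ℝ × ℝ → ℂ, ContDiffOn ℝ n K (J ×ˢ univ) → ContDiffOn ℝ n (backproj K) S := by
  induction n with
  | zero => exact fun K hK => contDiffOn_zero.2 (h.continuousOn_backproj hK.continuousOn)
  | succ n ih =>
    intro K hK
    refine contDiffOn_succ_of_interior h.convex h.nonempty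
      (h.continuousOn_backproj hK.continuousOn)
      (h.continuousOn_backprojDeriv ih hK) fun x hx => ?_
    exact h.hasFDerivAt_backproj (hK.of_le (by simp)) hx

theorem OffsetDomain.contDiffOn_backproj (h : OffsetDomain S J) {K : ℝ × ℝ → ℂ}
    (hK : ContDiffOn ℝ ∞ K (J ×ˢ univ)) : ContDiffOn ℝ ∞ (backproj K) S :=
  contDiffOn_infty.2 fun n => h.contDiffOn_backproj_nat n K (hK.of_le (by exact_mod_cast le_top))

theorem OffsetDomain.dirDeriv_backproj (h : OffsetDomain S J) {K : ℝ × ℝ → ℂ}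
    (hK : ContDiffOn ℝ ∞ K (J ×ˢ univ)) (v : ℂ) {x : ℂ} (hx : x ∈ S) :
    dirDeriv S v (backproj K) x = backproj (fun p => offset v p.2 * offsetDeriv J K p) x := by
  have hK1 : ContDiffOn ℝ 1 K (J ×ˢ univ) := hK.of_le (by simp)
  have hd := hasFDerivWithinAt_of_interior h.convex h.nonempty
    (h.continuousOn_backproj hK.continuousOn)
    (h.continuousOn_backprojDeriv (n := 0) (h.contDiffOn_backproj_nat 0)
      (by simpa using hK1)).continuousOn (fun x hx => h.hasFDerivAt_backproj hK1 hx) hx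
  have hKi : ContDiffOn ℝ (∞ + 1) K (J ×ˢ univ) := by simpa using hK
  have i1 := (h.intervalIntegrable (h.contDiffOn_mul hKi 1).continuousOn hx).const_mul (v.re : ℂ)
  have i2 := (h.intervalIntegrable
    (h.contDiffOn_mul hKi Complex.I).continuousOn hx).const_mul (v.im : ℂ)
  rw [dirDeriv, hd.fderivWithin (h.uniqueDiffOn x hx)]
  simp only [backprojDeriv, add_apply, ContinuousLinearMap.smulRight_apply, Complex.reCLM_apply,
    Complex.imCLM_apply, Complex.real_smul, backproj]
  rw [← intervalIntegral.integral_const_mul, ← intervalIntegral.integral_const_mul,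
    ← intervalIntegral.integral_add i1 i2]
  congr 1; funext θ
  rw [offset_eq_re_im v]
  push_cast
  ring

/-- Backprojection intertwines `-(1 - q²) ∂_q² + 3 q ∂_q + 1` with the Zernike operator. -/
theorem OffsetDomain.zernike_backproj (h : OffsetDomain S J) {K : ℝ × ℝ → ℂ}
    (hK : ContDiffOn ℝ ∞ K (J ×ˢ univ)) {x : ℂ} (hx : x ∈ S) :
    zernike S (backproj K) x = backproj (fun p => -((1 - p.1 ^ 2) *
      offsetDeriv J (offsetDeriv J K) p) + 3 * p.1 * offsetDeriv J K p + K p) x := by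
  have hKi : ContDiffOn ℝ (∞ + 1) K (J ×ˢ univ) := by simpa using hK
  have hK1 := h.contDiffOn_offsetDeriv hKi
  have hK1i : ContDiffOn ℝ (∞ + 1) (offsetDeriv J K) (J ×ˢ univ) := by simpa using hK1
  have hK2 := h.contDiffOn_offsetDeriv hK1i
  have hmul : ∀ {F : ℝ × ℝ → ℂ}, ContDiffOn ℝ ∞ F (J ×ˢ univ) → ∀ v : ℂ,
      ContDiffOn ℝ ∞ (fun p => offset v p.2 * F p) (J ×ˢ univ) :=
    fun hF v => (contDiff_offset v _).contDiffOn.mul hF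
  -- The trigonometric factor depends on the direction only and is constant for ∂_q.
  have hder : ∀ v : ℂ, ∀ p ∈ J ×ˢ (univ : Set ℝ),
      offsetDeriv J (fun p => offset v p.2 * offsetDeriv J K p) p =
        offset v p.2 * offsetDeriv J (offsetDeriv J K) p := by
    intro v p hp
    have hu := h.uniqueDiffOn' p hp
    have h1 : DifferentiableWithinAt ℝ (fun p : ℝ × ℝ => (offset v p.2 : ℂ)) (J ×ˢ univ) p :=
      ((contDiff_offset v 1).differentiable (by simp) p).differentiableWithinAt
    have h0 : fderivWithin ℝ (fun p : ℝ × ℝ => (offset v p.2 : ℂ)) (J ×ˢ univ) p (1, 0) = 0 := by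
      have hc : ContDiff ℝ 1 fun θ : ℝ => (offset v θ : ℂ) :=
        (contDiff_offset v 1).comp (contDiff_prodMk_right (0 : ℝ))
      have hd : HasFDerivAt (fun p : ℝ × ℝ => (offset v p.2 : ℂ)) _ p :=
        ((hc.differentiable (by simp)) p.2).hasFDerivAt.comp p hasFDerivAt_snd
      rw [hd.hasFDerivWithinAt.fderivWithin hu]
      simp
    rw [offsetDeriv, fderivWithin_fun_mul hu h1 (hK1.differentiableOn (by simp) p hp)]
    simp only [add_apply, smul_apply, h0, smul_eq_mul, mul_zero, add_zero]
    rfl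
  have hsecond : ∀ u v : ℂ, dirDeriv S u (dirDeriv S v (backproj K)) x =
      backproj (fun p => offset u p.2 * (offset v p.2 * offsetDeriv J (offsetDeriv J K) p)) x := by
    intro u v
    rw [dirDeriv_congr (fun y hy => h.dirDeriv_backproj hK v hy) u hx,
      h.dirDeriv_backproj (hmul hK1 v) u hx]
    unfold backproj
    congr 1; funext θ
    dsimp only
    rw [hder v _ ⟨h.mem x hx θ, mem_univ _⟩]
  have i11 := (h.intervalIntegrable (hmul (hmul hK2 1) 1).continuousOn hx)
  have i12 := (h.intervalIntegrable (hmul (hmul hK2 Complex.I) 1).continuousOn hx)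
  have i22 := (h.intervalIntegrable (hmul (hmul hK2 Complex.I) Complex.I).continuousOn hx)
  have i1 := (h.intervalIntegrable (hmul hK1 1).continuousOn hx)
  have i2 := (h.intervalIntegrable (hmul hK1 Complex.I).continuousOn hx)
  have i0 := (h.intervalIntegrable hK.continuousOn hx)
  rw [zernike, neg_eq_neg_one_mul, hsecond, hsecond, hsecond, h.dirDeriv_backproj hK _ hx,
    h.dirDeriv_backproj hK _ hx]
  simp only [backproj]
  rw [← intervalIntegral.integral_const_mul, ← intervalIntegral.integral_const_mul,
    ← intervalIntegral.integral_const_mul,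
    ← intervalIntegral.integral_sub (i11.const_mul _) (i12.const_mul _),
    ← intervalIntegral.integral_add ((i11.const_mul _).sub (i12.const_mul _)) (i22.const_mul _),
    ← intervalIntegral.integral_const_mul, ← intervalIntegral.integral_const_mul,
    ← intervalIntegral.integral_const_mul,
    ← intervalIntegral.integral_add (i1.const_mul _) (i2.const_mul _),
    ← intervalIntegral.integral_const_mul,
    ← intervalIntegral.integral_add ((((i11.const_mul _).sub (i12.const_mul _)).add
      (i22.const_mul _)).const_mul _) (((i1.const_mul _).add (i2.const_mul _)).const_mul _),
    ← intervalIntegral.integral_add (((((i11.const_mul _).sub (i12.const_mul _)).add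
      (i22.const_mul _)).const_mul _).add (((i1.const_mul _).add (i2.const_mul _)).const_mul _)) i0]
  congr 1; funext θ
  -- The offset is the product of x with a unit vector ν, on which the principal symbol of `zernike`
  -- is |ν|² - (x·ν)² = 1 - q².
  have hcs : (Real.sin θ : ℂ) ^ 2 + (Real.cos θ : ℂ) ^ 2 = 1 := by
    exact_mod_cast Real.sin_sq_add_cos_sq θ
  rw [offset_eq x, offset_one, offset_I]
  push_cast at hcs ⊢
  generalize offsetDeriv J (offsetDeriv J K) _ = k2
  linear_combination (-k2) * hcs

end

/-- The backprojection of the means along chords of a smooth function is smooth up to the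
boundary. -/
theorem smoothOnDisk_backproj_chordMean {g : ℂ → ℂ} (hg : SmoothOnDisk 1 g) :
    SmoothOnDisk 1 (backproj (chordMean 0 g)) :=
  offsetDomain_disk.contDiffOn_backproj (contDiffOn_chordMean hg 0)

/-! ### Integration over the unit disk along parallel chords -/

/-- Orthonormal coordinates of the plane, the first one being the offset in direction `θ`. -/
def frame (θ : ℝ) (p : ℝ × ℝ) : ℂ := Complex.exp (Complex.I * θ) * (p.2 + Complex.I * p.1)

theorem norm_frame_sq (θ : ℝ) (p : ℝ × ℝ) : ‖frame θ p‖ ^ 2 = p.1 ^ 2 + p.2 ^ 2 := by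
  have h2 : ‖Complex.exp (Complex.I * θ)‖ = 1 := by
    rw [mul_comm]; exact Complex.norm_exp_ofReal_mul_I _
  rw [frame, norm_mul, h2, one_mul, ← Complex.normSq_eq_norm_sq, Complex.normSq_apply]
  simp
  ring

theorem offset_frame (θ : ℝ) (p : ℝ × ℝ) : offset (frame θ p) θ = p.1 := by
  rw [offset, frame, mul_comm (Complex.exp _), mul_assoc, ← Complex.exp_add]
  simp

theorem frame_mem_ball {θ : ℝ} {p : ℝ × ℝ} :
    frame θ p ∈ Metric.ball (0 : ℂ) 1 ↔ p.1 ∈ Ioo (-1 : ℝ) 1 ∧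
      p.2 ∈ Ioo (-√(1 - p.1 ^ 2)) √(1 - p.1 ^ 2) := by
  have h := norm_frame_sq θ p
  rw [mem_ball_zero_iff]
  have h3 : p.2 ∈ Ioo (-√(1 - p.1 ^ 2)) √(1 - p.1 ^ 2) ↔ p.2 ^ 2 < 1 - p.1 ^ 2 := by
    rw [mem_Ioo, ← abs_lt, Real.lt_sqrt (abs_nonneg _), sq_abs]
  have h4 : p.1 ∈ Ioo (-1 : ℝ) 1 ↔ p.1 ^ 2 < 1 := by
    rw [mem_Ioo, ← abs_lt, sq_lt_one_iff_abs_lt_one]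
  rw [h3, h4, ← sq_lt_one_iff₀ (norm_nonneg _), h]
  constructor
  · intro h'; constructor <;> nlinarith [sq_nonneg p.1, sq_nonneg p.2]
  · rintro ⟨_, h'⟩; linarith

theorem measurePreserving_frame (θ : ℝ) : MeasurePreserving (frame θ) volume volume := by
  have h1 := (Complex.volume_preserving_equiv_real_prod.symm)
  have h2 : MeasurePreserving (Prod.swap : ℝ × ℝ → ℝ × ℝ) volume volume :=
    Measure.measurePreserving_swap
  have h3 := (rotation (Circle.exp θ)).measurePreserving
  have h := h3.comp (h1.comp h2)
  have e : frame θ = (rotation (Circle.exp θ)) ∘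
      (Complex.measurableEquivRealProd.symm ∘ Prod.swap) := by
    funext p
    simp only [Function.comp_apply, rotation_apply, Circle.coe_exp, frame]
    rw [mul_comm Complex.I (θ : ℂ)]
    congr 1
    apply Complex.ext <;> simp [Complex.measurableEquivRealProd_symm_apply]
  rw [e]
  exact h

theorem continuous_frame (θ : ℝ) : Continuous (frame θ) := by unfold frame; fun_prop

theorem measurableEmbedding_frame (θ : ℝ) : MeasurableEmbedding (frame θ) := by
  refine (continuous_frame θ).measurableEmbedding fun p p' h => ?_
  have h' := mul_left_cancel₀ (Complex.exp_ne_zero _) h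
  have h1 := congrArg Complex.re h'
  have h2 := congrArg Complex.im h'
  simp at h1 h2
  exact Prod.ext h2 h1

theorem indicator_ball_frame {β : Type*} [Zero β] (F : ℂ → β) (θ q t : ℝ) :
    (Metric.ball (0 : ℂ) 1).indicator F (frame θ (q, t)) =
      (Ioo (-1 : ℝ) 1).indicator (fun q => (Ioo (-√(1 - q ^ 2)) √(1 - q ^ 2)).indicator
        (fun t => F (frame θ (q, t))) t) q := by
  by_cases h : frame θ (q, t) ∈ Metric.ball (0 : ℂ) 1
  · rw [indicator_of_mem h]
    obtain ⟨h1, h2⟩ := frame_mem_ball.1 h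
    rw [indicator_of_mem h1, indicator_of_mem h2]
  · rw [indicator_of_notMem h]
    by_cases h1 : q ∈ Ioo (-1 : ℝ) 1
    · have h2 : t ∉ Ioo (-√(1 - q ^ 2)) √(1 - q ^ 2) := fun h2 => h (frame_mem_ball.2 ⟨h1, h2⟩)
      rw [indicator_of_mem h1, indicator_of_notMem h2]
    · rw [indicator_of_notMem h1]

theorem lintegral_ball_eq (θ : ℝ) {F : ℂ → ENNReal}
    (hF : AEMeasurable F (volume.restrict (Metric.ball 0 1))) :
    ∫⁻ x in Metric.ball (0 : ℂ) 1, F x = ∫⁻ q in Ioo (-1 : ℝ) 1,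
      ∫⁻ t in Ioo (-√(1 - q ^ 2)) √(1 - q ^ 2), F (frame θ (q, t)) := by
  have hF' : AEMeasurable ((Metric.ball (0 : ℂ) 1).indicator F) volume :=
    (aemeasurable_indicator_iff measurableSet_ball).2 hF
  have hF'' : AEMeasurable (fun a => (Metric.ball (0 : ℂ) 1).indicator F (frame θ a))
      ((volume : Measure ℝ).prod volume) :=
    hF'.comp_quasiMeasurePreserving (measurePreserving_frame θ).quasiMeasurePreserving
  rw [← lintegral_indicator measurableSet_ball, ← (measurePreserving_frame θ).lintegral_comp_emb
    (measurableEmbedding_frame θ), Measure.volume_eq_prod, lintegral_prod _ hF'',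
    ← lintegral_indicator measurableSet_Ioo]
  refine lintegral_congr fun q => ?_
  simp only [indicator_ball_frame]
  by_cases h1 : q ∈ Ioo (-1 : ℝ) 1
  · simp only [indicator_of_mem h1]
    rw [lintegral_indicator measurableSet_Ioo]
  · simp [indicator_of_notMem h1]

theorem integral_ball_eq (θ : ℝ) {F : ℂ → ℂ} (hF : IntegrableOn F (Metric.ball 0 1)) :
    ∫ x in Metric.ball (0 : ℂ) 1, F x = ∫ q in Ioo (-1 : ℝ) 1,
      ∫ t in Ioo (-√(1 - q ^ 2)) √(1 - q ^ 2), F (frame θ (q, t)) := by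
  have hF' : Integrable ((Metric.ball (0 : ℂ) 1).indicator F) volume :=
    (integrable_indicator_iff measurableSet_ball).2 hF
  have hF'' : Integrable (fun a => (Metric.ball (0 : ℂ) 1).indicator F (frame θ a))
      ((volume : Measure ℝ).prod volume) :=
    ((measurePreserving_frame θ).integrable_comp_emb (measurableEmbedding_frame θ)).2 hF'
  rw [← integral_indicator measurableSet_ball, ← (measurePreserving_frame θ).integral_comp
    (measurableEmbedding_frame θ), Measure.volume_eq_prod, integral_prod _ hF'',
    ← integral_indicator measurableSet_Ioo]
  congr 1; funext q
  simp only [indicator_ball_frame]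
  by_cases h1 : q ∈ Ioo (-1 : ℝ) 1
  · simp only [indicator_of_mem h1]
    rw [integral_indicator measurableSet_Ioo]
  · simp [indicator_of_notMem h1]

theorem chordPoint_eq_frame (p : ℝ × ℝ) (s : ℝ) :
    chordPoint p s = frame p.2 (p.1, √(1 - p.1 ^ 2) * s) := by
  simp [chordPoint, frame]

theorem sqrt_one_sub_sq_pos {q : ℝ} (hq : q ∈ Ioo (-1 : ℝ) 1) : 0 < √(1 - q ^ 2) :=
  Real.sqrt_pos.2 (by nlinarith [hq.1, hq.2])

/-- The chord mean is not normalized by arclength: the substitution t = √(1 - q²) s makes the line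
integral √(1 - q²) times the mean. -/
theorem integral_chord_eq (F : ℂ → ℂ) {q : ℝ} (hq : q ∈ Ioo (-1 : ℝ) 1) (θ : ℝ) :
    ∫ t in Ioo (-√(1 - q ^ 2)) √(1 - q ^ 2), F (frame θ (q, t)) =
      √(1 - q ^ 2) * chordMean 0 F (q, θ) := by
  have hp := sqrt_one_sub_sq_pos hq
  rw [← integral_Ioc_eq_integral_Ioo, ← intervalIntegral.integral_of_le (by linarith), chordMean]
  have := intervalIntegral.integral_comp_mul_left (a := -1) (b := 1)
    (fun t => F (frame θ (q, t))) hp.ne'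
  simp only [chordPoint_eq_frame, pow_zero, Complex.ofReal_one, one_mul]
  rw [this]
  simp only [mul_neg, mul_one, Complex.real_smul]
  push_cast
  have hp' : (√(1 - q ^ 2) : ℂ) ≠ 0 := by exact_mod_cast hp.ne'
  field_simp

theorem integrableOn_of_continuousOn_disk {F : ℂ → ℂ} (hF : ContinuousOn F (disk 1)) :
    IntegrableOn F (Metric.ball 0 1) :=
  (hF.integrableOn_compact (isCompact_closedBall 0 1)).mono_set Metric.ball_subset_closedBall

theorem integral_ball_eq_chordMean (θ : ℝ) {F : ℂ → ℂ} (hF : ContinuousOn F (disk 1)) :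
    ∫ x in Metric.ball (0 : ℂ) 1, F x =
      ∫ q in Ioo (-1 : ℝ) 1, √(1 - q ^ 2) * chordMean 0 F (q, θ) := by
  rw [integral_ball_eq θ (integrableOn_of_continuousOn_disk hF)]
  exact setIntegral_congr_fun measurableSet_Ioo fun q hq => integral_chord_eq F hq θ

/-! ### The duality of means along chords and backprojection -/

/-- The kernel `K` on the space of chords is integrable with respect to `√(1 - q²) dq dθ`. -/
structure IsChordKernel (K : ℝ × ℝ → ℂ) : Prop where
  continuousOn : ContinuousOn K (Ioo (-1) 1 ×ˢ univ)
  lintegral_ne_top : ∫⁻ θ in Ioc 0 (2 * Real.pi), ∫⁻ q in Ioo (-1 : ℝ) 1,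
    ENNReal.ofReal √(1 - q ^ 2) * ‖K (q, θ)‖ₑ ≠ ⊤

/-- As u is bounded and K is constant along chords of direction θ, integrating over such a chord
costs its length 2√(1 - q²), exactly the weight in the definition. -/
theorem IsChordKernel.integrable {K : ℝ × ℝ → ℂ} (hK : IsChordKernel K) {u : ℂ → ℂ}
    (hu : ContinuousOn u (disk 1)) :
    Integrable (Function.uncurry fun (θ : ℝ) (x : ℂ) => u x * (starRingEnd ℂ) (K (offset x θ, θ)))
      ((volume.restrict (Ioc 0 (2 * Real.pi))).prod (volume.restrict (Metric.ball 0 1))) := by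
  set H : ℝ → ℂ → ℂ := fun θ x => u x * (starRingEnd ℂ) (K (offset x θ, θ)) with hH
  have hcont : ContinuousOn (Function.uncurry H) (univ ×ˢ Metric.ball 0 1) := by
    refine ContinuousOn.mul ?_ (Complex.continuous_conj.comp_continuousOn ?_)
    · exact hu.comp continuous_snd.continuousOn fun y hy => Metric.ball_subset_closedBall hy.2
    · refine hK.continuousOn.comp (f := fun y : ℝ × ℂ => (offset y.2 y.1, y.1)) ?_ fun y hy =>
        ⟨offsetDomain_ball.mem y.2 hy.2 y.1, mem_univ _⟩
      exact ((continuous_offset.comp continuous_swap).prodMk continuous_fst).continuousOn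
  have hmeas : AEStronglyMeasurable (Function.uncurry H)
      ((volume.restrict (Ioc 0 (2 * Real.pi))).prod (volume.restrict (Metric.ball 0 1))) := by
    rw [Measure.prod_restrict]
    exact (hcont.mono (prod_mono (subset_univ _) subset_rfl)).aestronglyMeasurable
      (measurableSet_Ioc.prod measurableSet_ball)
  refine ⟨hmeas, ?_⟩
  obtain ⟨C, hC⟩ := (isCompact_closedBall (0 : ℂ) 1).exists_bound_of_continuousOn hu
  rw [hasFiniteIntegral_iff_enorm, lintegral_prod _ hmeas.enorm]
  have hle : ∀ θ : ℝ, ∫⁻ x in Metric.ball (0 : ℂ) 1, ‖Function.uncurry H (θ, x)‖ₑ ≤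
      2 * ENNReal.ofReal C * ∫⁻ q in Ioo (-1 : ℝ) 1,
        ENNReal.ofReal √(1 - q ^ 2) * ‖K (q, θ)‖ₑ := by
    intro θ
    have hsec : ContinuousOn (fun x => Function.uncurry H (θ, x)) (Metric.ball 0 1) :=
      hcont.comp (f := fun x => (θ, x)) (by fun_prop) fun x hx => ⟨mem_univ _, hx⟩
    rw [lintegral_ball_eq θ (hsec.aestronglyMeasurable measurableSet_ball).enorm,
      ← lintegral_const_mul' _ _ (by finiteness)]
    refine setLIntegral_mono' measurableSet_Ioo fun q hq => ?_
    calc ∫⁻ t in Ioo (-√(1 - q ^ 2)) √(1 - q ^ 2), ‖Function.uncurry H (θ, frame θ (q, t))‖ₑ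
        ≤ ∫⁻ t in Ioo (-√(1 - q ^ 2)) √(1 - q ^ 2), ENNReal.ofReal C * ‖K (q, θ)‖ₑ := by
          refine setLIntegral_mono' measurableSet_Ioo fun t ht => ?_
          have hmem : frame θ (q, t) ∈ Metric.ball (0 : ℂ) 1 := frame_mem_ball.2 ⟨hq, ht⟩
          simp only [hH, Function.uncurry, offset_frame, enorm_mul]
          gcongr ?_ * ?_
          · rw [← ofReal_norm]
            exact ENNReal.ofReal_le_ofReal (hC _ (Metric.ball_subset_closedBall hmem))
          · rw [← ofReal_norm, ← ofReal_norm, RCLike.norm_conj]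
      _ = 2 * ENNReal.ofReal C * (ENNReal.ofReal √(1 - q ^ 2) * ‖K (q, θ)‖ₑ) := by
          rw [setLIntegral_const, Real.volume_Ioo]
          have : √(1 - q ^ 2) - -√(1 - q ^ 2) = 2 * √(1 - q ^ 2) := by ring
          rw [this, ENNReal.ofReal_mul (by norm_num)]
          simp only [ENNReal.ofReal_ofNat]
          ring
  calc ∫⁻ θ in Ioc 0 (2 * Real.pi), ∫⁻ x in Metric.ball (0 : ℂ) 1, ‖Function.uncurry H (θ, x)‖ₑ
      ≤ ∫⁻ θ in Ioc 0 (2 * Real.pi), 2 * ENNReal.ofReal C * ∫⁻ q in Ioo (-1 : ℝ) 1,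
        ENNReal.ofReal √(1 - q ^ 2) * ‖K (q, θ)‖ₑ := lintegral_mono hle
    _ < ⊤ := by
      rw [lintegral_const_mul' _ _ (by finiteness)]
      exact ENNReal.mul_lt_top (by finiteness) hK.lintegral_ne_top.lt_top

theorem IsChordKernel.integrable_backproj {K : ℝ × ℝ → ℂ} (hK : IsChordKernel K) {u : ℂ → ℂ}
    (hu : ContinuousOn u (disk 1)) :
    IntegrableOn (fun x => u x * (starRingEnd ℂ) (backproj K x)) (Metric.ball 0 1) := by
  have h := (hK.integrable hu).integral_prod_right
  refine h.congr (.of_forall fun x => ?_)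
  simp only [Function.uncurry, backproj]
  rw [integral_const_mul, integral_conj, intervalIntegral.integral_of_le (by positivity)]

/-- Fubini, then slicing the disk by the chords of direction θ, on each of which the kernel is
constant: backprojection is dual to chord means for √(1 - q²) dq dθ. -/
theorem IsChordKernel.integral_backproj {K : ℝ × ℝ → ℂ} (hK : IsChordKernel K) {u : ℂ → ℂ}
    (hu : ContinuousOn u (disk 1)) :
    ∫ x in Metric.ball (0 : ℂ) 1, u x * (starRingEnd ℂ) (backproj K x) =
      ∫ θ in Ioc 0 (2 * Real.pi), ∫ q in Ioo (-1 : ℝ) 1,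
        √(1 - q ^ 2) * chordMean 0 u (q, θ) * (starRingEnd ℂ) (K (q, θ)) := by
  have h := hK.integrable hu
  have h1 : ∀ x : ℂ, u x * (starRingEnd ℂ) (backproj K x) = ∫ θ in Ioc 0 (2 * Real.pi),
      u x * (starRingEnd ℂ) (K (offset x θ, θ)) := by
    intro x
    rw [integral_const_mul, integral_conj, backproj,
      intervalIntegral.integral_of_le (by positivity)]
  simp only [h1]
  rw [← integral_integral_swap h]
  refine integral_congr_ae ?_
  filter_upwards [h.prod_right_ae] with θ hθ
  refine (integral_ball_eq θ hθ).trans ?_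
  refine setIntegral_congr_fun measurableSet_Ioo fun q hq => ?_
  simp only [Function.uncurry, offset_frame]
  rw [integral_mul_const, integral_chord_eq u hq]

theorem isChordKernel_of_continuousOn {K : ℝ × ℝ → ℂ} (hK : ContinuousOn K chordSpace) :
    IsChordKernel K where
  continuousOn := hK.mono (prod_mono Ioo_subset_Icc_self subset_rfl)
  lintegral_ne_top := by
    have hc : IsCompact (Icc (-1 : ℝ) 1 ×ˢ Icc 0 (2 * Real.pi)) := isCompact_Icc.prod isCompact_Icc
    obtain ⟨C, hC⟩ := hc.exists_bound_of_continuousOn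
      (hK.mono (prod_mono subset_rfl (subset_univ _)))
    have hle : ∫⁻ θ in Ioc 0 (2 * Real.pi), ∫⁻ q in Ioo (-1 : ℝ) 1,
        ENNReal.ofReal √(1 - q ^ 2) * ‖K (q, θ)‖ₑ ≤
        ∫⁻ θ in Ioc 0 (2 * Real.pi), ∫⁻ q in Ioo (-1 : ℝ) 1, ENNReal.ofReal 1 * ENNReal.ofReal C := by
      refine setLIntegral_mono' measurableSet_Ioc fun θ hθ => ?_
      refine setLIntegral_mono' measurableSet_Ioo fun q hq => ?_
      gcongr
      · exact Real.sqrt_le_iff.2 ⟨by norm_num, by nlinarith [sq_nonneg q]⟩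
      · rw [← ofReal_norm]
        exact ENNReal.ofReal_le_ofReal (hC _ ⟨Ioo_subset_Icc_self hq, Ioc_subset_Icc_self hθ⟩)
    refine (hle.trans_lt ?_).ne
    simp only [setLIntegral_const, Real.volume_Ioo, Real.volume_Ioc]
    finiteness

/-- The operator `u ↦ backproj (chordMean 0 u)` is symmetric. -/
theorem integral_backproj_chordMean_symm {u v : ℂ → ℂ} (hu : ContinuousOn u (disk 1))
    (hv : ContinuousOn v (disk 1)) :
    ∫ x in Metric.ball (0 : ℂ) 1, backproj (chordMean 0 u) x * (starRingEnd ℂ) (v x) =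
      ∫ x in Metric.ball (0 : ℂ) 1, u x * (starRingEnd ℂ) (backproj (chordMean 0 v) x) := by
  have h1 := (isChordKernel_of_continuousOn (continuousOn_chordMean hv 0)).integral_backproj hu
  have h2 := (isChordKernel_of_continuousOn (continuousOn_chordMean hu 0)).integral_backproj hv
  rw [h1]
  have h3 : ∫ x in Metric.ball (0 : ℂ) 1, backproj (chordMean 0 u) x * (starRingEnd ℂ) (v x) =
      (starRingEnd ℂ) (∫ x in Metric.ball (0 : ℂ) 1,
        v x * (starRingEnd ℂ) (backproj (chordMean 0 u) x)) := by
    rw [← integral_conj]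
    congr 1; funext x
    rw [map_mul, Complex.conj_conj, mul_comm]
  rw [h3, h2, ← integral_conj]
  congr 1; funext θ
  rw [← integral_conj]
  congr 1; funext q
  simp only [map_mul, Complex.conj_conj, Complex.conj_ofReal]
  ring

/-! ### Green's formula for the Zernike operator -/

theorem contDiff_re : ContDiff ℝ ∞ fun z : ℂ => (z.re : ℂ) :=
  Complex.ofRealCLM.contDiff.comp Complex.reCLM.contDiff

theorem contDiff_im : ContDiff ℝ ∞ fun z : ℂ => (z.im : ℂ) :=
  Complex.ofRealCLM.contDiff.comp Complex.imCLM.contDiff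

theorem chordPoint_re_im (p : ℝ × ℝ) (s : ℝ) :
    (chordPoint p s).re = √(1 - p.1 ^ 2) * s * (Complex.exp (Complex.I * p.2)).re -
      p.1 * (Complex.exp (Complex.I * p.2)).im ∧
    (chordPoint p s).im = √(1 - p.1 ^ 2) * s * (Complex.exp (Complex.I * p.2)).im +
      p.1 * (Complex.exp (Complex.I * p.2)).re := by
  unfold chordPoint
  constructor
  · simp; ring
  · simp; ring

/-- The integrand is the divergence of (1 - |x|²) F v. Along a chord of direction v the factor 1 -
|x|² equals (1 - q²)(1 - s²) and vanishes at the ends, so there is no boundary term. -/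
theorem integral_div_eq_zero {F : ℂ → ℂ} (hF : SmoothOnDisk 1 F) (θ : ℝ) :
    ∫ x in Metric.ball (0 : ℂ) 1, ((1 - x.re ^ 2 - x.im ^ 2) *
      dirDeriv (disk 1) (Complex.exp (Complex.I * θ)) F x -
      2 * (x.re * (Complex.exp (Complex.I * θ)).re + x.im * (Complex.exp (Complex.I * θ)).im) *
        F x) = 0 := by
  set v := Complex.exp (Complex.I * θ) with hv
  have hd := (hF.diskDeriv one_pos v).continuousOn
  have hc := hF.continuousOn
  rw [diskDeriv_eq_dirDeriv] at hd
  have hre := contDiff_re.continuous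
  have him := contDiff_im.continuous
  rw [integral_ball_eq_chordMean θ (by fun_prop)]
  rw [← integral_zero ℝ ℂ (μ := volume.restrict (Ioo (-1 : ℝ) 1))]
  refine setIntegral_congr_fun measurableSet_Ioo fun q hq => ?_
  have hp' : (q, θ) ∈ chordSpace := ⟨Ioo_subset_Icc_self hq, mem_univ _⟩
  have h1 := integral_mul_chord_eq hF (p := (q, θ)) hq (a := fun s => 1 - s ^ 2)
    (a' := fun s => -2 * s) (fun s => ((hasDerivAt_pow 2 s).const_sub 1).congr_deriv (by simp))
    (by fun_prop) (by norm_num) (by norm_num)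
  set r : ℝ := √(1 - q ^ 2) with hr
  have hsq : (r : ℂ) * r = 1 - q ^ 2 := by
    rw [← Complex.ofReal_mul, Real.mul_self_sqrt (by nlinarith [hq.1, hq.2])]
    simp
  have hvv : (v.re : ℂ) ^ 2 + (v.im : ℂ) ^ 2 = 1 := by exact_mod_cast exp_re_sq_add_im_sq θ
  have h2 : chordMean 0 (fun x : ℂ => (1 - x.re ^ 2 - x.im ^ 2) * dirDeriv (disk 1) v F x -
      2 * (x.re * v.re + x.im * v.im) * F x) (q, θ) =
      ∫ s in (-1 : ℝ)..1, ((r ^ 2 : ℂ) * (((1 - s ^ 2 : ℝ) : ℂ) *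
        diskDeriv 1 v F (chordPoint (q, θ) s)) +
        r * (((-2 * s : ℝ) : ℂ) * F (chordPoint (q, θ) s))) := by
    unfold chordMean
    congr 1; funext s
    beta_reduce
    rw [(chordPoint_re_im (q, θ) s).1, (chordPoint_re_im (q, θ) s).2]
    simp only [← hv, ← hr, diskDeriv_eq_dirDeriv]
    push_cast
    generalize dirDeriv (disk 1) v F (chordPoint (q, θ) s) = X
    generalize F (chordPoint (q, θ) s) = Y
    have hv2 : (v.im : ℂ) ^ 2 = 1 - (v.re : ℂ) ^ 2 := by linear_combination hvv
    linear_combination (-(r : ℂ) ^ 2 * s ^ 2 * X - q ^ 2 * X - 2 * r * s * Y) * hvv - X * hsq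
  simp only [diskDeriv_eq_dirDeriv, ← hv] at h1 h2
  rw [h2, intervalIntegral.integral_add
    ((intervalIntegrable_chord hd hp' (by fun_prop)).const_mul _)
    ((intervalIntegrable_chord hc hp' (by fun_prop)).const_mul _),
    intervalIntegral.integral_const_mul, intervalIntegral.integral_const_mul, h1]
  ring

theorem hasDerivAt_chordMean_snd {g : ℂ → ℂ} (hg : SmoothOnDisk 1 g) {q : ℝ}
    (hq : q ∈ Ioo (-1 : ℝ) 1) (θ : ℝ) :
    HasDerivAt (fun θ => chordMean 0 g (q, θ)) (chordMean 0 (rotDeriv g) (q, θ)) θ := by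
  have h := (hasFDerivAt_chordMean hg 0 (p := (q, θ)) hq).comp_hasDerivAt θ
    ((hasDerivAt_const θ q).prodMk (hasDerivAt_id θ))
  exact h.congr_deriv (by simp [chordMeanDeriv])

/-- Slicing by chords gives the same value for every direction θ, so the integral is an average over
θ. On chords the rotation field acts as ∂_θ, and the integral of ∂_θ of a periodic function over a
period vanishes. -/
theorem integral_rotDeriv_eq_zero {F : ℂ → ℂ} (hF : SmoothOnDisk 1 F) :
    ∫ x in Metric.ball (0 : ℂ) 1, rotDeriv F x = 0 := by
  have hc := hF.rotDeriv.continuousOn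
  have hpi := Real.pi_pos
  have hA := continuousOn_chordMean hc 0
  set G : ℝ → ℝ → ℂ := fun θ q => √(1 - q ^ 2) * chordMean 0 (rotDeriv F) (q, θ) with hG
  have hGc : ContinuousOn (Function.uncurry G) (Icc 0 (2 * Real.pi) ×ˢ Icc (-1) 1) := by
    refine ContinuousOn.mul (Continuous.continuousOn (by fun_prop)) ?_
    exact hA.comp continuous_swap.continuousOn fun y hy => ⟨hy.2, mem_univ _⟩
  have hGi : Integrable (Function.uncurry G)
      ((volume.restrict (Ioc 0 (2 * Real.pi))).prod (volume.restrict (Ioo (-1 : ℝ) 1))) := by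
    rw [Measure.prod_restrict]
    exact (hGc.integrableOn_compact (isCompact_Icc.prod isCompact_Icc)).mono_set
      (prod_mono Ioc_subset_Icc_self Ioo_subset_Icc_self)
  have h1 : ∫ θ in Ioc 0 (2 * Real.pi), ∫ q in Ioo (-1 : ℝ) 1, G θ q =
      (2 * Real.pi) * ∫ x in Metric.ball (0 : ℂ) 1, rotDeriv F x := by
    have : ∀ θ : ℝ, ∫ q in Ioo (-1 : ℝ) 1, G θ q = ∫ x in Metric.ball (0 : ℂ) 1, rotDeriv F x :=
      fun θ => (integral_ball_eq_chordMean θ hc).symm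
    simp only [this]
    simp [hpi.le]
  have h2 : ∫ θ in Ioc 0 (2 * Real.pi), ∫ q in Ioo (-1 : ℝ) 1, G θ q = 0 := by
    rw [integral_integral_swap hGi]
    rw [← integral_zero ℝ ℂ (μ := volume.restrict (Ioo (-1 : ℝ) 1))]
    refine setIntegral_congr_fun measurableSet_Ioo fun q hq => ?_
    simp only [hG]
    rw [integral_const_mul, ← intervalIntegral.integral_of_le (by positivity),
      intervalIntegral.integral_eq_sub_of_hasDerivAt
        (fun θ _ => hasDerivAt_chordMean_snd hF hq θ)]
    · have : chordMean 0 F (q, 2 * Real.pi) = chordMean 0 F (q, 0) := by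
        unfold chordMean chordPoint
        have : Complex.exp (Complex.I * ((2 * Real.pi : ℝ) : ℂ)) =
            Complex.exp (Complex.I * ((0 : ℝ) : ℂ)) := by
          push_cast
          rw [mul_comm, Complex.exp_two_pi_mul_I]
          simp
        simp only [this]
      rw [this, sub_self, mul_zero]
    · refine ContinuousOn.intervalIntegrable ?_
      exact hA.comp (f := fun θ => (q, θ)) (by fun_prop) fun θ _ =>
        ⟨Ioo_subset_Icc_self hq, mem_univ _⟩
  rw [h1] at h2
  have hne : (2 * Real.pi : ℂ) ≠ 0 := by exact_mod_cast (by positivity : (2 * Real.pi : ℝ) ≠ 0)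
  exact (mul_eq_zero.1 h2).resolve_left hne

/-- The integrand of the quadratic form of the Zernike operator. -/
def energyDensity (u v : ℂ → ℂ) (x : ℂ) : ℂ :=
  (1 - x.re ^ 2 - x.im ^ 2) *
    (dirDeriv (disk 1) 1 u x * dirDeriv (disk 1) 1 v x +
      dirDeriv (disk 1) Complex.I u x * dirDeriv (disk 1) Complex.I v x) +
    rotDeriv u x * rotDeriv v x + u x * v x

theorem rotDeriv_eq (g : ℂ → ℂ) (z : ℂ) :
    rotDeriv g z = z.re * dirDeriv (disk 1) Complex.I g z - z.im * dirDeriv (disk 1) 1 g z := by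
  rw [rotDeriv, fderivWithin_apply_eq]
  simp
  ring

theorem dirDeriv_re {z : ℂ} (hz : z ∈ disk 1) (v : ℂ) :
    dirDeriv (disk 1) v (fun z => (z.re : ℂ)) z = v.re := by
  have : HasFDerivWithinAt (fun z : ℂ => (z.re : ℂ)) (Complex.ofRealCLM.comp Complex.reCLM)
    (disk 1) z := (Complex.ofRealCLM.comp Complex.reCLM).hasFDerivWithinAt
  rw [dirDeriv, this.fderivWithin (uniqueDiffOn_disk one_pos z hz)]
  simp

theorem dirDeriv_im {z : ℂ} (hz : z ∈ disk 1) (v : ℂ) :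
    dirDeriv (disk 1) v (fun z => (z.im : ℂ)) z = v.im := by
  have : HasFDerivWithinAt (fun z : ℂ => (z.im : ℂ)) (Complex.ofRealCLM.comp Complex.imCLM)
    (disk 1) z := (Complex.ofRealCLM.comp Complex.imCLM).hasFDerivWithinAt
  rw [dirDeriv, this.fderivWithin (uniqueDiffOn_disk one_pos z hz)]
  simp

theorem dirDeriv_rotDeriv {g : ℂ → ℂ} (hg : SmoothOnDisk 1 g) (v : ℂ) {z : ℂ} (hz : z ∈ disk 1) :
    dirDeriv (disk 1) v (rotDeriv g) z =
      v.re * dirDeriv (disk 1) Complex.I g z - v.im * dirDeriv (disk 1) 1 g z +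
      z.re * dirDeriv (disk 1) v (dirDeriv (disk 1) Complex.I g) z -
      z.im * dirDeriv (disk 1) v (dirDeriv (disk 1) 1 g) z := by
  have hU := uniqueDiffOn_disk one_pos
  have hre := (contDiff_re.contDiffOn (s := disk 1)).differentiableOn (by simp)
  have him := (contDiff_im.contDiffOn (s := disk 1)).differentiableOn (by simp)
  have d1 := (contDiffOn_dirDeriv hU hg 1).differentiableOn (by simp)
  have dI := (contDiffOn_dirDeriv hU hg Complex.I).differentiableOn (by simp)
  have e : rotDeriv g = fun z : ℂ => (z.re : ℂ) * dirDeriv (disk 1) Complex.I g z +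
      (-1 : ℂ) * ((z.im : ℂ) * dirDeriv (disk 1) 1 g z) := by
    funext z; rw [rotDeriv_eq]; ring
  have m1 : DifferentiableOn ℝ (fun z : ℂ => (z.re : ℂ) * dirDeriv (disk 1) Complex.I g z)
    (disk 1) := hre.mul dI
  have m2 : DifferentiableOn ℝ (fun z : ℂ => (z.im : ℂ) * dirDeriv (disk 1) 1 g z)
    (disk 1) := him.mul d1
  have m3 : DifferentiableOn ℝ (fun z : ℂ => (-1 : ℂ) * ((z.im : ℂ) * dirDeriv (disk 1) 1 g z))
    (disk 1) := m2.const_mul _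
  rw [e, dirDeriv_add hU m1 m3 v hz,
    dirDeriv_const_mul hU m2 _ _ hz, dirDeriv_mul hU hre dI v hz,
    dirDeriv_mul hU him d1 v hz, dirDeriv_re hz, dirDeriv_im hz]
  ring

/-- Green's formula for `zernike` = -div((1 - |x|²)∇) - ∂_ω² + 1. The pointwise difference of the
two integrands consists of two divergences of fields vanishing on the circle and one rotational
derivative, all of integral zero. -/
theorem integral_zernike_mul {u v : ℂ → ℂ} (hu : SmoothOnDisk 1 u) (hv : SmoothOnDisk 1 v) :
    ∫ x in Metric.ball (0 : ℂ) 1, zernike (disk 1) u x * v x =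
      ∫ x in Metric.ball (0 : ℂ) 1, energyDensity u v x := by
  have hU := uniqueDiffOn_disk one_pos
  have su1 := hu.diskDeriv one_pos 1
  have suI := hu.diskDeriv one_pos Complex.I
  rw [diskDeriv_eq_dirDeriv] at su1 suI
  have hF1 : SmoothOnDisk 1 (fun z => dirDeriv (disk 1) 1 u z * v z) := ContDiffOn.mul su1 hv
  have hF2 : SmoothOnDisk 1 (fun z => dirDeriv (disk 1) Complex.I u z * v z) :=
    ContDiffOn.mul suI hv
  have hF3 : SmoothOnDisk 1 (fun z => rotDeriv u z * v z) := ContDiffOn.mul hu.rotDeriv hv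
  have z1 := integral_div_eq_zero hF1 0
  have z2 := integral_div_eq_zero hF2 (Real.pi / 2)
  have z3 := integral_rotDeriv_eq_zero hF3
  have e1 : Complex.exp (Complex.I * ((0 : ℝ) : ℂ)) = 1 := by simp
  have e2 : Complex.exp (Complex.I * ((Real.pi / 2 : ℝ) : ℂ)) = Complex.I := by
    push_cast; rw [mul_comm, Complex.exp_pi_div_two_mul_I]
  rw [e1] at z1
  rw [e2] at z2
  have cre := contDiff_re.continuous.continuousOn (s := disk 1)
  have cim := contDiff_im.continuous.continuousOn (s := disk 1)
  have cF1 := hF1.continuousOn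
  have cF2 := hF2.continuousOn
  have cD1 := (hF1.diskDeriv one_pos 1).continuousOn
  have cD2 := (hF2.diskDeriv one_pos Complex.I).continuousOn
  have cv := hv.continuousOn
  have cu := hu.continuousOn
  have cu1 := su1.continuousOn
  have cuI := suI.continuousOn
  have cv1 := (hv.diskDeriv one_pos 1).continuousOn
  have cvI := (hv.diskDeriv one_pos Complex.I).continuousOn
  have cru := hu.rotDeriv.continuousOn
  have crv := hv.rotDeriv.continuousOn
  have cz := (zernike_contDiffOn hU hu).continuousOn
  rw [diskDeriv_eq_dirDeriv] at cD1 cD2 cv1 cvI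
  have i1 := integrableOn_of_continuousOn_disk
    (F := fun x : ℂ => (1 - x.re ^ 2 - x.im ^ 2) * dirDeriv (disk 1) 1
      (fun z => dirDeriv (disk 1) 1 u z * v z) x -
      2 * (x.re * (1 : ℂ).re + x.im * (1 : ℂ).im) * (dirDeriv (disk 1) 1 u x * v x)) (by fun_prop)
  have i2 := integrableOn_of_continuousOn_disk
    (F := fun x : ℂ => (1 - x.re ^ 2 - x.im ^ 2) * dirDeriv (disk 1) Complex.I
      (fun z => dirDeriv (disk 1) Complex.I u z * v z) x -
      2 * (x.re * Complex.I.re + x.im * Complex.I.im) * (dirDeriv (disk 1) Complex.I u x * v x))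
      (by fun_prop)
  have i3 := integrableOn_of_continuousOn_disk hF3.rotDeriv.continuousOn
  have i4 := integrableOn_of_continuousOn_disk (F := energyDensity u v)
    (by unfold energyDensity; fun_prop)
  have key : ∫ x in Metric.ball (0 : ℂ) 1, zernike (disk 1) u x * v x =
      ∫ x in Metric.ball (0 : ℂ) 1, (energyDensity u v x -
        (((1 - x.re ^ 2 - x.im ^ 2) * dirDeriv (disk 1) 1
      (fun z => dirDeriv (disk 1) 1 u z * v z) x -
      2 * (x.re * (1 : ℂ).re + x.im * (1 : ℂ).im) * (dirDeriv (disk 1) 1 u x * v x)) +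
      ((1 - x.re ^ 2 - x.im ^ 2) * dirDeriv (disk 1) Complex.I
      (fun z => dirDeriv (disk 1) Complex.I u z * v z) x -
      2 * (x.re * Complex.I.re + x.im * Complex.I.im) * (dirDeriv (disk 1) Complex.I u x * v x)) +
      rotDeriv (fun z => rotDeriv u z * v z) x)) := by
    refine setIntegral_congr_fun measurableSet_ball fun x hx => ?_
    have hx' : x ∈ disk 1 := Metric.ball_subset_closedBall hx
    have dv := ContDiffOn.differentiableOn hv (by simp)
    have du1 := su1.differentiableOn (by simp)
    have duI := suI.differentiableOn (by simp)
    have dru := ContDiffOn.differentiableOn hu.rotDeriv (by simp)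
    simp only [rotDeriv_eq (fun z => rotDeriv u z * v z)]
    rw [dirDeriv_mul hU du1 dv _ hx', dirDeriv_mul hU duI dv _ hx', dirDeriv_mul hU dru dv _ hx',
      dirDeriv_mul hU dru dv _ hx', dirDeriv_rotDeriv hu _ hx', dirDeriv_rotDeriv hu _ hx',
      energyDensity, zernike, dirDeriv_comm (convex_disk 1) (interior_disk_nonempty one_pos) hu
        Complex.I 1 hx', rotDeriv_eq, rotDeriv_eq]
    simp
    ring
  have i12 := i1.add i2
  refine (key.trans (integral_sub i4 (i12.add i3))).trans ?_
  have hz : ∫ x in Metric.ball (0 : ℂ) 1, (((1 - x.re ^ 2 - x.im ^ 2) * dirDeriv (disk 1) 1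
      (fun z => dirDeriv (disk 1) 1 u z * v z) x -
      2 * (x.re * (1 : ℂ).re + x.im * (1 : ℂ).im) * (dirDeriv (disk 1) 1 u x * v x)) +
      ((1 - x.re ^ 2 - x.im ^ 2) * dirDeriv (disk 1) Complex.I
      (fun z => dirDeriv (disk 1) Complex.I u z * v z) x -
      2 * (x.re * Complex.I.re + x.im * Complex.I.im) * (dirDeriv (disk 1) Complex.I u x * v x)) +
      rotDeriv (fun z => rotDeriv u z * v z) x) = 0 := by
    have a1 := integral_add i12 i3
    have a2 := integral_add i1 i2
    simp only [Pi.add_apply] at a1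
    rw [a1, a2, z1, z2, z3]
    simp
  rw [hz, sub_zero]

theorem integral_zernike_symm {u v : ℂ → ℂ} (hu : SmoothOnDisk 1 u) (hv : SmoothOnDisk 1 v) :
    ∫ x in Metric.ball (0 : ℂ) 1, zernike (disk 1) u x * v x =
      ∫ x in Metric.ball (0 : ℂ) 1, u x * zernike (disk 1) v x := by
  simp only [mul_comm (u _)]
  rw [integral_zernike_mul hu hv, integral_zernike_mul hv hu]
  congr 1; funext x
  unfold energyDensity
  ring

theorem dirDeriv_conj {S : Set ℂ} {f : ℂ → ℂ} (hS : UniqueDiffOn ℝ S)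
    (hf : DifferentiableOn ℝ f S) (v : ℂ) {z : ℂ} (hz : z ∈ S) :
    dirDeriv S v (fun z => (starRingEnd ℂ) (f z)) z = (starRingEnd ℂ) (dirDeriv S v f z) := by
  have h := (Complex.conjCLE.toContinuousLinearMap.hasFDerivAt (x := f z)).comp_hasFDerivWithinAt z
    (hf z hz).hasFDerivWithinAt
  have h' : HasFDerivWithinAt (fun z => (starRingEnd ℂ) (f z)) _ S z := h
  rw [dirDeriv, h'.fderivWithin (hS z hz)]
  simp [dirDeriv]

theorem SmoothOnDisk.conj {R : ℝ} {f : ℂ → ℂ} (hf : SmoothOnDisk R f) :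
    SmoothOnDisk R (fun z => (starRingEnd ℂ) (f z)) :=
  Complex.conjCLE.contDiff.comp_contDiffOn hf

theorem zernike_conj {S : Set ℂ} (hS : UniqueDiffOn ℝ S) {f : ℂ → ℂ} (hf : ContDiffOn ℝ ∞ f S)
    {z : ℂ} (hz : z ∈ S) :
    zernike S (fun z => (starRingEnd ℂ) (f z)) z = (starRingEnd ℂ) (zernike S f z) := by
  have d0 := hf.differentiableOn (by simp)
  have d := fun v => (contDiffOn_dirDeriv hS hf v).differentiableOn (by simp)
  have key : ∀ u v, dirDeriv S u (dirDeriv S v (fun z => (starRingEnd ℂ) (f z))) z =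
      (starRingEnd ℂ) (dirDeriv S u (dirDeriv S v f) z) := by
    intro u v
    rw [dirDeriv_congr (fun y hy => dirDeriv_conj hS d0 v hy) u hz, dirDeriv_conj hS (d v) u hz]
  rw [zernike, key, key, key, dirDeriv_conj hS d0 _ hz, dirDeriv_conj hS d0 _ hz, zernike]
  simp [map_ofNat]

theorem integral_zernike_conj_symm {u v : ℂ → ℂ} (hu : SmoothOnDisk 1 u) (hv : SmoothOnDisk 1 v) :
    ∫ x in Metric.ball (0 : ℂ) 1, zernike (disk 1) u x * (starRingEnd ℂ) (v x) =
      ∫ x in Metric.ball (0 : ℂ) 1, u x * (starRingEnd ℂ) (zernike (disk 1) v x) := by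
  rw [integral_zernike_symm hu hv.conj]
  refine setIntegral_congr_fun measurableSet_ball fun x hx => ?_
  rw [zernike_conj (uniqueDiffOn_disk one_pos) hv (Metric.ball_subset_closedBall hx)]

/-- The Zernike operator is bounded below by the identity. -/
theorem integral_norm_sq_le_zernike {u : ℂ → ℂ} (hu : SmoothOnDisk 1 u) :
    (∫ x in Metric.ball (0 : ℂ) 1, u x * (starRingEnd ℂ) (u x)).re ≤
      (∫ x in Metric.ball (0 : ℂ) 1, zernike (disk 1) u x * (starRingEnd ℂ) (u x)).re := by
  have hU := uniqueDiffOn_disk one_pos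
  have d0 := ContDiffOn.differentiableOn hu (by simp)
  have cre := contDiff_re.continuous.continuousOn (s := disk 1)
  have cim := contDiff_im.continuous.continuousOn (s := disk 1)
  have hv := hu.conj
  have cu := hu.continuousOn
  have cv := hv.continuousOn
  have cu1 := (hu.diskDeriv one_pos 1).continuousOn
  have cuI := (hu.diskDeriv one_pos Complex.I).continuousOn
  have cv1 := (hv.diskDeriv one_pos 1).continuousOn
  have cvI := (hv.diskDeriv one_pos Complex.I).continuousOn
  have cru := hu.rotDeriv.continuousOn
  have crv := hv.rotDeriv.continuousOn
  rw [diskDeriv_eq_dirDeriv] at cu1 cuI cv1 cvI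
  have i1 := integrableOn_of_continuousOn_disk (F := fun x => u x * (starRingEnd ℂ) (u x))
    (by fun_prop)
  have i2 := integrableOn_of_continuousOn_disk
    (F := energyDensity u (fun x => (starRingEnd ℂ) (u x))) (by unfold energyDensity; fun_prop)
  rw [integral_zernike_mul hu hv]
  have r1 := integral_re (𝕜 := ℂ) i1
  have r2 := integral_re (𝕜 := ℂ) i2
  simp only [RCLike.re_eq_complex_re] at r1 r2
  rw [← r1, ← r2]
  refine setIntegral_mono_on i1.re i2.re measurableSet_ball fun x hx => ?_
  have hx' : x ∈ disk 1 := Metric.ball_subset_closedBall hx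
  have hn : 0 ≤ 1 - x.re ^ 2 - x.im ^ 2 := by
    have : ‖x‖ < 1 := by simpa using hx
    have h2 : ‖x‖ ^ 2 = x.re ^ 2 + x.im ^ 2 := by
      rw [← Complex.normSq_eq_norm_sq, Complex.normSq_apply]; ring
    nlinarith [norm_nonneg x]
  have hrot : rotDeriv (fun x => (starRingEnd ℂ) (u x)) x = (starRingEnd ℂ) (rotDeriv u x) := by
    rw [rotDeriv_eq, rotDeriv_eq, dirDeriv_conj hU d0 _ hx', dirDeriv_conj hU d0 _ hx']
    simp
  -- With v = ū the density is a sum of squares with nonnegative coefficients, of which only |u|² is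
  -- kept.
  have e : energyDensity u (fun x => (starRingEnd ℂ) (u x)) x =
      (((1 - x.re ^ 2 - x.im ^ 2) * (Complex.normSq (dirDeriv (disk 1) 1 u x) +
        Complex.normSq (dirDeriv (disk 1) Complex.I u x)) + Complex.normSq (rotDeriv u x) +
        Complex.normSq (u x) : ℝ) : ℂ) := by
    rw [energyDensity, hrot, dirDeriv_conj hU d0 _ hx', dirDeriv_conj hU d0 _ hx']
    simp only [Complex.mul_conj]
    push_cast
    ring
  simp only [e, Complex.mul_conj, Complex.ofReal_re]
  have := Complex.normSq_nonneg (dirDeriv (disk 1) 1 u x)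
  have := Complex.normSq_nonneg (dirDeriv (disk 1) Complex.I u x)
  have := Complex.normSq_nonneg (rotDeriv u x)
  nlinarith [mul_nonneg hn (add_nonneg (Complex.normSq_nonneg (dirDeriv (disk 1) 1 u x))
    (Complex.normSq_nonneg (dirDeriv (disk 1) Complex.I u x)))]

/-! ### Plane waves and the normal operator of the flat disk -/

open Polynomial

/-- A polynomial in the offset of a point from the line through the origin in direction `φ`. -/
def planeWave (P : ℝ[X]) (φ : ℝ) (x : ℂ) : ℂ := ((P.eval (offset x φ) : ℝ) : ℂ)

theorem offset_eq_offsetCLM (φ : ℝ) : (fun x => offset x φ) = offsetCLM φ := by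
  funext x; rw [offsetCLM_apply]

theorem contDiff_planeWave (P : ℝ[X]) (φ : ℝ) : ContDiff ℝ ∞ (planeWave P φ) := by
  have h : ContDiff ℝ ∞ fun x => offset x φ := by
    rw [offset_eq_offsetCLM]; exact (offsetCLM φ).contDiff
  have h2 : ContDiff ℝ ∞ fun q : ℝ => P.eval q := by
    simpa [Polynomial.coe_aeval_eq_eval] using P.contDiff_aeval (𝕜 := ℝ) (n := ∞)
  exact Complex.ofRealCLM.contDiff.comp (h2.comp h)

theorem hasFDerivAt_planeWave (P : ℝ[X]) (φ : ℝ) (x : ℂ) :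
    HasFDerivAt (planeWave P φ) (((P.derivative.eval (offset x φ)) • offsetCLM φ).smulRight (1 : ℂ))
      x := by
  have h : HasFDerivAt (fun x => offset x φ) (offsetCLM φ) x := by
    rw [offset_eq_offsetCLM]; exact (offsetCLM φ).hasFDerivAt
  have h2 := (P.hasDerivAt (offset x φ)).comp_hasFDerivAt x h
  have h3 := (Complex.ofRealCLM.hasFDerivAt (x := P.eval (offset x φ))).comp x h2
  refine HasFDerivAt.congr_fderiv h3 ?_
  ext
  simp

theorem dirDeriv_planeWave {S : Set ℂ} (hS : UniqueDiffOn ℝ S) (P : ℝ[X]) (φ : ℝ) (v : ℂ) {x : ℂ}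
    (hx : x ∈ S) :
    dirDeriv S v (planeWave P φ) x = offset v φ * planeWave P.derivative φ x := by
  rw [dirDeriv, (hasFDerivAt_planeWave P φ x).hasFDerivWithinAt.fderivWithin (hS x hx)]
  simp [planeWave, offsetCLM_apply]
  ring

theorem dirDeriv_dirDeriv_planeWave {S : Set ℂ} (hS : UniqueDiffOn ℝ S) (P : ℝ[X]) (φ : ℝ)
    (u v : ℂ) {x : ℂ} (hx : x ∈ S) :
    dirDeriv S u (dirDeriv S v (planeWave P φ)) x =
      offset v φ * (offset u φ * planeWave P.derivative.derivative φ x) := by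
  rw [dirDeriv_congr (fun y hy => dirDeriv_planeWave hS P φ v hy) u hx,
    dirDeriv_const_mul hS ((contDiff_planeWave _ φ).contDiffOn.differentiableOn (by simp)) _ _ hx,
    dirDeriv_planeWave hS _ _ _ hx]

/-- On a function of the offset alone `zernike` acts as the same ordinary differential operator that
appears for chord means, since the gradient of the offset is a unit vector. -/
theorem zernike_planeWave {S : Set ℂ} (hS : UniqueDiffOn ℝ S) (P : ℝ[X]) (φ : ℝ) {x : ℂ}
    (hx : x ∈ S) :
    zernike S (planeWave P φ) x =
      planeWave (-((1 - X ^ 2) * P.derivative.derivative) + 3 * X * P.derivative + P) φ x := by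
  rw [zernike]
  simp only [dirDeriv_dirDeriv_planeWave hS P φ _ _ hx, dirDeriv_planeWave hS P φ _ hx]
  have h1 : ((offset 1 φ : ℝ) : ℂ) ^ 2 + ((offset Complex.I φ : ℝ) : ℂ) ^ 2 = 1 := by
    have : (offset 1 φ) ^ 2 + (offset Complex.I φ) ^ 2 = 1 := by
      rw [offset_one, offset_I]; simp
    exact_mod_cast this
  have h2 : ((offset x φ : ℝ) : ℂ) = x.re * offset 1 φ + x.im * offset Complex.I φ := by
    exact_mod_cast offset_eq_re_im x φ
  simp only [planeWave]
  simp only [eval_add, eval_neg, eval_mul, eval_sub, eval_one, eval_pow, eval_X, eval_ofNat]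
  push_cast
  rw [h2]
  linear_combination (-((eval (offset x φ) P.derivative.derivative : ℝ) : ℂ)) * h1

/-! ### Ridge functions and Marr's formula -/

/-- The Zernike ridge functions. -/
def ridge (n : ℕ) (φ : ℝ) : ℂ → ℂ := planeWave (Chebyshev.U ℝ n) φ

theorem smoothOnDisk_ridge (n : ℕ) (φ : ℝ) : SmoothOnDisk 1 (ridge n φ) :=
  (contDiff_planeWave _ φ).contDiffOn

/-- This is the Chebyshev equation (1 - q²)U'' - 3qU' + n(n + 2)U = 0, since n(n + 2) + 1 = (n +
1)². -/
theorem zernike_ridge {S : Set ℂ} (hS : UniqueDiffOn ℝ S) (n : ℕ) (φ : ℝ) {x : ℂ} (hx : x ∈ S) :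
    zernike S (ridge n φ) x = ((n : ℂ) + 1) ^ 2 * ridge n φ x := by
  rw [ridge, zernike_planeWave hS _ _ hx]
  have h := Chebyshev.one_sub_X_sq_mul_derivative_derivative_U_eq_poly_in_U (R := ℝ) n
  rw [Function.iterate_succ, Function.iterate_one, Function.comp_apply] at h
  rw [h]
  simp only [planeWave]
  simp only [eval_add, eval_neg, eval_mul, eval_sub, eval_X, eval_ofNat, eval_intCast]
  push_cast
  simp
  ring

theorem offset_chordPoint (q θ φ s : ℝ) :
    offset (chordPoint (q, θ) s) φ = √(1 - q ^ 2) * s * Real.sin (θ - φ) + q * Real.cos (θ - φ) := by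
  rw [offset, chordPoint, mul_comm (Complex.exp _), mul_assoc, ← Complex.exp_add]
  have : Complex.I * ((q, θ) : ℝ × ℝ).2 + -(Complex.I * φ) = ((θ - φ : ℝ) : ℂ) * Complex.I := by
    push_cast; ring
  rw [this, Complex.mul_im, Complex.exp_ofReal_mul_I_re, Complex.exp_ofReal_mul_I_im]
  simp

/-- Marr's formula. -/
theorem chordMean_ridge (n : ℕ) (φ : ℝ) {q : ℝ} (hq : q ∈ Ioo (-1 : ℝ) 1) (θ : ℝ) :
    chordMean 0 (ridge n φ) (q, θ) =
      ((2 / (n + 1) * ((Chebyshev.U ℝ n).eval q * (Chebyshev.U ℝ n).eval (Real.cos (θ - φ))) : ℝ) :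
        ℂ) := by
  have hn : ((n : ℝ) + 1) ≠ 0 := by positivity
  unfold chordMean ridge planeWave
  simp only [pow_zero, Complex.ofReal_one, one_mul, offset_chordPoint]
  rw [intervalIntegral.integral_ofReal]
  congr 1
  -- If the chord is parallel to the lines on which the ridge function is constant, the integrand is
  -- constant and no primitive in s is needed.
  by_cases hs : Real.sin (θ - φ) = 0
  · simp only [hs, mul_zero, zero_add, intervalIntegral.integral_const, smul_eq_mul]
    have hc : Real.cos (θ - φ) = 1 ∨ Real.cos (θ - φ) = -1 := by
      have := Real.sin_sq_add_cos_sq (θ - φ)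
      rw [hs] at this
      rw [← sq_eq_one_iff]
      linarith
    rcases hc with hc | hc
    · rw [hc, Chebyshev.U_eval_one]; push_cast; field_simp; ring
    · rw [hc, mul_neg_one, Chebyshev.U_eval_neg, Chebyshev.U_eval_neg_one]; push_cast
      field_simp; ring
  · generalize θ - φ = δ at hs ⊢
    set p := √(1 - q ^ 2) with hp
    have hp0 : p ≠ 0 := (sqrt_one_sub_sq_pos hq).ne'
    -- Since T_{n+1}' = (n + 1)U_n, the Chebyshev polynomial T_{n+1} along the chord is a primitive.
    have hder : ∀ s ∈ uIcc (-1 : ℝ) 1, HasDerivAt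
        (fun s => (Chebyshev.T ℝ (n + 1)).eval (p * s * Real.sin δ + q * Real.cos δ) /
          ((n + 1) * (p * Real.sin δ)))
        ((Chebyshev.U ℝ n).eval (p * s * Real.sin δ + q * Real.cos δ)) s := by
      intro s _
      have h1 : HasDerivAt (fun s => p * s * Real.sin δ + q * Real.cos δ) (p * Real.sin δ) s := by
        have := (((hasDerivAt_id s).const_mul p).mul_const (Real.sin δ)).add_const
          (q * Real.cos δ)
        exact this.congr_deriv (by simp)
      have h2 := (((Chebyshev.T ℝ (n + 1)).hasDerivAt _).comp s h1).div_const
        (((n : ℝ) + 1) * (p * Real.sin δ))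
      refine HasDerivAt.congr_deriv h2 ?_
      rw [Chebyshev.T_derivative_eq_U]
      simp
      field_simp
    rw [intervalIntegral.integral_eq_sub_of_hasDerivAt hder
      (Continuous.intervalIntegrable (by fun_prop) _ _)]
    have ha := Real.cos_arccos hq.1.le hq.2.le
    have hsa : Real.sin (Real.arccos q) = p := Real.sin_arccos q
    set a := Real.arccos q with hadef
    -- With q = cos a, the two ends of the chord have offsets cos(a ∓ δ), where T_{n+1} becomes
    -- cos((n + 1)(a ∓ δ)); the difference factors into sines, hence into values of U_n.
    have e1 : p * 1 * Real.sin δ + q * Real.cos δ = Real.cos (a - δ) := by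
      rw [Real.cos_sub, ha, hsa]; ring
    have e2 : p * -1 * Real.sin δ + q * Real.cos δ = Real.cos (a + δ) := by
      rw [Real.cos_add, ha, hsa]; ring
    rw [e1, e2, Chebyshev.T_real_cos, Chebyshev.T_real_cos, ← ha, ← sub_div,
      div_eq_iff (mul_ne_zero hn (mul_ne_zero hp0 hs))]
    have u1 := Chebyshev.U_real_cos a n
    have u2 := Chebyshev.U_real_cos δ n
    push_cast at u1 u2 ⊢
    rw [hsa] at u1
    have t : Real.cos ((n + 1) * (a - δ)) - Real.cos ((n + 1) * (a + δ)) =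
        2 * (Real.sin ((n + 1) * a) * Real.sin ((n + 1) * δ)) := by
      rw [mul_sub, mul_add, Real.cos_sub, Real.cos_add]; ring
    rw [t, ← u1, ← u2]
    field_simp

/-- The functions of `θ` with frequencies `n, n - 2, …, -n`. -/
def trigSpan (n : ℕ) : Submodule ℂ (ℝ → ℂ) :=
  Submodule.span ℂ {f | ∃ k : ℕ, k ≤ n ∧ f = fun θ : ℝ => Complex.exp (Complex.I * ((n - 2 * k) * θ))}

theorem continuous_of_mem_trigSpan {n : ℕ} {f : ℝ → ℂ} (hf : f ∈ trigSpan n) : Continuous f := by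
  refine Submodule.span_induction (p := fun f _ => Continuous f) ?_ ?_ ?_ ?_ hf
  · rintro _ ⟨k, _, rfl⟩; fun_prop
  · exact continuous_const
  · exact fun _ _ _ _ h1 h2 => h1.add h2
  · exact fun c _ _ h => h.const_smul c

/-- The offset is a combination of e^{iθ} and e^{-iθ}, so multiplication by it shifts frequencies by
±1. -/
theorem offset_mul_mem_trigSpan (x : ℂ) {n : ℕ} {f : ℝ → ℂ} (hf : f ∈ trigSpan n) :
    (fun θ => (offset x θ : ℂ) * f θ) ∈ trigSpan (n + 1) := by
  refine Submodule.span_induction (p := fun f _ => (fun θ => (offset x θ : ℂ) * f θ) ∈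
    trigSpan (n + 1)) ?_ ?_ ?_ ?_ hf
  · rintro _ ⟨k, hk, rfl⟩
    have e : (fun θ : ℝ => (offset x θ : ℂ) * Complex.exp (Complex.I * ((n - 2 * k) * θ))) =
        (-(starRingEnd ℂ x) / (2 * Complex.I)) •
          (fun θ : ℝ => Complex.exp (Complex.I * (((n + 1 : ℕ) - 2 * (k : ℕ)) * θ))) +
        (x / (2 * Complex.I)) •
          (fun θ : ℝ => Complex.exp (Complex.I * (((n + 1 : ℕ) - 2 * (k + 1 : ℕ)) * θ))) := by
      funext θ
      have h1 : (offset x θ : ℂ) = (x * Complex.exp (-(Complex.I * θ)) -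
          starRingEnd ℂ x * Complex.exp (Complex.I * θ)) / (2 * Complex.I) := by
        rw [offset, Complex.im_eq_sub_conj, map_mul, ← Complex.exp_conj]
        simp
      have h2 : Complex.exp (Complex.I * (((n + 1 : ℕ) - 2 * (k : ℕ)) * θ)) =
          Complex.exp (Complex.I * θ) * Complex.exp (Complex.I * ((n - 2 * k) * θ)) := by
        rw [← Complex.exp_add]; congr 1; push_cast; ring
      have h3 : Complex.exp (Complex.I * (((n + 1 : ℕ) - 2 * (k + 1 : ℕ)) * θ)) =
          Complex.exp (-(Complex.I * θ)) * Complex.exp (Complex.I * ((n - 2 * k) * θ)) := by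
        rw [← Complex.exp_add]; congr 1; push_cast; ring
      simp only [Pi.add_apply, Pi.smul_apply, smul_eq_mul, h1, h2, h3]
      ring
    rw [e]
    exact Submodule.add_mem _
      (Submodule.smul_mem _ _ (Submodule.subset_span ⟨k, by omega, rfl⟩))
      (Submodule.smul_mem _ _ (Submodule.subset_span ⟨k + 1, by omega, rfl⟩))
  · have h0 : (fun θ => (offset x θ : ℂ) * (0 : ℝ → ℂ) θ) = 0 := by funext θ; simp
    rw [h0]
    exact (trigSpan (n + 1)).zero_mem
  · intro f g _ _ h1 h2
    convert Submodule.add_mem _ h1 h2 using 1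
    funext θ; simp; ring
  · intro c f _ h
    convert Submodule.smul_mem _ c h using 1
    funext θ; simp; ring

theorem trigSpan_le (n : ℕ) : trigSpan n ≤ trigSpan (n + 2) := by
  refine Submodule.span_le.2 ?_
  rintro _ ⟨k, hk, rfl⟩
  refine Submodule.subset_span ⟨k + 1, by omega, ?_⟩
  funext θ
  congr 3
  push_cast; ring

/-- U_n has degree n and the parity of n; the three-term recursion carries this over to frequencies.
-/
theorem chebyshev_offset_mem_trigSpan (x : ℂ) (n : ℕ) :
    (fun θ => (((Chebyshev.U ℝ n).eval (offset x θ) : ℝ) : ℂ)) ∈ trigSpan n := by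
  induction n using Nat.twoStepInduction with
  | zero =>
    refine Submodule.subset_span ⟨0, le_rfl, ?_⟩
    simp
  | one =>
    have h0 : (fun _ : ℝ => (2 : ℂ)) ∈ trigSpan 0 := by
      have : (fun _ : ℝ => (2 : ℂ)) = (2 : ℂ) • (fun θ : ℝ =>
          Complex.exp (Complex.I * (((0 : ℕ) - 2 * (0 : ℕ)) * θ))) := by
        funext θ; simp
      rw [this]
      exact Submodule.smul_mem _ _ (Submodule.subset_span ⟨0, le_rfl, rfl⟩)
    convert offset_mul_mem_trigSpan x h0 using 1
    funext θ
    simp [mul_comm]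
  | more n h0 h1 =>
    have h2 := Submodule.smul_mem _ (2 : ℂ) (offset_mul_mem_trigSpan x h1)
    convert Submodule.sub_mem _ h2 (trigSpan_le n h0) using 1
    funext θ
    have := Chebyshev.U_add_two ℂ n
    push_cast
    rw [this]
    simp
    ring

/-- The Dirichlet-type sum for sin((n + 1)δ)/sin δ, obtained here by induction so that zeros of the
sine need no separate treatment. -/
theorem chebyshev_cos_eq_sum (n : ℕ) (δ : ℝ) :
    (((Chebyshev.U ℝ n).eval (Real.cos δ) : ℝ) : ℂ) =
      ∑ k ∈ Finset.range (n + 1), Complex.exp (Complex.I * ((n - 2 * k) * δ)) := by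
  induction n using Nat.twoStepInduction with
  | zero => simp
  | one =>
    simp [Finset.sum_range_succ, Complex.cos]
    ring_nf
  | more n h0 h1 =>
    have := Chebyshev.U_add_two ℂ n
    push_cast at h0 h1 ⊢
    rw [this]
    simp only [eval_sub, eval_mul, eval_X, eval_ofNat]
    rw [h1, h0, Complex.cos, mul_div_cancel₀ _ (two_ne_zero), add_mul, Finset.mul_sum,
      Finset.mul_sum, Finset.sum_range_succ (n := n + 1 + 1), Finset.sum_range_succ
      (fun k : ℕ => Complex.exp (-(δ : ℂ) * Complex.I) * _)]
    have e1 : ∀ k : ℕ, Complex.exp ((δ : ℂ) * Complex.I) *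
        Complex.exp (Complex.I * (((n : ℂ) + 1 - 2 * k) * δ)) =
        Complex.exp (Complex.I * (((n : ℂ) + 2 - 2 * k) * δ)) := by
      intro k; rw [← Complex.exp_add]; congr 1; ring
    have e2 : ∀ k : ℕ, Complex.exp (-(δ : ℂ) * Complex.I) *
        Complex.exp (Complex.I * (((n : ℂ) + 1 - 2 * k) * δ)) =
        Complex.exp (Complex.I * (((n : ℂ) - 2 * k) * δ)) := by
      intro k; rw [← Complex.exp_add]; congr 1; ring
    simp only [e1, e2]
    have e3 : Complex.exp (Complex.I * (((n : ℂ) - 2 * (n + 1 : ℕ)) * δ)) =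
      Complex.exp (Complex.I * (((n : ℂ) + 2 - 2 * (n + 1 + 1 : ℕ)) * δ)) := by
      congr 1; push_cast; ring
    rw [e3]
    ring

theorem integral_exp_int_mul (m : ℤ) :
    ∫ θ in (0 : ℝ)..(2 * Real.pi), Complex.exp (Complex.I * (m * θ)) =
      if m = 0 then 2 * (Real.pi : ℂ) else 0 := by
  split_ifs with h
  · simp [h]
  · have hm : Complex.I * m ≠ 0 := mul_ne_zero Complex.I_ne_zero (by exact_mod_cast h)
    simp only [← mul_assoc]
    rw [integral_exp_mul_complex hm]
    have : Complex.exp (Complex.I * m * ((2 * Real.pi : ℝ) : ℂ)) = 1 := by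
      rw [Complex.exp_eq_one_iff]
      exact ⟨m, by push_cast; ring⟩
    rw [this]
    simp

/-- By orthogonality of exponentials, U_n(cos(θ - φ)) is 2π times the reproducing kernel of
`trigSpan n`. -/
theorem integral_mul_chebyshev_cos {n : ℕ} {f : ℝ → ℂ} (hf : f ∈ trigSpan n) (φ : ℝ) :
    ∫ θ in (0 : ℝ)..(2 * Real.pi),
      f θ * (((Chebyshev.U ℝ n).eval (Real.cos (θ - φ)) : ℝ) : ℂ) = 2 * Real.pi * f φ := by
  have hc : Continuous fun θ : ℝ => (((Chebyshev.U ℝ n).eval (Real.cos (θ - φ)) : ℝ) : ℂ) := by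
    fun_prop
  refine Submodule.span_induction (p := fun f _ => ∫ θ in (0 : ℝ)..(2 * Real.pi),
      f θ * (((Chebyshev.U ℝ n).eval (Real.cos (θ - φ)) : ℝ) : ℂ) = 2 * Real.pi * f φ)
      ?_ ?_ ?_ ?_ hf
  · rintro _ ⟨j, hj, rfl⟩
    have e : ∀ θ : ℝ, Complex.exp (Complex.I * ((n - 2 * j) * θ)) *
        (((Chebyshev.U ℝ n).eval (Real.cos (θ - φ)) : ℝ) : ℂ) =
        ∑ k ∈ Finset.range (n + 1), Complex.exp (-(Complex.I * ((n - 2 * (n - k : ℕ)) * φ)) ) *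
          Complex.exp (Complex.I * (((2 * (k : ℤ) - 2 * j : ℤ) : ℂ) * θ)) := by
      intro θ
      rw [chebyshev_cos_eq_sum, ← Finset.sum_range_reflect, Finset.mul_sum]
      refine Finset.sum_congr rfl fun k hk => ?_
      have hk' : k ≤ n := Nat.lt_succ_iff.1 (Finset.mem_range.1 hk)
      rw [← Complex.exp_add, ← Complex.exp_add]
      congr 1
      have : n + 1 - 1 - k = n - k := by omega
      rw [this, Nat.cast_sub hk']
      push_cast
      ring
    simp only [e]
    rw [intervalIntegral.integral_finsetSum
      (fun k _ => Continuous.intervalIntegrable (by fun_prop) _ _)]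
    simp only [intervalIntegral.integral_const_mul, integral_exp_int_mul]
    rw [Finset.sum_eq_single j]
    · have : n - 2 * ((n - j : ℕ) : ℂ) = -(n - 2 * j) := by
        rw [Nat.cast_sub hj]; ring
      rw [this]
      simp
      ring_nf
    · intro k _ hk
      rw [if_neg (by omega), mul_zero]
    · intro h
      exact absurd (Finset.mem_range.2 (by omega)) h
  · simp
  · intro f g hf hg h1 h2
    have c1 := continuous_of_mem_trigSpan hf
    have c2 := continuous_of_mem_trigSpan hg
    simp only [Pi.add_apply, add_mul]
    refine (intervalIntegral.integral_add ((c1.mul hc).intervalIntegrable _ _)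
      ((c2.mul hc).intervalIntegrable _ _)).trans ?_
    simp only [Pi.mul_apply]
    rw [h1, h2]
    ring
  · intro c f _ h
    simp only [Pi.smul_apply, smul_eq_mul, mul_assoc]
    rw [intervalIntegral.integral_const_mul, h]
    ring

/-- Marr's formula separates the variables into 2/(n + 1) U_n(q) U_n(cos(θ - φ)). With q the offset
of x, the first factor is in `trigSpan n` and the second reproduces its value at φ, with a factor
2π. -/
theorem backproj_chordMean_ridge (n : ℕ) (φ : ℝ) {x : ℂ} (hx : x ∈ Metric.ball (0 : ℂ) 1) :
    backproj (chordMean 0 (ridge n φ)) x = (4 * Real.pi / (n + 1) : ℝ) * ridge n φ x := by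
  unfold backproj
  simp only [fun θ => chordMean_ridge n φ (offsetDomain_ball.mem x hx θ) θ]
  push_cast
  rw [intervalIntegral.integral_const_mul]
  have := integral_mul_chebyshev_cos (chebyshev_offset_mem_trigSpan x n) φ
  push_cast at this
  rw [this, ridge, planeWave]
  push_cast
  have hn : ((n : ℂ) + 1) ≠ 0 := by exact_mod_cast n.succ_ne_zero
  field_simp
  ring

/-! ### Completeness of the ridge functions -/

/-- Orthogonality to all U_n implies orthogonality to all X^k U_n, because X U_n = (U_{n+1} +
U_{n-1})/2. The case n = 0 then gives all monomials. -/
theorem integral_mul_planeWave_eq_zero {F : ℂ → ℂ} (hF : ContinuousOn F (disk 1)) {φ : ℝ}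
    (h : ∀ n, ∫ x in Metric.ball (0 : ℂ) 1, F x * ridge n φ x = 0) (k n : ℕ) :
    ∫ x in Metric.ball (0 : ℂ) 1, F x * planeWave (X ^ k * Chebyshev.U ℝ n) φ x = 0 := by
  have hi : ∀ P : ℝ[X], IntegrableOn (fun x => F x * planeWave P φ x) (Metric.ball 0 1) :=
    fun P => integrableOn_of_continuousOn_disk
      (hF.mul (contDiff_planeWave P φ).continuous.continuousOn)
  induction k generalizing n with
  | zero => simpa [ridge] using h n
  | succ k ih =>
    have key : ∀ x, F x * planeWave (X ^ (k + 1) * Chebyshev.U ℝ n) φ x =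
        (1 / 2 : ℂ) * (F x * planeWave (X ^ k * Chebyshev.U ℝ (n + 1)) φ x +
          F x * planeWave (X ^ k * Chebyshev.U ℝ (n - 1)) φ x) := by
      intro x
      have := congrArg (fun P => P.eval (offset x φ)) (Chebyshev.U_add_one ℝ n)
      simp only [eval_sub, eval_mul, eval_X, eval_ofNat] at this
      simp only [planeWave, eval_mul, eval_pow, eval_X, this, Complex.ofReal_mul,
        Complex.ofReal_pow, Complex.ofReal_sub, Complex.ofReal_ofNat]
      ring
    simp only [key]
    rw [integral_const_mul, integral_add (hi _) (hi _)]
    have h1 : ∫ x in Metric.ball (0 : ℂ) 1,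
        F x * planeWave (X ^ k * Chebyshev.U ℝ (n + 1)) φ x = 0 := by
      exact_mod_cast ih (n + 1)
    have h2 : ∫ x in Metric.ball (0 : ℂ) 1,
        F x * planeWave (X ^ k * Chebyshev.U ℝ (n - 1)) φ x = 0 := by
      -- For n = 0 the lower neighbour is U_{-1} = 0.
      cases n with
      | zero => simp [planeWave]
      | succ m =>
        have := ih m
        have e : (((m + 1 : ℕ) : ℤ) - 1) = m := by push_cast; ring
        rw [e]; exact this
    rw [h1, h2]
    simp

theorem norm_offset_le_one (φ : ℝ) {x : ℂ} (hx : x ∈ disk 1) : |offset x φ| ≤ 1 :=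
  (abs_offset_le x φ).trans (mem_disk.1 hx)

/-- The exponential series may be integrated term by term because offsets on the unit disk are at
most 1 in absolute value; every term is orthogonal to F. -/
theorem integral_mul_exp_offset_eq_zero {F : ℂ → ℂ} (hF : ContinuousOn F (disk 1)) {φ : ℝ}
    (h : ∀ n, ∫ x in Metric.ball (0 : ℂ) 1, F x * ridge n φ x = 0) (t : ℝ) :
    ∫ x in Metric.ball (0 : ℂ) 1, F x * Complex.exp (Complex.I * (t * offset x φ)) = 0 := by
  set G : ℕ → ℂ → ℂ := fun k x =>
    ((Complex.I * t) ^ k / (k.factorial : ℂ)) * (F x * planeWave (X ^ k) φ x) with hG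
  have hi : ∀ k, IntegrableOn (G k) (Metric.ball 0 1) := fun k =>
    (integrableOn_of_continuousOn_disk
      (hF.mul (contDiff_planeWave _ φ).continuous.continuousOn)).const_mul _
  have hz : ∀ k, ∫ x in Metric.ball (0 : ℂ) 1, G k x = 0 := by
    intro k
    have h1 := integral_mul_planeWave_eq_zero hF h k 0
    simp only [Nat.cast_zero, Chebyshev.U_zero, mul_one] at h1
    simp only [hG]
    rw [integral_const_mul, h1, mul_zero]
  have hs : Summable fun k => ∫ x in Metric.ball (0 : ℂ) 1, ‖G k x‖ := by
    refine Summable.of_nonneg_of_le (fun k => integral_nonneg fun x => norm_nonneg _)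
      (fun k => ?_) ((Real.summable_pow_div_factorial |t|).mul_right
        (∫ x in Metric.ball (0 : ℂ) 1, ‖F x‖))
    rw [← integral_const_mul]
    refine setIntegral_mono_on (hi k).norm
      ((integrableOn_of_continuousOn_disk hF).norm.const_mul _) measurableSet_ball fun x hx => ?_
    have hx' := norm_offset_le_one φ (Metric.ball_subset_closedBall hx : x ∈ disk 1)
    have h1 : ‖planeWave (X ^ k) φ x‖ ≤ 1 := by
      simp only [planeWave, eval_pow, eval_X, Complex.norm_real, norm_pow, Real.norm_eq_abs]
      exact pow_le_one₀ (abs_nonneg _) hx'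
    simp only [hG, norm_mul, norm_div, norm_pow, Complex.norm_I, one_mul, Complex.norm_real,
      Real.norm_eq_abs, Complex.norm_natCast]
    have h2 : 0 ≤ |t| ^ k / (k.factorial : ℝ) := by positivity
    nlinarith [mul_nonneg h2 (norm_nonneg (F x)), norm_nonneg (F x)]
  have h1 := hasSum_integral_of_summable_integral_norm hi hs
  simp only [hz] at h1
  have h2 := h1.unique hasSum_zero
  refine Eq.trans (integral_congr_ae (ae_of_all _ fun x => ?_)) h2
  have h3 := (NormedSpace.expSeries_div_hasSum_exp (𝔸 := ℂ)
    (Complex.I * (t * offset x φ))).mul_left (F x)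
  rw [← Complex.exp_eq_exp_ℂ] at h3
  refine h3.tsum_eq.symm.trans ?_
  congr 1; funext k
  simp only [hG, planeWave, eval_pow, eval_X]
  push_cast
  ring

/-- A function on the disk that is orthogonal to all ridge functions vanishes. -/
theorem eqOn_zero_of_integral_mul_ridge {F : ℂ → ℂ} (hF : ContinuousOn F (disk 1))
    (h : ∀ n φ, ∫ x in Metric.ball (0 : ℂ) 1, F x * ridge n φ x = 0) : EqOn F 0 (disk 1) := by
  set G : ℂ → ℂ := (Metric.ball 0 1).indicator F with hG
  have hGi : Integrable G :=
    (integrable_indicator_iff measurableSet_ball).2 (integrableOn_of_continuousOn_disk hF)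
  have hfour : FourierTransform.fourier G = 0 := by
    funext ξ
    rw [Real.fourier_eq']
    have e : ∀ x, Complex.exp ((↑(-2 * Real.pi * inner ℝ x ξ) * Complex.I)) • G x =
        (Metric.ball 0 1).indicator (fun x => F x * Complex.exp (Complex.I *
          ((-2 * Real.pi * ‖ξ‖ : ℝ) * offset x (ξ.arg - Real.pi / 2)))) x := by
      intro x
      -- The offset from the line perpendicular to ξ is the component of x along ξ; this line has
      -- direction arg ξ - π/2.
      have hin : inner ℝ x ξ = ‖ξ‖ * offset x (ξ.arg - Real.pi / 2) := by
        rw [offset_eq, Real.cos_sub_pi_div_two, Real.sin_sub_pi_div_two]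
        have h1 := Complex.norm_mul_cos_arg ξ
        have h2 := Complex.norm_mul_sin_arg ξ
        rw [Complex.inner]
        simp only [Complex.mul_re, Complex.conj_re, Complex.conj_im]
        linear_combination (-x.re) * h1 - x.im * h2
      rw [hG, hin]
      by_cases hx : x ∈ Metric.ball (0 : ℂ) 1
      · rw [indicator_of_mem hx, indicator_of_mem hx, smul_eq_mul, mul_comm]
        congr 2
        push_cast; ring
      · rw [indicator_of_notMem hx, indicator_of_notMem hx, smul_zero]
    simp only [e]
    rw [integral_indicator measurableSet_ball,
      integral_mul_exp_offset_eq_zero hF (fun n => h n _)]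
    rfl
  -- The extension by zero may jump across the circle, so Fourier inversion is used only at interior
  -- points, where the extension is continuous; the circle follows by closure.
  have hball : EqOn F 0 (Metric.ball 0 1) := by
    intro x hx
    have hc : ContinuousAt G x := by
      have : ContinuousAt F x := hF.continuousAt (disk_mem_nhds (by simpa using hx))
      refine this.congr ?_
      filter_upwards [Metric.isOpen_ball.mem_nhds hx] with y hy
      rw [hG, indicator_of_mem hy]
    have := hGi.fourierInv_fourier_eq (by rw [hfour]; exact integrable_zero _ _ _) hc
    rw [hfour, hG, indicator_of_mem hx] at this
    rw [← this, Real.fourierInv_eq]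
    simp
  have hcl : disk 1 ⊆ closure (Metric.ball (0 : ℂ) 1) := by
    rw [closure_ball _ one_ne_zero]; rfl
  exact hball.of_subset_closure hF continuousOn_const Metric.ball_subset_closedBall hcl

theorem integral_backproj_mul_ridge {u : ℂ → ℂ} (hu : ContinuousOn u (disk 1)) (n : ℕ) (φ : ℝ) :
    ∫ x in Metric.ball (0 : ℂ) 1, backproj (chordMean 0 u) x * (starRingEnd ℂ) (ridge n φ x) =
      (4 * Real.pi / (n + 1) : ℝ) *
        ∫ x in Metric.ball (0 : ℂ) 1, u x * (starRingEnd ℂ) (ridge n φ x) := by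
  rw [integral_backproj_chordMean_symm hu (smoothOnDisk_ridge n φ).continuousOn,
    ← integral_const_mul]
  refine setIntegral_congr_fun measurableSet_ball fun x hx => ?_
  simp only [backproj_chordMean_ridge n φ hx, map_mul, Complex.conj_ofReal]
  ring

/-- The Zernike operator inverts the square of the normal operator of the flat disk. -/
theorem zernike_normal_normal {g : ℂ → ℂ} (hg : SmoothOnDisk 1 g) {x : ℂ} (hx : x ∈ disk 1) :
    zernike (disk 1) (backproj (chordMean 0 (backproj (chordMean 0 g)))) x =
      (4 * Real.pi) ^ 2 * g x := by
  have hU := uniqueDiffOn_disk one_pos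
  have h1 := smoothOnDisk_backproj_chordMean hg
  have h2 := smoothOnDisk_backproj_chordMean h1
  have hz := zernike_contDiffOn hU h2
  have hF : ContinuousOn (fun x => zernike (disk 1)
      (backproj (chordMean 0 (backproj (chordMean 0 g)))) x - (4 * Real.pi) ^ 2 * g x) (disk 1) :=
    hz.continuousOn.sub (ContDiffOn.continuousOn hg |>.const_mul' _)
  -- The identity is verified weakly: the symmetric operators are moved onto each ridge function, an
  -- eigenfunction of both.
  refine sub_eq_zero.1 (eqOn_zero_of_integral_mul_ridge hF (fun n φ => ?_) hx)
  have hr := smoothOnDisk_ridge n φ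
  have hconj : ∀ x, ridge n φ x = (starRingEnd ℂ) (ridge n φ x) := by
    intro x; rw [ridge, planeWave, Complex.conj_ofReal]
  have i1 := integrableOn_of_continuousOn_disk (hz.continuousOn.mul hr.continuousOn)
  have i2 := integrableOn_of_continuousOn_disk
    ((ContDiffOn.continuousOn hg).mul hr.continuousOn)
  have e : ∀ x, (zernike (disk 1)
      (backproj (chordMean 0 (backproj (chordMean 0 g)))) x - (4 * Real.pi) ^ 2 * g x) *
      ridge n φ x = zernike (disk 1)
      (backproj (chordMean 0 (backproj (chordMean 0 g)))) x * ridge n φ x -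
      (4 * Real.pi) ^ 2 * (g x * ridge n φ x) := fun x => by ring
  simp only [e]
  refine (integral_sub i1 (i2.const_mul _)).trans ?_
  rw [integral_const_mul]
  have e1 : ∫ x in Metric.ball (0 : ℂ) 1, zernike (disk 1)
      (backproj (chordMean 0 (backproj (chordMean 0 g)))) x * ridge n φ x =
      (4 * Real.pi) ^ 2 * ∫ x in Metric.ball (0 : ℂ) 1, g x * ridge n φ x := by
    have e2' : ∫ x in Metric.ball (0 : ℂ) 1, g x * ridge n φ x =
        ∫ x in Metric.ball (0 : ℂ) 1, g x * (starRingEnd ℂ) (ridge n φ x) := by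
      congr 1; funext x; rw [← hconj]
    have e2 : ∫ x in Metric.ball (0 : ℂ) 1, zernike (disk 1)
      (backproj (chordMean 0 (backproj (chordMean 0 g)))) x * ridge n φ x =
      ∫ x in Metric.ball (0 : ℂ) 1, zernike (disk 1)
      (backproj (chordMean 0 (backproj (chordMean 0 g)))) x * (starRingEnd ℂ) (ridge n φ x) := by
      congr 1; funext x; rw [← hconj]
    rw [e2, e2', integral_zernike_conj_symm h2 hr]
    have e3 : ∫ x in Metric.ball (0 : ℂ) 1, backproj (chordMean 0 (backproj (chordMean 0 g))) x *
        (starRingEnd ℂ) (zernike (disk 1) (ridge n φ) x) =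
        ((n : ℂ) + 1) ^ 2 * ∫ x in Metric.ball (0 : ℂ) 1,
          backproj (chordMean 0 (backproj (chordMean 0 g))) x * (starRingEnd ℂ) (ridge n φ x) := by
      rw [← integral_const_mul]
      refine setIntegral_congr_fun measurableSet_ball fun x hx => ?_
      simp only [zernike_ridge hU n φ (Metric.ball_subset_closedBall hx : x ∈ disk 1)]
      simp
      ring
    rw [e3, integral_backproj_mul_ridge h1.continuousOn, integral_backproj_mul_ridge
      (ContDiffOn.continuousOn hg)]
    -- The eigenvalues combine to (n + 1)² (4π/(n + 1))² = (4π)², independent of n.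
    have hn : ((n : ℂ) + 1) ≠ 0 := by exact_mod_cast n.succ_ne_zero
    push_cast
    field_simp
  simp only [Pi.mul_apply]
  rw [e1, sub_self]

/-! ### Straightening the geodesics of `g_κ` -/

/-- The factor `c` that makes `z ↦ c z / (1 - κ|z|²)` map the disk onto the unit disk. -/
def scale (κ R : ℝ) : ℝ := (1 - κ * R ^ 2) / R

/-- The value of `(1 - κ|z|²) / (1 + κ|z|²)` at the boundary. -/
def rimFactor (κ R : ℝ) : ℝ := (1 - κ * R ^ 2) / (1 + κ * R ^ 2)

/-- The curvature `4κ` in the units of the straightened disk. -/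
def relCurv (κ R : ℝ) : ℝ := 4 * κ / scale κ R ^ 2

/-- The weight `w`. -/
def weight (κ : ℝ) (z : ℂ) : ℝ := (1 + κ * ‖z‖ ^ 2) / (1 - κ * ‖z‖ ^ 2)

/-- The diffeomorphism of the disk onto the unit disk that maps geodesics to straight lines. -/
def straighten (κ R : ℝ) (z : ℂ) : ℂ := ((scale κ R / (1 - κ * ‖z‖ ^ 2) : ℝ) : ℂ) * z

/-- The inverse of `straighten`. -/
def unstraighten (κ R : ℝ) (x : ℂ) : ℂ :=
  ((2 / (scale κ R * (1 + √(1 + relCurv κ R * ‖x‖ ^ 2))) : ℝ) : ℂ) * x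

section

variable {κ R : ℝ}

theorem abs_mul_norm_sq_lt (hκ : R ^ 2 * |κ| < 1) {z : ℂ} (hz : z ∈ disk R) :
    |κ * ‖z‖ ^ 2| < 1 := by
  have h := mem_disk.1 hz
  rw [abs_mul, abs_of_nonneg (sq_nonneg ‖z‖)]
  have : ‖z‖ ^ 2 ≤ R ^ 2 := pow_le_pow_left₀ (norm_nonneg z) h 2
  nlinarith [abs_nonneg κ]

theorem one_add_pos (hκ : R ^ 2 * |κ| < 1) {z : ℂ} (hz : z ∈ disk R) : 0 < 1 + κ * ‖z‖ ^ 2 := by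
  linarith [(abs_lt.1 (abs_mul_norm_sq_lt hκ hz)).1]

theorem one_sub_pos (hκ : R ^ 2 * |κ| < 1) {z : ℂ} (hz : z ∈ disk R) : 0 < 1 - κ * ‖z‖ ^ 2 := by
  linarith [(abs_lt.1 (abs_mul_norm_sq_lt hκ hz)).2]

theorem abs_mul_sq_lt (hκ : R ^ 2 * |κ| < 1) : |κ * R ^ 2| < 1 := by
  rwa [abs_mul, abs_of_nonneg (sq_nonneg R), mul_comm]

theorem one_add_rim_pos (hκ : R ^ 2 * |κ| < 1) : 0 < 1 + κ * R ^ 2 := by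
  linarith [(abs_lt.1 (abs_mul_sq_lt hκ)).1]

theorem one_sub_rim_pos (hκ : R ^ 2 * |κ| < 1) : 0 < 1 - κ * R ^ 2 := by
  linarith [(abs_lt.1 (abs_mul_sq_lt hκ)).2]

theorem scale_pos (hR : 0 < R) (hκ : R ^ 2 * |κ| < 1) : 0 < scale κ R :=
  div_pos (one_sub_rim_pos hκ) hR

theorem rimFactor_pos (hκ : R ^ 2 * |κ| < 1) : 0 < rimFactor κ R :=
  div_pos (one_sub_rim_pos hκ) (one_add_rim_pos hκ)

theorem weight_pos (hκ : R ^ 2 * |κ| < 1) {z : ℂ} (hz : z ∈ disk R) : 0 < weight κ z :=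
  div_pos (one_add_pos hκ hz) (one_sub_pos hκ hz)

theorem relCurv_mul_scale_sq (hR : 0 < R) (hκ : R ^ 2 * |κ| < 1) :
    relCurv κ R * scale κ R ^ 2 = 4 * κ := by
  rw [relCurv, div_mul_cancel₀ _ (pow_ne_zero 2 (scale_pos hR hκ).ne')]

/-- Equivalently a²(1 + `relCurv`) = 1: on the rim 1 + `relCurv` |x|² is the squared weight, and a
is the reciprocal of the weight there. -/
theorem rimFactor_sq_mul (hR : 0 < R) (hκ : R ^ 2 * |κ| < 1) :
    rimFactor κ R ^ 2 * relCurv κ R = 1 - rimFactor κ R ^ 2 := by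
  have h1 := (one_add_rim_pos hκ).ne'
  have h2 := (one_sub_rim_pos hκ).ne'
  rw [relCurv, scale, rimFactor]
  field_simp
  ring

theorem one_add_relCurv_pos (hR : 0 < R) (hκ : R ^ 2 * |κ| < 1) {q : ℝ} (hq : q ^ 2 ≤ 1) :
    0 < 1 + relCurv κ R * q ^ 2 := by
  have h := rimFactor_sq_mul hR hκ
  have ha := pow_pos (rimFactor_pos hκ) 2
  have : 0 < rimFactor κ R ^ 2 * (1 + relCurv κ R * q ^ 2) := by
    have e : rimFactor κ R ^ 2 * (1 + relCurv κ R * q ^ 2) =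
      rimFactor κ R ^ 2 * (1 - q ^ 2) + q ^ 2 := by linear_combination q ^ 2 * h
    rw [e]
    rcases hq.eq_or_lt with h1 | h1
    · rw [h1]; norm_num
    · have := mul_pos ha (sub_pos.2 h1)
      positivity
  exact pos_of_mul_pos_right this ha.le

theorem norm_straighten (hR : 0 < R) (hκ : R ^ 2 * |κ| < 1) {z : ℂ} (hz : z ∈ disk R) :
    ‖straighten κ R z‖ = scale κ R * ‖z‖ / (1 - κ * ‖z‖ ^ 2) := by
  have h := div_pos (scale_pos hR hκ) (one_sub_pos hκ hz)
  rw [straighten, norm_mul, Complex.norm_real, Real.norm_of_nonneg h.le]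
  ring

/-- The factorization shows that the closed disk goes to the closed disk and that only the rim
reaches the unit circle. -/
theorem one_sub_norm_straighten (hR : 0 < R) (hκ : R ^ 2 * |κ| < 1) {z : ℂ} (hz : z ∈ disk R) :
    1 - ‖straighten κ R z‖ =
      (R - ‖z‖) * (1 + κ * R * ‖z‖) / (R * (1 - κ * ‖z‖ ^ 2)) := by
  have h := (one_sub_pos hκ hz).ne'
  rw [norm_straighten hR hκ hz, scale]
  field_simp
  ring

theorem one_add_mul_norm_pos (hR : 0 < R) (hκ : R ^ 2 * |κ| < 1) {z : ℂ} (hz : z ∈ disk R) :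
    0 < 1 + κ * R * ‖z‖ := by
  have h := mem_disk.1 hz
  have h1 := (abs_lt.1 (abs_mul_sq_lt hκ)).1
  have h2 := norm_nonneg z
  have h3 : |κ * R * ‖z‖| ≤ R ^ 2 * |κ| := by
    rw [abs_mul, abs_mul, abs_of_pos hR, abs_of_nonneg h2]
    nlinarith [abs_nonneg κ, mul_nonneg (abs_nonneg κ) hR.le]
  linarith [neg_abs_le (κ * R * ‖z‖)]

theorem straighten_mem_disk (hR : 0 < R) (hκ : R ^ 2 * |κ| < 1) {z : ℂ} (hz : z ∈ disk R) :
    straighten κ R z ∈ disk 1 := by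
  have h1 := one_sub_pos hκ hz
  have h2 := one_add_mul_norm_pos hR hκ hz
  have h3 := mem_disk.1 hz
  have := one_sub_norm_straighten hR hκ hz
  rw [mem_disk]
  have : 0 ≤ (R - ‖z‖) * (1 + κ * R * ‖z‖) / (R * (1 - κ * ‖z‖ ^ 2)) := by
    have := sub_nonneg.2 h3
    positivity
  linarith

theorem mem_disk_of_mem_ball {z : ℂ} {r : ℝ} (hz : z ∈ Metric.ball (0 : ℂ) r) : z ∈ disk r :=
  Metric.ball_subset_closedBall hz

theorem straighten_mem_ball_iff (hR : 0 < R) (hκ : R ^ 2 * |κ| < 1) {z : ℂ} (hz : z ∈ disk R) :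
    straighten κ R z ∈ Metric.ball (0 : ℂ) 1 ↔ z ∈ Metric.ball (0 : ℂ) R := by
  have h1 := one_sub_pos hκ hz
  have h2 := one_add_mul_norm_pos hR hκ hz
  have := one_sub_norm_straighten hR hκ hz
  rw [mem_ball_zero_iff, mem_ball_zero_iff, ← sub_pos, this,
    div_pos_iff_of_pos_right (by positivity), mul_pos_iff_of_pos_right h2, sub_pos]

/-- Expresses the weight through the straightened point; inverting the straightening therefore needs
one square root, that of 1 + `relCurv` |x|². -/
theorem one_add_relCurv_straighten (hR : 0 < R) (hκ : R ^ 2 * |κ| < 1) {z : ℂ} (hz : z ∈ disk R) :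
    1 + relCurv κ R * ‖straighten κ R z‖ ^ 2 = weight κ z ^ 2 := by
  have h := (one_sub_pos hκ hz).ne'
  have h2 := relCurv_mul_scale_sq hR hκ
  rw [norm_straighten hR hκ hz, weight, div_pow, div_pow, eq_div_iff (pow_ne_zero 2 h), add_mul,
    mul_assoc, div_mul_cancel₀ _ (pow_ne_zero 2 h)]
  linear_combination ‖z‖ ^ 2 * h2

theorem unstraighten_straighten (hR : 0 < R) (hκ : R ^ 2 * |κ| < 1) {z : ℂ} (hz : z ∈ disk R) :
    unstraighten κ R (straighten κ R z) = z := by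
  have h := (one_sub_pos hκ hz).ne'
  have hc := (scale_pos hR hκ).ne'
  rw [unstraighten, one_add_relCurv_straighten hR hκ hz, Real.sqrt_sq (weight_pos hκ hz).le,
    straighten, ← mul_assoc, ← Complex.ofReal_mul]
  have : 2 / (scale κ R * (1 + weight κ z)) * (scale κ R / (1 - κ * ‖z‖ ^ 2)) = 1 := by
    have e : 1 + weight κ z = 2 / (1 - κ * ‖z‖ ^ 2) := by
      rw [weight]; field_simp; ring
    rw [e]
    field_simp
  rw [this]
  simp

theorem norm_sq_le_one_of_mem_disk {x : ℂ} (hx : x ∈ disk 1) : ‖x‖ ^ 2 ≤ 1 :=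
  pow_le_one₀ (norm_nonneg x) (mem_disk.1 hx)

theorem mul_norm_sq_unstraighten (hR : 0 < R) (hκ : R ^ 2 * |κ| < 1) {x : ℂ} (hx : x ∈ disk 1) :
    κ * ‖unstraighten κ R x‖ ^ 2 = (√(1 + relCurv κ R * ‖x‖ ^ 2) - 1) /
      (√(1 + relCurv κ R * ‖x‖ ^ 2) + 1) := by
  have h1 := one_add_relCurv_pos hR hκ (norm_sq_le_one_of_mem_disk hx)
  have h2 := Real.sq_sqrt h1.le
  have h3 := relCurv_mul_scale_sq hR hκ
  have hc := scale_pos hR hκ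
  set k := √(1 + relCurv κ R * ‖x‖ ^ 2) with hk
  have hk0 : 0 ≤ k := Real.sqrt_nonneg _
  rw [unstraighten, ← hk, norm_mul, Complex.norm_real, Real.norm_of_nonneg (by positivity)]
  have h4 : k + 1 ≠ 0 := by positivity
  have h5 : 1 + k ≠ 0 := by positivity
  field_simp
  have e : 4 * κ * ‖x‖ ^ 2 = scale κ R ^ 2 * (k ^ 2 - 1) := by
    rw [h2]; linear_combination (-‖x‖ ^ 2) * h3
  linear_combination (k + 1) * e

theorem straighten_unstraighten (hR : 0 < R) (hκ : R ^ 2 * |κ| < 1) {x : ℂ} (hx : x ∈ disk 1) :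
    straighten κ R (unstraighten κ R x) = x := by
  have hc := scale_pos hR hκ
  rw [straighten, mul_norm_sq_unstraighten hR hκ hx, unstraighten, ← mul_assoc,
    ← Complex.ofReal_mul]
  set k := √(1 + relCurv κ R * ‖x‖ ^ 2) with hk
  have hk0 : 0 ≤ k := Real.sqrt_nonneg _
  have h4 : k + 1 ≠ 0 := by positivity
  have h5 : 1 + k ≠ 0 := by positivity
  have : scale κ R / (1 - (k - 1) / (k + 1)) * (2 / (scale κ R * (1 + k))) = 1 := by
    have e : 1 - (k - 1) / (k + 1) = 2 / (k + 1) := by field_simp; ring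
    rw [e]
    field_simp
    ring
  rw [this]
  simp

theorem unstraighten_mem_disk (hR : 0 < R) (hκ : R ^ 2 * |κ| < 1) {x : ℂ} (hx : x ∈ disk 1) :
    unstraighten κ R x ∈ disk R := by
  have hc := scale_pos hR hκ
  have h1 := mul_norm_sq_unstraighten hR hκ hx
  have h2 := congrArg norm (straighten_unstraighten hR hκ hx)
  set k := √(1 + relCurv κ R * ‖x‖ ^ 2) with hk
  have hk0 : 0 < k := Real.sqrt_pos.2 (one_add_relCurv_pos hR hκ (norm_sq_le_one_of_mem_disk hx))
  set r := ‖unstraighten κ R x‖ with hr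
  have hr0 : 0 ≤ r := norm_nonneg _
  have h3 : |κ * r ^ 2| < 1 := by
    rw [h1, abs_div, abs_of_pos (by positivity : 0 < k + 1), div_lt_one (by positivity), abs_lt]
    constructor <;> linarith
  rw [straighten, norm_mul, Complex.norm_real, ← hr, Real.norm_of_nonneg
    (div_nonneg hc.le (by linarith [(abs_lt.1 h3).2]))] at h2
  have h4 : 0 < 1 - κ * r ^ 2 := by linarith [(abs_lt.1 h3).2]
  have h5 : scale κ R * r ≤ 1 - κ * r ^ 2 := by
    have := mem_disk.1 hx
    rw [← h2, div_mul_eq_mul_div, div_le_one h4] at this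
    exact this
  rw [scale, div_mul_eq_mul_div, div_le_iff₀ hR] at h5
  -- The bound on the straightened norm is this product inequality; the second factor is positive
  -- because (κRr)² = (κR²)(κr²) is a product of numbers of modulus less than 1.
  have h6 : 0 ≤ (R - r) * (1 + κ * R * r) := by nlinarith
  have h7 : 0 < 1 + κ * R * r := by
    have e : (κ * R * r) ^ 2 = (κ * R ^ 2) * (κ * r ^ 2) := by ring
    have h8 : |κ * R * r| < 1 := by
      rw [← sq_lt_one_iff_abs_lt_one, e]
      refine (le_abs_self _).trans_lt ?_
      rw [abs_mul]
      exact mul_lt_one_of_nonneg_of_lt_one_left (abs_nonneg _) (abs_mul_sq_lt hκ) h3.le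
    linarith [(abs_lt.1 h8).1]
  rw [mem_disk]
  exact sub_nonneg.1 (nonneg_of_mul_nonneg_left h6 h7)

theorem unstraighten_mem_ball (hR : 0 < R) (hκ : R ^ 2 * |κ| < 1) {x : ℂ}
    (hx : x ∈ Metric.ball (0 : ℂ) 1) : unstraighten κ R x ∈ Metric.ball (0 : ℂ) R := by
  have hx' := mem_disk_of_mem_ball hx
  rw [← straighten_mem_ball_iff hR hκ (unstraighten_mem_disk hR hκ hx'),
    straighten_unstraighten hR hκ hx']
  exact hx

theorem contDiffOn_straighten (hκ : R ^ 2 * |κ| < 1) :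
    ContDiffOn ℝ ∞ (straighten κ R) (disk R) := by
  have h1 : ContDiffOn ℝ ∞ (fun z : ℂ => scale κ R / (1 - κ * ‖z‖ ^ 2)) (disk R) :=
    contDiffOn_const.div (contDiff_const.sub (contDiff_const.mul (contDiff_norm_sq ℝ))).contDiffOn
      fun z hz => (one_sub_pos hκ hz).ne'
  exact (Complex.ofRealCLM.contDiff.comp_contDiffOn h1).mul contDiffOn_id

theorem contDiffOn_weight (hκ : R ^ 2 * |κ| < 1) : ContDiffOn ℝ ∞ (weight κ) (disk R) :=
  (contDiff_const.add (contDiff_const.mul (contDiff_norm_sq ℝ))).contDiffOn.div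
    (contDiff_const.sub (contDiff_const.mul (contDiff_norm_sq ℝ))).contDiffOn
      fun _ hz => (one_sub_pos hκ hz).ne'

theorem contDiffOn_unstraighten (hR : 0 < R) (hκ : R ^ 2 * |κ| < 1) :
    ContDiffOn ℝ ∞ (unstraighten κ R) (disk 1) := by
  have hc := scale_pos hR hκ
  have h0 : ContDiffOn ℝ ∞ (fun x : ℂ => 1 + relCurv κ R * ‖x‖ ^ 2) (disk 1) :=
    (contDiff_const.add (contDiff_const.mul (contDiff_norm_sq ℝ))).contDiffOn
  have h1 : ContDiffOn ℝ ∞ (fun x : ℂ => √(1 + relCurv κ R * ‖x‖ ^ 2)) (disk 1) :=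
    h0.sqrt fun x hx => (one_add_relCurv_pos hR hκ (norm_sq_le_one_of_mem_disk hx)).ne'
  have h2 : ContDiffOn ℝ ∞ (fun x : ℂ => 2 / (scale κ R * (1 + √(1 + relCurv κ R * ‖x‖ ^ 2))))
      (disk 1) :=
    contDiffOn_const.div (contDiffOn_const.mul (contDiffOn_const.add h1)) fun x _ => by positivity
  exact (Complex.ofRealCLM.contDiff.comp_contDiffOn h2).mul contDiffOn_id

/-! ### Geodesics -/

theorem fderiv_conformal {z : ℂ} (hz : 1 + κ * ‖z‖ ^ 2 ≠ 0) (v : ℂ) :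
    fderiv ℝ (fun y : ℂ => ((1 + κ * ‖y‖ ^ 2) ^ 2)⁻¹) z v =
      -(4 * κ * (z.re * v.re + z.im * v.im)) / (1 + κ * ‖z‖ ^ 2) ^ 3 := by
  have h0 : HasFDerivAt (fun y : ℂ => ‖y‖ ^ 2) (2 • (innerSL ℝ z)) z :=
    (hasStrictFDerivAt_norm_sq z).hasFDerivAt
  have h1 := (h0.const_mul κ).const_add 1
  have h2 := ((hasDerivAt_pow 2 _).comp_hasFDerivAt z h1)
  have h3 : HasFDerivAt (fun y : ℂ => ((1 + κ * ‖y‖ ^ 2) ^ 2)⁻¹) _ z :=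
    (hasDerivAt_inv (pow_ne_zero 2 hz)).comp_hasFDerivAt z h2
  rw [h3.fderiv]
  simp [Complex.inner]
  field_simp
  ring

/-- The metric is conformal, so its Christoffel symbols come from the gradient of log(1 + κ|z|²),
and in complex notation the geodesic equation becomes v' = 2κ z̄ v²/(1 + κ|z|²). -/
theorem geodesicAcc_eq {z : ℂ} (hz : 1 + κ * ‖z‖ ^ 2 ≠ 0) (v : ℂ) :
    geodesicAcc κ z v = 2 * κ * (starRingEnd ℂ) z * v ^ 2 / ((1 + κ * ‖z‖ ^ 2 : ℝ) : ℂ) := by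
  have hm : ∀ y : ℂ, ∀ i j, metric κ y i j =
      ((1 + κ * ‖y‖ ^ 2) ^ 2)⁻¹ * (1 : Matrix (Fin 2) (Fin 2) ℝ) i j := fun y i j => by
    simp [metric]
  have hd : ∀ l i j, dMetric κ l i j z = -(4 * κ * coord l z) / (1 + κ * ‖z‖ ^ 2) ^ 3 *
      (1 : Matrix (Fin 2) (Fin 2) ℝ) i j := by
    intro l i j
    rw [dMetric]
    simp only [hm]
    by_cases hij : i = j
    · subst hij
      simp only [Matrix.one_apply_eq, mul_one]
      rw [fderiv_conformal hz]
      fin_cases l <;> simp [coordVec, coord]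
    · simp [Matrix.one_apply_ne hij]
  have hinv : (metric κ z)⁻¹ = (1 + κ * ‖z‖ ^ 2) ^ 2 • (1 : Matrix (Fin 2) (Fin 2) ℝ) := by
    refine Matrix.inv_eq_right_inv ?_
    rw [metric]
    simp
    rw [smul_smul, mul_inv_cancel₀ (pow_ne_zero 2 hz), one_smul]
  have hzc : ((1 + κ * ‖z‖ ^ 2 : ℝ) : ℂ) ≠ 0 := by exact_mod_cast hz
  have hchr : ∀ k i j, christoffel κ k i j z = -(2 * κ) / (1 + κ * ‖z‖ ^ 2) *
      (coord i z * (1 : Matrix (Fin 2) (Fin 2) ℝ) k j +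
        coord j z * (1 : Matrix (Fin 2) (Fin 2) ℝ) k i -
        coord k z * (1 : Matrix (Fin 2) (Fin 2) ℝ) i j) := by
    intro k i j
    have : ∀ l, ((1 + κ * ‖z‖ ^ 2) ^ 2 • (1 : Matrix (Fin 2) (Fin 2) ℝ)) k l =
        (1 + κ * ‖z‖ ^ 2) ^ 2 * (1 : Matrix (Fin 2) (Fin 2) ℝ) k l := fun l => by simp
    rw [christoffel, hinv]
    simp only [hd, this]
    have e : ∀ l, (1 + κ * ‖z‖ ^ 2) ^ 2 * (1 : Matrix (Fin 2) (Fin 2) ℝ) k l *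
        (-(4 * κ * coord i z) / (1 + κ * ‖z‖ ^ 2) ^ 3 * (1 : Matrix (Fin 2) (Fin 2) ℝ) j l +
          -(4 * κ * coord j z) / (1 + κ * ‖z‖ ^ 2) ^ 3 * (1 : Matrix (Fin 2) (Fin 2) ℝ) i l -
          -(4 * κ * coord l z) / (1 + κ * ‖z‖ ^ 2) ^ 3 * (1 : Matrix (Fin 2) (Fin 2) ℝ) i j) =
        if k = l then -(4 * κ) / (1 + κ * ‖z‖ ^ 2) *
          (coord i z * (1 : Matrix (Fin 2) (Fin 2) ℝ) j k +
          coord j z * (1 : Matrix (Fin 2) (Fin 2) ℝ) i k -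
          coord k z * (1 : Matrix (Fin 2) (Fin 2) ℝ) i j) else 0 := by
      intro l
      split_ifs with h
      · subst h
        rw [Matrix.one_apply_eq]
        field_simp
        ring
      · rw [Matrix.one_apply_ne h]; ring
    simp only [e, Finset.sum_ite_eq, Finset.mem_univ, if_true]
    rw [← Matrix.transpose_one, Matrix.transpose_apply, Matrix.transpose_apply,
      Matrix.transpose_apply, Matrix.transpose_one]
    ring
  rw [eq_div_iff hzc, geodesicAcc]
  simp only [hchr, Fin.sum_univ_two, Matrix.one_apply_eq, Matrix.one_apply_ne zero_ne_one,
    Matrix.one_apply_ne one_ne_zero, mul_zero, mul_one, zero_sub, add_zero, zero_add, sub_zero]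
  simp only [coord, coordVec, Matrix.cons_val_zero, Matrix.cons_val_one]
  generalize 1 + κ * ‖z‖ ^ 2 = E at hz ⊢
  apply Complex.ext
  · simp only [Complex.neg_re, Complex.add_re, Complex.mul_re, Complex.mul_im, Complex.smul_re,
      Complex.smul_im, Complex.neg_im, Complex.add_im, pow_two, Complex.conj_re, Complex.conj_im,
      Complex.ofReal_re, Complex.ofReal_im, Complex.I_re, Complex.I_im, Complex.one_re,
      Complex.one_im, Complex.re_ofNat, Complex.im_ofNat, smul_eq_mul]
    field_simp
    ring
  · simp only [Complex.neg_re, Complex.add_re, Complex.mul_re, Complex.mul_im, Complex.smul_re,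
      Complex.smul_im, Complex.neg_im, Complex.add_im, pow_two, Complex.conj_re, Complex.conj_im,
      Complex.ofReal_re, Complex.ofReal_im, Complex.I_re, Complex.I_im, Complex.one_re,
      Complex.one_im, Complex.re_ofNat, Complex.im_ofNat, smul_eq_mul]
    field_simp
    ring

end

/-! ### Chord coordinates of geodesics -/

/-- The function `cos² α + a² sin² α`. -/
def spread (κ R α : ℝ) : ℝ := Real.cos α ^ 2 + rimFactor κ R ^ 2 * Real.sin α ^ 2

/-- The offset of the straightened geodesic with incidence angle `α`. -/
def chordOffset (κ R α : ℝ) : ℝ := rimFactor κ R * Real.sin α / √(spread κ R α)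

/-- The offset and the direction of the straightened geodesic issued from `p`. -/
def chordOf (κ R : ℝ) (p : ℝ × ℝ) : ℝ × ℝ :=
  (chordOffset κ R p.2, p.1 + Real.pi + Real.arcsin (chordOffset κ R p.2))

/-- The element of the boundary with given straightened geodesic. -/
def bdryOf (κ R : ℝ) (p : ℝ × ℝ) : ℝ × ℝ :=
  (p.2 - Real.pi - Real.arcsin p.1, Real.arctan (p.1 / (rimFactor κ R * √(1 - p.1 ^ 2))))

section

variable {κ R : ℝ}

theorem spread_pos (hκ : R ^ 2 * |κ| < 1) (α : ℝ) : 0 < spread κ R α := by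
  have ha := rimFactor_pos hκ
  have h := Real.sin_sq_add_cos_sq α
  rcases eq_or_ne (Real.sin α) 0 with h0 | h0
  · rw [spread, h0]; rw [h0] at h; nlinarith
  · rw [spread]
    have : 0 < Real.sin α ^ 2 := by positivity
    positivity

theorem one_sub_chordOffset_sq (hκ : R ^ 2 * |κ| < 1) (α : ℝ) :
    1 - chordOffset κ R α ^ 2 = Real.cos α ^ 2 / spread κ R α := by
  have h := spread_pos hκ α
  rw [chordOffset, div_pow, Real.sq_sqrt h.le, eq_div_iff h.ne', sub_mul,
    div_mul_cancel₀ _ h.ne', spread]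
  ring

theorem sqrt_one_sub_chordOffset_sq (hκ : R ^ 2 * |κ| < 1) {α : ℝ}
    (hα : α ∈ Ioo (-(Real.pi / 2)) (Real.pi / 2)) :
    √(1 - chordOffset κ R α ^ 2) = Real.cos α / √(spread κ R α) := by
  rw [one_sub_chordOffset_sq hκ, Real.sqrt_div (sq_nonneg _),
    Real.sqrt_sq (Real.cos_pos_of_mem_Ioo hα).le]

theorem chordOffset_mem (hκ : R ^ 2 * |κ| < 1) {α : ℝ}
    (hα : α ∈ Ioo (-(Real.pi / 2)) (Real.pi / 2)) : chordOffset κ R α ∈ Ioo (-1 : ℝ) 1 := by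
  have h := one_sub_chordOffset_sq hκ α
  have h1 : 0 < Real.cos α ^ 2 / spread κ R α :=
    div_pos (pow_pos (Real.cos_pos_of_mem_Ioo hα) 2) (spread_pos hκ α)
  exact abs_lt.1 ((sq_lt_one_iff_abs_lt_one _).1 (by linarith))

/-- `spread` is 1/(1 + `relCurv` q²) at offset q; in this form it appears in all computations on the
space of chords. -/
theorem spread_eq (hR : 0 < R) (hκ : R ^ 2 * |κ| < 1) (α : ℝ) :
    (1 + relCurv κ R * chordOffset κ R α ^ 2) * spread κ R α = 1 := by
  have h := spread_pos hκ α
  have h1 := rimFactor_sq_mul hR hκ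
  rw [chordOffset, div_pow, Real.sq_sqrt h.le, add_mul, mul_assoc, div_mul_cancel₀ _ h.ne', spread]
  linear_combination Real.sin α ^ 2 * h1 + Real.sin_sq_add_cos_sq α

theorem exp_arcsin {q : ℝ} (hq : q ∈ Icc (-1 : ℝ) 1) :
    Complex.exp (Complex.I * Real.arcsin q) = √(1 - q ^ 2) + Complex.I * q := by
  rw [mul_comm, Complex.exp_mul_I, ← Complex.ofReal_cos, ← Complex.ofReal_sin,
    Real.sin_arcsin hq.1 hq.2, Real.cos_arcsin]
  ring

/-- The right side is the initial velocity seen in the straightened disk, up to a positive factor;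
this identity is the origin of the formulas for `chordOffset` and `spread`. -/
theorem sqrt_spread_mul_exp (hκ : R ^ 2 * |κ| < 1) {p : ℝ × ℝ} (hp : p ∈ strip) :
    √(spread κ R p.2) * Complex.exp (Complex.I * (chordOf κ R p).2) =
      -Complex.exp (Complex.I * p.1) *
        (Real.cos p.2 + Complex.I * (rimFactor κ R * Real.sin p.2)) := by
  have hs := Real.sqrt_pos.2 (spread_pos hκ p.2)
  have hs' : ((√(spread κ R p.2) : ℝ) : ℂ) ≠ 0 := by exact_mod_cast hs.ne'
  have e : Complex.I * ((chordOf κ R p).2 : ℝ) = Complex.I * p.1 + Real.pi * Complex.I +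
      Complex.I * Real.arcsin (chordOffset κ R p.2) := by
    simp only [chordOf]; push_cast; ring
  rw [e, Complex.exp_add, Complex.exp_add, Complex.exp_pi_mul_I,
    exp_arcsin (Ioo_subset_Icc_self (chordOffset_mem hκ hp.2)),
    sqrt_one_sub_chordOffset_sq hκ hp.2, chordOffset]
  push_cast
  field_simp

theorem bdryOf_chordOf (hκ : R ^ 2 * |κ| < 1) {p : ℝ × ℝ} (hp : p ∈ strip) :
    bdryOf κ R (chordOf κ R p) = p := by
  have hs := Real.sqrt_pos.2 (spread_pos hκ p.2)
  have ha := rimFactor_pos hκ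
  have hc := Real.cos_pos_of_mem_Ioo hp.2
  have e : chordOffset κ R p.2 / (rimFactor κ R * √(1 - chordOffset κ R p.2 ^ 2)) =
      Real.tan p.2 := by
    rw [sqrt_one_sub_chordOffset_sq hκ hp.2, chordOffset, Real.tan_eq_sin_div_cos]
    field_simp
  ext
  · simp only [bdryOf, chordOf]
    ring
  · simp only [bdryOf, chordOf]
    rw [e, Real.arctan_tan hp.2.1 hp.2.2]

theorem bdryOf_mem_strip (κ R : ℝ) (p : ℝ × ℝ) : bdryOf κ R p ∈ strip :=
  ⟨mem_univ _, Real.arctan_mem_Ioo _⟩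

theorem sq_lt_one_of_mem {q : ℝ} (hq : q ∈ Ioo (-1 : ℝ) 1) : q ^ 2 < 1 := by
  nlinarith [hq.1, hq.2]

theorem cos_sin_bdryOf (hR : 0 < R) (hκ : R ^ 2 * |κ| < 1) {q : ℝ} (hq : q ∈ Ioo (-1 : ℝ) 1)
    (θ : ℝ) :
    Real.cos (bdryOf κ R (q, θ)).2 = √(1 - q ^ 2) / √(1 + relCurv κ R * q ^ 2) ∧
    Real.sin (bdryOf κ R (q, θ)).2 = q / (rimFactor κ R * √(1 + relCurv κ R * q ^ 2)) := by
  have ha := rimFactor_pos hκ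
  have hp := sqrt_one_sub_sq_pos hq
  have hl := one_add_relCurv_pos hR hκ (sq_lt_one_of_mem hq).le
  have hp2 := Real.sq_sqrt (sub_nonneg.2 (sq_lt_one_of_mem hq).le)
  set P := √(1 - q ^ 2) with hP
  set l := √(1 + relCurv κ R * q ^ 2) with hldef
  have hl2 : l ^ 2 = 1 + relCurv κ R * q ^ 2 := Real.sq_sqrt hl.le
  have hl0 : 0 < l := Real.sqrt_pos.2 hl
  have h1 := rimFactor_sq_mul hR hκ
  have e : √(1 + (q / (rimFactor κ R * P)) ^ 2) = l / P := by
    rw [Real.sqrt_eq_iff_mul_self_eq (by positivity) (by positivity)]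
    field_simp
    rw [hl2, hp2]
    linear_combination (-q ^ 2) * h1
  simp only [bdryOf]
  rw [Real.cos_arctan, Real.sin_arctan, e]
  constructor
  · field_simp
  · rw [← hP]
    field_simp

theorem spread_bdryOf (hR : 0 < R) (hκ : R ^ 2 * |κ| < 1) {q : ℝ} (hq : q ∈ Ioo (-1 : ℝ) 1)
    (θ : ℝ) : spread κ R (bdryOf κ R (q, θ)).2 = 1 / (1 + relCurv κ R * q ^ 2) := by
  have ha := rimFactor_pos hκ
  have hl := one_add_relCurv_pos hR hκ (sq_lt_one_of_mem hq).le
  obtain ⟨h1, h2⟩ := cos_sin_bdryOf hR hκ hq θ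
  rw [spread, h1, h2, div_pow, div_pow, mul_pow, Real.sq_sqrt hl.le,
    Real.sq_sqrt (sub_nonneg.2 (sq_lt_one_of_mem hq).le)]
  field_simp
  ring

theorem chordOf_bdryOf (hR : 0 < R) (hκ : R ^ 2 * |κ| < 1) {q : ℝ} (hq : q ∈ Ioo (-1 : ℝ) 1)
    (θ : ℝ) : chordOf κ R (bdryOf κ R (q, θ)) = (q, θ) := by
  have ha := rimFactor_pos hκ
  have hl := one_add_relCurv_pos hR hκ (sq_lt_one_of_mem hq).le
  have hl' := Real.sqrt_pos.2 hl
  have h : chordOffset κ R (bdryOf κ R (q, θ)).2 = q := by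
    rw [chordOffset, spread_bdryOf hR hκ hq, (cos_sin_bdryOf hR hκ hq θ).2,
      Real.sqrt_div zero_le_one, Real.sqrt_one]
    generalize √(1 + relCurv κ R * q ^ 2) = l at hl' ⊢
    field_simp
  ext
  · exact h
  · simp only [chordOf, h]
    simp only [bdryOf]
    ring

/-! ### The straightened geodesics are chords -/

theorem straighten_eq (κ R : ℝ) (z : ℂ) :
    straighten κ R z = scale κ R * z / (1 - κ * (z * (starRingEnd ℂ) z)) := by
  rw [straighten, Complex.mul_conj']
  push_cast
  ring

theorem IsExitGeodesic.mem_disk {p : ℝ × ℝ} {τ : ℝ} {γ V : ℝ → ℂ} (hR : 0 < R)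
    (h : IsExitGeodesic κ R p τ γ V) {t : ℝ} (ht : t ∈ Icc 0 τ) : γ t ∈ disk R := by
  rw [GeodesicDisk.mem_disk]
  rcases ht.1.eq_or_lt with h0 | h0
  · rw [← h0, h.init_position, bdryPoint, norm_mul, mul_comm Complex.I, Complex.norm_exp_ofReal_mul_I]
    simp [abs_of_pos hR]
  rcases ht.2.eq_or_lt with h1 | h1
  · rw [h1, h.exit]
  · exact (h.interior t ⟨h0, h1⟩).le

theorem HasDerivWithinAt.conj {f : ℝ → ℂ} {f' : ℂ} {s : Set ℝ} {t : ℝ}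
    (h : HasDerivWithinAt f f' s t) :
    HasDerivWithinAt (fun t => (starRingEnd ℂ) (f t)) ((starRingEnd ℂ) f') s t := by
  have := (Complex.conjCLE.toContinuousLinearMap.hasFDerivAt
    (x := f t)).comp_hasDerivWithinAt t h
  exact this

theorem eq_of_hasDerivWithinAt_zero {E : Type*} [NormedAddCommGroup E] [NormedSpace ℝ E]
    {f : ℝ → E} {τ : ℝ} (h : ∀ t ∈ Icc 0 τ, HasDerivWithinAt f 0 (Icc 0 τ) t) :
    ∀ t ∈ Icc 0 τ, f t = f 0 :=
  constant_of_has_deriv_right_zero (fun t ht => (h t ht).continuousWithinAt) fun t ht =>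
    ((h t (Ico_subset_Icc_self ht)).mono (Icc_subset_Icc_left ht.1)).mono_of_mem_nhdsWithin
      (Icc_mem_nhdsGE ht.2)

/-- The quantity (V + κγ²V̄)/(1 + κ|γ|²)² is a first integral: its derivative vanishes by the
geodesic equation. Its initial value is the right side without the last factor. -/
theorem IsExitGeodesic.velocity_eq {p : ℝ × ℝ} {τ : ℝ} {γ V : ℝ → ℂ} (hR : 0 < R)
    (hκ : R ^ 2 * |κ| < 1) (hp : p ∈ strip) (h : IsExitGeodesic κ R p τ γ V) {t : ℝ}
    (ht : t ∈ Icc 0 τ) :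
    V t + κ * γ t ^ 2 * (starRingEnd ℂ) (V t) =
      √(spread κ R p.2) * Complex.exp (Complex.I * (chordOf κ R p).2) *
        (1 + κ * (γ t * (starRingEnd ℂ) (γ t))) ^ 2 := by
  have hE : ∀ t ∈ Icc 0 τ, (1 + κ * (γ t * (starRingEnd ℂ) (γ t)) : ℂ) ≠ 0 := by
    intro t ht
    rw [Complex.mul_conj']
    exact_mod_cast (one_add_pos hκ (h.mem_disk hR ht)).ne'
  have hc : ∀ t ∈ Icc 0 τ, HasDerivWithinAt
      (fun t => (V t + κ * γ t ^ 2 * (starRingEnd ℂ) (V t)) /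
        (1 + κ * (γ t * (starRingEnd ℂ) (γ t))) ^ 2) 0 (Icc 0 τ) t := by
    intro t ht
    have h1 := h.position t ht
    have h2 := h.velocity t ht
    have h1' := HasDerivWithinAt.conj h1
    have h2' := HasDerivWithinAt.conj h2
    have hE' := hE t ht
    have hd := (h2.add (((h1.pow 2).const_mul (κ : ℂ)).mul h2')).div
      ((((h1.mul h1').const_mul (κ : ℂ)).const_add 1).pow 2) (pow_ne_zero 2 hE')
    refine HasDerivWithinAt.congr_deriv hd ?_
    have hz : 1 + κ * ‖γ t‖ ^ 2 ≠ 0 := (one_add_pos hκ (h.mem_disk hR ht)).ne'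
    have hacc := geodesicAcc_eq hz (V t)
    have e : ((1 + κ * ‖γ t‖ ^ 2 : ℝ) : ℂ) = 1 + κ * (γ t * (starRingEnd ℂ) (γ t)) := by
      rw [Complex.mul_conj']; push_cast; ring
    rw [e, eq_div_iff hE'] at hacc
    have hacc' := congrArg (starRingEnd ℂ) hacc
    simp only [map_mul, map_pow, map_add, map_one, Complex.conj_conj, Complex.conj_ofReal,
      map_ofNat] at hacc'
    simp only [Pi.mul_apply, Pi.add_apply, Pi.pow_apply]
    rw [div_eq_zero_iff]
    left
    push_cast
    linear_combination (1 + κ * (γ t * (starRingEnd ℂ) (γ t))) * hacc +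
      (1 + κ * (γ t * (starRingEnd ℂ) (γ t))) * κ * γ t ^ 2 * hacc'
  have h0 := eq_of_hasDerivWithinAt_zero hc t ht
  -- At the rim the quotient equals -e^{iβ}(e^{iα} + κR² e^{-iα})/(1 + κR²) = -e^{iβ}(cos α + i a
  -- sin α).
  have hinit : (V 0 + κ * γ 0 ^ 2 * (starRingEnd ℂ) (V 0)) /
        (1 + κ * (γ 0 * (starRingEnd ℂ) (γ 0))) ^ 2 =
      √(spread κ R p.2) * Complex.exp (Complex.I * (chordOf κ R p).2) := by
    have hE0 := hE 0 (left_mem_Icc.2 h.pos.le)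
    rw [sqrt_spread_mul_exp hκ hp, div_eq_iff (pow_ne_zero 2 hE0), h.init_position,
      h.init_velocity, bdryPoint, bdryVector]
    have e1 : Complex.exp (Complex.I * ((p.1 + Real.pi + p.2 : ℝ) : ℂ)) =
        -Complex.exp (Complex.I * p.1) * (Real.cos p.2 + Complex.I * Real.sin p.2) := by
      have : Complex.I * ((p.1 + Real.pi + p.2 : ℝ) : ℂ) =
        Complex.I * p.1 + Real.pi * Complex.I + p.2 * Complex.I := by push_cast; ring
      rw [this, Complex.exp_add, Complex.exp_add, Complex.exp_pi_mul_I, Complex.exp_mul_I,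
        Complex.ofReal_cos, Complex.ofReal_sin]
      ring
    have e2 : Complex.exp (Complex.I * p.1) * (starRingEnd ℂ) (Complex.exp (Complex.I * p.1)) =
        1 := by
      rw [Complex.mul_conj', mul_comm, Complex.norm_exp_ofReal_mul_I]; simp
    have e3 : (1 + κ * R ^ 2 : ℂ) ≠ 0 := by exact_mod_cast (one_add_rim_pos hκ).ne'
    rw [e1, rimFactor]
    generalize Complex.exp (Complex.I * p.1) = u at e2 ⊢
    simp only [map_mul, map_neg, map_add, Complex.conj_ofReal, Complex.conj_I]
    generalize (starRingEnd ℂ) u = v at e2 ⊢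
    have e4 : (1 + κ * (R * u * (R * v)) : ℂ) = 1 + κ * R ^ 2 := by
      linear_combination κ * R ^ 2 * e2
    rw [e4]
    push_cast
    field_simp
    linear_combination (-(κ : ℂ) * R ^ 2 * u *
      (Complex.cos p.2 - Complex.I * Complex.sin p.2)) * e2
  rw [← hinit, ← h0, div_mul_cancel₀ _ (pow_ne_zero 2 (hE t ht))]

/-- The derivative of z/(1 - κ z z̄) along V is (V + κz²V̄)/(1 - κ|z|²)², whose numerator is
governed by the first integral. Hence the direction is constant: the image is a straight line. -/
theorem IsExitGeodesic.hasDerivWithinAt_straighten {p : ℝ × ℝ} {τ : ℝ} {γ V : ℝ → ℂ} (hR : 0 < R)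
    (hκ : R ^ 2 * |κ| < 1) (hp : p ∈ strip) (h : IsExitGeodesic κ R p τ γ V) {t : ℝ}
    (ht : t ∈ Icc 0 τ) :
    HasDerivWithinAt (fun t => straighten κ R (γ t))
      ((scale κ R * √(spread κ R p.2) * weight κ (γ t) ^ 2 : ℝ) *
        Complex.exp (Complex.I * (chordOf κ R p).2)) (Icc 0 τ) t := by
  have hz := h.mem_disk hR ht
  have h1 := h.position t ht
  have h1' := HasDerivWithinAt.conj h1
  have e : (κ * ‖γ t‖ ^ 2 : ℂ) = κ * (γ t * (starRingEnd ℂ) (γ t)) := by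
    rw [Complex.mul_conj']
  have hE : (1 - κ * (γ t * (starRingEnd ℂ) (γ t)) : ℂ) ≠ 0 := by
    rw [← e]
    exact_mod_cast (one_sub_pos hκ hz).ne'
  have hd := (h1.const_mul (scale κ R : ℂ)).div
    (((h1.mul h1').const_mul (κ : ℂ)).const_sub 1) hE
  have hfun : (fun t => straighten κ R (γ t)) = fun t => scale κ R * γ t /
      (1 - κ * (γ t * (starRingEnd ℂ) (γ t))) := by
    funext t; rw [straighten_eq]
  rw [hfun]
  refine HasDerivWithinAt.congr_deriv hd ?_
  have hv := h.velocity_eq hR hκ hp ht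
  have hw : (weight κ (γ t) : ℂ) = (1 + κ * (γ t * (starRingEnd ℂ) (γ t))) /
      (1 - κ * (γ t * (starRingEnd ℂ) (γ t))) := by
    rw [weight, ← e]; push_cast; rfl
  push_cast
  rw [hw]
  simp only [Pi.mul_apply]
  rw [div_pow, mul_div_assoc', div_mul_eq_mul_div, div_left_inj' (pow_ne_zero 2 hE)]
  linear_combination (scale κ R : ℂ) * hv

/-- The straightened geodesic as a function of a chord parameter. -/
theorem IsExitGeodesic.exists_chord {p : ℝ × ℝ} {τ : ℝ} {γ V : ℝ → ℂ} (hR : 0 < R)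
    (hκ : R ^ 2 * |κ| < 1) (hp : p ∈ strip) (h : IsExitGeodesic κ R p τ γ V) :
    ∃ S : ℝ → ℝ, S 0 = -1 ∧ S τ = 1 ∧
      (∀ t ∈ Icc 0 τ, straighten κ R (γ t) = chordPoint (chordOf κ R p) (S t)) ∧
      (∀ t ∈ Icc 0 τ, HasDerivWithinAt S (scale κ R * √(spread κ R p.2) * weight κ (γ t) ^ 2 /
        √(1 - chordOffset κ R p.2 ^ 2)) (Icc 0 τ) t) := by
  set θ := (chordOf κ R p).2 with hθ
  set q := chordOffset κ R p.2 with hq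
  set P := √(1 - q ^ 2) with hP
  have hqm := chordOffset_mem hκ hp.2
  have hP0 : 0 < P := sqrt_one_sub_sq_pos hqm
  have hP2 : P ^ 2 = 1 - q ^ 2 := Real.sq_sqrt (sub_nonneg.2 (sq_lt_one_of_mem hqm).le)
  have hsp := Real.sqrt_pos.2 (spread_pos (R := R) hκ p.2)
  have hc := scale_pos hR hκ
  -- Turning the line parallel to the real axis: the imaginary part is then the constant offset, and
  -- the real part divided by the half-length is the chord parameter.
  set Y : ℝ → ℂ := fun t => Complex.exp (-(Complex.I * θ)) * straighten κ R (γ t) with hY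
  have hexp : Complex.exp (-(Complex.I * θ)) * Complex.exp (Complex.I * θ) = 1 := by
    rw [← Complex.exp_add]; simp
  have hYd : ∀ t ∈ Icc 0 τ, HasDerivWithinAt Y
      ((scale κ R * √(spread κ R p.2) * weight κ (γ t) ^ 2 : ℝ) : ℂ) (Icc 0 τ) t := by
    intro t ht
    refine ((h.hasDerivWithinAt_straighten hR hκ hp ht).const_mul _).congr_deriv ?_
    linear_combination ((scale κ R * √(spread κ R p.2) * weight κ (γ t) ^ 2 : ℝ) : ℂ) * hexp
  have hre : ∀ t ∈ Icc 0 τ, HasDerivWithinAt (fun t => (Y t).re)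
      (scale κ R * √(spread κ R p.2) * weight κ (γ t) ^ 2) (Icc 0 τ) t := fun t ht => by
    have := (Complex.reCLM.hasFDerivAt (x := Y t)).comp_hasDerivWithinAt t (hYd t ht)
    exact this
  have him : ∀ t ∈ Icc 0 τ, HasDerivWithinAt (fun t => (Y t).im) 0 (Icc 0 τ) t := fun t ht => by
    have := (Complex.imCLM.hasFDerivAt (x := Y t)).comp_hasDerivWithinAt t (hYd t ht)
    exact this.congr_deriv (Complex.ofReal_im (scale κ R * √(spread κ R p.2) * weight κ (γ t) ^ 2))
  have hY0 : Y 0 = -P + Complex.I * q := by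
    have h1 := sqrt_spread_mul_exp hκ hp
    have hs : straighten κ R (γ 0) = Complex.exp (Complex.I * p.1) := by
      have e2 : Complex.exp (Complex.I * p.1) * (starRingEnd ℂ) (Complex.exp (Complex.I * p.1)) =
          1 := by
        rw [Complex.mul_conj', mul_comm, Complex.norm_exp_ofReal_mul_I]; simp
      have hr : (1 - κ * R ^ 2 : ℂ) ≠ 0 := by exact_mod_cast (one_sub_rim_pos hκ).ne'
      have hR' : (R : ℂ) ≠ 0 := by exact_mod_cast hR.ne'
      rw [straighten_eq, h.init_position, bdryPoint, map_mul, Complex.conj_ofReal]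
      have : (1 - κ * (R * Complex.exp (Complex.I * p.1) *
          (R * (starRingEnd ℂ) (Complex.exp (Complex.I * p.1)))) : ℂ) = 1 - κ * R ^ 2 := by
        linear_combination (-κ * R ^ 2 : ℂ) * e2
      rw [this, scale]
      push_cast
      field_simp
    have h2 : Complex.exp (Complex.I * θ) * (-P + Complex.I * q) =
        Complex.exp (Complex.I * p.1) := by
      have e : Complex.I * (θ : ℂ) = Complex.I * p.1 + Real.pi * Complex.I +
          Complex.I * Real.arcsin q := by
        simp only [hθ, chordOf, hq]; push_cast; ring
      rw [e, Complex.exp_add, Complex.exp_add, Complex.exp_pi_mul_I,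
        exp_arcsin (Ioo_subset_Icc_self hqm), ← hP]
      have hP2' : (P : ℂ) ^ 2 = 1 - q ^ 2 := by exact_mod_cast hP2
      linear_combination Complex.exp (Complex.I * p.1) * hP2' -
        Complex.exp (Complex.I * p.1) * q ^ 2 * Complex.I_sq
    simp only [hY]
    rw [hs, ← h2, ← mul_assoc, hexp, one_mul]
  have himq : ∀ t ∈ Icc 0 τ, (Y t).im = q := by
    intro t ht
    rw [eq_of_hasDerivWithinAt_zero him t ht, hY0]
    simp
  have hchord : ∀ t ∈ Icc 0 τ, straighten κ R (γ t) =
      chordPoint (chordOf κ R p) ((Y t).re / P) := by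
    intro t ht
    have e1 : straighten κ R (γ t) = Complex.exp (Complex.I * θ) * Y t := by
      simp only [hY]
      rw [← mul_assoc, mul_comm (Complex.exp (Complex.I * θ)), hexp, one_mul]
    have e2 : Y t = (Y t).re + Complex.I * q := by
      apply Complex.ext
      · simp
      · simp [himq t ht]
    rw [e1, chordPoint, ← hθ]
    have e3 : (chordOf κ R p).1 = q := rfl
    rw [e3, ← hP, mul_div_cancel₀ _ hP0.ne']
    congr 1
  have hd : ∀ t ∈ Icc 0 τ, HasDerivWithinAt (fun t => (Y t).re / P)
      (scale κ R * √(spread κ R p.2) * weight κ (γ t) ^ 2 / P) (Icc 0 τ) t :=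
    fun t ht => (hre t ht).div_const P
  have h0 : (Y 0).re / P = -1 := by
    rw [hY0]
    simp
    field_simp
  have hmono : StrictMonoOn (fun t => (Y t).re / P) (Icc 0 τ) := by
    refine strictMonoOn_of_deriv_pos (convex_Icc 0 τ)
      (fun t ht => (hd t ht).continuousWithinAt) fun t ht => ?_
    rw [interior_Icc] at ht
    rw [((hd t (Ioo_subset_Icc_self ht)).hasDerivAt (Icc_mem_nhds ht.1 ht.2)).deriv]
    have := weight_pos hκ (h.mem_disk hR (Ioo_subset_Icc_self ht))
    positivity
  have hτ := right_mem_Icc.2 h.pos.le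
  refine ⟨fun t => (Y t).re / P, h0, ?_, hchord, hd⟩
  have hlt := hmono (left_mem_Icc.2 h.pos.le) hτ h.pos
  simp only [h0] at hlt
  -- At the exit time the point is on the circle, which leaves s = ±1; the parameter has increased
  -- from -1, hence s = 1.
  have hn : ‖chordPoint (chordOf κ R p) ((Y τ).re / P)‖ = 1 := by
    rw [← hchord τ hτ]
    have := one_sub_norm_straighten hR hκ (h.mem_disk hR hτ)
    rw [h.exit, sub_self, zero_mul, zero_div] at this
    linarith
  have hn2 := norm_chordPoint_sq (p := chordOf κ R p) (Ioo_subset_Icc_self hqm) ((Y τ).re / P)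
  rw [hn] at hn2
  change (Y τ).re / P = 1
  generalize (Y τ).re / P = s at hlt hn2 ⊢
  have e3 : (chordOf κ R p).1 = q := rfl
  rw [e3] at hn2
  have h3 : (1 - q ^ 2) * (1 - s ^ 2) = 0 := by linarith
  have h4 : 1 - s ^ 2 = 0 := (mul_eq_zero.1 h3).resolve_left (by
    rw [← hP2]; positivity)
  have h5 : (1 - s) * (1 + s) = 0 := by linarith
  rcases mul_eq_zero.1 h5 with h6 | h6 <;> linarith

end

/-! ### Existence of geodesics -/

/-- The Riccati equation `u' = 1 + κ u²` on an interval on which `u` increases from `0` to `U`. -/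
theorem exists_riccati {κ U : ℝ} (hU : 0 < U) (h : 0 < 1 + κ * U ^ 2) :
    ∃ (τ : ℝ) (u : ℝ → ℝ), 0 < τ ∧ (∀ t ∈ Icc 0 τ, HasDerivAt u (1 + κ * u t ^ 2) t) ∧ u 0 = 0 ∧
      u τ = U ∧ ∀ t ∈ Ioo 0 τ, u t ∈ Ioo 0 U := by
  suffices H : ∃ (τ : ℝ) (u : ℝ → ℝ), 0 < τ ∧
      (∀ t ∈ Icc 0 τ, HasDerivAt u (1 + κ * u t ^ 2) t ∧ 0 < 1 + κ * u t ^ 2) ∧ u 0 = 0 ∧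
      u τ = U by
    obtain ⟨τ, u, hτ, hu, h0, h1⟩ := H
    have hm : StrictMonoOn u (Icc 0 τ) := by
      refine strictMonoOn_of_deriv_pos (convex_Icc 0 τ)
        (fun t ht => (hu t ht).1.continuousAt.continuousWithinAt) fun t ht => ?_
      rw [interior_Icc] at ht
      rw [(hu t (Ioo_subset_Icc_self ht)).1.deriv]
      exact (hu t (Ioo_subset_Icc_self ht)).2
    refine ⟨τ, u, hτ, fun t ht => (hu t ht).1, h0, h1, fun t ht => ⟨?_, ?_⟩⟩
    · rw [← h0]
      exact hm (left_mem_Icc.2 hτ.le) (Ioo_subset_Icc_self ht) ht.1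
    · rw [← h1]
      exact hm (Ioo_subset_Icc_self ht) (right_mem_Icc.2 hτ.le) ht.2
  -- The solutions are tanh(kt)/k, t and tan(kt)/k with k = √|κ|. For κ < 0 the hypothesis says kU <
  -- 1, so that U is attained.
  rcases lt_trichotomy κ 0 with hk | hk | hk
  · set k := √(-κ) with hkdef
    have hk0 : 0 < k := Real.sqrt_pos.2 (by linarith)
    have hk2 : k ^ 2 = -κ := Real.sq_sqrt (by linarith)
    have hkU : k * U ∈ Ioo (-1 : ℝ) 1 := by
      refine abs_lt.1 ((sq_lt_one_iff_abs_lt_one _).1 ?_)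
      rw [mul_pow, hk2]; linarith
    have hkU0 : 0 < k * U := by positivity
    refine ⟨Real.artanh (k * U) / k, fun t => Real.tanh (k * t) / k,
      div_pos (Real.artanh_pos ⟨hkU0, hkU.2⟩) hk0, fun t _ => ⟨?_, ?_⟩, by simp, ?_⟩
    · have hc := (Real.cosh_pos (k * t)).ne'
      have hin : HasDerivAt (fun t => k * t) k t := by
        simpa using (hasDerivAt_id t).const_mul k
      have h1 := (hin.sinh.div hin.cosh hc).div_const k
      have e : (fun t => Real.tanh (k * t) / k) =
          fun t => Real.sinh (k * t) / Real.cosh (k * t) / k := by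
        funext t; rw [Real.tanh_eq_sinh_div_cosh]
      rw [e]
      refine h1.congr_deriv ?_
      have e2 : κ = -k ^ 2 := by linarith
      rw [e2]
      field_simp
      ring
    · rw [div_pow, hk2]
      have := Real.tanh_sq_lt_one (k * t)
      have e : κ * (Real.tanh (k * t) ^ 2 / -κ) = -Real.tanh (k * t) ^ 2 := by
        rw [div_neg, mul_neg, mul_div_cancel₀ _ hk.ne]
      rw [e]
      linarith
    · simp only []
      rw [mul_div_cancel₀ _ hk0.ne', Real.tanh_artanh hkU, mul_div_cancel_left₀ _ hk0.ne']
  · subst hk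
    exact ⟨U, fun t => t, hU, fun t _ => ⟨(hasDerivAt_id t).congr_deriv (by simp), by simp⟩, rfl, rfl⟩
  · set k := √κ with hkdef
    have hk0 : 0 < k := Real.sqrt_pos.2 hk
    have hk2 : k ^ 2 = κ := Real.sq_sqrt hk.le
    have hkU0 : 0 < k * U := by positivity
    refine ⟨Real.arctan (k * U) / k, fun t => Real.tan (k * t) / k,
      div_pos (Real.arctan_pos.2 hkU0) hk0, fun t ht => ⟨?_, by positivity⟩, by simp, ?_⟩
    · have hc : Real.cos (k * t) ≠ 0 := by
        refine (Real.cos_pos_of_mem_Ioo ⟨?_, ?_⟩).ne'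
        · have := mul_nonneg hk0.le ht.1
          linarith [Real.pi_pos]
        · have : k * t ≤ Real.arctan (k * U) := by
            have := mul_le_mul_of_nonneg_left ht.2 hk0.le
            rwa [mul_div_cancel₀ _ hk0.ne'] at this
          exact this.trans_lt (Real.arctan_lt_pi_div_two _)
      have hin : HasDerivAt (fun t => k * t) k t := by
        simpa using (hasDerivAt_id t).const_mul k
      have h1 : HasDerivAt (fun t => Real.tan (k * t) / k) _ t :=
        ((Real.hasDerivAt_tan hc).comp t hin).div_const k
      refine h1.congr_deriv ?_
      simp only [← hk2, Real.tan_eq_sin_div_cos]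
      field_simp
      linarith [Real.sin_sq_add_cos_sq (k * t)]
    · simp only []
      rw [mul_div_cancel₀ _ hk0.ne', Real.tan_arctan, mul_div_cancel_left₀ _ hk0.ne']

section

variable {κ R : ℝ}

theorem conj_mul_exp_I (β : ℝ) :
    Complex.exp (Complex.I * β) * (starRingEnd ℂ) (Complex.exp (Complex.I * β)) = 1 := by
  rw [Complex.mul_conj', mul_comm, Complex.norm_exp_ofReal_mul_I]; simp

/-- The geodesic is written down: the Möbius isometry z ↦ (z₀ + z)/(1 - κ z̄₀ z) moves the origin to
the starting point z₀, and the radial geodesic e·u(t) through the origin has u' = 1 + κu². -/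
theorem exists_isExitGeodesic (hR : 0 < R) (hκ : R ^ 2 * |κ| < 1) {p : ℝ × ℝ} (hp : p ∈ strip) :
    ∃ (τ : ℝ) (γ V : ℝ → ℂ), IsExitGeodesic κ R p τ γ V := by
  have hc := Real.cos_pos_of_mem_Ioo hp.2
  have hA := one_add_rim_pos hκ
  have hB := one_sub_rim_pos hκ
  -- The value of u at which the geodesic meets the rim again.
  set U := 2 * R * Real.cos p.2 / (1 - κ * R ^ 2) with hUdef
  have hU : 0 < U := by positivity
  have hUB : U * (1 - κ * R ^ 2) = 2 * R * Real.cos p.2 := div_mul_cancel₀ _ hB.ne'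
  have hκU : 0 < 1 + κ * U ^ 2 := by
    have hcos : Real.cos p.2 ^ 2 ≤ 1 := Real.cos_sq_le_one p.2
    have e : (1 + κ * U ^ 2) * (1 - κ * R ^ 2) ^ 2 =
        (1 + κ * R ^ 2) ^ 2 * Real.cos p.2 ^ 2 +
          (1 - κ * R ^ 2) ^ 2 * (1 - Real.cos p.2 ^ 2) := by
      linear_combination κ * (U * (1 - κ * R ^ 2) + 2 * R * Real.cos p.2) * hUB
    have h1 : 0 < (1 + κ * U ^ 2) * (1 - κ * R ^ 2) ^ 2 := by
      rw [e]
      have := sub_nonneg.2 hcos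
      positivity
    exact pos_of_mul_pos_left h1 (sq_nonneg _)
  obtain ⟨τ, u, hτ, hu, hu0, huτ, hmem⟩ := exists_riccati hU hκU
  have hmem' : ∀ t ∈ Icc 0 τ, u t ∈ Icc 0 U := by
    intro t ht
    rcases ht.1.eq_or_lt with h0 | h0
    · rw [← h0, hu0]; exact left_mem_Icc.2 hU.le
    rcases ht.2.eq_or_lt with h1 | h1
    · rw [h1, huτ]; exact right_mem_Icc.2 hU.le
    · exact Ioo_subset_Icc_self (hmem t ⟨h0, h1⟩)
  set z₀ := bdryPoint R p with hz₀
  set e := Complex.exp (Complex.I * (p.1 + Real.pi + p.2 : ℝ)) with he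
  have hee : e * (starRingEnd ℂ) e = 1 := conj_mul_exp_I _
  have hzz : z₀ * (starRingEnd ℂ) z₀ = R ^ 2 := by
    rw [hz₀, bdryPoint, map_mul, Complex.conj_ofReal]
    linear_combination (R : ℂ) ^ 2 * conj_mul_exp_I p.1
  have hez : (starRingEnd ℂ) z₀ * e + z₀ * (starRingEnd ℂ) e = -2 * R * Real.cos p.2 := by
    have h1 : e = -Complex.exp (Complex.I * p.1) * Complex.exp (p.2 * Complex.I) := by
      have : Complex.I * ((p.1 + Real.pi + p.2 : ℝ) : ℂ) =
        Complex.I * p.1 + Real.pi * Complex.I + p.2 * Complex.I := by push_cast; ring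
      rw [he, this, Complex.exp_add, Complex.exp_add, Complex.exp_pi_mul_I]
      ring
    have h2 : Complex.exp (p.2 * Complex.I) + (starRingEnd ℂ) (Complex.exp (p.2 * Complex.I)) =
        2 * Real.cos p.2 := by
      rw [Complex.add_conj, Complex.exp_ofReal_mul_I_re]; push_cast; ring
    rw [h1, hz₀, bdryPoint]
    simp only [map_mul, map_neg, Complex.conj_ofReal]
    linear_combination (-(R : ℂ) * (Complex.exp (p.2 * Complex.I) +
      (starRingEnd ℂ) (Complex.exp (p.2 * Complex.I)))) * conj_mul_exp_I p.1 - R * h2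
  set n : ℝ → ℂ := fun t => z₀ + e * u t with hn
  set d : ℝ → ℂ := fun t => 1 - κ * (starRingEnd ℂ) z₀ * e * u t with hd
  -- The difference is quadratic in u with roots 0 and U. This one identity gives interior times,
  -- the exit, and the closed bound.
  have hdiff : ∀ t, R ^ 2 * ‖d t‖ ^ 2 - ‖n t‖ ^ 2 =
      (1 + κ * R ^ 2) * (1 - κ * R ^ 2) * (u t * (U - u t)) := by
    intro t
    have : ((R ^ 2 * ‖d t‖ ^ 2 - ‖n t‖ ^ 2 : ℝ) : ℂ) =
        (((1 + κ * R ^ 2) * (1 - κ * R ^ 2) * (u t * (U - u t)) : ℝ) : ℂ) := by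
      push_cast
      rw [← Complex.mul_conj', ← Complex.mul_conj']
      simp only [hd, hn, map_sub, map_add, map_mul, map_one, Complex.conj_ofReal, Complex.conj_conj]
      have hUB' : (U : ℂ) * (1 - κ * R ^ 2) = 2 * R * Real.cos p.2 := by exact_mod_cast hUB
      linear_combination (κ ^ 2 * R ^ 2 * u t ^ 2 * e * (starRingEnd ℂ) e - 1) * hzz +
        (κ ^ 2 * R ^ 4 * u t ^ 2 - u t ^ 2) * hee - (u t + κ * R ^ 2 * u t) * hez -
        (1 + κ * R ^ 2) * u t * hUB'
    exact_mod_cast this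
  have hle : ∀ t ∈ Icc 0 τ, ‖n t‖ ^ 2 ≤ R ^ 2 * ‖d t‖ ^ 2 := by
    intro t ht
    have h1 := hmem' t ht
    have : 0 ≤ (1 + κ * R ^ 2) * (1 - κ * R ^ 2) * (u t * (U - u t)) :=
      mul_nonneg (mul_pos hA hB).le (mul_nonneg h1.1 (sub_nonneg.2 h1.2))
    linarith [hdiff t]
  -- If the denominator vanished, so would the numerator, and eliminating u would give 1 + κR² = 0.
  have hd0 : ∀ t ∈ Icc 0 τ, d t ≠ 0 := by
    intro t ht h0
    have h1 := hle t ht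
    rw [h0, norm_zero] at h1
    have h2 : n t = 0 := by
      have : ‖n t‖ ^ 2 ≤ 0 := by linarith
      simpa using le_antisymm this (sq_nonneg _)
    simp only [hn, hd] at h0 h2
    have h3 : (1 + κ * R ^ 2 : ℂ) = 0 := by
      linear_combination h0 + κ * (starRingEnd ℂ) z₀ * h2 - κ * hzz
    have h4 : (1 + κ * R ^ 2 : ℝ) = 0 := by exact_mod_cast h3
    exact hA.ne' h4
  have hnorm : ∀ t ∈ Icc 0 τ, ‖n t / d t‖ ≤ R := by
    intro t ht
    rw [norm_div, div_le_iff₀ (norm_pos_iff.2 (hd0 t ht))]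
    refine le_of_sq_le_sq ?_ (by positivity)
    rw [mul_pow]; exact hle t ht
  have hud : ∀ t ∈ Icc 0 τ, HasDerivAt (fun t => (u t : ℂ)) ((1 + κ * u t ^ 2 : ℝ) : ℂ) t :=
    fun t ht => (hu t ht).ofReal_comp
  have hnd : ∀ t ∈ Icc 0 τ, HasDerivAt n (e * (1 + κ * u t ^ 2 : ℝ)) t := fun t ht =>
    ((hud t ht).const_mul e).const_add z₀
  have hdd : ∀ t ∈ Icc 0 τ, HasDerivAt d
      (-(κ * (starRingEnd ℂ) z₀ * e * (1 + κ * u t ^ 2 : ℝ))) t := fun t ht =>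
    ((hud t ht).const_mul _).const_sub 1
  refine ⟨τ, fun t => n t / d t, fun t => e * (1 + κ * R ^ 2) * (1 + κ * (u t : ℂ) ^ 2) / d t ^ 2,
    hτ, fun t ht => ?_, fun t ht => ?_, ?_, ?_, fun t ht => ?_, ?_⟩
  · refine (((hnd t ht).div (hdd t ht) (hd0 t ht)).congr_deriv ?_).hasDerivWithinAt
    congr 1
    simp only [hn, hd]
    push_cast
    linear_combination (e * κ * (1 + κ * (u t : ℂ) ^ 2)) * hzz
  · have hz : n t / d t ∈ disk R := mem_disk.2 (hnorm t ht)
    have hE : (1 + κ * ‖n t / d t‖ ^ 2) ≠ 0 := (one_add_pos hκ hz).ne'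
    have hEc : ((1 + κ * ‖n t / d t‖ ^ 2 : ℝ) : ℂ) ≠ 0 := by exact_mod_cast hE
    have hdt := hd0 t ht
    have hdc : (starRingEnd ℂ) (d t) ≠ 0 := (_root_.map_ne_zero _).2 hdt
    have h1 := ((((hud t ht).pow 2).const_mul (κ : ℂ)).const_add 1).const_mul (e * (1 + κ * R ^ 2))
    have h2 := h1.div ((hdd t ht).pow 2) (pow_ne_zero 2 hdt)
    refine (HasDerivAt.congr_deriv h2 ?_).hasDerivWithinAt
    rw [geodesicAcc_eq hE, eq_div_iff hEc]
    -- The transformation law of the conformal factor under the Möbius isometry.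
    have hEval : ((1 + κ * ‖n t / d t‖ ^ 2 : ℝ) : ℂ) * (d t * (starRingEnd ℂ) (d t)) =
        (1 + κ * R ^ 2) * (1 + κ * (u t : ℂ) ^ 2) := by
      push_cast
      rw [← Complex.mul_conj', map_div₀]
      have : (1 + κ * (n t / d t * ((starRingEnd ℂ) (n t) / (starRingEnd ℂ) (d t)))) *
          (d t * (starRingEnd ℂ) (d t)) =
          d t * (starRingEnd ℂ) (d t) + κ * (n t * (starRingEnd ℂ) (n t)) := by
        field_simp
      rw [this]
      simp only [hd, hn, map_sub, map_add, map_mul, map_one, Complex.conj_ofReal, Complex.conj_conj]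
      linear_combination (κ + κ ^ 2 * u t ^ 2 * e * (starRingEnd ℂ) e) * hzz +
        (κ ^ 2 * R ^ 2 * u t ^ 2 + κ * u t ^ 2) * hee
    have hE2 : ((1 + κ * ‖n t / d t‖ ^ 2 : ℝ) : ℂ) =
        (1 + κ * R ^ 2) * (1 + κ * (u t : ℂ) ^ 2) / (d t * (starRingEnd ℂ) (d t)) := by
      rw [eq_div_iff (mul_ne_zero hdt hdc), hEval]
    have hne : (starRingEnd ℂ) (n t) * e = (starRingEnd ℂ) z₀ * e + u t := by
      simp only [hn, map_add, map_mul, Complex.conj_ofReal]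
      linear_combination (u t : ℂ) * hee
    have hdt2 : d t = 1 - κ * (starRingEnd ℂ) z₀ * e * u t := rfl
    rw [hE2, map_div₀]
    simp only [Pi.pow_apply]
    push_cast
    have key : e * (1 + κ * R ^ 2) * (κ * (2 * (u t : ℂ) ^ 1 * (1 + κ * (u t : ℂ) ^ 2))) *
        d t ^ 2 - e * (1 + κ * R ^ 2) * (1 + κ * (u t : ℂ) ^ 2) *
          (2 * d t ^ 1 * -(κ * (starRingEnd ℂ) z₀ * e * (1 + κ * (u t : ℂ) ^ 2))) =
        2 * κ * e ^ 2 * (1 + κ * R ^ 2) * (1 + κ * (u t : ℂ) ^ 2) * d t *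
          (starRingEnd ℂ) (n t) := by
      linear_combination 2 * κ * e * (1 + κ * R ^ 2) * (1 + κ * (u t : ℂ) ^ 2) * d t * u t * hdt2 -
        2 * κ * e * (1 + κ * R ^ 2) * (1 + κ * (u t : ℂ) ^ 2) * d t * hne
    rw [key]
    field_simp
  · simp [hn, hd, hu0, ← hz₀]
  · simp only [hd, hu0]
    rw [bdryVector, ← he]
    push_cast
    simp
    ring
  · have h1 := hmem t ht
    have ht' := Ioo_subset_Icc_self ht
    have h2 : 0 < (1 + κ * R ^ 2) * (1 - κ * R ^ 2) * (u t * (U - u t)) :=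
      mul_pos (mul_pos hA hB) (mul_pos h1.1 (sub_pos.2 h1.2))
    rw [norm_div, div_lt_iff₀ (norm_pos_iff.2 (hd0 t ht'))]
    refine lt_of_pow_lt_pow_left₀ 2 (by positivity) ?_
    rw [mul_pow]; linarith [hdiff t]
  · have hτ' := right_mem_Icc.2 hτ.le
    have h1 := hdiff τ
    rw [huτ, sub_self, mul_zero, mul_zero] at h1
    rw [norm_div, div_eq_iff (norm_pos_iff.2 (hd0 τ hτ')).ne']
    refine (sq_eq_sq₀ (norm_nonneg _) (by positivity)).1 ?_
    rw [mul_pow]; linarith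

end

section

variable {κ R : ℝ}

/-! ### The X-ray transform in chord coordinates -/

theorem mem_Icc_of_chordPoint_mem {p : ℝ × ℝ} (hp : p.1 ∈ Ioo (-1 : ℝ) 1) {s : ℝ}
    (hs : chordPoint p s ∈ disk 1) : s ∈ Icc (-1 : ℝ) 1 := by
  have h := norm_chordPoint_sq (Ioo_subset_Icc_self hp) s
  have h1 := norm_sq_le_one_of_mem_disk hs
  have h2 := sub_pos.2 (sq_lt_one_of_mem hp)
  have h3 : s ^ 2 ≤ 1 := by nlinarith
  exact abs_le.1 ((sq_le_one_iff_abs_le_one _).1 h3)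

theorem continuousOn_chord {g : ℂ → ℂ} (hg : ContinuousOn g (disk 1)) {p : ℝ × ℝ}
    (hp : p ∈ chordSpace) : ContinuousOn (fun s => g (chordPoint p s)) (Icc (-1) 1) :=
  hg.comp (f := fun s => chordPoint p s)
    (continuous_chordPoint.comp (by fun_prop : Continuous fun s : ℝ => (p, s))).continuousOn
    fun _ hs => chordPoint_mem hp hs

/-- The density of the pushforward of a function under the straightening. -/
def flatten (κ R : ℝ) (f : ℂ → ℂ) (x : ℂ) : ℂ :=
  f (unstraighten κ R x) / (weight κ (unstraighten κ R x) : ℂ) ^ 2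

theorem continuousOn_flatten (hR : 0 < R) (hκ : R ^ 2 * |κ| < 1) {f : ℂ → ℂ}
    (hf : ContinuousOn f (disk R)) : ContinuousOn (flatten κ R f) (disk 1) := by
  have hΦ := (contDiffOn_unstraighten hR hκ).continuousOn
  have hm : MapsTo (unstraighten κ R) (disk 1) (disk R) := fun x hx =>
    unstraighten_mem_disk hR hκ hx
  have hw := (contDiffOn_weight (κ := κ) hκ).continuousOn.comp hΦ hm
  refine (hf.comp hΦ hm).div ((Complex.continuous_ofReal.comp_continuousOn hw).pow 2)
    fun x hx => pow_ne_zero 2 ?_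
  exact_mod_cast (weight_pos hκ (hm hx)).ne'

theorem chordOf_mem (hκ : R ^ 2 * |κ| < 1) {p : ℝ × ℝ} (hp : p ∈ strip) :
    (chordOf κ R p).1 ∈ Ioo (-1 : ℝ) 1 := chordOffset_mem hκ hp.2

theorem chordOf_mem_chordSpace (hκ : R ^ 2 * |κ| < 1) {p : ℝ × ℝ} (hp : p ∈ strip) :
    chordOf κ R p ∈ chordSpace := ⟨Ioo_subset_Icc_self (chordOf_mem hκ hp), mem_univ _⟩

/-- Substitution of the chord parameter s = S(t), where S' = c D w²/cos α; the factor w² is absorbed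
in `flatten`. -/
theorem IsExitGeodesic.integral_eq {p : ℝ × ℝ} {τ : ℝ} {γ V : ℝ → ℂ} (hR : 0 < R)
    (hκ : R ^ 2 * |κ| < 1) (hp : p ∈ strip) (h : IsExitGeodesic κ R p τ γ V) {f : ℂ → ℂ}
    (hf : ContinuousOn f (disk R)) :
    ∫ t in (0 : ℝ)..τ, f (γ t) = (Real.cos p.2 / (scale κ R * spread κ R p.2) : ℝ) *
      chordMean 0 (flatten κ R f) (chordOf κ R p) := by
  obtain ⟨S, hS0, hSτ, hS, hSd⟩ := h.exists_chord hR hκ hp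
  have hc := scale_pos hR hκ
  have hsp := spread_pos (R := R) hκ p.2
  have hsq := Real.sqrt_pos.2 hsp
  have hsq2 := Real.sq_sqrt hsp.le
  have hcos := Real.cos_pos_of_mem_Ioo hp.2
  have hg := continuousOn_flatten hR hκ hf
  have hmem : ∀ t ∈ Icc 0 τ, S t ∈ Icc (-1 : ℝ) 1 := fun t ht =>
    mem_Icc_of_chordPoint_mem (chordOf_mem hκ hp)
      (by rw [← hS t ht]; exact straighten_mem_disk hR hκ (h.mem_disk hR ht))
  rw [sqrt_one_sub_chordOffset_sq hκ hp.2] at hSd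
  have hγ : ContinuousOn γ (Icc 0 τ) := fun t ht => (h.position t ht).continuousWithinAt
  have hw : ContinuousOn (fun t => weight κ (γ t)) (Icc 0 τ) :=
    (contDiffOn_weight (κ := κ) hκ).continuousOn.comp hγ fun t ht => h.mem_disk hR ht
  have hu : uIcc 0 τ = Icc 0 τ := uIcc_of_le h.pos.le
  have key := intervalIntegral.integral_deriv_smul_comp'' (a := 0) (b := τ) (f := S)
    (f' := fun t => scale κ R * √(spread κ R p.2) * weight κ (γ t) ^ 2 /
      (Real.cos p.2 / √(spread κ R p.2)))
    (g := fun s => flatten κ R f (chordPoint (chordOf κ R p) s))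
    (by rw [hu]; exact fun t ht => (hSd t ht).continuousWithinAt)
    (fun t ht => by
      rw [min_eq_left h.pos.le, max_eq_right h.pos.le] at ht
      exact ((hSd t (Ioo_subset_Icc_self ht)).hasDerivAt
        (Icc_mem_nhds ht.1 ht.2)).hasDerivWithinAt)
    (by rw [hu]; exact (continuousOn_const.mul (hw.pow 2)).div_const _)
    (by
      rw [hu]
      refine (continuousOn_chord hg (chordOf_mem_chordSpace hκ hp)).mono ?_
      rintro _ ⟨t, ht, rfl⟩
      exact hmem t ht)
  rw [hS0, hSτ] at key
  unfold chordMean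
  simp only [pow_zero, Complex.ofReal_one, one_mul]
  rw [← key, ← intervalIntegral.integral_const_mul]
  refine intervalIntegral.integral_congr fun t ht => ?_
  rw [hu] at ht
  have hz := h.mem_disk hR ht
  have hwp := weight_pos hκ hz
  simp only [Function.comp_apply]
  rw [← hS t ht, flatten, unstraighten_straighten hR hκ hz, Complex.real_smul]
  have hwc : (weight κ (γ t) : ℂ) ≠ 0 := by exact_mod_cast hwp.ne'
  have e : ((Real.cos p.2 / (scale κ R * spread κ R p.2) : ℝ) : ℂ) *
      ((scale κ R * √(spread κ R p.2) * weight κ (γ t) ^ 2 /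
      (Real.cos p.2 / √(spread κ R p.2)) : ℝ) : ℂ) = (weight κ (γ t) : ℂ) ^ 2 := by
    rw [← Complex.ofReal_mul, ← Complex.ofReal_pow]
    congr 1
    nth_rw 1 [← hsq2]
    field_simp
  rw [← mul_assoc, e]
  field_simp

/-- The formula holds for every exit geodesic from p, hence for the chosen one; uniqueness of
geodesics is not needed. -/
theorem xray_eq (hR : 0 < R) (hκ : R ^ 2 * |κ| < 1) {p : ℝ × ℝ} (hp : p ∈ strip) {f : ℂ → ℂ}
    (hf : ContinuousOn f (disk R)) :
    xray κ R f p = (Real.cos p.2 / (scale κ R * spread κ R p.2) : ℝ) *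
      chordMean 0 (flatten κ R f) (chordOf κ R p) := by
  have h : HasExitGeodesic κ R p := by
    obtain ⟨τ, γ, V, h⟩ := exists_isExitGeodesic hR hκ hp
    exact ⟨(τ, γ, V), h⟩
  rw [xray, dif_pos h]
  exact h.choose_spec.integral_eq hR hκ hp hf

/-! ### Footpoints -/

theorem exp_congr {θ θ' : ℝ} (h : Complex.exp (Complex.I * θ) = Complex.exp (Complex.I * θ')) :
    ∃ k : ℤ, θ = θ' + k * (2 * Real.pi) := by
  obtain ⟨k, hk⟩ := Complex.exp_eq_exp_iff_exists_int.1 h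
  refine ⟨k, ?_⟩
  have : Complex.I * (θ : ℂ) = Complex.I * ((θ' + k * (2 * Real.pi) : ℝ) : ℂ) := by
    rw [hk]; push_cast; ring
  exact_mod_cast mul_left_cancel₀ Complex.I_ne_zero this

theorem offset_chordPoint_self (p : ℝ × ℝ) (s : ℝ) : offset (chordPoint p s) p.2 = p.1 := by
  have := offset_chordPoint p.1 p.2 p.2 s
  simpa using this

theorem offset_congr {θ θ' : ℝ} (h : Complex.exp (Complex.I * θ) = Complex.exp (Complex.I * θ'))
    (x : ℂ) : offset x θ = offset x θ' := by
  rw [offset, offset, Complex.exp_neg, Complex.exp_neg, h]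

/-- The first integral determines the direction of the straightened geodesic, and its offset is that
of the image of z. So the chord is known up to 2π in the direction, and `bdryOf` inverts `chordOf`.
-/
theorem IsFootpoint.eq_bdryOf (hR : 0 < R) (hκ : R ^ 2 * |κ| < 1) {z : ℂ} {θ θ' ρ : ℝ}
    (hρ : 0 < ρ)
    (hm : Complex.exp (Complex.I * θ) + κ * z ^ 2 * Complex.exp (-(Complex.I * θ)) =
      ρ * Complex.exp (Complex.I * θ')) {p : ℝ × ℝ} (h : IsFootpoint κ R z θ p) :
    ∃ k : ℤ, p = ((bdryOf κ R (offset (straighten κ R z) θ', θ')).1 + k * (2 * Real.pi),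
      (bdryOf κ R (offset (straighten κ R z) θ', θ')).2) := by
  obtain ⟨hp, τ, γ, V, hg, t, ht, hz, hV⟩ := h
  have hps : p ∈ strip := ⟨mem_univ _, hp.2⟩
  have hzd : z ∈ disk R := hz ▸ hg.mem_disk hR ht
  have hE := one_add_pos hκ hzd
  have hs := Real.sqrt_pos.2 (spread_pos (R := R) hκ p.2)
  have h1 := hg.velocity_eq hR hκ hps ht
  have hconj : (starRingEnd ℂ) (Complex.exp (Complex.I * θ)) =
      Complex.exp (-(Complex.I * θ)) := by
    rw [← Complex.exp_conj]; simp
  rw [hz, hV, map_mul, Complex.conj_ofReal, hconj, Complex.mul_conj'] at h1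
  have hEc : (1 + κ * (‖z‖ : ℂ) ^ 2) ≠ 0 := by exact_mod_cast hE.ne'
  push_cast at h1
  have h2 : (ρ : ℂ) * Complex.exp (Complex.I * θ') = ((√(spread κ R p.2) * (1 + κ * ‖z‖ ^ 2) : ℝ) : ℂ) *
      Complex.exp (Complex.I * (chordOf κ R p).2) := by
    rw [← hm]
    push_cast
    refine mul_left_cancel₀ hEc ?_
    linear_combination h1
  have h3 : ρ = √(spread κ R p.2) * (1 + κ * ‖z‖ ^ 2) := by
    have := congrArg norm h2
    rw [norm_mul, norm_mul, mul_comm Complex.I, mul_comm Complex.I, Complex.norm_exp_ofReal_mul_I,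
      Complex.norm_exp_ofReal_mul_I, Complex.norm_real, Complex.norm_real,
      Real.norm_of_nonneg hρ.le, Real.norm_of_nonneg (by positivity)] at this
    simpa using this
  rw [← h3] at h2
  have h4 := mul_left_cancel₀ (by exact_mod_cast hρ.ne' : (ρ : ℂ) ≠ 0) h2
  obtain ⟨S, _, _, hS, _⟩ := hg.exists_chord hR hκ hps
  have h5 : offset (straighten κ R z) θ' = (chordOf κ R p).1 := by
    rw [offset_congr h4, ← hz, hS t ht, offset_chordPoint_self]
  obtain ⟨k, hk⟩ := exp_congr h4.symm
  refine ⟨k, ?_⟩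
  have h6 := bdryOf_chordOf hκ hps
  rw [h5]
  have e : chordOf κ R p = ((chordOf κ R p).1, θ' + k * (2 * Real.pi)) := by rw [← hk]
  rw [e] at h6
  clear e h5 hk
  generalize (chordOf κ R p).1 = q at h6 ⊢
  refine h6.symm.trans ?_
  simp only [bdryOf, Prod.mk.injEq, and_true]
  ring

/-- A unit vector that is not tangent to the boundary has a footpoint. -/
theorem exists_isFootpoint (hR : 0 < R) (hκ : R ^ 2 * |κ| < 1) {z : ℂ} (hz : z ∈ disk R)
    {θ θ' ρ : ℝ} (hρ : 0 < ρ)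
    (hm : Complex.exp (Complex.I * θ) + κ * z ^ 2 * Complex.exp (-(Complex.I * θ)) =
      ρ * Complex.exp (Complex.I * θ'))
    (hq : offset (straighten κ R z) θ' ∈ Ioo (-1 : ℝ) 1) : ∃ p, IsFootpoint κ R z θ p := by
  set q := offset (straighten κ R z) θ' with hqdef
  set p₀ := bdryOf κ R (q, θ') with hp₀
  -- Normalizing β to [0, 2π) changes the direction of the chord by a multiple of 2π, which leaves
  -- the line unchanged.
  set p : ℝ × ℝ := (toIcoMod Real.two_pi_pos 0 p₀.1, p₀.2) with hpdef
  have hps : p ∈ strip := ⟨mem_univ _, (bdryOf_mem_strip κ R (q, θ')).2⟩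
  have hp : p ∈ Ico 0 (2 * Real.pi) ×ˢ Ioo (-(Real.pi / 2)) (Real.pi / 2) :=
    ⟨by simpa using toIcoMod_mem_Ico Real.two_pi_pos 0 p₀.1, hps.2⟩
  obtain ⟨k, hk⟩ : ∃ k : ℤ, p.1 = p₀.1 - k * (2 * Real.pi) :=
    ⟨toIcoDiv Real.two_pi_pos 0 p₀.1, by
      have := self_sub_toIcoDiv_zsmul Real.two_pi_pos 0 p₀.1
      rw [zsmul_eq_mul] at this
      exact this.symm⟩
  have hchord₀ : chordOf κ R p₀ = (q, θ') := chordOf_bdryOf hR hκ hq θ'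
  have hoff : chordOffset κ R p.2 = q := congrArg Prod.fst hchord₀
  have hdir : (chordOf κ R p).2 = θ' - k * (2 * Real.pi) := by
    have h1 : p₀.1 + Real.pi + Real.arcsin (chordOffset κ R p₀.2) = θ' :=
      congrArg Prod.snd hchord₀
    have h2 : p.2 = p₀.2 := rfl
    simp only [chordOf, hk, h2]
    linarith
  have hexp : Complex.exp (Complex.I * (chordOf κ R p).2) = Complex.exp (Complex.I * θ') := by
    rw [Complex.exp_eq_exp_iff_exists_int]
    refine ⟨-k, ?_⟩
    rw [hdir]
    push_cast
    ring
  obtain ⟨τ, γ, V, hg⟩ := exists_isExitGeodesic hR hκ hps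
  obtain ⟨S, hS0, hSτ, hS, hSd⟩ := hg.exists_chord hR hκ hps
  have hE := one_add_pos hκ hz
  have hx := straighten_mem_disk hR hκ hz
  have hP0 := sqrt_one_sub_sq_pos hq
  set s := (straighten κ R z * Complex.exp (-(Complex.I * θ'))).re / √(1 - q ^ 2) with hs
  have hchord : straighten κ R z = chordPoint (chordOf κ R p) s := by
    have e1 : (chordOf κ R p).1 = q := hoff
    rw [chordPoint, hexp, e1, hs, mul_div_cancel₀ _ hP0.ne']
    have e2 : (((straighten κ R z * Complex.exp (-(Complex.I * θ'))).re : ℝ) : ℂ) +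
        Complex.I * q = straighten κ R z * Complex.exp (-(Complex.I * θ')) := by
      apply Complex.ext
      · simp
      · simp [hqdef, offset]
    rw [e2, mul_comm, mul_assoc, ← Complex.exp_add]
    simp
  have hsm : s ∈ Icc (-1 : ℝ) 1 :=
    mem_Icc_of_chordPoint_mem (chordOf_mem hκ hps) (by rw [← hchord]; exact hx)
  have hcont : ContinuousOn S (Icc 0 τ) := fun t ht => (hSd t ht).continuousWithinAt
  -- The chord parameter runs from -1 to 1, so the geodesic passes through every point of its chord,
  -- in particular through z.
  have hivt := intermediate_value_Icc hg.pos.le hcont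
  rw [hS0, hSτ] at hivt
  obtain ⟨t, ht, hts⟩ := hivt hsm
  have hγd := hg.mem_disk hR ht
  have hγ : γ t = z := by
    rw [← unstraighten_straighten hR hκ hγd, hS t ht, hts, ← hchord,
      unstraighten_straighten hR hκ hz]
  refine ⟨p, hp, τ, γ, V, hg, t, ht, hγ, ?_⟩
  have hv := hg.velocity_eq hR hκ hps ht
  rw [hγ, hexp, Complex.mul_conj'] at hv
  set V₀ : ℂ := (1 + κ * ‖z‖ ^ 2 : ℝ) * Complex.exp (Complex.I * θ) with hV₀
  have hconj : (starRingEnd ℂ) (Complex.exp (Complex.I * θ)) =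
      Complex.exp (-(Complex.I * θ)) := by
    rw [← Complex.exp_conj]; simp
  have hv₀ : V₀ + κ * z ^ 2 * (starRingEnd ℂ) V₀ =
      (1 + κ * ‖z‖ ^ 2 : ℝ) * (ρ * Complex.exp (Complex.I * θ')) := by
    rw [← hm, hV₀, map_mul, Complex.conj_ofReal, hconj]; ring
  -- Directions of the straightened vectors already agree; this matches their lengths. It reduces to
  -- an identity between ρ², the offset and |z|, checked for the vector turned so that θ = 0.
  have hρ2 : ρ = (1 + κ * ‖z‖ ^ 2) * √(spread κ R p.2) := by
    have hsp : spread κ R p.2 * (1 + relCurv κ R * q ^ 2) = 1 := by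
      rw [mul_comm, ← hoff]; exact spread_eq hR hκ p.2
    have hl := one_add_relCurv_pos hR hκ (sq_lt_one_of_mem hq).le
    have hspp := spread_pos (R := R) hκ p.2
    refine (sq_eq_sq₀ hρ.le (by positivity)).1 ?_
    rw [mul_pow, Real.sq_sqrt hspp.le]
    have hB := (one_sub_pos hκ hz).ne'
    have hBc : (1 - κ * ‖z‖ ^ 2 : ℂ) ≠ 0 := by exact_mod_cast hB
    have key : ρ ^ 2 * (1 + relCurv κ R * q ^ 2) = (1 + κ * ‖z‖ ^ 2) ^ 2 := by
      set ζ := z * Complex.exp (-(Complex.I * θ)) with hζ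
      have hζn : ‖ζ‖ = ‖z‖ := by
        rw [hζ, norm_mul, ← mul_neg, mul_comm Complex.I, ← Complex.ofReal_neg,
          Complex.norm_exp_ofReal_mul_I, mul_one]
      have hee : Complex.exp (Complex.I * θ) * Complex.exp (-(Complex.I * θ)) = 1 := by
        rw [← Complex.exp_add]; simp
      have hee' : Complex.exp (Complex.I * θ') * Complex.exp (-(Complex.I * θ')) = 1 := by
        rw [← Complex.exp_add]; simp
      have hm' : ρ * Complex.exp (Complex.I * θ') = Complex.exp (Complex.I * θ) * (1 + κ * ζ ^ 2) := by
        rw [← hm, hζ]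
        linear_combination (-κ * z ^ 2 * Complex.exp (-(Complex.I * θ))) * hee
      have hmc : ρ * Complex.exp (-(Complex.I * θ')) =
          Complex.exp (-(Complex.I * θ)) * (1 + κ * (starRingEnd ℂ) ζ ^ 2) := by
        have := congrArg (starRingEnd ℂ) hm'
        simp only [map_mul, map_add, map_one, map_pow, Complex.conj_ofReal, hconj] at this
        rw [← this, ← Complex.exp_conj]
        simp
      have hρρ : ((ρ ^ 2 : ℝ) : ℂ) = (1 + κ * ζ ^ 2) * (1 + κ * (starRingEnd ℂ) ζ ^ 2) := by
        push_cast
        have : (ρ * Complex.exp (Complex.I * θ')) * (ρ * Complex.exp (-(Complex.I * θ'))) =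
          (ρ : ℂ) ^ 2 := by linear_combination (ρ : ℂ) ^ 2 * hee'
        rw [← this, hm', hmc]
        linear_combination (1 + κ * ζ ^ 2) * (1 + κ * (starRingEnd ℂ) ζ ^ 2) * hee
      have hqρ : ρ * q = scale κ R * ζ.im := by
        have h1 : ((ρ * q : ℝ) : ℂ) = (((scale κ R / (1 - κ * ‖z‖ ^ 2) : ℝ) : ℂ) *
            (ζ * (1 + κ * (starRingEnd ℂ) ζ ^ 2))).im := by
          rw [hqdef, offset, straighten]
          congr 1
          rw [← Complex.im_ofReal_mul]
          congr 1
          rw [hζ]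
          linear_combination ((scale κ R / (1 - κ * ‖z‖ ^ 2) : ℝ) : ℂ) * z * hmc
        have h2 : ζ * (1 + κ * (starRingEnd ℂ) ζ ^ 2) =
            ζ + ((κ * ‖z‖ ^ 2 : ℝ) : ℂ) * (starRingEnd ℂ) ζ := by
          push_cast
          rw [← hζn, ← Complex.mul_conj']
          ring
        rw [h2, Complex.im_ofReal_mul, Complex.add_im, Complex.im_ofReal_mul, Complex.conj_im] at h1
        have h3 : ρ * q = scale κ R / (1 - κ * ‖z‖ ^ 2) * (ζ.im + κ * ‖z‖ ^ 2 * -ζ.im) := by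
          exact_mod_cast h1
        rw [h3]
        field_simp
        ring
      have h4 := relCurv_mul_scale_sq hR hκ
      have h5 : ρ ^ 2 = 1 + 2 * κ * (ζ.re ^ 2 - ζ.im ^ 2) + κ ^ 2 * (‖z‖ ^ 2) ^ 2 := by
        have h6 : ‖z‖ ^ 2 = ζ.re ^ 2 + ζ.im ^ 2 := by
          rw [← hζn, ← Complex.normSq_eq_norm_sq, Complex.normSq_apply]; ring
        have h7 : (starRingEnd ℂ) ζ = ζ.re - ζ.im * Complex.I := by
          apply Complex.ext <;> simp
        have h8 : ζ = ζ.re + ζ.im * Complex.I := (Complex.re_add_im ζ).symm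
        have : ((ρ ^ 2 : ℝ) : ℂ) =
            ((1 + 2 * κ * (ζ.re ^ 2 - ζ.im ^ 2) + κ ^ 2 * (‖z‖ ^ 2) ^ 2 : ℝ) : ℂ) := by
          rw [hρρ, h6, h7]
          nth_rw 1 [h8]
          push_cast
          generalize (ζ.re : ℂ) = a
          generalize (ζ.im : ℂ) = b
          linear_combination (2 * κ * b ^ 2 - 2 * κ ^ 2 * a ^ 2 * b ^ 2 + κ ^ 2 * b ^ 4 *
            (Complex.I ^ 2 - 1)) * Complex.I_sq
        exact_mod_cast this
      have h6 : ‖z‖ ^ 2 = ζ.re ^ 2 + ζ.im ^ 2 := by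
        rw [← hζn, ← Complex.normSq_eq_norm_sq, Complex.normSq_apply]; ring
      linear_combination h5 + relCurv κ R * (ρ * q + scale κ R * ζ.im) * hqρ +
        ζ.im ^ 2 * h4 - 2 * κ * h6
    refine mul_right_cancel₀ hl.ne' ?_
    rw [key, mul_assoc, hsp, mul_one]
  -- The real-linear map W ↦ W + κz²W̄ is injective because |κ||z|² < 1, so equal images force equal
  -- velocities.
  have hW : (V t - V₀) + κ * z ^ 2 * (starRingEnd ℂ) (V t - V₀) = 0 := by
    have h1 : V₀ + κ * z ^ 2 * (starRingEnd ℂ) V₀ = V t + κ * z ^ 2 * (starRingEnd ℂ) (V t) := by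
      rw [hv, hv₀, hρ2]
      push_cast
      ring
    rw [map_sub]
    linear_combination -h1
  have hW0 : ‖V t - V₀‖ = |κ * ‖z‖ ^ 2| * ‖V t - V₀‖ := by
    have h1 : V t - V₀ = -(((κ : ℝ) : ℂ) * z ^ 2 * (starRingEnd ℂ) (V t - V₀)) := by
      linear_combination hW
    conv_lhs => rw [h1]
    rw [norm_neg, norm_mul, norm_mul, Complex.norm_conj, Complex.norm_real, norm_pow, abs_mul,
      Real.norm_eq_abs, abs_of_nonneg (sq_nonneg ‖z‖)]
  have h1 := abs_mul_norm_sq_lt hκ hz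
  have h2 : ‖V t - V₀‖ = 0 := by nlinarith [norm_nonneg (V t - V₀)]
  exact sub_eq_zero.1 (norm_eq_zero.1 h2)

end

/-! ### The change of angles -/

/-- The lift of the map of the circle of directions induced by `diag(1, b)`. -/
def tilt (b φ : ℝ) : ℝ :=
  φ + Real.arctan ((b - 1) * (Real.sin φ * Real.cos φ) / (Real.cos φ ^ 2 + b * Real.sin φ ^ 2))

theorem cos_sq_add_mul_sin_sq_pos {b : ℝ} (hb : 0 < b) (φ : ℝ) :
    0 < Real.cos φ ^ 2 + b * Real.sin φ ^ 2 := by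
  have h := Real.sin_sq_add_cos_sq φ
  rcases eq_or_ne (Real.sin φ) 0 with h0 | h0
  · rw [h0] at h ⊢; nlinarith
  · have : 0 < Real.sin φ ^ 2 := by positivity
    positivity

theorem hasDerivAt_tilt {b : ℝ} (hb : 0 < b) (φ : ℝ) :
    HasDerivAt (tilt b) (b / (Real.cos φ ^ 2 + b ^ 2 * Real.sin φ ^ 2)) φ := by
  have hD := cos_sq_add_mul_sin_sq_pos hb φ
  have hD2 := cos_sq_add_mul_sin_sq_pos (pow_pos hb 2) φ
  have hs := Real.hasDerivAt_sin φ
  have hc := Real.hasDerivAt_cos φ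
  have hsc := Real.sin_sq_add_cos_sq φ
  have h1 := (((hs.mul hc).const_mul (b - 1)).div ((hc.pow 2).add ((hs.pow 2).const_mul b))
    hD.ne').arctan
  have h2 := (hasDerivAt_id φ).add h1
  refine HasDerivAt.congr_deriv h2 ?_
  simp only [Pi.mul_apply, Pi.add_apply, Pi.div_apply, Pi.pow_apply]
  set s := Real.sin φ
  set c := Real.cos φ
  have hsum : (c ^ 2 + b * s ^ 2) ^ 2 + ((b - 1) * (s * c)) ^ 2 = c ^ 2 + b ^ 2 * s ^ 2 := by
    linear_combination (c ^ 2 + b ^ 2 * s ^ 2) * hsc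
  have e : 1 + ((b - 1) * (s * c) / (c ^ 2 + b * s ^ 2)) ^ 2 =
      (c ^ 2 + b ^ 2 * s ^ 2) / (c ^ 2 + b * s ^ 2) ^ 2 := by
    rw [← hsum]; field_simp
  rw [e]
  push_cast
  field_simp
  linear_combination ((b - 1) * (c ^ 2 - b * s ^ 2) + b) * hsc

theorem exp_arctan_div {x y : ℝ} (hx : 0 < x) :
    Complex.exp (Complex.I * Real.arctan (y / x)) * √(x ^ 2 + y ^ 2) = x + Complex.I * y := by
  have h1 : √(1 + (y / x) ^ 2) = √(x ^ 2 + y ^ 2) / x := by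
    rw [← Real.sqrt_sq hx.le, ← Real.sqrt_div (by positivity)]
    congr 1
    rw [Real.sqrt_sq hx.le]
    field_simp
  have h0 : 0 < √(x ^ 2 + y ^ 2) := Real.sqrt_pos.2 (by positivity)
  have h0' : ((√(x ^ 2 + y ^ 2) : ℝ) : ℂ) ≠ 0 := by exact_mod_cast h0.ne'
  have hx' : (x : ℂ) ≠ 0 := by exact_mod_cast hx.ne'
  rw [mul_comm Complex.I, Complex.exp_mul_I, ← Complex.ofReal_cos, ← Complex.ofReal_sin,
    Real.cos_arctan, Real.sin_arctan, h1]
  push_cast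
  field_simp

/-- Turning (cos φ, b sin φ) by -φ gives (cos² φ + b sin² φ, (b - 1) sin φ cos φ). The first entry
is positive, so an arctangent gives the argument for all φ without jumps. -/
theorem exp_tilt {b : ℝ} (hb : 0 < b) (φ : ℝ) :
    Complex.exp (Complex.I * tilt b φ) * √(Real.cos φ ^ 2 + b ^ 2 * Real.sin φ ^ 2) =
      Real.cos φ + Complex.I * (b * Real.sin φ) := by
  have hD := cos_sq_add_mul_sin_sq_pos hb φ
  have hsc := Real.sin_sq_add_cos_sq φ
  have hsum : Real.cos φ ^ 2 + b ^ 2 * Real.sin φ ^ 2 =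
      (Real.cos φ ^ 2 + b * Real.sin φ ^ 2) ^ 2 +
        ((b - 1) * (Real.sin φ * Real.cos φ)) ^ 2 := by
    linear_combination -(Real.cos φ ^ 2 + b ^ 2 * Real.sin φ ^ 2) * hsc
  have h1 := exp_arctan_div (y := (b - 1) * (Real.sin φ * Real.cos φ)) hD
  have h2 : Complex.exp (Complex.I * φ) = Real.cos φ + Real.sin φ * Complex.I := by
    rw [mul_comm, Complex.exp_mul_I, Complex.ofReal_cos, Complex.ofReal_sin]
  have hsc' : (Real.sin φ : ℂ) ^ 2 + (Real.cos φ : ℂ) ^ 2 = 1 := by exact_mod_cast hsc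
  rw [hsum]
  unfold tilt
  rw [Complex.ofReal_add, mul_add, Complex.exp_add, mul_assoc, h1, h2]
  push_cast at hsc' ⊢
  linear_combination (Complex.cos φ + b * Complex.I * Complex.sin φ) * hsc' +
    (b - 1) * Complex.sin φ ^ 2 * Complex.cos φ * Complex.I_sq

theorem tilt_add_two_pi (b φ : ℝ) : tilt b (φ + 2 * Real.pi) = tilt b φ + 2 * Real.pi := by
  unfold tilt
  rw [Real.sin_add_two_pi, Real.cos_add_two_pi]
  ring

theorem strictMono_tilt {b : ℝ} (hb : 0 < b) : StrictMono (tilt b) :=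
  strictMono_of_deriv_pos fun φ => by
    rw [(hasDerivAt_tilt hb φ).deriv]
    exact div_pos hb (cos_sq_add_mul_sin_sq_pos (pow_pos hb 2) φ)

/-- The substitution is increasing and advances by 2π over a period; periodicity of F makes the
starting point irrelevant. -/
theorem integral_comp_tilt {b : ℝ} (hb : 0 < b) (ψ : ℝ) {F : ℝ → ℂ}
    (hF : Function.Periodic F (2 * Real.pi)) :
    ∫ θ in (0 : ℝ)..(2 * Real.pi), F θ =
      ∫ φ in (0 : ℝ)..(2 * Real.pi), ((b / (Real.cos (φ - ψ) ^ 2 +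
        b ^ 2 * Real.sin (φ - ψ) ^ 2) : ℝ) : ℂ) * F (ψ + tilt b (φ - ψ)) := by
  have h2π : (0 : ℝ) ≤ 2 * Real.pi := by positivity
  set G : ℝ → ℝ := fun φ => ψ + tilt b (φ - ψ) with hG
  have hGd : ∀ φ, HasDerivAt G (b / (Real.cos (φ - ψ) ^ 2 + b ^ 2 * Real.sin (φ - ψ) ^ 2)) φ := by
    intro φ
    have h1 : HasDerivAt (fun φ => φ - ψ) 1 φ := (hasDerivAt_id φ).sub_const ψ
    have := ((hasDerivAt_tilt hb (φ - ψ)).comp φ h1).const_add ψ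
    exact this.congr_deriv (by simp)
  have hGm : StrictMono G := fun x y hxy => by
    have := strictMono_tilt hb (sub_lt_sub_right hxy ψ)
    simp only [hG]; linarith
  have hGc : Continuous G := continuous_iff_continuousAt.2 fun φ => (hGd φ).continuousAt
  have him : G '' Icc 0 (2 * Real.pi) = Icc (G 0) (G (2 * Real.pi)) := by
    refine Subset.antisymm ?_ (intermediate_value_Icc h2π hGc.continuousOn)
    rintro _ ⟨x, hx, rfl⟩
    exact ⟨hGm.monotone hx.1, hGm.monotone hx.2⟩
  have hG2 : G (2 * Real.pi) = G 0 + 2 * Real.pi := by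
    simp only [hG]
    have : 2 * Real.pi - ψ = (0 - ψ) + 2 * Real.pi := by ring
    rw [this, tilt_add_two_pi]; ring
  have h1 := integral_image_eq_integral_deriv_smul_of_monotoneOn measurableSet_Icc
    (fun x _ => (hGd x).hasDerivWithinAt) (hGm.monotone.monotoneOn (Icc 0 (2 * Real.pi))) F
  rw [him, integral_Icc_eq_integral_Ioc, integral_Icc_eq_integral_Ioc,
    ← intervalIntegral.integral_of_le (hGm.monotone h2π),
    ← intervalIntegral.integral_of_le h2π, hG2, hF.intervalIntegral_add_eq (G 0) 0, zero_add] at h1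
  rw [h1]
  simp only [Complex.real_smul, hG]

/-! ### Backprojection through footpoints -/

section

variable {κ R : ℝ}

theorem IsPeriodic.add_int {E : Type*} {h : ℝ × ℝ → E} (hh : IsPeriodic h) (β α : ℝ) (k : ℤ) :
    h (β + k * (2 * Real.pi), α) = h (β, α) := by
  have : Function.Periodic (fun β => h (β, α)) (2 * Real.pi) := fun β => hh β α
  exact this.int_mul k β

theorem footpoint_periodic (κ R : ℝ) (z : ℂ) :
    Function.Periodic (footpoint κ R z) (2 * Real.pi) := by
  intro θ
  have h : IsFootpoint κ R z (θ + 2 * Real.pi) = IsFootpoint κ R z θ := by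
    have : Complex.exp (Complex.I * ((θ + 2 * Real.pi : ℝ) : ℂ)) =
        Complex.exp (Complex.I * (θ : ℂ)) := by
      rw [Complex.exp_eq_exp_iff_exists_int]
      exact ⟨1, by push_cast; ring⟩
    funext p
    unfold IsFootpoint
    rw [this]
  -- The chosen footpoint depends only on the defining predicate, so equality of the predicates
  -- suffices.
  exact congrArg (fun P : ℝ × ℝ → Prop => @dite (ℝ × ℝ) (∃ p, P p) (Classical.propDecidable _)
    (fun h => h.choose) fun _ => 0) h

/-- The footpoint agrees with `bdryOf` up to a multiple of 2π in β, which a periodic function does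
not see. -/
theorem apply_footpoint (hR : 0 < R) (hκ : R ^ 2 * |κ| < 1) {z : ℂ} (hz : z ∈ disk R)
    {θ θ' ρ : ℝ} (hρ : 0 < ρ)
    (hm : Complex.exp (Complex.I * θ) + κ * z ^ 2 * Complex.exp (-(Complex.I * θ)) =
      ρ * Complex.exp (Complex.I * θ'))
    (hq : offset (straighten κ R z) θ' ∈ Ioo (-1 : ℝ) 1) {E : Type*} {h : ℝ × ℝ → E}
    (hh : IsPeriodic h) :
    h (footpoint κ R z θ) = h (bdryOf κ R (offset (straighten κ R z) θ', θ')) := by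
  have hex := exists_isFootpoint hR hκ hz hρ hm hq
  rw [footpoint, dif_pos hex]
  obtain ⟨k, hk⟩ := hex.choose_spec.eq_bdryOf hR hκ hρ hm
  rw [hk, hh.add_int]

theorem offset_polar (x : ℂ) (θ : ℝ) : offset x θ = -‖x‖ * Real.sin (θ - x.arg) := by
  rw [offset_eq, Real.sin_sub]
  have h1 := Complex.norm_mul_cos_arg x
  have h2 := Complex.norm_mul_sin_arg x
  linear_combination Real.sin θ * h1 - Real.cos θ * h2

/-- The relation between the direction of a geodesic at a point and the direction of its
straightening. -/
theorem exp_tilt_add (hκ : R ^ 2 * |κ| < 1) {z : ℂ} (hz : z ∈ disk R) (θ' : ℝ) :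
    ∃ ρ : ℝ, 0 < ρ ∧
      Complex.exp (Complex.I * (z.arg + tilt (weight κ z) (θ' - z.arg) : ℝ)) + κ * z ^ 2 *
        Complex.exp (-(Complex.I * (z.arg + tilt (weight κ z) (θ' - z.arg) : ℝ))) =
        ρ * Complex.exp (Complex.I * θ') := by
  have hb := weight_pos hκ hz
  have hE := one_add_pos hκ hz
  have hB := one_sub_pos hκ hz
  set b := weight κ z with hbdef
  set φ := θ' - z.arg with hφ
  set l := √(Real.cos φ ^ 2 + b ^ 2 * Real.sin φ ^ 2) with hl
  have hl0 : 0 < l := Real.sqrt_pos.2 (cos_sq_add_mul_sin_sq_pos (pow_pos hb 2) φ)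
  refine ⟨(1 + κ * ‖z‖ ^ 2) / l, div_pos hE hl0, ?_⟩
  have hlc : (l : ℂ) ≠ 0 := by exact_mod_cast hl0.ne'
  have h1 := exp_tilt hb φ
  rw [← hl] at h1
  have h2 : Complex.exp (-(Complex.I * tilt b φ)) * l =
      Real.cos φ - Complex.I * (b * Real.sin φ) := by
    have := congrArg (starRingEnd ℂ) h1
    rw [map_mul, ← Complex.exp_conj] at this
    simp only [map_mul, map_add, Complex.conj_I, Complex.conj_ofReal] at this
    rw [← neg_mul, this]
    ring
  have hω : z = ‖z‖ * Complex.exp (Complex.I * z.arg) := by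
    rw [mul_comm Complex.I]; exact (Complex.norm_mul_exp_arg_mul_I z).symm
  have hθ : Complex.exp (Complex.I * θ') = Complex.exp (Complex.I * z.arg) *
      (Real.cos φ + Complex.I * Real.sin φ) := by
    have : Complex.I * (θ' : ℂ) = Complex.I * z.arg + φ * Complex.I := by
      rw [hφ]; push_cast; ring
    rw [this, Complex.exp_add, Complex.exp_mul_I, Complex.ofReal_cos, Complex.ofReal_sin]
    ring
  have hee : Complex.exp (Complex.I * z.arg) * Complex.exp (-(Complex.I * z.arg)) = 1 := by
    rw [← Complex.exp_add]; simp
  have hbB : (b : ℂ) * (1 - κ * ‖z‖ ^ 2) = 1 + κ * ‖z‖ ^ 2 := by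
    have : b * (1 - κ * ‖z‖ ^ 2) = 1 + κ * ‖z‖ ^ 2 := by
      rw [hbdef, weight, div_mul_cancel₀ _ hB.ne']
    exact_mod_cast this
  refine mul_right_cancel₀ hlc ?_
  have hz2 : z ^ 2 = ‖z‖ ^ 2 * Complex.exp (Complex.I * z.arg) ^ 2 := by
    conv_lhs => rw [hω]
    ring
  rw [Complex.ofReal_add, mul_add, neg_add, Complex.exp_add, Complex.exp_add, hz2, hθ]
  push_cast at h1 h2 ⊢
  rw [div_mul_eq_mul_div, div_mul_cancel₀ _ hlc]
  generalize Complex.exp (Complex.I * z.arg) = u at *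
  generalize Complex.exp (-(Complex.I * z.arg)) = v at *
  linear_combination u * h1 + κ * ‖z‖ ^ 2 * u ^ 2 * v * h2 +
    κ * ‖z‖ ^ 2 * u * (Complex.cos φ - Complex.I * (b * Complex.sin φ)) * hee +
    u * Complex.I * Complex.sin φ * hbB

theorem arg_straighten (hR : 0 < R) (hκ : R ^ 2 * |κ| < 1) {z : ℂ} (hz : z ∈ disk R) :
    (straighten κ R z).arg = z.arg :=
  Complex.arg_real_mul z (div_pos (scale_pos hR hκ) (one_sub_pos hκ hz))

/-- The function on the space of chords that corresponds to `h / μ`. -/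
def starKernel (κ R : ℝ) (h : ℝ × ℝ → ℂ) (p : ℝ × ℝ) : ℂ :=
  (spread κ R (bdryOf κ R p).2 / mu (bdryOf κ R p) : ℝ) * h (bdryOf κ R p)

/-- Offset ±1 forces cos(θ - arg x) = 0, a countable set of directions. For x on the circle these
are the tangent directions, where the footpoint takes a default value. -/
theorem ae_offset_mem {x : ℂ} (hx : x ∈ disk 1) :
    ∀ᵐ θ : ℝ, offset x θ ∈ Ioo (-1 : ℝ) 1 := by
  have hc : (range fun k : ℤ => (2 * k + 1) * Real.pi / 2 + x.arg).Countable :=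
    countable_range _
  filter_upwards [hc.ae_notMem volume] with θ hθ
  have hcos : Real.cos (θ - x.arg) ≠ 0 := by
    intro h0
    obtain ⟨k, hk⟩ := Real.cos_eq_zero_iff.1 h0
    exact hθ ⟨k, by simp only []; linarith⟩
  have h1 : Real.sin (θ - x.arg) ^ 2 < 1 := by
    have := Real.sin_sq_add_cos_sq (θ - x.arg)
    have : 0 < Real.cos (θ - x.arg) ^ 2 := by positivity
    linarith
  refine abs_lt.1 ((sq_lt_one_iff_abs_lt_one _).1 ?_)
  rw [offset_polar]
  have := norm_sq_le_one_of_mem_disk hx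
  nlinarith [sq_nonneg (Real.sin (θ - x.arg)), sq_nonneg ‖x‖]

/-- Near z the differential of the straightening stretches the radial direction by w relative to the
angular one, so directions change by `tilt` with b = w. The Jacobian of this change is w D along the
line of offset q, which accounts for both the outer weight and the factor in `starKernel`. -/
theorem xrayStar_eq (hR : 0 < R) (hκ : R ^ 2 * |κ| < 1) {h : ℝ × ℝ → ℂ} (hh : IsPeriodic h)
    {z : ℂ} (hz : z ∈ disk R) :
    xrayStar κ R h z = weight κ z * backproj (starKernel κ R h) (straighten κ R z) := by
  have hb := weight_pos hκ hz
  have hx := straighten_mem_disk hR hκ hz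
  rw [xrayStar, xraySharp, integral_comp_tilt hb z.arg
    (fun θ => by simp only [footpoint_periodic κ R z θ]), backproj,
    ← intervalIntegral.integral_const_mul]
  refine intervalIntegral.integral_congr_ae ?_
  filter_upwards [ae_offset_mem hx] with θ' hq _
  obtain ⟨ρ, hρ, hm⟩ := exp_tilt_add hκ hz θ'
  have hper : IsPeriodic (fun p => h p / mu p) := fun β α => by
    simp only [mu, hh β α]
  rw [apply_footpoint hR hκ hz hρ hm hq hper (h := fun p => h p / mu p), starKernel,
    spread_bdryOf hR hκ hq]
  -- The Jacobian's denominator is 1/D: the offset is -|x| sin(θ' - arg z) and w² = 1 + `relCurv`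
  -- |x|².
  have e : Real.cos (θ' - z.arg) ^ 2 + weight κ z ^ 2 * Real.sin (θ' - z.arg) ^ 2 =
      1 + relCurv κ R * offset (straighten κ R z) θ' ^ 2 := by
    have h1 := one_add_relCurv_straighten hR hκ hz
    rw [offset_polar, arg_straighten hR hκ hz, ← h1]
    linear_combination Real.sin_sq_add_cos_sq (θ' - z.arg)
  rw [e]
  push_cast
  ring

end

/-! ### The operator `𝓛` -/

/-- The factor of the principal part. -/
def opScale (κ R : ℝ) (z : ℂ) : ℝ := (1 - κ * ‖z‖ ^ 2) ^ 2 / scale κ R ^ 2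

/-- The coefficient of the degenerate radial part. -/
def opRadial (κ R : ℝ) (z : ℂ) : ℝ := (scale κ R ^ 2 + 4 * κ) / (1 + κ * ‖z‖ ^ 2) ^ 2

/-- The coefficient of the radial field `x ∂_x + y ∂_y`. -/
def opDrift (κ R : ℝ) (z : ℂ) : ℝ :=
  (3 * scale κ R ^ 2 * (1 - κ * ‖z‖ ^ 2) +
    2 * κ * (1 - κ * ‖z‖ ^ 2) ^ 2 * (4 - 3 * opRadial κ R z * ‖z‖ ^ 2) +
    8 * κ * (1 - κ * ‖z‖ ^ 2) * (1 + κ * ‖z‖ ^ 2) * (1 - opRadial κ R z * ‖z‖ ^ 2)) /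
    (scale κ R ^ 2 * (1 + κ * ‖z‖ ^ 2))

/-- The coefficient of order zero. -/
def opPotential (κ R : ℝ) (z : ℂ) : ℝ :=
  1 + ((1 - κ * ‖z‖ ^ 2) / (1 + κ * ‖z‖ ^ 2)) *
    ((4 * κ * (2 - opRadial κ R z * ‖z‖ ^ 2) +
      16 * κ ^ 2 * ‖z‖ ^ 2 * (1 - opRadial κ R z * ‖z‖ ^ 2) / (1 - κ * ‖z‖ ^ 2)) / scale κ R ^ 2 -
    4 * κ * ‖z‖ ^ 2 * opDrift κ R z / (1 - κ * ‖z‖ ^ 2) ^ 2)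

/-- The operator `𝓛`, the Zernike operator in the coordinates `straighten` and conjugated by the
weight. -/
def kimuraOp (κ R : ℝ) : SecondOrderOp where
  a₁₁ z := opScale κ R z * (1 - opRadial κ R z * z.re ^ 2)
  a₁₂ z := -(opScale κ R z * opRadial κ R z * (z.re * z.im))
  a₂₂ z := opScale κ R z * (1 - opRadial κ R z * z.im ^ 2)
  b₁ z := opDrift κ R z * z.re
  b₂ z := opDrift κ R z * z.im
  c z := opPotential κ R z

/-- The action of a second-order operator on functions on `S`. -/
def SecondOrderOp.applyOn (L : SecondOrderOp) (S : Set ℂ) (f : ℂ → ℂ) (z : ℂ) : ℂ :=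
  -(L.a₁₁ z * dirDeriv S 1 (dirDeriv S 1 f) z
      + 2 * L.a₁₂ z * dirDeriv S 1 (dirDeriv S Complex.I f) z
      + L.a₂₂ z * dirDeriv S Complex.I (dirDeriv S Complex.I f) z)
    + L.b₁ z * dirDeriv S 1 f z + L.b₂ z * dirDeriv S Complex.I f z + L.c z * f z

theorem SecondOrderOp.apply_eq_applyOn (L : SecondOrderOp) (R : ℝ) (f : ℂ → ℂ) (z : ℂ) :
    L.apply R f z = L.applyOn (disk R) f z := rfl

/-- `F'` is the derivative of `F` in the direction `v` on `S`. -/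
def HasDirDeriv (S : Set ℂ) (v : ℂ) (F F' : ℂ → ℂ) : Prop :=
  DifferentiableOn ℝ F S ∧ ∀ z ∈ S, dirDeriv S v F z = F' z

section

variable {S S' : Set ℂ} {v : ℂ} {F G F' G' : ℂ → ℂ}

theorem HasDirDeriv.congr_deriv (h : HasDirDeriv S v F F') (h' : ∀ z ∈ S, F' z = G' z) :
    HasDirDeriv S v F G' := ⟨h.1, fun z hz => (h.2 z hz).trans (h' z hz)⟩

theorem HasDirDeriv.congr (h : HasDirDeriv S v F F') (h' : ∀ z ∈ S, G z = F z) :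
    HasDirDeriv S v G F' :=
  ⟨h.1.congr h', fun z hz => (dirDeriv_congr h' v hz).trans (h.2 z hz)⟩

theorem HasDirDeriv.add (hS : UniqueDiffOn ℝ S) (hF : HasDirDeriv S v F F')
    (hG : HasDirDeriv S v G G') :
    HasDirDeriv S v (fun z => F z + G z) (fun z => F' z + G' z) :=
  ⟨hF.1.add hG.1, fun z hz => by
    rw [dirDeriv_add hS hF.1 hG.1 v hz, hF.2 z hz, hG.2 z hz]⟩

theorem HasDirDeriv.mul (hS : UniqueDiffOn ℝ S) (hF : HasDirDeriv S v F F')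
    (hG : HasDirDeriv S v G G') :
    HasDirDeriv S v (fun z => F z * G z) (fun z => F' z * G z + F z * G' z) :=
  ⟨hF.1.mul hG.1, fun z hz => by
    rw [dirDeriv_mul hS hF.1 hG.1 v hz, hF.2 z hz, hG.2 z hz]; ring⟩

theorem HasDirDeriv.const_mul (hS : UniqueDiffOn ℝ S) (c : ℂ) (hF : HasDirDeriv S v F F') :
    HasDirDeriv S v (fun z => c * F z) (fun z => c * F' z) :=
  ⟨hF.1.const_mul c, fun z hz => by rw [dirDeriv_const_mul hS hF.1 c v hz, hF.2 z hz]⟩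

theorem hasDirDeriv_of_hasFDerivAt (hS : UniqueDiffOn ℝ S) {f' : ℂ → ℂ →L[ℝ] ℂ}
    (h : ∀ z ∈ S, HasFDerivAt F (f' z) z) : HasDirDeriv S v F (fun z => f' z v) :=
  ⟨fun z hz => (h z hz).hasFDerivWithinAt.differentiableWithinAt, fun z hz => by
    rw [dirDeriv, (h z hz).hasFDerivWithinAt.fderivWithin (hS z hz)]⟩

theorem hasDirDeriv_const (hS : UniqueDiffOn ℝ S) (c : ℂ) :
    HasDirDeriv S v (fun _ => c) (fun _ => 0) :=
  hasDirDeriv_of_hasFDerivAt hS (f' := fun _ => 0) fun z _ => hasFDerivAt_const c z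

theorem hasDirDeriv_re (hS : UniqueDiffOn ℝ S) :
    HasDirDeriv S v (fun z => (z.re : ℂ)) (fun _ => v.re) :=
  hasDirDeriv_of_hasFDerivAt hS (f' := fun _ => Complex.ofRealCLM.comp Complex.reCLM) fun _ _ =>
    (Complex.ofRealCLM.comp Complex.reCLM).hasFDerivAt

theorem hasDirDeriv_im (hS : UniqueDiffOn ℝ S) :
    HasDirDeriv S v (fun z => (z.im : ℂ)) (fun _ => v.im) :=
  hasDirDeriv_of_hasFDerivAt hS (f' := fun _ => Complex.ofRealCLM.comp Complex.imCLM) fun _ _ =>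
    (Complex.ofRealCLM.comp Complex.imCLM).hasFDerivAt

theorem hasDirDeriv_inv (hS : UniqueDiffOn ℝ S) {κ : ℝ} (hne : ∀ z ∈ S, 1 - κ * ‖z‖ ^ 2 ≠ 0) :
    HasDirDeriv S v (fun z => (((1 - κ * ‖z‖ ^ 2)⁻¹ : ℝ) : ℂ))
      (fun z => 2 * κ * (z.re * v.re + z.im * v.im) * (((1 - κ * ‖z‖ ^ 2)⁻¹ : ℝ) : ℂ) ^ 2) := by
  have h : ∀ z ∈ S, HasFDerivAt (fun z : ℂ => (((1 - κ * ‖z‖ ^ 2)⁻¹ : ℝ) : ℂ))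
      (Complex.ofRealCLM.comp ((-((1 - κ * ‖z‖ ^ 2) ^ 2)⁻¹) •
        (-(κ • ((2 : ℕ) • innerSL ℝ z))))) z := by
    intro z hz
    have h0 : HasFDerivAt (fun y : ℂ => ‖y‖ ^ 2) (2 • (innerSL ℝ z)) z :=
      (hasStrictFDerivAt_norm_sq z).hasFDerivAt
    have h1 := (h0.const_mul κ).const_sub 1
    exact Complex.ofRealCLM.hasFDerivAt.comp z ((hasDerivAt_inv (hne z hz)).comp_hasFDerivAt z h1)
  refine (hasDirDeriv_of_hasFDerivAt hS h).congr_deriv fun z hz => ?_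
  simp [Complex.inner]
  ring

theorem ofReal_re_fderivWithin (hS : UniqueDiffOn ℝ S) {Ψ : ℂ → ℂ} (hΨ : DifferentiableOn ℝ Ψ S)
    {P : ℂ → ℂ} (hP : HasDirDeriv S v (fun z => ((Ψ z).re : ℂ)) P) {z : ℂ} (hz : z ∈ S) :
    (((fderivWithin ℝ Ψ S z v).re : ℝ) : ℂ) = P z := by
  rw [← hP.2 z hz, dirDeriv]
  have h3 : HasFDerivWithinAt (fun z => ((Ψ z).re : ℂ))
    ((Complex.ofRealCLM.comp Complex.reCLM).comp (fderivWithin ℝ Ψ S z)) S z :=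
    (Complex.ofRealCLM.comp Complex.reCLM).hasFDerivAt.comp_hasFDerivWithinAt z
      (hΨ z hz).hasFDerivWithinAt
  rw [h3.fderivWithin (hS z hz)]
  simp

theorem ofReal_im_fderivWithin (hS : UniqueDiffOn ℝ S) {Ψ : ℂ → ℂ} (hΨ : DifferentiableOn ℝ Ψ S)
    {Q : ℂ → ℂ} (hQ : HasDirDeriv S v (fun z => ((Ψ z).im : ℂ)) Q) {z : ℂ} (hz : z ∈ S) :
    (((fderivWithin ℝ Ψ S z v).im : ℝ) : ℂ) = Q z := by
  rw [← hQ.2 z hz, dirDeriv]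
  have h3 : HasFDerivWithinAt (fun z => ((Ψ z).im : ℂ))
    ((Complex.ofRealCLM.comp Complex.imCLM).comp (fderivWithin ℝ Ψ S z)) S z :=
    (Complex.ofRealCLM.comp Complex.imCLM).hasFDerivAt.comp_hasFDerivWithinAt z
      (hΨ z hz).hasFDerivWithinAt
  rw [h3.fderivWithin (hS z hz)]
  simp

/-- The chain rule in coordinates, with the derivatives of Re Ψ and Im Ψ supplied as complex-valued
functions so that later identities are polynomial over ℂ. -/
theorem HasDirDeriv.comp (hS : UniqueDiffOn ℝ S) {Ψ : ℂ → ℂ} (hm : MapsTo Ψ S S')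
    {P Q : ℂ → ℂ} (hP : HasDirDeriv S v (fun z => ((Ψ z).re : ℂ)) P)
    (hQ : HasDirDeriv S v (fun z => ((Ψ z).im : ℂ)) Q) {g : ℂ → ℂ}
    (hg : DifferentiableOn ℝ g S') :
    HasDirDeriv S v (fun z => g (Ψ z)) (fun z => P z * dirDeriv S' 1 g (Ψ z) +
      Q z * dirDeriv S' Complex.I g (Ψ z)) := by
  have hΨ : DifferentiableOn ℝ Ψ S := by
    have : Ψ = fun z => ((Ψ z).re : ℂ) + ((Ψ z).im : ℂ) * Complex.I := by
      funext z; exact (Complex.re_add_im _).symm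
    rw [this]
    exact hP.1.add (hQ.1.mul_const _)
  refine ⟨hg.comp hΨ hm, fun z hz => ?_⟩
  have h1 := (hg (Ψ z) (hm hz)).hasFDerivWithinAt.comp z (hΨ z hz).hasFDerivWithinAt hm
  have h2 : dirDeriv S v (fun z => g (Ψ z)) z =
      fderivWithin ℝ g S' (Ψ z) (fderivWithin ℝ Ψ S z v) := by
    rw [dirDeriv]
    have := h1.fderivWithin (hS z hz)
    exact congrArg (fun L : ℂ →L[ℝ] ℂ => L v) this
  rw [h2, fderivWithin_apply_eq, ofReal_re_fderivWithin hS hΨ hP hz,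
    ofReal_im_fderivWithin hS hΨ hQ hz]

/-- The derivatives of a conjugated pull-back. -/
theorem hasDirDeriv_conjugate (hS : UniqueDiffOn ℝ S) {Ψ : ℂ → ℂ} (hm : MapsTo Ψ S S')
    {W Wv P Q : ℂ → ℂ} (hW : HasDirDeriv S v W Wv)
    (hP : HasDirDeriv S v (fun z => ((Ψ z).re : ℂ)) P)
    (hQ : HasDirDeriv S v (fun z => ((Ψ z).im : ℂ)) Q) {g : ℂ → ℂ}
    (hg : DifferentiableOn ℝ g S') :
    HasDirDeriv S v (fun z => W z * g (Ψ z)) (fun z => Wv z * g (Ψ z) + W z *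
      (P z * dirDeriv S' 1 g (Ψ z) + Q z * dirDeriv S' Complex.I g (Ψ z))) :=
  hW.mul hS (hP.comp hS hm hQ hg)

/-- The product and chain rules applied twice to W·(g∘Ψ), sorted by the derivatives of g; the
operator identity is then a comparison of coefficients. -/
theorem dirDeriv_dirDeriv_conjugate (hS : UniqueDiffOn ℝ S) (hS' : Convex ℝ S')
    (hne : (interior S').Nonempty) {Ψ : ℂ → ℂ} (hm : MapsTo Ψ S S') {u : ℂ}
    {W Wu Wv Wuv Pu Qu Pv Qv Puv Quv : ℂ → ℂ}
    (hWu : HasDirDeriv S u W Wu) (hWv : HasDirDeriv S v W Wv) (hWuv : HasDirDeriv S u Wv Wuv)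
    (hPu : HasDirDeriv S u (fun z => ((Ψ z).re : ℂ)) Pu)
    (hPv : HasDirDeriv S v (fun z => ((Ψ z).re : ℂ)) Pv) (hPuv : HasDirDeriv S u Pv Puv)
    (hQu : HasDirDeriv S u (fun z => ((Ψ z).im : ℂ)) Qu)
    (hQv : HasDirDeriv S v (fun z => ((Ψ z).im : ℂ)) Qv) (hQuv : HasDirDeriv S u Qv Quv)
    {g : ℂ → ℂ} (hg : ContDiffOn ℝ ∞ g S') {z : ℂ} (hz : z ∈ S) :
    dirDeriv S u (dirDeriv S v (fun z => W z * g (Ψ z))) z =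
      Wuv z * g (Ψ z) +
      (Wv z * Pu z + Wu z * Pv z + W z * Puv z) * dirDeriv S' 1 g (Ψ z) +
      (Wv z * Qu z + Wu z * Qv z + W z * Quv z) * dirDeriv S' Complex.I g (Ψ z) +
      W z * (Pu z * Pv z) * dirDeriv S' 1 (dirDeriv S' 1 g) (Ψ z) +
      W z * (Pu z * Qv z + Qu z * Pv z) * dirDeriv S' 1 (dirDeriv S' Complex.I g) (Ψ z) +
      W z * (Qu z * Qv z) * dirDeriv S' Complex.I (dirDeriv S' Complex.I g) (Ψ z) := by
  have hU := uniqueDiffOn_convex hS' hne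
  have hg0 := hg.differentiableOn (n := ∞) (by simp)
  have hg1 := (contDiffOn_dirDeriv hU hg 1).differentiableOn (n := ∞) (by simp)
  have hg2 := (contDiffOn_dirDeriv hU hg Complex.I).differentiableOn (n := ∞) (by simp)
  have h1 := hasDirDeriv_conjugate hS hm hWv hPv hQv hg0
  have h2 := ((hWuv.mul hS (hPu.comp hS hm hQu hg0)).add hS
    (hWu.mul hS ((hPuv.mul hS (hPu.comp hS hm hQu hg1)).add hS
      (hQuv.mul hS (hPu.comp hS hm hQu hg2)))))
  have e := dirDeriv_comm hS' hne hg Complex.I 1 (hm hz)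
  rw [dirDeriv_congr (fun y hy => h1.2 y hy) u hz, h2.2 z hz]
  beta_reduce
  rw [e]
  ring

end

/-! ### The conjugation of the operator -/

section

variable {x y k c D E J A m β γ : ℂ}

/-- Comparison of second-order coefficients: the differential of Ψ pushes the symbol of `kimuraOp`
to I - ξξᵗ with ξ = Ψ(z). Here x, y are the coordinates of z and J = 1/(1 - κ|z|²). -/
theorem symbol_identities (hc : c ≠ 0) (hD : D ≠ 0) (hE : E ≠ 0)
    (hDx : D = 1 - k * (x ^ 2 + y ^ 2)) (hEx : E = 1 + k * (x ^ 2 + y ^ 2))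
    (hJ : J = D⁻¹) (hA : A = D ^ 2 / c ^ 2) (hm : m = (c ^ 2 + 4 * k) / E ^ 2) :
    A * (1 - m * x ^ 2) * (c * (J + 2 * k * x ^ 2 * J ^ 2)) ^ 2 +
      2 * -(A * m * (x * y)) * (c * (J + 2 * k * x ^ 2 * J ^ 2) * (c * (2 * k * x * y * J ^ 2))) +
      A * (1 - m * y ^ 2) * (c * (2 * k * x * y * J ^ 2)) ^ 2 = 1 - (c * x * J) ^ 2 ∧
    A * (1 - m * x ^ 2) * (c * (J + 2 * k * x ^ 2 * J ^ 2) * (c * (2 * k * x * y * J ^ 2))) +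
      -(A * m * (x * y)) * (c * (J + 2 * k * x ^ 2 * J ^ 2) *
        (c * (J + 2 * k * y ^ 2 * J ^ 2)) + (c * (2 * k * x * y * J ^ 2)) ^ 2) +
      A * (1 - m * y ^ 2) * (c * (2 * k * x * y * J ^ 2) * (c * (J + 2 * k * y ^ 2 * J ^ 2))) =
      -(c * x * J * (c * y * J)) := by
  subst hA hm hJ
  constructor
  · field_simp
    rw [hDx, hEx]
    ring
  · field_simp
    rw [hDx, hEx]
    ring

/-- Comparison of the coefficients of the first derivative of g in the first coordinate, where the
weight is 2J - 1; solving for β gives `opDrift`. -/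
theorem drift_identity (hc : c ≠ 0) (hD : D ≠ 0) (hE : E ≠ 0)
    (hDx : D = 1 - k * (x ^ 2 + y ^ 2)) (hEx : E = 1 + k * (x ^ 2 + y ^ 2))
    (hJ : J = D⁻¹) (hA : A = D ^ 2 / c ^ 2) (hm : m = (c ^ 2 + 4 * k) / E ^ 2)
    (hβ : β = (3 * c ^ 2 * D + 2 * k * D ^ 2 * (4 - 3 * m * (x ^ 2 + y ^ 2)) +
      8 * k * D * E * (1 - m * (x ^ 2 + y ^ 2))) / (c ^ 2 * E)) :
    -(A * (1 - m * x ^ 2) * (2 * (4 * k * x * J ^ 2) * (c * (J + 2 * k * x ^ 2 * J ^ 2)) +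
          (2 * J - 1) * (c * (6 * k * x * J ^ 2 + 8 * k ^ 2 * x ^ 3 * J ^ 3))) +
        2 * -(A * m * (x * y)) * (4 * k * x * J ^ 2 * (c * (2 * k * x * y * J ^ 2)) +
          4 * k * y * J ^ 2 * (c * (J + 2 * k * x ^ 2 * J ^ 2)) +
          (2 * J - 1) * (c * (2 * k * y * J ^ 2 + 8 * k ^ 2 * x ^ 2 * y * J ^ 3))) +
        A * (1 - m * y ^ 2) * (2 * (4 * k * y * J ^ 2) * (c * (2 * k * x * y * J ^ 2)) +
          (2 * J - 1) * (c * (2 * k * x * J ^ 2 + 8 * k ^ 2 * x * y ^ 2 * J ^ 3)))) +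
      (2 * J - 1) * (β * x * (c * (J + 2 * k * x ^ 2 * J ^ 2)) +
        β * y * (c * (2 * k * x * y * J ^ 2))) = 3 * (2 * J - 1) * (c * x * J) := by
  subst hβ hA hm hJ
  field_simp
  rw [hDx, hEx]
  ring

/-- Comparison of the coefficients of g itself: 𝓛w = w, because `zernike` maps the constant 1 to 1.
Solving for γ gives `opPotential`. -/
theorem potential_identity (hc : c ≠ 0) (hD : D ≠ 0) (hE : E ≠ 0)
    (hDx : D = 1 - k * (x ^ 2 + y ^ 2)) (hEx : E = 1 + k * (x ^ 2 + y ^ 2))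
    (hJ : J = D⁻¹) (hA : A = D ^ 2 / c ^ 2)
    (hγ : γ = 1 + D / E * ((4 * k * (2 - m * (x ^ 2 + y ^ 2)) +
      16 * k ^ 2 * (x ^ 2 + y ^ 2) * (1 - m * (x ^ 2 + y ^ 2)) / D) / c ^ 2 -
      4 * k * (x ^ 2 + y ^ 2) * β / D ^ 2)) :
    -(A * (1 - m * x ^ 2) * (4 * k * J ^ 2 + 16 * k ^ 2 * x ^ 2 * J ^ 3) +
        2 * -(A * m * (x * y)) * (16 * k ^ 2 * x * y * J ^ 3) +
        A * (1 - m * y ^ 2) * (4 * k * J ^ 2 + 16 * k ^ 2 * y ^ 2 * J ^ 3)) +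
      β * x * (4 * k * x * J ^ 2) + β * y * (4 * k * y * J ^ 2) + γ * (2 * J - 1) = 2 * J - 1 := by
  have hW : 2 * J - 1 = E / D := by
    rw [hJ, eq_div_iff hD]; field_simp; rw [hDx, hEx]; ring
  rw [hW]
  subst hγ hA hJ
  field_simp
  ring

end

variable {κ R : ℝ}

/-- `κ`-dependent derivatives of the weight and of the straightening map. -/
theorem hasDirDeriv_weight {S : Set ℂ} (hS : UniqueDiffOn ℝ S) (v : ℂ)
    (hD : ∀ z ∈ S, 1 - κ * ‖z‖ ^ 2 ≠ 0) :
    HasDirDeriv S v (fun z => (weight κ z : ℂ)) (fun z => 4 * κ * (z.re * v.re + z.im * v.im) *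
      (((1 - κ * ‖z‖ ^ 2)⁻¹ : ℝ) : ℂ) ^ 2) := by
  refine ((((hasDirDeriv_inv hS hD).const_mul hS 2).add hS
    (hasDirDeriv_const hS (-1))).congr fun z hz => ?_).congr_deriv fun z hz => by ring
  -- In this form the weight and the straightening depend on the single nonlinear function 1/(1 -
  -- κ|z|²).
  have : weight κ z = 2 * (1 - κ * ‖z‖ ^ 2)⁻¹ + -1 := by
    have := hD z hz
    rw [weight]; field_simp; ring
  rw [this]; push_cast; ring

theorem hasDirDeriv_weight_deriv {S : Set ℂ} (hS : UniqueDiffOn ℝ S) (u v : ℂ)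
    (hD : ∀ z ∈ S, 1 - κ * ‖z‖ ^ 2 ≠ 0) :
    HasDirDeriv S u (fun z => 4 * κ * (z.re * v.re + z.im * v.im) *
      (((1 - κ * ‖z‖ ^ 2)⁻¹ : ℝ) : ℂ) ^ 2) (fun z =>
      4 * κ * (u.re * v.re + u.im * v.im) * (((1 - κ * ‖z‖ ^ 2)⁻¹ : ℝ) : ℂ) ^ 2 +
      16 * κ ^ 2 * (z.re * v.re + z.im * v.im) * (z.re * u.re + z.im * u.im) *
        (((1 - κ * ‖z‖ ^ 2)⁻¹ : ℝ) : ℂ) ^ 3) := by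
  have hJ := hasDirDeriv_inv (v := u) hS hD
  have hl := (((hasDirDeriv_re (v := u) hS).const_mul hS v.re).add hS
    ((hasDirDeriv_im (v := u) hS).const_mul hS v.im)).const_mul hS (4 * κ)
  exact ((hl.mul hS (hJ.mul hS hJ)).congr fun z _ => by ring).congr_deriv fun z _ => by ring

theorem straighten_re (z : ℂ) :
    (straighten κ R z).re = scale κ R * z.re * (1 - κ * ‖z‖ ^ 2)⁻¹ := by
  rw [straighten, Complex.re_ofReal_mul]; ring

theorem straighten_im (z : ℂ) :
    (straighten κ R z).im = scale κ R * z.im * (1 - κ * ‖z‖ ^ 2)⁻¹ := by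
  rw [straighten, Complex.im_ofReal_mul]; ring

section

variable {S : Set ℂ} {ℓ : ℂ → ℂ} {ℓu ℓv : ℂ}

/-- Applied with ℓ one of the two coordinate functions, to treat both components of the
straightening at once. -/
theorem HasDirDeriv.mul_inv (hS : UniqueDiffOn ℝ S) (c : ℂ) {v : ℂ}
    (hD : ∀ z ∈ S, 1 - κ * ‖z‖ ^ 2 ≠ 0) (hv : HasDirDeriv S v ℓ fun _ => ℓv) :
    HasDirDeriv S v (fun z => c * ℓ z * (((1 - κ * ‖z‖ ^ 2)⁻¹ : ℝ) : ℂ)) (fun z =>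
      c * (ℓv * (((1 - κ * ‖z‖ ^ 2)⁻¹ : ℝ) : ℂ) + 2 * κ * ℓ z * (z.re * v.re + z.im * v.im) *
        (((1 - κ * ‖z‖ ^ 2)⁻¹ : ℝ) : ℂ) ^ 2)) :=
  ((hv.const_mul hS c).mul hS (hasDirDeriv_inv hS hD)).congr_deriv fun z _ => by ring

theorem HasDirDeriv.mul_inv_deriv (hS : UniqueDiffOn ℝ S) (c : ℂ) {u v : ℂ}
    (hD : ∀ z ∈ S, 1 - κ * ‖z‖ ^ 2 ≠ 0) (hu : HasDirDeriv S u ℓ fun _ => ℓu) :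
    HasDirDeriv S u (fun z =>
      c * (ℓv * (((1 - κ * ‖z‖ ^ 2)⁻¹ : ℝ) : ℂ) + 2 * κ * ℓ z * (z.re * v.re + z.im * v.im) *
        (((1 - κ * ‖z‖ ^ 2)⁻¹ : ℝ) : ℂ) ^ 2)) (fun z =>
      c * (2 * κ * (ℓv * (z.re * u.re + z.im * u.im) + ℓu * (z.re * v.re + z.im * v.im) +
        ℓ z * (u.re * v.re + u.im * v.im)) * (((1 - κ * ‖z‖ ^ 2)⁻¹ : ℝ) : ℂ) ^ 2 +
        8 * κ ^ 2 * ℓ z * (z.re * v.re + z.im * v.im) * (z.re * u.re + z.im * u.im) *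
          (((1 - κ * ‖z‖ ^ 2)⁻¹ : ℝ) : ℂ) ^ 3)) := by
  have hJ := hasDirDeriv_inv (v := u) hS hD
  have hl := ((hasDirDeriv_re (v := u) hS).const_mul hS v.re).add hS
    ((hasDirDeriv_im (v := u) hS).const_mul hS v.im)
  exact ((((hJ.const_mul hS ℓv).add hS (((hu.mul hS hl).mul hS (hJ.mul hS hJ)).const_mul hS
    (2 * κ))).const_mul hS c).congr fun z _ => by ring).congr_deriv fun z _ => by ring

end

/-- `kimuraOp` is the Zernike operator in the coordinates `straighten`, conjugated by `weight`. -/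
theorem kimuraOp_applyOn (hR : 0 < R) (hκ : R ^ 2 * |κ| < 1) {S S' : Set ℂ}
    (hS : UniqueDiffOn ℝ S) (hSR : S ⊆ disk R) (hS' : Convex ℝ S')
    (hne : (interior S').Nonempty) (hm : MapsTo (straighten κ R) S S') {g : ℂ → ℂ}
    (hg : ContDiffOn ℝ ∞ g S') {z : ℂ} (hz : z ∈ S) :
    (kimuraOp κ R).applyOn S (fun z => weight κ z * g (straighten κ R z)) z =
      weight κ z * zernike S' g (straighten κ R z) := by
  have hD : ∀ z ∈ S, 1 - κ * ‖z‖ ^ 2 ≠ 0 := fun z hz => (one_sub_pos hκ (hSR hz)).ne'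
  have hE := (one_add_pos hκ (hSR hz)).ne'
  have hc := (scale_pos hR hκ).ne'
  have hW := fun v => hasDirDeriv_weight hS v hD
  have hWW := fun u v => hasDirDeriv_weight_deriv hS u v hD
  have hP : ∀ v, HasDirDeriv S v (fun z => ((straighten κ R z).re : ℂ)) _ := fun v =>
    ((hasDirDeriv_re (v := v) hS).mul_inv hS (scale κ R) hD).congr fun z _ => by
      rw [straighten_re]; push_cast; ring
  have hQ : ∀ v, HasDirDeriv S v (fun z => ((straighten κ R z).im : ℂ)) _ := fun v =>
    ((hasDirDeriv_im (v := v) hS).mul_inv hS (scale κ R) hD).congr fun z _ => by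
      rw [straighten_im]; push_cast; ring
  have hPP : ∀ u v : ℂ, HasDirDeriv S u _ _ := fun u v =>
    (hasDirDeriv_re (v := u) hS).mul_inv_deriv (v := v) (ℓv := v.re) hS (scale κ R) hD
  have hQQ : ∀ u v : ℂ, HasDirDeriv S u _ _ := fun u v =>
    (hasDirDeriv_im (v := u) hS).mul_inv_deriv (v := v) (ℓv := v.im) hS (scale κ R) hD
  have hU := uniqueDiffOn_convex hS' hne
  have hg0 := hg.differentiableOn (n := ∞) (by simp)
  have first := fun v => (hasDirDeriv_conjugate hS hm (hW v) (hP v) (hQ v) hg0).2 z hz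
  have second := fun u v => dirDeriv_dirDeriv_conjugate hS hS' hne hm (hW u) (hW v) (hWW u v)
    (hP u) (hP v) (hPP u v) (hQ u) (hQ v) (hQQ u v) hg hz
  rw [SecondOrderOp.applyOn, first, first, second, second, second, zernike, straighten_re,
    straighten_im]
  have hn : ((‖z‖ ^ 2 : ℝ) : ℂ) = (z.re : ℂ) ^ 2 + (z.im : ℂ) ^ 2 := by
    rw [Complex.sq_norm, Complex.normSq_apply]; push_cast; ring
  have hw : (weight κ z : ℂ) = 2 * (((1 - κ * ‖z‖ ^ 2)⁻¹ : ℝ) : ℂ) - 1 := by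
    have := hD z hz
    rw [show weight κ z = 2 * (1 - κ * ‖z‖ ^ 2)⁻¹ - 1 by rw [weight]; field_simp; ring]
    push_cast; ring
  have hA : (opScale κ R z : ℂ) = ((1 - κ * ‖z‖ ^ 2 : ℝ) : ℂ) ^ 2 / (scale κ R : ℂ) ^ 2 := by
    rw [opScale]; push_cast; ring
  have hM : (opRadial κ R z : ℂ) =
      ((scale κ R : ℂ) ^ 2 + 4 * κ) / ((1 + κ * ‖z‖ ^ 2 : ℝ) : ℂ) ^ 2 := by
    rw [opRadial]; push_cast; ring
  have hDx : ((1 - κ * ‖z‖ ^ 2 : ℝ) : ℂ) = 1 - κ * ((z.re : ℂ) ^ 2 + (z.im : ℂ) ^ 2) := by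
    rw [← hn]; push_cast; ring
  have hEx : ((1 + κ * ‖z‖ ^ 2 : ℝ) : ℂ) = 1 + κ * ((z.re : ℂ) ^ 2 + (z.im : ℂ) ^ 2) := by
    rw [← hn]; push_cast; ring
  have hβ : (opDrift κ R z : ℂ) = (3 * (scale κ R : ℂ) ^ 2 * ((1 - κ * ‖z‖ ^ 2 : ℝ) : ℂ) +
      2 * κ * ((1 - κ * ‖z‖ ^ 2 : ℝ) : ℂ) ^ 2 *
        (4 - 3 * (opRadial κ R z : ℂ) * ((z.re : ℂ) ^ 2 + (z.im : ℂ) ^ 2)) +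
      8 * κ * ((1 - κ * ‖z‖ ^ 2 : ℝ) : ℂ) * ((1 + κ * ‖z‖ ^ 2 : ℝ) : ℂ) *
        (1 - (opRadial κ R z : ℂ) * ((z.re : ℂ) ^ 2 + (z.im : ℂ) ^ 2))) /
      ((scale κ R : ℂ) ^ 2 * ((1 + κ * ‖z‖ ^ 2 : ℝ) : ℂ)) := by
    rw [opDrift, ← hn]; push_cast; ring
  have hγ : (opPotential κ R z : ℂ) =
      1 + ((1 - κ * ‖z‖ ^ 2 : ℝ) : ℂ) / ((1 + κ * ‖z‖ ^ 2 : ℝ) : ℂ) *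
      ((4 * κ * (2 - (opRadial κ R z : ℂ) * ((z.re : ℂ) ^ 2 + (z.im : ℂ) ^ 2)) +
        16 * κ ^ 2 * ((z.re : ℂ) ^ 2 + (z.im : ℂ) ^ 2) *
          (1 - (opRadial κ R z : ℂ) * ((z.re : ℂ) ^ 2 + (z.im : ℂ) ^ 2)) /
          ((1 - κ * ‖z‖ ^ 2 : ℝ) : ℂ)) / (scale κ R : ℂ) ^ 2 -
        4 * κ * ((z.re : ℂ) ^ 2 + (z.im : ℂ) ^ 2) * (opDrift κ R z : ℂ) /
          ((1 - κ * ‖z‖ ^ 2 : ℝ) : ℂ) ^ 2) := by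
    rw [opPotential, ← hn]; push_cast; ring
  have hJ : (((1 - κ * ‖z‖ ^ 2)⁻¹ : ℝ) : ℂ) = ((1 - κ * ‖z‖ ^ 2 : ℝ) : ℂ)⁻¹ := Complex.ofReal_inv _
  have hc' : (scale κ R : ℂ) ≠ 0 := Complex.ofReal_ne_zero.2 hc
  have hD' : ((1 - κ * ‖z‖ ^ 2 : ℝ) : ℂ) ≠ 0 := Complex.ofReal_ne_zero.2 (hD z hz)
  have hE' : ((1 + κ * ‖z‖ ^ 2 : ℝ) : ℂ) ≠ 0 := Complex.ofReal_ne_zero.2 hE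
  have eA : (((kimuraOp κ R).a₁₁ z : ℝ) : ℂ) =
      (opScale κ R z : ℂ) * (1 - (opRadial κ R z : ℂ) * (z.re : ℂ) ^ 2) := by
    simp only [kimuraOp]; push_cast; ring
  have eB : (((kimuraOp κ R).a₁₂ z : ℝ) : ℂ) =
      -((opScale κ R z : ℂ) * (opRadial κ R z : ℂ) * (z.re * z.im)) := by
    simp only [kimuraOp]; push_cast; ring
  have eC : (((kimuraOp κ R).a₂₂ z : ℝ) : ℂ) =
      (opScale κ R z : ℂ) * (1 - (opRadial κ R z : ℂ) * (z.im : ℂ) ^ 2) := by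
    simp only [kimuraOp]; push_cast; ring
  have e1 : (((kimuraOp κ R).b₁ z : ℝ) : ℂ) = (opDrift κ R z : ℂ) * z.re := by
    simp only [kimuraOp]; push_cast; ring
  have e2 : (((kimuraOp κ R).b₂ z : ℝ) : ℂ) = (opDrift κ R z : ℂ) * z.im := by
    simp only [kimuraOp]; push_cast; ring
  have e3 : (((kimuraOp κ R).c z : ℝ) : ℂ) = (opPotential κ R z : ℂ) := rfl
  -- The identities for the second coordinate follow from those for the first by exchanging x and y.
  have hDy := hDx
  have hEy := hEx
  have hβy := hβ
  rw [add_comm ((z.re : ℂ) ^ 2)] at hDy hEy hβy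
  obtain ⟨s11, s12⟩ := symbol_identities hc' hD' hE' hDx hEx hJ hA hM
  obtain ⟨s22, -⟩ := symbol_identities hc' hD' hE' hDy hEy hJ hA hM
  have d1 := drift_identity hc' hD' hE' hDx hEx hJ hA hM hβ
  have d2 := drift_identity hc' hD' hE' hDy hEy hJ hA hM hβy
  have p0 := potential_identity hc' hD' hE' hDx hEx hJ hA hγ
  beta_reduce
  rw [eA, eB, eC, e1, e2, e3, hw]
  simp only [Complex.one_re, Complex.one_im, Complex.I_re, Complex.I_im, Complex.ofReal_one,
    Complex.ofReal_zero, Complex.ofReal_mul]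
  clear hA hM hβ hγ hβy hDx hEx hDy hEy hD' hE' hJ hw first second hW hWW hP hQ hPP hQQ eA eB eC e1 e2 e3
  generalize (((1 - κ * ‖z‖ ^ 2)⁻¹ : ℝ) : ℂ) = J at *
  generalize (opScale κ R z : ℂ) = A at *
  generalize (opRadial κ R z : ℂ) = m at *
  generalize (opDrift κ R z : ℂ) = β at *
  generalize (opPotential κ R z : ℂ) = γ at *
  generalize (scale κ R : ℂ) = c at *
  generalize (z.re : ℂ) = x at *
  generalize (z.im : ℂ) = y at *
  generalize dirDeriv S' 1 (dirDeriv S' 1 g) (straighten κ R z) = g11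
  generalize dirDeriv S' 1 (dirDeriv S' Complex.I g) (straighten κ R z) = g12
  generalize dirDeriv S' Complex.I (dirDeriv S' Complex.I g) (straighten κ R z) = g22
  generalize dirDeriv S' 1 g (straighten κ R z) = g1
  generalize dirDeriv S' Complex.I g (straighten κ R z) = g2
  generalize g (straighten κ R z) = g0
  linear_combination g0 * p0 + g1 * d1 + g2 * d2 - (2 * J - 1) * g11 * s11 -
    2 * (2 * J - 1) * g12 * s12 - (2 * J - 1) * g22 * s22

/-! ### Locality, coefficients and principal symbol of the operator -/

theorem dirDeriv_of_mem_nhds {S : Set ℂ} {z : ℂ} (hS : S ∈ 𝓝 z) (v : ℂ) (f : ℂ → ℂ) :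
    dirDeriv S v f z = fderiv ℝ f z v := by
  rw [dirDeriv, fderivWithin_of_mem_nhds hS]

/-- In the interior of the disk, second-order operators act as on the open disk. -/
theorem SecondOrderOp.apply_eq_applyOn_ball (L : SecondOrderOp) {R : ℝ} (f : ℂ → ℂ) {z : ℂ}
    (hz : ‖z‖ < R) : L.apply R f z = L.applyOn (Metric.ball 0 R) f z := by
  have hb : Metric.ball (0 : ℂ) R ∈ 𝓝 z := Metric.isOpen_ball.mem_nhds (by simpa using hz)
  have h1 : ∀ v, dirDeriv (disk R) v f z = dirDeriv (Metric.ball 0 R) v f z := fun v => by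
    rw [dirDeriv_of_mem_nhds (disk_mem_nhds hz), dirDeriv_of_mem_nhds hb]
  have h2 : ∀ u v, dirDeriv (disk R) u (dirDeriv (disk R) v f) z =
      dirDeriv (Metric.ball 0 R) u (dirDeriv (Metric.ball 0 R) v f) z := fun u v => by
    rw [dirDeriv_of_mem_nhds (disk_mem_nhds hz), dirDeriv_of_mem_nhds hb]
    have : dirDeriv (disk R) v f =ᶠ[𝓝 z] dirDeriv (Metric.ball 0 R) v f := by
      filter_upwards [hb] with y hy
      rw [dirDeriv_of_mem_nhds (disk_mem_nhds (by simpa using hy)),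
        dirDeriv_of_mem_nhds (Metric.isOpen_ball.mem_nhds hy)]
    rw [this.fderiv_eq]
  simp only [SecondOrderOp.apply_eq_applyOn, SecondOrderOp.applyOn, h1, h2]

theorem SecondOrderOp.applyOn_congr (L : SecondOrderOp) {S : Set ℂ} {f g : ℂ → ℂ}
    (h : EqOn f g S) {z : ℂ} (hz : z ∈ S) : L.applyOn S f z = L.applyOn S g z := by
  have h1 : ∀ v, EqOn (dirDeriv S v f) (dirDeriv S v g) S := fun v y hy => dirDeriv_congr h v hy
  rw [SecondOrderOp.applyOn, SecondOrderOp.applyOn, dirDeriv_congr (h1 _) _ hz,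
    dirDeriv_congr (h1 _) _ hz, dirDeriv_congr (h1 _) _ hz, h1 _ hz, h1 _ hz, h hz]

section

variable {κ R : ℝ}

theorem kimuraOp_apply (hR : 0 < R) (hκ : R ^ 2 * |κ| < 1) {g : ℂ → ℂ} (hg : SmoothOnDisk 1 g)
    {z : ℂ} (hz : z ∈ disk R) :
    (kimuraOp κ R).apply R (fun z => weight κ z * g (straighten κ R z)) z =
      weight κ z * zernike (disk 1) g (straighten κ R z) :=
  kimuraOp_applyOn hR hκ (uniqueDiffOn_disk hR) Subset.rfl (convex_disk 1)
    (interior_disk_nonempty one_pos) (fun _ h => straighten_mem_disk hR hκ h) hg hz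

/-- The version for functions that need not extend smoothly to the rim, such as I₀^*h. -/
theorem kimuraOp_apply_ball (hR : 0 < R) (hκ : R ^ 2 * |κ| < 1) {g : ℂ → ℂ}
    (hg : ContDiffOn ℝ ∞ g (Metric.ball 0 1)) {z : ℂ} (hz : ‖z‖ < R) :
    (kimuraOp κ R).apply R (fun z => weight κ z * g (straighten κ R z)) z =
      weight κ z * zernike (Metric.ball 0 1) g (straighten κ R z) := by
  have hsub : Metric.ball (0 : ℂ) R ⊆ disk R := Metric.ball_subset_closedBall
  rw [SecondOrderOp.apply_eq_applyOn_ball _ _ hz]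
  exact kimuraOp_applyOn hR hκ Metric.isOpen_ball.uniqueDiffOn hsub (convex_ball 0 1)
    (by rw [Metric.isOpen_ball.interior_eq]; exact ⟨0, by simp⟩)
    (fun y hy => (straighten_mem_ball_iff hR hκ (hsub hy)).2 hy) hg (by simpa using hz)

theorem kimuraOp_isSmooth (hR : 0 < R) (hκ : R ^ 2 * |κ| < 1) : (kimuraOp κ R).IsSmooth R := by
  have hc := (scale_pos hR hκ).ne'
  have hn : ContDiffOn ℝ ∞ (fun z : ℂ => ‖z‖ ^ 2) (disk R) := (contDiff_norm_sq ℝ).contDiffOn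
  have hD : ContDiffOn ℝ ∞ (fun z : ℂ => 1 - κ * ‖z‖ ^ 2) (disk R) :=
    contDiffOn_const.sub (contDiffOn_const.mul hn)
  have hE : ContDiffOn ℝ ∞ (fun z : ℂ => 1 + κ * ‖z‖ ^ 2) (disk R) :=
    contDiffOn_const.add (contDiffOn_const.mul hn)
  have hD0 : ∀ z ∈ disk R, 1 - κ * ‖z‖ ^ 2 ≠ 0 := fun z hz => (one_sub_pos hκ hz).ne'
  have hE0 : ∀ z ∈ disk R, 1 + κ * ‖z‖ ^ 2 ≠ 0 := fun z hz => (one_add_pos hκ hz).ne'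
  have hx : ContDiffOn ℝ ∞ (fun z : ℂ => z.re) (disk R) := Complex.reCLM.contDiff.contDiffOn
  have hy : ContDiffOn ℝ ∞ (fun z : ℂ => z.im) (disk R) := Complex.imCLM.contDiff.contDiffOn
  have hA : ContDiffOn ℝ ∞ (opScale κ R) (disk R) :=
    (hD.pow 2).div contDiffOn_const fun z _ => pow_ne_zero 2 hc
  have hm : ContDiffOn ℝ ∞ (opRadial κ R) (disk R) :=
    contDiffOn_const.div (hE.pow 2) fun z hz => pow_ne_zero 2 (hE0 z hz)
  have hβ : ContDiffOn ℝ ∞ (opDrift κ R) (disk R) :=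
    (((contDiffOn_const.mul hD).add ((contDiffOn_const.mul (hD.pow 2)).mul
      (contDiffOn_const.sub ((contDiffOn_const.mul hm).mul hn)))).add
      (((contDiffOn_const.mul hD).mul hE).mul (contDiffOn_const.sub (hm.mul hn)))).div
      (contDiffOn_const.mul hE) fun z hz => mul_ne_zero (pow_ne_zero 2 hc) (hE0 z hz)
  have hγ : ContDiffOn ℝ ∞ (opPotential κ R) (disk R) :=
    contDiffOn_const.add ((hD.div hE hE0).mul ((((contDiffOn_const.mul
      (contDiffOn_const.sub (hm.mul hn))).add (((contDiffOn_const.mul hn).mul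
      (contDiffOn_const.sub (hm.mul hn))).div hD hD0)).div contDiffOn_const
      fun z _ => pow_ne_zero 2 hc).sub (((contDiffOn_const.mul hn).mul hβ).div (hD.pow 2)
      fun z hz => pow_ne_zero 2 (hD0 z hz))))
  exact ⟨hA.mul (contDiffOn_const.sub (hm.mul (hx.pow 2))), ((hA.mul hm).mul (hx.mul hy)).neg,
    hA.mul (contDiffOn_const.sub (hm.mul (hy.pow 2))), hβ.mul hx, hβ.mul hy, hγ⟩

theorem kimuraOp_symbol (z ξ η : ℂ) : (kimuraOp κ R).symbol z ξ η = opScale κ R z *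
    (ξ.re * η.re + ξ.im * η.im -
      opRadial κ R z * ((ξ.re * z.re + ξ.im * z.im) * (η.re * z.re + η.im * z.im))) := by
  simp only [SecondOrderOp.symbol, kimuraOp]
  ring

theorem scale_sq_add (hR : 0 < R) :
    scale κ R ^ 2 + 4 * κ = (1 + κ * R ^ 2) ^ 2 / R ^ 2 := by
  rw [scale]; field_simp; ring

/-- This is the symbol in the radial direction up to the positive factor `opScale`; the simple
factor R - |z| is the Kimura degeneracy. -/
theorem one_sub_opRadial (hR : 0 < R) (hκ : R ^ 2 * |κ| < 1) {z : ℂ} (hz : z ∈ disk R) :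
    1 - opRadial κ R z * ‖z‖ ^ 2 = (1 - (κ * R * ‖z‖) ^ 2) * (R + ‖z‖) * (R - ‖z‖) /
      (R ^ 2 * (1 + κ * ‖z‖ ^ 2) ^ 2) := by
  have := (one_add_pos hκ hz).ne'
  rw [opRadial, scale_sq_add hR]
  field_simp
  ring

theorem one_sub_sq_pos (hR : 0 < R) (hκ : R ^ 2 * |κ| < 1) {z : ℂ} (hz : z ∈ disk R) :
    0 < 1 - (κ * R * ‖z‖) ^ 2 := by
  have h : |κ * R * ‖z‖| < 1 := by
    rw [abs_mul, abs_mul, abs_of_pos hR, abs_norm]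
    calc |κ| * R * ‖z‖ ≤ |κ| * R * R := by gcongr; exact mem_disk.1 hz
      _ = R ^ 2 * |κ| := by ring
      _ < 1 := hκ
  nlinarith [(sq_lt_one_iff_abs_lt_one _).2 h]

theorem opScale_pos (hR : 0 < R) (hκ : R ^ 2 * |κ| < 1) {z : ℂ} (hz : z ∈ disk R) :
    0 < opScale κ R z :=
  div_pos (pow_pos (one_sub_pos hκ hz) 2) (pow_pos (scale_pos hR hκ) 2)

/-- The symbol is `opScale` (|ξ|² - m(ξ·z)²) with m = `opRadial`. It is rotationally invariant,
hence diagonal in polar coordinates, with radial entry vanishing to first order at the rim. The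
collar of width R/2 keeps |z| smooth and nonzero. -/
theorem kimuraOp_isKimuraType (hR : 0 < R) (hκ : R ^ 2 * |κ| < 1) :
    (kimuraOp κ R).IsKimuraType R := by
  refine ⟨fun z hz ξ hξ => ?_, R / 2, by linarith, by linarith,
    fun z => opScale κ R z * ((1 - (κ * R * ‖z‖) ^ 2) * (R + ‖z‖) /
      (R ^ 2 * (1 + κ * ‖z‖ ^ 2) ^ 2)), fun z => opScale κ R z / ‖z‖ ^ 2, ?_, ?_, ?_⟩
  · have hd := mem_disk.2 hz.le
    have hs := opScale_pos hR hκ hd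
    have hE := one_add_pos hκ hd
    have h1 : 0 < 1 - opRadial κ R z * ‖z‖ ^ 2 := by
      rw [one_sub_opRadial hR hκ hd]
      have := one_sub_sq_pos hR hκ hd
      have h2 : 0 < R - ‖z‖ := by linarith
      have := norm_nonneg z
      positivity
    have hm : 0 ≤ opRadial κ R z := by
      rw [opRadial, scale_sq_add hR]; positivity
    have hξ' : 0 < ξ.re ^ 2 + ξ.im ^ 2 := by
      have := Complex.normSq_pos.2 hξ
      rw [Complex.normSq_apply] at this; linarith
    rw [kimuraOp_symbol]
    refine mul_pos hs ?_
    rw [Complex.sq_norm, Complex.normSq_apply] at h1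
    -- By Lagrange's identity |ξ|² - m(ξ·z)² = |ξ|²(1 - m|z|²) + m(ξ × z)².
    nlinarith [mul_pos hξ' h1, mul_nonneg hm (sq_nonneg (ξ.re * z.im - ξ.im * z.re))]
  · intro z hz
    have hz0 : z ≠ 0 := by
      rintro rfl; have := hz.1; simp at this; linarith
    have hd := mem_disk.2 hz.2
    have hn : ContDiffAt ℝ ∞ (fun z : ℂ => ‖z‖) z := contDiffAt_norm ℝ hz0
    have hE : ContDiffAt ℝ ∞ (fun z : ℂ => 1 + κ * ‖z‖ ^ 2) z :=
      contDiffAt_const.add (contDiffAt_const.mul (hn.pow 2))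
    have hA : ContDiffAt ℝ ∞ (opScale κ R) z :=
      ((contDiffAt_const.sub (contDiffAt_const.mul (hn.pow 2))).pow 2).div contDiffAt_const
        (pow_ne_zero 2 (scale_pos hR hκ).ne')
    exact (hA.mul (((contDiffAt_const.sub ((contDiffAt_const.mul hn).pow 2)).mul
      (contDiffAt_const.add hn)).div (contDiffAt_const.mul (hE.pow 2))
      (mul_ne_zero (pow_ne_zero 2 hR.ne')
        (pow_ne_zero 2 (one_add_pos hκ hd).ne')))).contDiffWithinAt
  · intro z hz
    have hz0 : z ≠ 0 := by
      rintro rfl; have := hz.1; simp at this; linarith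
    have hn : ContDiffAt ℝ ∞ (fun z : ℂ => ‖z‖) z := contDiffAt_norm ℝ hz0
    have hA : ContDiffAt ℝ ∞ (opScale κ R) z :=
      ((contDiffAt_const.sub (contDiffAt_const.mul (hn.pow 2))).pow 2).div contDiffAt_const
        (pow_ne_zero 2 (scale_pos hR hκ).ne')
    exact (hA.div (hn.pow 2) (pow_ne_zero 2 (norm_ne_zero_iff.2 hz0))).contDiffWithinAt
  · intro z h1 h2
    have hρ : 0 < ‖z‖ := by linarith
    have hd := mem_disk.2 h2
    have hs := opScale_pos hR hκ hd
    have hE := one_add_pos hκ hd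
    have hq := one_sub_sq_pos hR hκ hd
    have hsq : z.re ^ 2 + z.im ^ 2 = ‖z‖ ^ 2 := by
      rw [Complex.sq_norm, Complex.normSq_apply]; ring
    have r1 : (-dRho z).re = -(z.re / ‖z‖) := by
      rw [Complex.neg_re, dRho, Complex.div_ofReal_re]
    have r2 : (-dRho z).im = -(z.im / ‖z‖) := by
      rw [Complex.neg_im, dRho, Complex.div_ofReal_im]
    have o1 : (dOmega z).re = -(z.im / ‖z‖ ^ 2) := by
      rw [dOmega, ← Complex.ofReal_pow, Complex.div_ofReal_re]; simp [neg_div]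
    have o2 : (dOmega z).im = z.re / ‖z‖ ^ 2 := by
      rw [dOmega, ← Complex.ofReal_pow, Complex.div_ofReal_im]; simp
    refine ⟨by positivity, by positivity, ?_, ?_, ?_⟩
    · have := one_sub_opRadial hR hκ hd
      rw [kimuraOp_symbol, r1, r2, show -(z.re / ‖z‖) * -(z.re / ‖z‖) +
        -(z.im / ‖z‖) * -(z.im / ‖z‖) = 1 by field_simp; linarith,
        show -(z.re / ‖z‖) * z.re + -(z.im / ‖z‖) * z.im = -‖z‖ by field_simp; linarith,
        show (-‖z‖) * (-‖z‖) = ‖z‖ ^ 2 by ring, this]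
      ring
    · rw [kimuraOp_symbol, r1, r2, o1, o2]
      ring
    · rw [kimuraOp_symbol, o1, o2, show -(z.im / ‖z‖ ^ 2) * -(z.im / ‖z‖ ^ 2) +
        z.re / ‖z‖ ^ 2 * (z.re / ‖z‖ ^ 2) = 1 / ‖z‖ ^ 2 by field_simp; linarith]
      ring

end

section

variable {κ R : ℝ}

/-! ### The area measure in the straightened coordinates -/

theorem det_complex (A : ℂ →L[ℝ] ℂ) :
    A.det = (A 1).re * (A Complex.I).im - (A Complex.I).re * (A 1).im := by
  rw [ContinuousLinearMap.det, ← LinearMap.det_toMatrix Complex.basisOneI, Matrix.det_fin_two]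
  simp [LinearMap.toMatrix_apply]

theorem image_straighten (hR : 0 < R) (hκ : R ^ 2 * |κ| < 1) :
    straighten κ R '' Metric.ball 0 R = Metric.ball 0 1 := by
  have hsub : Metric.ball (0 : ℂ) R ⊆ disk R := Metric.ball_subset_closedBall
  have hsub' : Metric.ball (0 : ℂ) 1 ⊆ disk 1 := Metric.ball_subset_closedBall
  ext x
  constructor
  · rintro ⟨z, hz, rfl⟩
    exact (straighten_mem_ball_iff hR hκ (hsub hz)).2 hz
  · intro hx
    exact ⟨unstraighten κ R x, unstraighten_mem_ball hR hκ hx,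
      straighten_unstraighten hR hκ (hsub' hx)⟩

theorem injOn_straighten (hR : 0 < R) (hκ : R ^ 2 * |κ| < 1) :
    InjOn (straighten κ R) (disk R) := fun z hz y hy h => by
  rw [← unstraighten_straighten hR hκ hz, h, unstraighten_straighten hR hκ hy]

/-- The Jacobian is c²(1 + κ|z|²)/(1 - κ|z|²)³, written as the area density times c²w³. -/
theorem det_fderivWithin_straighten (hκ : R ^ 2 * |κ| < 1) {z : ℂ}
    (hz : z ∈ Metric.ball (0 : ℂ) R) :
    (fderivWithin ℝ (straighten κ R) (Metric.ball 0 R) z).det =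
      scale κ R ^ 2 * weight κ z ^ 3 * ((1 + κ * ‖z‖ ^ 2) ^ 2)⁻¹ := by
  have hsub : Metric.ball (0 : ℂ) R ⊆ disk R := Metric.ball_subset_closedBall
  have hS : UniqueDiffOn ℝ (Metric.ball (0 : ℂ) R) := Metric.isOpen_ball.uniqueDiffOn
  have hD : ∀ z ∈ Metric.ball (0 : ℂ) R, 1 - κ * ‖z‖ ^ 2 ≠ 0 :=
    fun z hz => (one_sub_pos hκ (hsub hz)).ne'
  have hd := ((contDiffOn_straighten (R := R) hκ).mono hsub).differentiableOn (n := ∞) (by simp)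
  have hP : ∀ v, HasDirDeriv _ v (fun z => ((straighten κ R z).re : ℂ)) _ := fun v =>
    ((hasDirDeriv_re (v := v) hS).mul_inv hS (scale κ R) hD).congr fun z _ => by
      rw [straighten_re]; push_cast; ring
  have hQ : ∀ v, HasDirDeriv _ v (fun z => ((straighten κ R z).im : ℂ)) _ := fun v =>
    ((hasDirDeriv_im (v := v) hS).mul_inv hS (scale κ R) hD).congr fun z _ => by
      rw [straighten_im]; push_cast; ring
  have p1 := ofReal_re_fderivWithin hS hd (hP 1) hz
  have p2 := ofReal_re_fderivWithin hS hd (hP Complex.I) hz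
  have q1 := ofReal_im_fderivWithin hS hd (hQ 1) hz
  have q2 := ofReal_im_fderivWithin hS hd (hQ Complex.I) hz
  have h1 := hD z hz
  have h2 := (one_add_pos hκ (hsub hz)).ne'
  have hn : z.re ^ 2 + z.im ^ 2 = ‖z‖ ^ 2 := by
    rw [Complex.sq_norm, Complex.normSq_apply]; ring
  simp only [Complex.one_re, Complex.one_im, Complex.I_re, Complex.I_im] at p1 p2 q1 q2
  norm_cast at p1 p2 q1 q2
  rw [det_complex, p1, p2, q1, q2, weight]
  field_simp
  linear_combination (2 * κ * scale κ R ^ 2 * (1 - κ * ‖z‖ ^ 2)) * hn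

theorem restrict_disk (R : ℝ) : (volume : Measure ℂ).restrict (disk R) =
    volume.restrict (Metric.ball 0 R) := by
  refine Measure.restrict_congr_set ?_
  rw [disk, ← Metric.ball_union_sphere]
  exact union_ae_eq_left_of_ae_eq_empty
    (ae_eq_empty.2 (Measure.addHaar_sphere volume (0 : ℂ) R))

theorem areaMeasure_eq (κ R : ℝ) : areaMeasure κ R =
    (volume.restrict (Metric.ball (0 : ℂ) R)).withDensity
      fun z => ENNReal.ofReal ((1 + κ * ‖z‖ ^ 2) ^ 2)⁻¹ := by
  rw [areaMeasure, restrict_disk]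
  congr 1
  funext z
  rw [metric, Matrix.det_smul, Matrix.det_one, mul_one, Fintype.card_fin, Real.sqrt_sq (by positivity)]

theorem measurable_areaDensity (κ : ℝ) :
    Measurable fun z : ℂ => ENNReal.ofReal ((1 + κ * ‖z‖ ^ 2) ^ 2)⁻¹ := by
  fun_prop

theorem hasFDerivWithinAt_straighten (hκ : R ^ 2 * |κ| < 1) {z : ℂ}
    (hz : z ∈ Metric.ball (0 : ℂ) R) : HasFDerivWithinAt (straighten κ R)
      (fderivWithin ℝ (straighten κ R) (Metric.ball 0 R) z) (Metric.ball 0 R) z :=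
  ((((contDiffOn_straighten (R := R) hκ).mono Metric.ball_subset_closedBall).differentiableOn
    (n := ∞) (by simp)) z hz).hasFDerivWithinAt

theorem abs_det_fderivWithin_straighten (hR : 0 < R) (hκ : R ^ 2 * |κ| < 1) (F : ℂ → ℂ) {z : ℂ}
    (hz : z ∈ Metric.ball (0 : ℂ) R) :
    |(fderivWithin ℝ (straighten κ R) (Metric.ball 0 R) z).det| • F (straighten κ R z) =
      (scale κ R ^ 2 : ℝ) * ((ENNReal.ofReal ((1 + κ * ‖z‖ ^ 2) ^ 2)⁻¹).toReal •
        ((weight κ z : ℂ) ^ 3 * F (straighten κ R z))) := by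
  have hw := weight_pos hκ (Metric.ball_subset_closedBall hz)
  have hc := scale_pos hR hκ
  rw [det_fderivWithin_straighten hκ hz, abs_of_nonneg (by positivity),
    ENNReal.toReal_ofReal (by positivity), Complex.real_smul, Complex.real_smul]
  push_cast
  ring

theorem integrable_areaMeasure (hR : 0 < R) (hκ : R ^ 2 * |κ| < 1) {F : ℂ → ℂ}
    (hF : IntegrableOn F (Metric.ball 0 1)) :
    Integrable (fun z => (weight κ z : ℂ) ^ 3 * F (straighten κ R z)) (areaMeasure κ R) := by
  have hc := (scale_pos hR hκ).ne'
  rw [areaMeasure_eq, integrable_withDensity_iff_integrable_smul' (measurable_areaDensity κ)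
    (by simp)]
  rw [← image_straighten hR hκ, integrableOn_image_iff_integrableOn_abs_det_fderiv_smul volume
    measurableSet_ball (fun z hz => hasFDerivWithinAt_straighten hκ hz)
    ((injOn_straighten hR hκ).mono Metric.ball_subset_closedBall)] at hF
  have h1 : IntegrableOn (fun z => (((scale κ R ^ 2)⁻¹ : ℝ) : ℂ) *
      (|(fderivWithin ℝ (straighten κ R) (Metric.ball 0 R) z).det| • F (straighten κ R z)))
      (Metric.ball 0 R) := hF.const_mul _
  refine h1.congr_fun (fun z hz => ?_) measurableSet_ball
  beta_reduce
  rw [abs_det_fderivWithin_straighten hR hκ F hz, ← mul_assoc, ← Complex.ofReal_mul,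
    inv_mul_cancel₀ (pow_ne_zero 2 hc), Complex.ofReal_one, one_mul]

/-- Change of variables; the sphere has measure zero, so the open disk, on which the straightening
is injective and differentiable, suffices. -/
theorem integral_areaMeasure (hR : 0 < R) (hκ : R ^ 2 * |κ| < 1) (F : ℂ → ℂ) :
    ∫ z, (weight κ z : ℂ) ^ 3 * F (straighten κ R z) ∂(areaMeasure κ R) =
      ((scale κ R ^ 2)⁻¹ : ℝ) * ∫ x in Metric.ball 0 1, F x := by
  have hc := (scale_pos hR hκ).ne'
  rw [areaMeasure_eq, integral_withDensity_eq_integral_toReal_smul (measurable_areaDensity κ)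
    (by simp), ← image_straighten hR hκ, integral_image_eq_integral_abs_det_fderiv_smul volume
    measurableSet_ball (fun z hz => hasFDerivWithinAt_straighten hκ hz)
    ((injOn_straighten hR hκ).mono Metric.ball_subset_closedBall),
    setIntegral_congr_fun measurableSet_ball
      (fun z hz => abs_det_fderivWithin_straighten hR hκ F hz), integral_const_mul, ← mul_assoc,
    ← Complex.ofReal_mul, inv_mul_cancel₀ (pow_ne_zero 2 hc), Complex.ofReal_one, one_mul]

theorem ae_areaMeasure_mem (κ R : ℝ) : ∀ᵐ z ∂(areaMeasure κ R), z ∈ Metric.ball (0 : ℂ) R := by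
  rw [areaMeasure_eq]
  exact (withDensity_absolutelyContinuous _ _).ae_le (ae_restrict_mem measurableSet_ball)

/-! ### The quadratic form of the operator -/

/-- The function `(u / w) ∘ straighten⁻¹`. -/
def unweight (κ R : ℝ) (u : ℂ → ℂ) (x : ℂ) : ℂ :=
  u (unstraighten κ R x) / weight κ (unstraighten κ R x)

theorem smoothOnDisk_unweight (hR : 0 < R) (hκ : R ^ 2 * |κ| < 1) {u : ℂ → ℂ}
    (hu : SmoothOnDisk R u) : SmoothOnDisk 1 (unweight κ R u) := by
  have hΦ := contDiffOn_unstraighten hR hκ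
  have hm : MapsTo (unstraighten κ R) (disk 1) (disk R) := fun x hx =>
    unstraighten_mem_disk hR hκ hx
  have hw := ((contDiffOn_weight (R := R) hκ).comp hΦ hm).inv
    fun x hx => (weight_pos hκ (hm hx)).ne'
  refine ((ContDiffOn.comp hu hΦ hm).mul (Complex.ofRealCLM.contDiff.comp_contDiffOn hw)).congr
    fun x _ => ?_
  simp [unweight, div_eq_mul_inv]

theorem weight_mul_unweight (hR : 0 < R) (hκ : R ^ 2 * |κ| < 1) (u : ℂ → ℂ) {z : ℂ}
    (hz : z ∈ disk R) : weight κ z * unweight κ R u (straighten κ R z) = u z := by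
  have := Complex.ofReal_ne_zero.2 (weight_pos hκ hz).ne'
  rw [unweight, unstraighten_straighten hR hκ hz]
  field_simp

/-- For functions of the form w·(g∘Ψ) the weight of the inner product completes w² to w³, the
Jacobian factor. So g ↦ w·(g∘Ψ) is unitary up to a constant. -/
theorem innerW_eq (hR : 0 < R) (hκ : R ^ 2 * |κ| < 1) {u v g k : ℂ → ℂ}
    (hu : ∀ z ∈ disk R, u z = weight κ z * g (straighten κ R z))
    (hv : ∀ z ∈ disk R, v z = weight κ z * k (straighten κ R z)) :
    innerW κ R (weight κ) u v =
      ((scale κ R ^ 2)⁻¹ : ℝ) * ∫ x in Metric.ball 0 1, g x * (starRingEnd ℂ) (k x) := by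
  rw [← integral_areaMeasure hR hκ (fun x => g x * (starRingEnd ℂ) (k x)), innerW]
  refine integral_congr_ae ?_
  filter_upwards [ae_areaMeasure_mem κ R] with z hz
  have hd : z ∈ disk R := Metric.ball_subset_closedBall hz
  rw [hu z hd, hv z hd, map_mul, Complex.conj_ofReal]
  ring

theorem kimuraOp_apply_eq (hR : 0 < R) (hκ : R ^ 2 * |κ| < 1) {u : ℂ → ℂ}
    (hu : SmoothOnDisk R u) {z : ℂ} (hz : z ∈ disk R) : (kimuraOp κ R).apply R u z =
      weight κ z * zernike (disk 1) (unweight κ R u) (straighten κ R z) := by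
  rw [← kimuraOp_apply hR hκ (smoothOnDisk_unweight hR hκ hu) hz, SecondOrderOp.apply_eq_applyOn,
    SecondOrderOp.apply_eq_applyOn]
  exact SecondOrderOp.applyOn_congr _ (fun y hy => (weight_mul_unweight hR hκ u hy).symm) hz

theorem innerW_kimuraOp_symm (hR : 0 < R) (hκ : R ^ 2 * |κ| < 1) {u v : ℂ → ℂ}
    (hu : SmoothOnDisk R u) (hv : SmoothOnDisk R v) :
    innerW κ R (weight κ) ((kimuraOp κ R).apply R u) v =
      innerW κ R (weight κ) u ((kimuraOp κ R).apply R v) := by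
  rw [innerW_eq hR hκ (fun z hz => kimuraOp_apply_eq hR hκ hu hz)
    (fun z hz => (weight_mul_unweight hR hκ v hz).symm),
    innerW_eq hR hκ (fun z hz => (weight_mul_unweight hR hκ u hz).symm)
    (fun z hz => kimuraOp_apply_eq hR hκ hv hz),
    integral_zernike_conj_symm (smoothOnDisk_unweight hR hκ hu) (smoothOnDisk_unweight hR hκ hv)]

theorem innerW_le_innerW_kimuraOp (hR : 0 < R) (hκ : R ^ 2 * |κ| < 1) {u : ℂ → ℂ}
    (hu : SmoothOnDisk R u) : (innerW κ R (weight κ) u u).re ≤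
      (innerW κ R (weight κ) ((kimuraOp κ R).apply R u) u).re := by
  rw [innerW_eq hR hκ (fun z hz => kimuraOp_apply_eq hR hκ hu hz)
    (fun z hz => (weight_mul_unweight hR hκ u hz).symm),
    innerW_eq hR hκ (fun z hz => (weight_mul_unweight hR hκ u hz).symm)
    (fun z hz => (weight_mul_unweight hR hκ u hz).symm), Complex.re_ofReal_mul,
    Complex.re_ofReal_mul]
  exact mul_le_mul_of_nonneg_left (integral_norm_sq_le_zernike (smoothOnDisk_unweight hR hκ hu))
    (by positivity)

theorem integral_mul_conj_pos {g : ℂ → ℂ} (hg : ContinuousOn g (disk 1))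
    (h0 : ∃ x ∈ disk 1, g x ≠ 0) :
    0 < (∫ x in Metric.ball (0 : ℂ) 1, g x * (starRingEnd ℂ) (g x)).re := by
  have hsub : Metric.ball (0 : ℂ) 1 ⊆ disk 1 := Metric.ball_subset_closedBall
  have e : ∀ x, g x * (starRingEnd ℂ) (g x) = ((‖g x‖ ^ 2 : ℝ) : ℂ) := fun x => by
    rw [Complex.mul_conj', Complex.ofReal_pow]
  simp only [e]
  rw [integral_complex_ofReal, Complex.ofReal_re]
  have hi : IntegrableOn (fun x => ‖g x‖ ^ 2) (Metric.ball (0 : ℂ) 1) :=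
    ((hg.norm.pow 2).integrableOn_compact (isCompact_closedBall 0 1)).mono_set hsub
  refine lt_of_le_of_ne (integral_nonneg fun x => by positivity) fun h => ?_
  have h1 := (integral_eq_zero_iff_of_nonneg (fun x => sq_nonneg ‖g x‖) hi).1 h.symm
  have h2 : EqOn g 0 (Metric.ball (0 : ℂ) 1) := by
    refine Measure.eqOn_open_of_ae_eq (μ := volume) ?_ Metric.isOpen_ball (hg.mono hsub)
      continuousOn_const
    filter_upwards [h1] with x hx
    simpa using hx
  obtain ⟨x, hx, hne⟩ := h0
  refine hne (h2.of_subset_closure hg continuousOn_const hsub ?_ hx)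
  rw [closure_ball (0 : ℂ) one_ne_zero]
  exact Subset.rfl

theorem innerW_self_pos (hR : 0 < R) (hκ : R ^ 2 * |κ| < 1) {u : ℂ → ℂ}
    (hu : SmoothOnDisk R u) (h0 : ∃ z ∈ disk R, u z ≠ 0) :
    0 < (innerW κ R (weight κ) u u).re := by
  have hc := scale_pos hR hκ
  obtain ⟨z, hz, hne⟩ := h0
  rw [innerW_eq hR hκ (fun z hz => (weight_mul_unweight hR hκ u hz).symm)
    (fun z hz => (weight_mul_unweight hR hκ u hz).symm), Complex.re_ofReal_mul]
  refine mul_pos (by positivity) (integral_mul_conj_pos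
    (smoothOnDisk_unweight hR hκ hu).continuousOn
    ⟨_, straighten_mem_disk hR hκ hz, fun h => hne ?_⟩)
  rw [← weight_mul_unweight hR hκ u hz, h, mul_zero]

end

/-! ### The operator `T` -/

/-- The vector field `∂_β - (D / a) ∂_α` with its zeroth-order correction. -/
def fanOp (κ R : ℝ) : FirstOrderOp where
  a _ := 1
  b p := -(spread κ R p.2 / rimFactor κ R)
  c p := (1 - rimFactor κ R ^ 2) * Real.sin p.2 * Real.cos p.2 / rimFactor κ R

theorem isOpen_strip : IsOpen strip := isOpen_univ.prod isOpen_Ioo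

section

variable {κ R : ℝ}

theorem fanOp_isSmooth : (fanOp κ R).IsSmooth := by
  have hs : ContDiffOn ℝ ∞ (fun p : ℝ × ℝ => Real.sin p.2) strip :=
    (Real.contDiff_sin.comp contDiff_snd).contDiffOn
  have hc : ContDiffOn ℝ ∞ (fun p : ℝ × ℝ => Real.cos p.2) strip :=
    (Real.contDiff_cos.comp contDiff_snd).contDiffOn
  refine ⟨fun _ _ => rfl, fun _ _ => rfl, fun _ _ => rfl, contDiffOn_const, ?_, ?_,
    fun p _ => Or.inl one_ne_zero⟩
  · exact (((hc.pow 2).add (contDiffOn_const.mul (hs.pow 2))).div_const _).neg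
  · exact ((contDiffOn_const.mul hs).mul hc).div_const _

theorem SmoothOnBdry.apply {T : FirstOrderOp} (hT : T.IsSmooth) {h : ℝ × ℝ → ℂ}
    (hh : SmoothOnBdry h) : SmoothOnBdry (T.apply h) := by
  obtain ⟨pa, pb, pc, sa, sb, sc, -⟩ := hT
  obtain ⟨hp, hs⟩ := hh
  have hf : ∀ β α : ℝ, fderiv ℝ h (β + 2 * Real.pi, α) = fderiv ℝ h (β, α) := fun β α => by
    have e : (fun p : ℝ × ℝ => h (p + (2 * Real.pi, 0))) = h := by
      funext p
      rw [show p + (2 * Real.pi, 0) = (p.1 + 2 * Real.pi, p.2) by ext <;> simp]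
      exact hp _ _
    have := fderiv_comp_add_right (𝕜 := ℝ) (f := h) (x := (β, α)) (2 * Real.pi, (0 : ℝ))
    rw [e] at this
    rw [this]; simp
  have hd : ∀ v, ContDiffOn ℝ ∞ (fun p => fderiv ℝ h p v) strip := fun v =>
    (hs.fderiv_of_isOpen isOpen_strip (m := ∞) (by simp)).clm_apply contDiffOn_const
  have ho : ∀ {k : ℝ × ℝ → ℝ}, ContDiffOn ℝ ∞ k strip →
      ContDiffOn ℝ ∞ (fun p => (k p : ℂ)) strip := fun hk =>
    Complex.ofRealCLM.contDiff.comp_contDiffOn hk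
  refine ⟨fun β α => ?_, (((ho sa).mul (hd _)).add ((ho sb).mul (hd _))).add ((ho sc).mul hs)⟩
  rw [FirstOrderOp.apply, FirstOrderOp.apply, hf, pa, pb, pc, hp]

theorem SmoothOnBdry.negSq {T : FirstOrderOp} (hT : T.IsSmooth) {h : ℝ × ℝ → ℂ}
    (hh : SmoothOnBdry h) : SmoothOnBdry (T.negSq h) := by
  obtain ⟨hp, hs⟩ := (hh.apply hT).apply hT
  exact ⟨fun β α => by rw [FirstOrderOp.negSq, FirstOrderOp.negSq, hp], hs.neg⟩

/-- The function `√D h` in the coordinates of the chords. -/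
def liftKernel (κ R : ℝ) (h : ℝ × ℝ → ℂ) (p : ℝ × ℝ) : ℂ :=
  ((√(1 + relCurv κ R * p.1 ^ 2))⁻¹ : ℝ) * h (bdryOf κ R p)

/-- On the chord of offset q one has cos α = √(1 - q²)√D, so D/cos α = √D/√(1 - q²). -/
theorem starKernel_eq (hR : 0 < R) (hκ : R ^ 2 * |κ| < 1) (h : ℝ × ℝ → ℂ) {q : ℝ}
    (hq : q ∈ Ioo (-1 : ℝ) 1) (θ : ℝ) :
    starKernel κ R h (q, θ) = ((√(1 - q ^ 2))⁻¹ : ℝ) * liftKernel κ R h (q, θ) := by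
  have hl := one_add_relCurv_pos hR hκ (sq_lt_one_of_mem hq).le
  have hl' := Real.sqrt_pos.2 hl
  have hp := sqrt_one_sub_sq_pos hq
  rw [starKernel, liftKernel, mu, spread_bdryOf hR hκ hq, (cos_sin_bdryOf hR hκ hq θ).1,
    ← mul_assoc, ← Complex.ofReal_mul]
  congr 2
  have := Real.sq_sqrt hl.le
  simp only
  generalize √(1 + relCurv κ R * q ^ 2) = l at *
  rw [← this]
  field_simp

/-- Multiplied by -√(1 - q²), the velocity is (1, -D/a): this is the vector field of `fanOp`. -/
theorem hasDerivAt_bdryOf (hR : 0 < R) (hκ : R ^ 2 * |κ| < 1) {q : ℝ} (hq : q ∈ Ioo (-1 : ℝ) 1)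
    (θ : ℝ) : HasDerivAt (fun q => bdryOf κ R (q, θ)) (-(√(1 - q ^ 2))⁻¹,
      (rimFactor κ R * √(1 - q ^ 2) * (1 + relCurv κ R * q ^ 2))⁻¹) q := by
  have ha := rimFactor_pos hκ
  have hp := sqrt_one_sub_sq_pos hq
  have hl := one_add_relCurv_pos hR hκ (sq_lt_one_of_mem hq).le
  have hp2 := Real.sq_sqrt (sub_nonneg.2 (sq_lt_one_of_mem hq).le)
  have h1 := rimFactor_sq_mul hR hκ
  refine HasDerivAt.prodMk ?_ ?_
  · exact ((Real.hasDerivAt_arcsin hq.1.ne' hq.2.ne).const_sub (θ - Real.pi)).congr_deriv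
      (by rw [one_div])
  · refine ((((hasDerivAt_id q).div ((hasDerivAt_sqrt_one_sub_sq hq).const_mul _)
      (mul_ne_zero ha.ne' hp.ne')).arctan)).congr_deriv ?_
    have h2 : 1 - q ^ 2 = √(1 - q ^ 2) ^ 2 := hp2.symm
    simp only [Pi.div_apply, id]
    generalize √(1 - q ^ 2) = P at *
    have h3 : (rimFactor κ R * P) ^ 2 + q ^ 2 ≠ 0 := by positivity
    have h4 : 1 + (q / (rimFactor κ R * P)) ^ 2 =
      (rimFactor κ R * P) ^ 2 / ((rimFactor κ R * P) ^ 2) * (1 + relCurv κ R * q ^ 2) / P ^ 2 := by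
      field_simp
      rw [← h2]
      linear_combination (-q ^ 2) * h1
    rw [h4]
    have h5 : P ^ 2 + q ^ 2 = 1 := by linarith
    field_simp
    linear_combination h5

/-- After multiplication by √D, `fanOp` becomes -√(1 - q²)∂_q; its zeroth-order term absorbs the
derivative of √D = 1/√(1 + `relCurv` q²). -/
theorem hasDerivAt_liftKernel (hR : 0 < R) (hκ : R ^ 2 * |κ| < 1) {h : ℝ × ℝ → ℂ}
    (hh : ContDiffOn ℝ ∞ h strip) {q : ℝ} (hq : q ∈ Ioo (-1 : ℝ) 1) (θ : ℝ) :
    HasDerivAt (fun q => liftKernel κ R h (q, θ))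
      (-(((√(1 - q ^ 2))⁻¹ : ℝ) * liftKernel κ R ((fanOp κ R).apply h) (q, θ))) q := by
  have ha := rimFactor_pos hκ
  have hp := sqrt_one_sub_sq_pos hq
  have hl := one_add_relCurv_pos hR hκ (sq_lt_one_of_mem hq).le
  have hl' := Real.sqrt_pos.2 hl
  have hl2 := Real.sq_sqrt hl.le
  have hp2 := Real.sq_sqrt (sub_nonneg.2 (sq_lt_one_of_mem hq).le)
  have h1 := rimFactor_sq_mul hR hκ
  have hm := bdryOf_mem_strip κ R (q, θ)
  have hd := ((hh.differentiableOn (by simp)) _ hm).differentiableAt (isOpen_strip.mem_nhds hm)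
  have hcomp := hd.hasFDerivAt.comp_hasDerivAt q (hasDerivAt_bdryOf hR hκ hq θ)
  have hs : HasDerivAt (fun q : ℝ => (√(1 + relCurv κ R * q ^ 2))⁻¹)
      (-(relCurv κ R * q / (√(1 + relCurv κ R * q ^ 2) ^ 3))) q := by
    have := (((((hasDerivAt_pow 2 q).const_mul (relCurv κ R)).const_add 1).sqrt hl.ne').inv hl'.ne')
    refine this.congr_deriv ?_
    generalize √(1 + relCurv κ R * q ^ 2) = l at *
    field_simp
    norm_num
  refine (hs.ofReal_comp.mul hcomp).congr_deriv ?_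
  have e : fderiv ℝ h (bdryOf κ R (q, θ)) (-(√(1 - q ^ 2))⁻¹,
      (rimFactor κ R * √(1 - q ^ 2) * (1 + relCurv κ R * q ^ 2))⁻¹) =
      (-(√(1 - q ^ 2))⁻¹ : ℝ) * fderiv ℝ h (bdryOf κ R (q, θ)) (1, 0) +
      ((rimFactor κ R * √(1 - q ^ 2) * (1 + relCurv κ R * q ^ 2))⁻¹ : ℝ) *
        fderiv ℝ h (bdryOf κ R (q, θ)) (0, 1) := by
    rw [← Complex.real_smul, ← Complex.real_smul, ← map_smul, ← map_smul, ← map_add]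
    simp
  obtain ⟨hc, hsn⟩ := cos_sin_bdryOf hR hκ hq θ
  have hc0 : (fanOp κ R).c (bdryOf κ R (q, θ)) =
      relCurv κ R * q * √(1 - q ^ 2) / √(1 + relCurv κ R * q ^ 2) ^ 2 := by
    simp only [fanOp]
    rw [hc, hsn, ← h1]
    field_simp
  have hb0 : (fanOp κ R).b (bdryOf κ R (q, θ)) =
      -(1 / √(1 + relCurv κ R * q ^ 2) ^ 2 / rimFactor κ R) := by
    simp only [fanOp]
    rw [spread_bdryOf hR hκ hq, hl2]
  have ha0 : (fanOp κ R).a (bdryOf κ R (q, θ)) = 1 := rfl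
  rw [e, liftKernel, FirstOrderOp.apply, hc0, hb0, ha0, ← hl2]
  simp only [Function.comp_apply]
  generalize fderiv ℝ h (bdryOf κ R (q, θ)) (1, 0) = X
  generalize fderiv ℝ h (bdryOf κ R (q, θ)) (0, 1) = Y
  generalize h (bdryOf κ R (q, θ)) = Z
  rw [hl2]
  generalize √(1 + relCurv κ R * q ^ 2) = l at *
  generalize √(1 - q ^ 2) = P at *
  rw [← hl2]
  have i1 : (l : ℂ) ≠ 0 := Complex.ofReal_ne_zero.2 hl'.ne'
  have i2 : (P : ℂ) ≠ 0 := Complex.ofReal_ne_zero.2 hp.ne'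
  have i3 : (rimFactor κ R : ℂ) ≠ 0 := Complex.ofReal_ne_zero.2 ha.ne'
  push_cast
  field_simp
  ring

/-- `-T²` is the Zernike operator in the offset variable. -/
theorem starKernel_negSq (hR : 0 < R) (hκ : R ^ 2 * |κ| < 1) {h : ℝ × ℝ → ℂ}
    (hh : SmoothOnBdry h) (θ : ℝ) {k₁ k₂ : ℝ → ℂ}
    (hk : ∀ q ∈ Ioo (-1 : ℝ) 1, HasDerivAt (fun q => starKernel κ R h (q, θ)) (k₁ q) q ∧
      HasDerivAt k₁ (k₂ q) q) {q : ℝ} (hq : q ∈ Ioo (-1 : ℝ) 1) :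
    starKernel κ R ((fanOp κ R).negSq h) (q, θ) =
      -((1 - q ^ 2) * k₂ q) + 3 * q * k₁ q + starKernel κ R h (q, θ) := by
  have hp : ∀ {q : ℝ}, q ∈ Ioo (-1 : ℝ) 1 → (√(1 - q ^ 2) : ℂ) ≠ 0 := fun hq =>
    Complex.ofReal_ne_zero.2 (sqrt_one_sub_sq_pos hq).ne'
  have hp2 : ∀ {q : ℝ}, q ∈ Ioo (-1 : ℝ) 1 → (√(1 - q ^ 2) : ℂ) ^ 2 = 1 - q ^ 2 := fun {q} hq => by
    rw [← Complex.ofReal_pow, Real.sq_sqrt (sub_nonneg.2 (sq_lt_one_of_mem hq).le)]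
    push_cast; ring
  have hK : ∀ q ∈ Ioo (-1 : ℝ) 1, liftKernel κ R h (q, θ) =
      (√(1 - q ^ 2) : ℂ) * starKernel κ R h (q, θ) := fun q hq => by
    rw [starKernel_eq hR hκ h hq, Complex.ofReal_inv, mul_inv_cancel_left₀ (hp hq)]
  -- `liftKernel` is √(1 - q²) k with k = `starKernel`, and -√(1 - q²)∂_q(√(1 - q²) k) = -((1 -
  -- q²)k' - qk); no square root is left, so the operator can be applied once more.
  have hT : ∀ q ∈ Ioo (-1 : ℝ) 1, liftKernel κ R ((fanOp κ R).apply h) (q, θ) =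
      -((1 - q ^ 2) * k₁ q - q * starKernel κ R h (q, θ)) := by
    intro q hq
    have h1 := hasDerivAt_liftKernel hR hκ hh.2 hq θ
    have h2 := ((hasDerivAt_sqrt_one_sub_sq hq).ofReal_comp.mul (hk q hq).1).congr_of_eventuallyEq
      (by filter_upwards [isOpen_Ioo.mem_nhds hq] with y hy using hK y hy)
    have h3 := h1.unique h2
    have h4 := hp2 hq
    have h5 := hp hq
    push_cast at h3
    generalize (√(1 - q ^ 2) : ℂ) = P at *
    field_simp at h3
    rw [h4] at h3
    linear_combination -h3
  have h1 := hasDerivAt_liftKernel hR hκ (hh.apply (fanOp_isSmooth (κ := κ) (R := R))).2 hq θ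
  have h2 := (((((hasDerivAt_pow 2 q).const_sub 1).ofReal_comp.mul (hk q hq).2).sub
    ((hasDerivAt_id q).ofReal_comp.mul (hk q hq).1)).neg).congr_of_eventuallyEq
      (f₁ := fun q => liftKernel κ R ((fanOp κ R).apply h) (q, θ))
      (by filter_upwards [isOpen_Ioo.mem_nhds hq] with y hy
          rw [hT y hy]; simp)
  have h3 := h1.unique h2
  have h4 : starKernel κ R ((fanOp κ R).negSq h) (q, θ) =
      -starKernel κ R ((fanOp κ R).apply ((fanOp κ R).apply h)) (q, θ) := by
    simp only [starKernel, FirstOrderOp.negSq, mul_neg]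
  rw [h4, starKernel_eq hR hκ _ hq, h3]
  simp
  ring

end

section

variable {κ R : ℝ}

/-! ### The intertwining property of the adjoint -/

theorem contDiffOn_bdryOf (hκ : R ^ 2 * |κ| < 1) :
    ContDiffOn ℝ ∞ (bdryOf κ R) (Ioo (-1) 1 ×ˢ univ) := by
  have ha := (rimFactor_pos hκ).ne'
  intro p hp
  have hs : ContDiffAt ℝ ∞ (fun p : ℝ × ℝ => √(1 - p.1 ^ 2)) p :=
    ContDiffAt.sqrt (contDiffAt_const.sub (contDiffAt_fst.pow 2))
      (by have := sq_lt_one_of_mem hp.1; linarith)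
  have hb : ContDiffAt ℝ ∞ (fun p : ℝ × ℝ => Real.arcsin p.1) p :=
    (Real.contDiffAt_arcsin hp.1.1.ne' hp.1.2.ne).comp p contDiffAt_fst
  exact ((((contDiffAt_snd.sub contDiffAt_const).sub hb)).prodMk
    (Real.contDiff_arctan.contDiffAt.comp p (contDiffAt_fst.div (contDiffAt_const.mul hs)
      (mul_ne_zero ha (sqrt_one_sub_sq_pos hp.1).ne')))).contDiffWithinAt

theorem contDiffOn_starKernel (hR : 0 < R) (hκ : R ^ 2 * |κ| < 1) {h : ℝ × ℝ → ℂ}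
    (hh : ContDiffOn ℝ ∞ h strip) : ContDiffOn ℝ ∞ (starKernel κ R h) (Ioo (-1) 1 ×ˢ univ) := by
  have h1 : ContDiffOn ℝ ∞ (fun p : ℝ × ℝ => (√(1 - p.1 ^ 2))⁻¹) (Ioo (-1) 1 ×ˢ univ) :=
    fun p hp => ((ContDiffAt.sqrt (contDiffAt_const.sub (contDiffAt_fst.pow 2))
      (by have := sq_lt_one_of_mem hp.1; linarith)).inv
        (sqrt_one_sub_sq_pos hp.1).ne').contDiffWithinAt
  have h2 : ContDiffOn ℝ ∞ (fun p : ℝ × ℝ => (√(1 + relCurv κ R * p.1 ^ 2))⁻¹)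
      (Ioo (-1) 1 ×ˢ univ) := fun p hp => by
    have hl := one_add_relCurv_pos hR hκ (sq_lt_one_of_mem hp.1).le
    exact ((ContDiffAt.sqrt (contDiffAt_const.add (contDiffAt_const.mul (contDiffAt_fst.pow 2)))
      hl.ne').inv (Real.sqrt_pos.2 hl).ne').contDiffWithinAt
  refine ((Complex.ofRealCLM.contDiff.comp_contDiffOn h1).mul
    ((Complex.ofRealCLM.contDiff.comp_contDiffOn h2).mul (hh.comp (contDiffOn_bdryOf hκ)
      fun p _ => bdryOf_mem_strip κ R p))).congr fun p hp => ?_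
  exact starKernel_eq hR hκ h hp.1 p.2

theorem contDiffOn_xrayStar (hR : 0 < R) (hκ : R ^ 2 * |κ| < 1) {h : ℝ × ℝ → ℂ}
    (hh : SmoothOnBdry h) : ContDiffOn ℝ ∞ (xrayStar κ R h) (Metric.ball 0 R) := by
  have hsub : Metric.ball (0 : ℂ) R ⊆ disk R := Metric.ball_subset_closedBall
  refine ((Complex.ofRealCLM.contDiff.comp_contDiffOn ((contDiffOn_weight hκ).mono hsub)).mul
    ((offsetDomain_ball.contDiffOn_backproj (contDiffOn_starKernel hR hκ hh.2)).comp
      ((contDiffOn_straighten (R := R) hκ).mono hsub)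
      fun z hz => (straighten_mem_ball_iff hR hκ (hsub hz)).2 hz)).congr fun z hz => ?_
  exact xrayStar_eq hR hκ hh.1 (hsub hz)

theorem hasDerivAt_offsetDeriv {K : ℝ × ℝ → ℂ} {J : Set ℝ} (hJ : IsOpen J)
    (hK : DifferentiableOn ℝ K (J ×ˢ univ)) {q : ℝ} (hq : q ∈ J) (θ : ℝ) :
    HasDerivAt (fun q => K (q, θ)) (offsetDeriv J K (q, θ)) q := by
  have hn : J ×ˢ (univ : Set ℝ) ∈ 𝓝 (q, θ) :=
    (hJ.prod isOpen_univ).mem_nhds ⟨hq, mem_univ _⟩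
  have h1 := (hK (q, θ) ⟨hq, mem_univ _⟩).differentiableAt hn
  rw [offsetDeriv, fderivWithin_of_mem_nhds hn]
  exact h1.hasFDerivAt.comp_hasDerivAt q ((hasDerivAt_id q).prodMk (hasDerivAt_const q θ))

/-- Passing to the chord picture, backprojection intertwines `zernike` with the operator in q, which
is -T² on kernels. The computation stays in the open disk, since the kernel may be singular at q =
±1. -/
theorem kimuraOp_xrayStar (hR : 0 < R) (hκ : R ^ 2 * |κ| < 1) {h : ℝ × ℝ → ℂ}
    (hh : SmoothOnBdry h) {z : ℂ} (hz : ‖z‖ < R) :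
    (kimuraOp κ R).apply R (xrayStar κ R h) z = xrayStar κ R ((fanOp κ R).negSq h) z := by
  have hsub : Metric.ball (0 : ℂ) R ⊆ disk R := Metric.ball_subset_closedBall
  have hzb : z ∈ Metric.ball (0 : ℂ) R := by simpa using hz
  have hx := (straighten_mem_ball_iff hR hκ (hsub hzb)).2 hzb
  have hK := contDiffOn_starKernel hR hκ hh.2
  have hKi : ContDiffOn ℝ (∞ + 1) (starKernel κ R h) (Ioo (-1) 1 ×ˢ univ) := by simpa using hK
  have hK1 := offsetDomain_ball.contDiffOn_offsetDeriv hKi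
  have hB := offsetDomain_ball.contDiffOn_backproj hK
  rw [SecondOrderOp.apply_eq_applyOn_ball _ _ hz, SecondOrderOp.applyOn_congr _
    (fun y hy => xrayStar_eq hR hκ hh.1 (hsub hy)) hzb,
    ← SecondOrderOp.apply_eq_applyOn_ball _ _ hz, kimuraOp_apply_ball hR hκ hB hz,
    xrayStar_eq hR hκ (hh.negSq fanOp_isSmooth).1 (hsub hzb),
    offsetDomain_ball.zernike_backproj hK hx]
  congr 1
  refine intervalIntegral.integral_congr fun θ _ => ?_
  beta_reduce
  rw [starKernel_negSq hR hκ hh θ (fun q hq => ⟨hasDerivAt_offsetDeriv isOpen_Ioo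
    (hK.differentiableOn (by simp)) hq θ, hasDerivAt_offsetDeriv isOpen_Ioo
    (hK1.differentiableOn (by simp)) hq θ⟩) (offsetDomain_ball.mem _ hx θ)]

/-! ### The intertwining property of the X-ray transform -/

/-- The integrand is w f = w²·(g∘Ψ), and `flatten` removes exactly w². -/
theorem xrayW_eq (hR : 0 < R) (hκ : R ^ 2 * |κ| < 1) {f g : ℂ → ℂ}
    (hg : ContinuousOn g (disk 1)) (hf : ∀ z ∈ disk R, f z = weight κ z * g (straighten κ R z))
    {p : ℝ × ℝ} (hp : p ∈ strip) : xrayW κ R (weight κ) f p =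
      (Real.cos p.2 / (scale κ R * spread κ R p.2) : ℝ) * chordMean 0 g (chordOf κ R p) := by
  have hw : ContinuousOn (fun z => (weight κ z : ℂ)) (disk R) :=
    Complex.continuous_ofReal.comp_continuousOn (contDiffOn_weight hκ).continuousOn
  have hc : ContinuousOn (fun z => weight κ z * f z) (disk R) := by
    refine (hw.mul (hw.mul (hg.comp (contDiffOn_straighten (R := R) hκ).continuousOn fun z hz =>
      straighten_mem_disk hR hκ hz))).congr fun z hz => ?_
    rw [hf z hz]; rfl
  rw [xrayW, xray_eq hR hκ hp hc]
  congr 1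
  refine chordMean_congr (fun x hx => ?_) 0 (chordOf_mem_chordSpace hκ hp)
  have hm := unstraighten_mem_disk hR hκ hx
  have := Complex.ofReal_ne_zero.2 (weight_pos hκ hm).ne'
  rw [flatten, hf _ hm, straighten_unstraighten hR hκ hx]
  field_simp

theorem contDiffOn_chordOf (hκ : R ^ 2 * |κ| < 1) : ContDiffOn ℝ ∞ (chordOf κ R) strip := by
  have hs : ContDiff ℝ ∞ (fun p : ℝ × ℝ => spread κ R p.2) :=
    ((Real.contDiff_cos.comp contDiff_snd).pow 2).add
      (contDiff_const.mul ((Real.contDiff_sin.comp contDiff_snd).pow 2))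
  have ho : ContDiff ℝ ∞ (fun p : ℝ × ℝ => chordOffset κ R p.2) :=
    (contDiff_const.mul (Real.contDiff_sin.comp contDiff_snd)).div
      (hs.sqrt fun p => (spread_pos hκ p.2).ne') fun p => (Real.sqrt_pos.2 (spread_pos hκ p.2)).ne'
  intro p hp
  have hm := chordOffset_mem hκ hp.2
  exact (ho.contDiffAt.prodMk ((contDiffAt_fst.add contDiffAt_const).add
    ((Real.contDiffAt_arcsin hm.1.ne' hm.2.ne).comp p ho.contDiffAt))).contDiffWithinAt

theorem contDiff_cos_div_spread (hR : 0 < R) (hκ : R ^ 2 * |κ| < 1) :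
    ContDiff ℝ ∞ (fun p : ℝ × ℝ => Real.cos p.2 / (scale κ R * spread κ R p.2)) := by
  have hs : ContDiff ℝ ∞ (fun p : ℝ × ℝ => spread κ R p.2) :=
    ((Real.contDiff_cos.comp contDiff_snd).pow 2).add
      (contDiff_const.mul ((Real.contDiff_sin.comp contDiff_snd).pow 2))
  exact (Real.contDiff_cos.comp contDiff_snd).div (contDiff_const.mul hs) fun p =>
    mul_ne_zero (scale_pos hR hκ).ne' (spread_pos hκ p.2).ne'

theorem bdryPoint_periodic (R β α : ℝ) :
    bdryPoint R (β + 2 * Real.pi, α) = bdryPoint R (β, α) := by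
  simp only [bdryPoint]
  rw [show Complex.I * ((β + 2 * Real.pi : ℝ) : ℂ) = Complex.I * β + 2 * Real.pi * Complex.I by
    push_cast; ring, Complex.exp_periodic]

theorem bdryVector_periodic (κ R β α : ℝ) :
    bdryVector κ R (β + 2 * Real.pi, α) = bdryVector κ R (β, α) := by
  simp only [bdryVector]
  rw [show Complex.I * ((β + 2 * Real.pi + Real.pi + α : ℝ) : ℂ) =
    Complex.I * ((β + Real.pi + α : ℝ) : ℂ) + 2 * Real.pi * Complex.I by
    push_cast; ring, Complex.exp_periodic]

open Classical in
theorem isPeriodic_xray (κ R : ℝ) (f : ℂ → ℂ) : IsPeriodic (xray κ R f) := by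
  intro β α
  -- The transform is defined by a choice of geodesic; equal predicates give the same choice, hence
  -- periodicity.
  have e : (fun q : ℝ × (ℝ → ℂ) × (ℝ → ℂ) =>
      IsExitGeodesic κ R (β + 2 * Real.pi, α) q.1 q.2.1 q.2.2) =
      fun q => IsExitGeodesic κ R (β, α) q.1 q.2.1 q.2.2 := by
    funext q
    refine propext ⟨fun h => ⟨h.pos, h.position, h.velocity, ?_, ?_, h.interior, h.exit⟩,
      fun h => ⟨h.pos, h.position, h.velocity, ?_, ?_, h.interior, h.exit⟩⟩
    · rw [h.init_position, bdryPoint_periodic]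
    · rw [h.init_velocity, bdryVector_periodic]
    · rw [h.init_position, bdryPoint_periodic]
    · rw [h.init_velocity, bdryVector_periodic]
  exact congrArg (fun P : ℝ × (ℝ → ℂ) × (ℝ → ℂ) → Prop =>
    if h : ∃ q, P q then ∫ t in (0 : ℝ)..h.choose.1, f (h.choose.2.1 t) else 0) e

theorem smoothOnBdry_xrayW (hR : 0 < R) (hκ : R ^ 2 * |κ| < 1) {f : ℂ → ℂ}
    (hf : SmoothOnDisk R f) : SmoothOnBdry (xrayW κ R (weight κ) f) := by
  have hg := smoothOnDisk_unweight hR hκ hf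
  refine ⟨isPeriodic_xray κ R _, ?_⟩
  refine ((Complex.ofRealCLM.contDiff.comp (contDiff_cos_div_spread hR hκ)).contDiffOn.mul
    ((contDiffOn_chordMean hg 0).comp (contDiffOn_chordOf hκ) fun p hp =>
      chordOf_mem_chordSpace hκ hp)).congr fun p hp => ?_
  exact xrayW_eq hR hκ hg.continuousOn (fun z hz => (weight_mul_unweight hR hκ f hz).symm) hp

/-- The factor D/cos α of the adjoint cancels cos α/(cD) of the transform, so the singularity at q =
±1 disappears and only the constant 1/c remains. -/
theorem starKernel_xrayW (hR : 0 < R) (hκ : R ^ 2 * |κ| < 1) {f g : ℂ → ℂ}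
    (hg : ContinuousOn g (disk 1)) (hf : ∀ z ∈ disk R, f z = weight κ z * g (straighten κ R z))
    {q : ℝ} (hq : q ∈ Ioo (-1 : ℝ) 1) (θ : ℝ) :
    starKernel κ R (xrayW κ R (weight κ) f) (q, θ) =
      ((scale κ R)⁻¹ : ℝ) * chordMean 0 g (q, θ) := by
  have hm := bdryOf_mem_strip κ R (q, θ)
  have h1 := (spread_pos hκ (bdryOf κ R (q, θ)).2).ne'
  have h2 := (Real.cos_pos_of_mem_Ioo hm.2).ne'
  have h3 := (scale_pos hR hκ).ne'
  rw [starKernel, xrayW_eq hR hκ hg hf hm, chordOf_bdryOf hR hκ hq, ← mul_assoc,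
    ← Complex.ofReal_mul, mu]
  congr 2
  field_simp

/-- The chord mean of `zernike g` is the operator in q applied to the chord mean of g, which on
kernels is -T². Evaluating at the chord of p and dividing by D/cos α returns to ∂₊SM. -/
theorem xrayW_kimuraOp (hR : 0 < R) (hκ : R ^ 2 * |κ| < 1) {f : ℂ → ℂ} (hf : SmoothOnDisk R f)
    {p : ℝ × ℝ} (hp : p ∈ strip) : xrayW κ R (weight κ) ((kimuraOp κ R).apply R f) p =
      (fanOp κ R).negSq (xrayW κ R (weight κ) f) p := by
  have hg := smoothOnDisk_unweight hR hκ hf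
  have hc := hg.continuousOn
  have hz := zernike_contDiffOn (uniqueDiffOn_disk one_pos) hg
  have hq := chordOf_mem hκ hp
  have h1 := fun z hz => (weight_mul_unweight hR hκ f (z := z) hz).symm
  obtain ⟨k₁, k₂, hk⟩ := exists_deriv_chordMean hg (chordOf κ R p).2
  have hT := starKernel_negSq hR hκ (smoothOnBdry_xrayW hR hκ hf) (chordOf κ R p).2
    (k₁ := fun q => ((scale κ R)⁻¹ : ℝ) * k₁ q) (k₂ := fun q => ((scale κ R)⁻¹ : ℝ) * k₂ q)
    (fun q hq => ⟨((hk q hq).1.const_mul _).congr_of_eventuallyEq (by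
      filter_upwards [isOpen_Ioo.mem_nhds hq] with y hy using starKernel_xrayW hR hκ hc h1 hy _),
      (hk q hq).2.1.const_mul _⟩) hq
  rw [starKernel_xrayW hR hκ hc h1 hq] at hT
  have h2 := (hk _ hq).2.2
  have h3 : (fun y => bdryOf κ R y) ((chordOf κ R p).1, (chordOf κ R p).2) = p :=
    bdryOf_chordOf hκ hp
  simp only at h3
  rw [starKernel, h3, mu] at hT
  have i1 := Complex.ofReal_ne_zero.2 (spread_pos hκ p.2).ne'
  have i2 := Complex.ofReal_ne_zero.2 (Real.cos_pos_of_mem_Ioo hp.2).ne'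
  have i3 := Complex.ofReal_ne_zero.2 (scale_pos hR hκ).ne'
  rw [xrayW_eq hR hκ hz.continuousOn (fun z hz => kimuraOp_apply_eq hR hκ hf hz) hp]
  change _ * chordMean 0 _ ((chordOf κ R p).1, (chordOf κ R p).2) = _
  rw [← h2]
  generalize (fanOp κ R).negSq (xrayW κ R (weight κ) f) p = N at *
  rw [Complex.ofReal_div, div_mul_eq_mul_div, div_eq_iff i2] at hT
  rw [Complex.ofReal_div, div_mul_eq_mul_div, Complex.ofReal_mul,
    div_eq_iff (mul_ne_zero i3 i1)]
  push_cast at hT ⊢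
  field_simp at hT
  linear_combination -hT

end

section

variable {κ R : ℝ}

/-! ### The normal operator -/

theorem backproj_const_mul (c : ℂ) (K : ℝ × ℝ → ℂ) (x : ℂ) :
    backproj (fun p => c * K p) x = c * backproj K x := by
  rw [backproj, backproj, intervalIntegral.integral_const_mul]

/-- The two chord descriptions compose to the flat normal operator divided by c. The formula holds
up to the rim because tangent directions form a null set. -/
theorem normalW_eq (hR : 0 < R) (hκ : R ^ 2 * |κ| < 1) {f g : ℂ → ℂ}
    (hg : ContinuousOn g (disk 1)) (hf : ∀ z ∈ disk R, f z = weight κ z * g (straighten κ R z))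
    {z : ℂ} (hz : z ∈ disk R) : normalW κ R (weight κ) f z = weight κ z *
      (((scale κ R)⁻¹ : ℝ) * backproj (chordMean 0 g) (straighten κ R z)) := by
  rw [normalW, xrayStar_eq hR hκ (h := xrayW κ R (weight κ) f) (isPeriodic_xray κ R _) hz,
    ← backproj_const_mul ((scale κ R)⁻¹ : ℝ)]
  congr 1
  rw [backproj, backproj]
  refine intervalIntegral.integral_congr_ae ?_
  filter_upwards [ae_offset_mem (straighten_mem_disk hR hκ hz)] with θ hθ _
  exact starKernel_xrayW hR hκ hg hf hθ θ

theorem smoothOnDisk_weight_mul (hR : 0 < R) (hκ : R ^ 2 * |κ| < 1) {f g : ℂ → ℂ}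
    (hg : SmoothOnDisk 1 g) (hf : ∀ z ∈ disk R, f z = weight κ z * g (straighten κ R z)) :
    SmoothOnDisk R f :=
  ((Complex.ofRealCLM.contDiff.comp_contDiffOn (contDiffOn_weight hκ)).mul
    (ContDiffOn.comp hg (contDiffOn_straighten (R := R) hκ)
      fun _ hz => straighten_mem_disk hR hκ hz)).congr hf

theorem smoothOnDisk_normalW (hR : 0 < R) (hκ : R ^ 2 * |κ| < 1) {f : ℂ → ℂ}
    (hf : SmoothOnDisk R f) : SmoothOnDisk R (normalW κ R (weight κ) f) := by
  have hg := smoothOnDisk_unweight hR hκ hf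
  exact smoothOnDisk_weight_mul hR hκ (ContDiffOn.mul contDiffOn_const
    (smoothOnDisk_backproj_chordMean hg)) fun z hz => normalW_eq hR hκ hg.continuousOn
      (fun z hz => (weight_mul_unweight hR hκ f hz).symm) hz

theorem kimuraOp_normalW_normalW (hR : 0 < R) (hκ : R ^ 2 * |κ| < 1) {f : ℂ → ℂ}
    (hf : SmoothOnDisk R f) {z : ℂ} (hz : z ∈ disk R) :
    (kimuraOp κ R).apply R (normalW κ R (weight κ) (normalW κ R (weight κ) f)) z =
      ((4 * Real.pi * R / (1 - κ * R ^ 2)) ^ 2 : ℝ) * f z := by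
  have hg := smoothOnDisk_unweight hR hκ hf
  set g := unweight κ R f with hgdef
  set c : ℂ := (((scale κ R)⁻¹ : ℝ) : ℂ) with hc
  have hcg : SmoothOnDisk 1 (fun x => c * (c * g x)) :=
    ContDiffOn.mul contDiffOn_const (ContDiffOn.mul contDiffOn_const hg)
  have hN := smoothOnDisk_backproj_chordMean hg
  have h1 : ∀ z ∈ disk R, normalW κ R (weight κ) f z = weight κ z *
      (fun x => c * backproj (chordMean 0 g) x) (straighten κ R z) := fun z hz =>
    normalW_eq hR hκ hg.continuousOn (fun z hz => (weight_mul_unweight hR hκ f hz).symm) hz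
  have hcN : SmoothOnDisk 1 (fun x => c * backproj (chordMean 0 g) x) :=
    ContDiffOn.mul contDiffOn_const hN
  have e1 : ∀ (a : ℂ) (u : ℂ → ℂ), backproj (chordMean 0 (fun x => a * u x)) =
      fun x => a * backproj (chordMean 0 u) x := fun a u => by
    funext x
    rw [← backproj_const_mul]
    congr 1
    funext p
    exact chordMean_const_mul u 0 a p
  have h2 : ∀ z ∈ disk R, normalW κ R (weight κ) (normalW κ R (weight κ) f) z = weight κ z *
      backproj (chordMean 0 (backproj (chordMean 0 fun x => c * (c * g x))))
        (straighten κ R z) := fun z hz => by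
    rw [normalW_eq hR hκ hcN.continuousOn h1 hz]
    simp only [e1, ← hc]
  have h3 : SmoothOnDisk 1
      (backproj (chordMean 0 (backproj (chordMean 0 fun x => c * (c * g x))))) :=
    smoothOnDisk_backproj_chordMean (smoothOnDisk_backproj_chordMean hcg)
  rw [SecondOrderOp.apply_eq_applyOn, SecondOrderOp.applyOn_congr _ h2 hz,
    ← SecondOrderOp.apply_eq_applyOn, kimuraOp_apply hR hκ h3 hz,
    zernike_normal_normal hcg (straighten_mem_disk hR hκ hz)]
  have h4 := weight_mul_unweight hR hκ f hz
  -- Each normal operator contributes 1/c = R/(1 - κR²), and the flat identity contributes (4π)².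
  have h5 : ((4 * Real.pi * R / (1 - κ * R ^ 2)) ^ 2 : ℝ) = (4 * Real.pi) ^ 2 *
      ((scale κ R)⁻¹ * (scale κ R)⁻¹) := by
    rw [scale, inv_div]; ring
  rw [h5, ← h4, ← hgdef]
  push_cast
  rw [hc]
  push_cast
  ring

end

section

variable {κ R : ℝ}

/-! ### The substitution from fan-beam coordinates to chords -/

/-- Every half-open interval of length 2π is a fundamental domain for the translations by 2πℤ. -/
theorem setLIntegral_periodic_shift {F : ℝ → ENNReal} (hF : ∀ x, F (x + 2 * Real.pi) = F x)
    (s : ℝ) : ∫⁻ θ in Ioc 0 (2 * Real.pi), F (θ + s) = ∫⁻ β in Ioc 0 (2 * Real.pi), F β := by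
  have h1 := (measurePreserving_add_right volume s).setLIntegral_comp_preimage_emb
    (measurableEmbedding_addRight s) F (Ioc s (s + 2 * Real.pi))
  have h2 : (fun x => x + s) ⁻¹' Ioc s (s + 2 * Real.pi) = Ioc 0 (2 * Real.pi) := by
    rw [preimage_add_const_Ioc]; congr 1 <;> ring
  rw [h2] at h1
  rw [h1]
  have h3 := isAddFundamentalDomain_Ioc Real.two_pi_pos s
  have h4 := isAddFundamentalDomain_Ioc Real.two_pi_pos 0
  rw [zero_add] at h4
  refine h3.setLIntegral_eq h4 F fun g x => ?_
  obtain ⟨n, hn⟩ := AddSubgroup.mem_zmultiples_iff.1 g.2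
  have hp : Function.Periodic F (2 * Real.pi) := hF
  have : g +ᵥ x = x + n • (2 * Real.pi) := by
    rw [AddSubgroup.vadd_def, ← hn, vadd_eq_add, add_comm]
  rw [this]
  exact hp.zsmul n x

theorem setIntegral_periodic_shift {F : ℝ → ℂ} (hF : ∀ x, F (x + 2 * Real.pi) = F x) (s : ℝ) :
    ∫ θ in Ioc 0 (2 * Real.pi), F (θ + s) = ∫ β in Ioc 0 (2 * Real.pi), F β := by
  have hp : Function.Periodic F (2 * Real.pi) := hF
  rw [← intervalIntegral.integral_of_le Real.two_pi_pos.le,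
    ← intervalIntegral.integral_of_le Real.two_pi_pos.le,
    intervalIntegral.integral_comp_add_right, zero_add, add_comm (2 * Real.pi),
    hp.intervalIntegral_add_eq s 0, zero_add]

/-- The derivative of the incidence angle with respect to the offset. -/
def angleDeriv (κ R q : ℝ) : ℝ := (rimFactor κ R * √(1 - q ^ 2) * (1 + relCurv κ R * q ^ 2))⁻¹

theorem angleDeriv_pos (hR : 0 < R) (hκ : R ^ 2 * |κ| < 1) {q : ℝ} (hq : q ∈ Ioo (-1 : ℝ) 1) :
    0 < angleDeriv κ R q := by
  have := rimFactor_pos hκ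
  have := sqrt_one_sub_sq_pos hq
  have := one_add_relCurv_pos hR hκ (sq_lt_one_of_mem hq).le
  rw [angleDeriv]
  positivity

theorem hasDerivWithinAt_angle (hR : 0 < R) (hκ : R ^ 2 * |κ| < 1) {q : ℝ}
    (hq : q ∈ Ioo (-1 : ℝ) 1) : HasDerivWithinAt (fun q => (bdryOf κ R (q, 0)).2)
      (angleDeriv κ R q) (Ioo (-1) 1) q :=
  ((ContinuousLinearMap.snd ℝ ℝ ℝ).hasFDerivAt.comp_hasDerivAt q
    (hasDerivAt_bdryOf hR hκ hq 0)).hasDerivWithinAt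

theorem injOn_angle (hR : 0 < R) (hκ : R ^ 2 * |κ| < 1) :
    InjOn (fun q => (bdryOf κ R (q, 0)).2) (Ioo (-1) 1) := by
  intro q hq q' hq' h
  have h1 := congrArg Prod.fst (chordOf_bdryOf hR hκ hq 0)
  have h2 := congrArg Prod.fst (chordOf_bdryOf hR hκ hq' 0)
  simp only [chordOf] at h1 h2
  simp only at h
  rw [← h1, ← h2, h]

theorem image_angle (hκ : R ^ 2 * |κ| < 1) :
    (fun q => (bdryOf κ R (q, 0)).2) '' Ioo (-1) 1 = Ioo (-(Real.pi / 2)) (Real.pi / 2) := by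
  ext α
  constructor
  · rintro ⟨q, -, rfl⟩
    exact (bdryOf_mem_strip κ R (q, 0)).2
  · intro hα
    have hp : ((0 : ℝ), α) ∈ strip := ⟨mem_univ _, hα⟩
    exact ⟨_, chordOf_mem hκ hp, congrArg Prod.snd (bdryOf_chordOf hκ hp)⟩

theorem bdryOf_eq (κ R q θ : ℝ) : bdryOf κ R (q, θ) =
    (θ + (-Real.pi - Real.arcsin q), (bdryOf κ R (q, 0)).2) := by
  simp only [bdryOf]
  ext
  · ring
  · rfl

/-- In chord coordinates α depends on q alone and β is θ shifted by a function of q, so the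
substitution is one-dimensional in q and the shift is removed by periodicity. -/
theorem lintegral_strip (hR : 0 < R) (hκ : R ^ 2 * |κ| < 1) {F : ℝ × ℝ → ENNReal}
    (hF : IsPeriodic F) :
    ∫⁻ α in Ioo (-(Real.pi / 2)) (Real.pi / 2), ∫⁻ β in Ioc 0 (2 * Real.pi), F (β, α) =
      ∫⁻ q in Ioo (-1 : ℝ) 1, ENNReal.ofReal (angleDeriv κ R q) *
        ∫⁻ θ in Ioc 0 (2 * Real.pi), F (bdryOf κ R (q, θ)) := by
  rw [← image_angle hκ, lintegral_image_eq_lintegral_abs_deriv_mul measurableSet_Ioo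
    (fun q hq => hasDerivWithinAt_angle hR hκ hq) (injOn_angle hR hκ)]
  refine setLIntegral_congr_fun measurableSet_Ioo fun q hq => ?_
  rw [abs_of_pos (angleDeriv_pos hR hκ hq),
    ← setLIntegral_periodic_shift (fun x => hF x _) (-Real.pi - Real.arcsin q)]
  simp only [← bdryOf_eq]

theorem integral_strip (hR : 0 < R) (hκ : R ^ 2 * |κ| < 1) {F : ℝ × ℝ → ℂ} (hF : IsPeriodic F) :
    ∫ α in Ioo (-(Real.pi / 2)) (Real.pi / 2), ∫ β in Ioc 0 (2 * Real.pi), F (β, α) =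
      ∫ q in Ioo (-1 : ℝ) 1, (angleDeriv κ R q : ℂ) *
        ∫ θ in Ioc 0 (2 * Real.pi), F (bdryOf κ R (q, θ)) := by
  rw [← image_angle hκ, integral_image_eq_integral_abs_deriv_smul measurableSet_Ioo
    (fun q hq => hasDerivWithinAt_angle hR hκ hq) (injOn_angle hR hκ)]
  refine setIntegral_congr_fun measurableSet_Ioo fun q hq => ?_
  rw [abs_of_pos (angleDeriv_pos hR hκ hq), Complex.real_smul,
    ← setIntegral_periodic_shift (fun x => hF x _) (-Real.pi - Real.arcsin q)]
  simp only [← bdryOf_eq]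

/-! ### The adjoint -/

theorem exists_norm_chordMean_le {u : ℂ → ℂ} (hu : ContinuousOn u (disk 1)) :
    ∃ C : ℝ, 0 ≤ C ∧ ∀ p ∈ chordSpace, ‖chordMean 0 u p‖ ≤ C := by
  obtain ⟨C, hC⟩ := (isCompact_closedBall (0 : ℂ) 1).exists_bound_of_continuousOn hu
  have hC0 : 0 ≤ C := (norm_nonneg _).trans (hC 0 (by simp))
  refine ⟨C * 2, by positivity, fun p hp => ?_⟩
  have : ‖chordMean 0 u p‖ ≤ C * |1 - (-1 : ℝ)| := by
    refine intervalIntegral.norm_integral_le_of_norm_le_const fun s hs => ?_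
    rw [uIoc_of_le (by norm_num)] at hs
    simpa using hC _ (chordPoint_mem hp (Ioc_subset_Icc_self hs))
  norm_num at this
  exact this

theorem measurable_prod_restrict {K : ℝ × ℝ → ℂ} (hK : ContinuousOn K (Ioo (-1) 1 ×ˢ univ)) :
    AEStronglyMeasurable (fun p : ℝ × ℝ => K (p.2, p.1))
      ((volume.restrict (Ioc 0 (2 * Real.pi))).prod (volume.restrict (Ioo (-1 : ℝ) 1))) := by
  rw [Measure.prod_restrict]
  refine ContinuousOn.aestronglyMeasurable ?_ (measurableSet_Ioc.prod measurableSet_Ioo)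
  exact hK.comp (f := fun p : ℝ × ℝ => (p.2, p.1)) continuous_swap.continuousOn
    fun p hp => ⟨hp.2, mem_univ _⟩

theorem continuousOn_sqrt_mul {K : ℝ × ℝ → ℂ} (hK : ContinuousOn K (Ioo (-1) 1 ×ˢ univ)) :
    ContinuousOn (fun p : ℝ × ℝ => (√(1 - p.1 ^ 2) : ℂ) * K p) (Ioo (-1) 1 ×ˢ univ) :=
  (Complex.continuous_ofReal.comp (by fun_prop : Continuous fun p : ℝ × ℝ =>
    √(1 - p.1 ^ 2))).continuousOn.mul hK

theorem IsChordKernel.integrable_prod {K : ℝ × ℝ → ℂ} (hK : IsChordKernel K) :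
    Integrable (fun p : ℝ × ℝ => (√(1 - p.2 ^ 2) : ℂ) * K (p.2, p.1))
      ((volume.restrict (Ioc 0 (2 * Real.pi))).prod (volume.restrict (Ioo (-1 : ℝ) 1))) := by
  have hm := measurable_prod_restrict (continuousOn_sqrt_mul hK.continuousOn)
  refine ⟨hm, ?_⟩
  rw [HasFiniteIntegral, lintegral_prod _ hm.enorm]
  refine lt_of_le_of_lt (le_of_eq ?_) hK.lintegral_ne_top.lt_top
  congr 1; funext θ; congr 1; funext q
  rw [enorm_mul, ← ofReal_norm, Complex.norm_real, Real.norm_of_nonneg (Real.sqrt_nonneg _)]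

theorem sigmaMeasure_eq (κ R : ℝ) : sigmaMeasure κ R = ENNReal.ofReal (R / (1 + κ * R ^ 2)) •
    ((volume.restrict (Ioc 0 (2 * Real.pi))).prod
      (volume.restrict (Ioo (-(Real.pi / 2)) (Real.pi / 2)))) := by
  rw [sigmaMeasure, Measure.volume_eq_prod, ← Measure.prod_restrict,
    Measure.restrict_congr_set Ico_ae_eq_Ioc]

theorem memLp_one_of_sigma (hR : 0 < R) (hκ : R ^ 2 * |κ| < 1) {h : ℝ × ℝ → ℂ}
    (hh : MemLp h 2 (sigmaMeasure κ R)) : Integrable h ((volume.restrict (Ioc 0 (2 * Real.pi))).prod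
      (volume.restrict (Ioo (-(Real.pi / 2)) (Real.pi / 2)))) := by
  have hpos : 0 < R / (1 + κ * R ^ 2) := div_pos hR (one_add_rim_pos hκ)
  rw [sigmaMeasure_eq] at hh
  have : IsFiniteMeasure (ENNReal.ofReal (R / (1 + κ * R ^ 2)) •
      (volume.restrict (Ioc 0 (2 * Real.pi))).prod
        (volume.restrict (Ioo (-(Real.pi / 2)) (Real.pi / 2)))) :=
    Measure.smul_finite _ ENNReal.ofReal_ne_top
  have h1 := hh.integrable (by norm_num)
  rwa [integrable_smul_measure (by simpa using hpos) (by simp)] at h1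

/-- Separates the Jacobian `angleDeriv` from a bounded factor, so that weighted integrals of the
kernel are controlled by integrals of h over ∂₊SM. -/
theorem sqrt_mul_starKernel (hR : 0 < R) (hκ : R ^ 2 * |κ| < 1) (h : ℝ × ℝ → ℂ) {q : ℝ}
    (hq : q ∈ Ioo (-1 : ℝ) 1) (θ : ℝ) : (√(1 - q ^ 2) : ℂ) * starKernel κ R h (q, θ) =
      (angleDeriv κ R q * (rimFactor κ R * √(1 - q ^ 2) * √(1 + relCurv κ R * q ^ 2)) : ℝ) *
        h (bdryOf κ R (q, θ)) := by
  have hl := one_add_relCurv_pos hR hκ (sq_lt_one_of_mem hq).le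
  have hl' := Real.sqrt_pos.2 hl
  have hp := sqrt_one_sub_sq_pos hq
  have ha := rimFactor_pos hκ
  rw [starKernel_eq hR hκ h hq, liftKernel, ← mul_assoc, ← mul_assoc, ← Complex.ofReal_mul,
    ← Complex.ofReal_mul, angleDeriv]
  congr 2
  simp only
  have := Real.sq_sqrt hl.le
  generalize √(1 + relCurv κ R * q ^ 2) = l at *
  rw [← this]
  field_simp

/-- The strip has finite measure, so h is integrable, and the substitution to chords bounds the
weighted L¹ norm of its kernel. -/
theorem isChordKernel_starKernel (hR : 0 < R) (hκ : R ^ 2 * |κ| < 1) {h : ℝ × ℝ → ℂ}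
    (hh : SmoothOnBdry h) (hL : MemLp h 2 (sigmaMeasure κ R)) :
    IsChordKernel (starKernel κ R h) where
  continuousOn := (contDiffOn_starKernel hR hκ hh.2).continuousOn
  lintegral_ne_top := by
    have hK := (contDiffOn_starKernel hR hκ hh.2).continuousOn
    have hi := memLp_one_of_sigma hR hκ hL
    have ha := rimFactor_pos hκ
    have hp : IsPeriodic fun p => ‖h p‖ₑ := fun β α => by simp only [hh.1 β α]
    have e : ∀ θ q : ℝ, ENNReal.ofReal √(1 - q ^ 2) * ‖starKernel κ R h (q, θ)‖ₑ =
        ‖(√(1 - q ^ 2) : ℂ) * starKernel κ R h (q, θ)‖ₑ := fun θ q => by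
      rw [enorm_mul, ← ofReal_norm (√(1 - q ^ 2) : ℂ), Complex.norm_real,
        Real.norm_of_nonneg (Real.sqrt_nonneg _)]
    simp only [e]
    rw [lintegral_lintegral_swap (measurable_prod_restrict (continuousOn_sqrt_mul hK)).enorm]
    have hle : ∫⁻ q in Ioo (-1 : ℝ) 1, ∫⁻ θ in Ioc 0 (2 * Real.pi),
        ‖(√(1 - q ^ 2) : ℂ) * starKernel κ R h (q, θ)‖ₑ ≤
        ENNReal.ofReal (rimFactor κ R * √(1 + |relCurv κ R|)) *
        ∫⁻ q in Ioo (-1 : ℝ) 1, ENNReal.ofReal (angleDeriv κ R q) *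
          ∫⁻ θ in Ioc 0 (2 * Real.pi), ‖h (bdryOf κ R (q, θ))‖ₑ := by
      rw [← lintegral_const_mul' _ _ ENNReal.ofReal_ne_top]
      refine setLIntegral_mono' measurableSet_Ioo fun q hq => ?_
      rw [← mul_assoc, ← ENNReal.ofReal_mul (by positivity),
        ← lintegral_const_mul' _ _ ENNReal.ofReal_ne_top]
      refine lintegral_mono fun θ => ?_
      rw [sqrt_mul_starKernel hR hκ h hq, enorm_mul]
      gcongr
      have hd := angleDeriv_pos hR hκ hq
      rw [← ofReal_norm, Complex.norm_real, Real.norm_of_nonneg (by positivity)]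
      refine ENNReal.ofReal_le_ofReal ?_
      have hq2 := sq_lt_one_of_mem hq
      have h1 : √(1 - q ^ 2) ≤ 1 := Real.sqrt_le_one.2 (by nlinarith [sq_nonneg q])
      have h2 : √(1 + relCurv κ R * q ^ 2) ≤ √(1 + |relCurv κ R|) := by
        refine Real.sqrt_le_sqrt ?_
        have := le_abs_self (relCurv κ R)
        have := abs_nonneg (relCurv κ R)
        nlinarith [sq_nonneg q]
      calc angleDeriv κ R q * (rimFactor κ R * √(1 - q ^ 2) * √(1 + relCurv κ R * q ^ 2))
          ≤ angleDeriv κ R q * (rimFactor κ R * 1 * √(1 + |relCurv κ R|)) := by gcongr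
        _ = rimFactor κ R * √(1 + |relCurv κ R|) * angleDeriv κ R q := by ring
    refine (hle.trans_lt ?_).ne
    rw [← lintegral_strip hR hκ hp, ← lintegral_prod_symm _ hi.1.enorm]
    exact ENNReal.mul_lt_top ENNReal.ofReal_lt_top hi.2

/-- A function on the disk in terms of the straightened coordinates. -/
theorem weight_sq_mul_flatten (hR : 0 < R) (hκ : R ^ 2 * |κ| < 1) (f : ℂ → ℂ) {z : ℂ}
    (hz : z ∈ disk R) : (weight κ z : ℂ) ^ 2 * flatten κ R f (straighten κ R z) = f z := by
  have := Complex.ofReal_ne_zero.2 (weight_pos hκ hz).ne'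
  rw [flatten, unstraighten_straighten hR hκ hz]
  field_simp

theorem mul_conj_xrayStar_ae (hR : 0 < R) (hκ : R ^ 2 * |κ| < 1) (f : ℂ → ℂ) {h : ℝ × ℝ → ℂ}
    (hh : IsPeriodic h) : (fun z => f z * (starRingEnd ℂ) (xrayStar κ R h z))
      =ᵐ[areaMeasure κ R] fun z => (weight κ z : ℂ) ^ 3 * (fun x => flatten κ R f x *
        (starRingEnd ℂ) (backproj (starKernel κ R h) x)) (straighten κ R z) := by
  filter_upwards [ae_areaMeasure_mem κ R] with z hz
  have hd : z ∈ disk R := Metric.ball_subset_closedBall hz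
  rw [xrayStar_eq hR hκ hh hd, map_mul, Complex.conj_ofReal]
  conv_lhs => rw [← weight_sq_mul_flatten hR hκ f hd]
  ring

theorem integrable_mul_conj_xrayStar (hR : 0 < R) (hκ : R ^ 2 * |κ| < 1) {f : ℂ → ℂ}
    (hf : ContinuousOn f (disk R)) {h : ℝ × ℝ → ℂ} (hh : SmoothOnBdry h)
    (hL : MemLp h 2 (sigmaMeasure κ R)) :
    Integrable (fun z => f z * (starRingEnd ℂ) (xrayStar κ R h z)) (areaMeasure κ R) :=
  (integrable_areaMeasure hR hκ ((isChordKernel_starKernel hR hκ hh hL).integrable_backproj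
    (continuousOn_flatten hR hκ hf))).congr (mul_conj_xrayStar_ae hR hκ f hh.1).symm

theorem integrable_xray_mul_conj (hR : 0 < R) (hκ : R ^ 2 * |κ| < 1) {f : ℂ → ℂ}
    (hf : ContinuousOn f (disk R)) {h : ℝ × ℝ → ℂ} (hL : MemLp h 2 (sigmaMeasure κ R)) :
    Integrable (fun p => xray κ R f p * (starRingEnd ℂ) (h p))
      ((volume.restrict (Ioc 0 (2 * Real.pi))).prod
        (volume.restrict (Ioo (-(Real.pi / 2)) (Real.pi / 2)))) := by
  have hF := continuousOn_flatten hR hκ hf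
  obtain ⟨C, hC0, hC⟩ := exists_norm_chordMean_le hF
  have hcs := (contDiff_cos_div_spread hR hκ).continuous
  obtain ⟨M, hM⟩ := (isCompact_Icc (a := -(Real.pi / 2)) (b := Real.pi / 2)).exists_bound_of_continuousOn
    (f := fun α => Real.cos α / (scale κ R * spread κ R α))
    (hcs.comp (Continuous.prodMk_right (0 : ℝ))).continuousOn
  have hx : ContinuousOn (xray κ R f) strip := by
    refine ((Complex.continuous_ofReal.comp hcs).continuousOn.mul ((continuousOn_chordMean hF 0).comp
      (contDiffOn_chordOf hκ).continuousOn fun p hp => chordOf_mem_chordSpace hκ hp)).congr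
      fun p hp => ?_
    exact xray_eq hR hκ hp hf
  have hi := memLp_one_of_sigma hR hκ hL
  rw [Measure.prod_restrict] at hi ⊢
  have hms : MeasurableSet (Ioc 0 (2 * Real.pi) ×ˢ Ioo (-(Real.pi / 2)) (Real.pi / 2)) :=
    measurableSet_Ioc.prod measurableSet_Ioo
  refine Integrable.bdd_mul (c := M * C) (Complex.conjCLE.toContinuousLinearMap.integrable_comp hi) ((hx.mono
    (prod_mono (subset_univ _) subset_rfl)).aestronglyMeasurable hms) ?_
  filter_upwards [ae_restrict_mem hms] with p hp
  have hps : p ∈ strip := ⟨mem_univ _, hp.2⟩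
  rw [xray_eq hR hκ hps hf, norm_mul, Complex.norm_real]
  have h1 := hM p.2 (Ioo_subset_Icc_self hp.2)
  exact mul_le_mul h1 (hC _ (chordOf_mem_chordSpace hκ hps)) (norm_nonneg _)
    ((norm_nonneg _).trans h1)

theorem IsChordKernel.integrable_chordMean_mul {K : ℝ × ℝ → ℂ} (hK : IsChordKernel K) {u : ℂ → ℂ}
    (hu : ContinuousOn u (disk 1)) :
    Integrable (Function.uncurry fun θ q : ℝ =>
      √(1 - q ^ 2) * chordMean 0 u (q, θ) * (starRingEnd ℂ) (K (q, θ)))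
      ((volume.restrict (Ioc 0 (2 * Real.pi))).prod (volume.restrict (Ioo (-1 : ℝ) 1))) := by
  obtain ⟨C, hC0, hC⟩ := exists_norm_chordMean_le hu
  have h1 := Complex.conjCLE.toContinuousLinearMap.integrable_comp hK.integrable_prod
  have hm := measurable_prod_restrict ((continuousOn_chordMean hu 0).mono
    (prod_mono Ioo_subset_Icc_self subset_rfl))
  have hb : ∀ᵐ p ∂((volume.restrict (Ioc 0 (2 * Real.pi))).prod
      (volume.restrict (Ioo (-1 : ℝ) 1))), ‖chordMean 0 u (p.2, p.1)‖ ≤ C := by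
    rw [Measure.prod_restrict]
    filter_upwards [ae_restrict_mem (measurableSet_Ioc.prod measurableSet_Ioo)] with p hp
    exact hC _ ⟨Ioo_subset_Icc_self hp.2, mem_univ _⟩
  refine (Integrable.bdd_mul h1 hm hb).congr (.of_forall fun p => ?_)
  simp only [Function.uncurry, ContinuousLinearEquiv.coe_coe, Complex.conjCLE_apply, map_mul,
    Complex.conj_ofReal]
  ring

/-- Both sides become integrals over chords, one by the duality of chord means and backprojection,
the other by the substitution from fan-beam coordinates; the densities are then compared pointwise.
-/
theorem integral_xray_mul_conj (hR : 0 < R) (hκ : R ^ 2 * |κ| < 1) {f : ℂ → ℂ}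
    (hf : ContinuousOn f (disk R)) {h : ℝ × ℝ → ℂ} (hh : SmoothOnBdry h)
    (hL : MemLp h 2 (sigmaMeasure κ R)) :
    ∫ p, xray κ R f p * (starRingEnd ℂ) (h p) ∂(sigmaMeasure κ R) =
      ∫ z, f z * (starRingEnd ℂ) (xrayStar κ R h z) ∂(areaMeasure κ R) := by
  have hK := isChordKernel_starKernel hR hκ hh hL
  have hF := continuousOn_flatten hR hκ hf
  have hρ : 0 < R / (1 + κ * R ^ 2) := div_pos hR (one_add_rim_pos hκ)
  have hper : IsPeriodic fun p => xray κ R f p * (starRingEnd ℂ) (h p) := fun β α => by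
    simp only [isPeriodic_xray κ R f β α, hh.1 β α]
  rw [integral_congr_ae (mul_conj_xrayStar_ae hR hκ f hh.1), integral_areaMeasure hR hκ
      (fun x => flatten κ R f x * (starRingEnd ℂ) (backproj (starKernel κ R h) x)),
    hK.integral_backproj hF, integral_integral_swap (hK.integrable_chordMean_mul hF),
    sigmaMeasure_eq, integral_smul_measure, integral_prod_symm _
      (integrable_xray_mul_conj hR hκ hf hL), integral_strip hR hκ hper,
    ENNReal.toReal_ofReal hρ.le, Complex.real_smul, ← integral_const_mul, ← integral_const_mul]
  refine setIntegral_congr_fun measurableSet_Ioo fun q hq => ?_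
  rw [← integral_const_mul, ← integral_const_mul, ← integral_const_mul]
  congr 1
  funext θ
  have hm := bdryOf_mem_strip κ R (q, θ)
  have hl := one_add_relCurv_pos hR hκ (sq_lt_one_of_mem hq).le
  have hl' := Real.sqrt_pos.2 hl
  have hl2 := Real.sq_sqrt hl.le
  have hp := sqrt_one_sub_sq_pos hq
  have ha := rimFactor_pos hκ
  have hc := scale_pos hR hκ
  have h1 := (one_add_rim_pos hκ (R := R)).ne'
  have h2 := (one_sub_rim_pos hκ (R := R)).ne'
  -- The arclength factor of dΣ², rewritten so that it cancels the a in the Jacobian and leaves the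
  -- 1/c² of the area formula.
  have hac : R / (1 + κ * R ^ 2) = rimFactor κ R / scale κ R := by
    rw [rimFactor, scale]
    generalize 1 + κ * R ^ 2 = s at *
    generalize 1 - κ * R ^ 2 = t at *
    field_simp
  rw [xray_eq hR hκ hm hf, chordOf_bdryOf hR hκ hq, starKernel_eq hR hκ h hq, liftKernel,
    spread_bdryOf hR hκ hq, (cos_sin_bdryOf hR hκ hq θ).1, hac, angleDeriv]
  simp only [map_mul, Complex.conj_ofReal]
  generalize √(1 + relCurv κ R * q ^ 2) = l at *
  generalize √(1 - q ^ 2) = P at *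
  rw [← hl2]
  have i1 : (l : ℂ) ≠ 0 := Complex.ofReal_ne_zero.2 hl'.ne'
  have i2 : (P : ℂ) ≠ 0 := Complex.ofReal_ne_zero.2 hp.ne'
  have i3 : (rimFactor κ R : ℂ) ≠ 0 := Complex.ofReal_ne_zero.2 ha.ne'
  have i4 : (scale κ R : ℂ) ≠ 0 := Complex.ofReal_ne_zero.2 hc.ne'
  push_cast
  field_simp

end

end

end GeodesicDisk

theorem theorem1 (κ R : ℝ) (hR : 0 < R) (hκ : R ^ 2 * |κ| < 1) :
    -- `I₀^*` is the adjoint of `I₀ : L²(M, dVol) → L²(∂₊SM, dΣ²)`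
    (∀ f : ℂ → ℂ, SmoothOnDisk R f → ∀ h : ℝ × ℝ → ℂ, SmoothOnBdry h →
      MeasureTheory.MemLp h 2 (sigmaMeasure κ R) →
      MeasureTheory.Integrable (fun z => f z * (starRingEnd ℂ) (xrayStar κ R h z))
        (areaMeasure κ R) ∧
      ∫ p, xray κ R f p * (starRingEnd ℂ) (h p) ∂(sigmaMeasure κ R) =
        ∫ z, f z * (starRingEnd ℂ) (xrayStar κ R h z) ∂(areaMeasure κ R)) ∧
    ∃ (L : SecondOrderOp) (T : FirstOrderOp) (w : ℂ → ℝ),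
      L.IsSmooth R ∧ T.IsSmooth ∧ ContDiffOn ℝ ∞ w (disk R) ∧ (∀ z ∈ disk R, 0 < w z) ∧
      -- `𝓛 ∘ I₀^* = I₀^* ∘ (-T²)`
      (∀ h : ℝ × ℝ → ℂ, SmoothOnBdry h →
        ContDiffOn ℝ ∞ (xrayStar κ R h) (Metric.ball 0 R) ∧
        ∀ z : ℂ, ‖z‖ < R → L.apply R (xrayStar κ R h) z = xrayStar κ R (T.negSq h) z) ∧
      -- `I₀ w ∘ 𝓛 = (-T²) ∘ I₀ w`
      (∀ f : ℂ → ℂ, SmoothOnDisk R f →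
        SmoothOnBdry (xrayW κ R w f) ∧
        ∀ p ∈ strip, xrayW κ R w (L.apply R f) p = T.negSq (xrayW κ R w f) p) ∧
      -- `𝓛` is of Kimura type, formally self-adjoint, positive and coercive on `L²(M, w dVol)`
      L.IsKimuraType R ∧
      (∀ u v : ℂ → ℂ, SmoothOnDisk R u → SmoothOnDisk R v →
        innerW κ R w (L.apply R u) v = innerW κ R w u (L.apply R v)) ∧
      (∀ u : ℂ → ℂ, SmoothOnDisk R u → (∃ z ∈ disk R, u z ≠ 0) →
        0 < (innerW κ R w (L.apply R u) u).re) ∧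
      (∃ C : ℝ, 0 < C ∧ ∀ u : ℂ → ℂ, SmoothOnDisk R u →
        C * (innerW κ R w u u).re ≤ (innerW κ R w (L.apply R u) u).re) ∧
      -- `𝓛 (I₀^* I₀ w)² = c² id` on `C^∞(M)`
      (∀ f : ℂ → ℂ, SmoothOnDisk R f →
        SmoothOnDisk R (normalW κ R w f) ∧
        ∀ z ∈ disk R, L.apply R (normalW κ R w (normalW κ R w f)) z =
          ((4 * Real.pi * R / (1 - κ * R ^ 2)) ^ 2 : ℝ) * f z) := by
  refine ⟨fun f hf h hh hL => ⟨integrable_mul_conj_xrayStar hR hκ hf.continuousOn hh hL,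
    integral_xray_mul_conj hR hκ hf.continuousOn hh hL⟩, kimuraOp κ R, fanOp κ R, weight κ,
    kimuraOp_isSmooth hR hκ, fanOp_isSmooth, contDiffOn_weight hκ, fun z hz => weight_pos hκ hz,
    fun h hh => ⟨contDiffOn_xrayStar hR hκ hh, fun z hz => kimuraOp_xrayStar hR hκ hh hz⟩,
    fun f hf => ⟨smoothOnBdry_xrayW hR hκ hf, fun p hp => xrayW_kimuraOp hR hκ hf hp⟩,
    kimuraOp_isKimuraType hR hκ, fun u v hu hv => innerW_kimuraOp_symm hR hκ hu hv,
    fun u hu h0 => (innerW_self_pos hR hκ hu h0).trans_le (innerW_le_innerW_kimuraOp hR hκ hu),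
    -- The coercivity constant is the zeroth-order term 1 of the Zernike operator, and positivity is
    -- a consequence of the same bound.
    ⟨1, one_pos, fun u hu => ?_⟩,
    fun f hf => ⟨smoothOnDisk_normalW hR hκ hf, fun z hz => kimuraOp_normalW_normalW hR hκ hf hz⟩⟩
  rw [one_mul]
  exact innerW_le_innerW_kimuraOp hR hκ hu
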